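/- **Setting.** Fix positive finite $\mu_{\max},\epsilon_{\max},\delta_{\min},\delta_{\max}$ and let $\mathcal P$ be the set of $\mathfrak p=(\mu,\epsilon,\delta,\gamma)$ with $0\le\mu\le\mu_{\max}$, $0\le\epsilon\le\epsilon_{\max}$, $\delta_{\min}<\delta<\delta_{\max}$, $0\le\gamma<1$. Write $h_1=1-\epsilon\zeta$, $h_2=\frac1\delta+\epsilon\zeta$. The Green–Naghdi system for $(\zeta,v)$ is $$\partial_t\zeta+\partial_x\Big(\tfrac{h_1h_2}{h_1+\gamma h_2}v\Big)=0,\qquad \partial_t\big(v+\mu\overline{\mathcal Q}v\big)+(\gamma+\delta)\partial_x\zeta+\tfrac\epsilon2\partial_x\Big(\tfrac{h_1^2-\gamma h_2^2}{(h_1+\gamma h_2)^2}v^2\Big)-\mu\epsilon\,\partial_x\big(\overline{\mathcal R}v\big)=0,$$ where, with $A=\partial_x\big(h_2^3\partial_x\frac{h_1v}{h_1+\gamma h_2}\big)$ and $B=\partial_x\big(h_1^3\partial_x\frac{h_2v}{h_1+\gamma h_2}\big)$, $$\overline{\mathcal Q}v=-\tfrac{1}{3h_1h_2}\big(h_1A+\gamma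 h_2B\big),$$ $$\overline{\mathcal R}v=\tfrac12\Big(\big(h_2\partial_x\tfrac{h_1v}{h_1+\gamma h_2}\big)^2-\gamma\big(h_1\partial_x\tfrac{h_2v}{h_1+\gamma h_2}\big)^2\Big)+\tfrac13\tfrac{v}{h_1+\gamma h_2}\Big(\tfrac{h_1}{h_2}A-\gamma\tfrac{h_2}{h_1}B\Big).$$ The residuals $(\mathcal R_1,\mathcal R_2)$ of a pair $(\zeta,v)$ are the left-hand sides of these two equations. **Decoupled approximation.** Set $$\alpha_1=\tfrac32\tfrac{\delta^2-\gamma}{\gamma+\delta},\quad \alpha_2=-3\tfrac{\gamma\delta(\delta+1)^2}{(\gamma+\delta)^2},\quad \alpha_3=-5\tfrac{\delta^2(\delta+1)^2\gamma(1-\gamma)}{(\gamma+\delta)^3},\quad \nu=\tfrac16\tfrac{1+\gamma\delta}{\delta(\gamma+\delta)},$$ $$\kappa_1=\tfrac{(1+\gamma\delta)(\delta^2-\gamma)}{3\delta(\gamma+\delta)^2},\quad \kappa_2=\tfrac{1-\gamma}{3(\gamma+\delta)},\quad \kappa_3=\tfrac{\gamma-1}{2(\gamma+\delta)},$$ and,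 for $\lambda,\theta\in\mathbb R$, $$\nu_t=\theta\nu+\lambda,\quad \nu_x=(1-\theta)\nu-\lambda,\quad \kappa_1^{\theta,\lambda}=\kappa_1\big(1+\tfrac{1-\theta}4\big)-\tfrac{1-\gamma}{6(\gamma+\delta)}+\lambda\alpha_1,\quad \kappa_2^{\theta}=\kappa_1\big(1+\tfrac{1-\theta}4\big)-\tfrac{1-\gamma}{12(\gamma+\delta)}.$$ Let $s>3/2$ and $\zeta^0,v^0\in H^{s+6}(\mathbb R)$. The Constantin–Lannes (CL) approximation on $[0,T)$, $0<T\le\infty$, is $$U_{CL}=\big(v_+(t,x-t)+v_-(t,x+t),\ (\gamma+\delta)(v_+(t,x-t)-v_-(t,x+t))\big),$$ where $v_\pm\in C^1([0,T);H^{s+5})$, $v_\pm(t)\in H^{s+6}$, $v_\pm|_{t=0}=\frac12\big(\zeta^0\pm\frac{v^0}{\gamma+\delta}\big)$, and $w=v_\pm^\lambda:=(1\pm\mu\lambda\partial_x^2)v_\pm$ satisfies on $[0,T)$ $$(1-\mu\nu_t\partial_x^2)\partial_tw\pm\Big(\epsilon\alpha_1w\partial_xw+\epsilon^2\alpha_2w^2\partial_xw+\epsilon^3\alpha_3w^3\partial_xw+\mu(\nu_x+\nu_t)\partial_x^3w+\mu\epsilon\,\partial_x\big(\kappa_1^{\theta,\lambda}w\partial_x^2w+\kappa_2^\theta(\partial_xw)^2\big)\Big)=0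 .$$ **Corrector.** For functions $l,r$ of $(t,x)$ put $$S(l,r)=\tfrac{\epsilon\alpha_1}2\partial_x\big((l+\tfrac r3)(l-r)\big)+\tfrac{\epsilon^2\alpha_2}3\partial_x\big((l-r)l(l+r)\big)+\tfrac{\epsilon^3\alpha_3}4\partial_x\big((l-\tfrac r5)(l-r)(l+r)^2\big)+\mu\epsilon\kappa_3\partial_x\big(\tfrac13(l-r)\partial_x^2(l-r)+\tfrac12(\partial_x(l-r))^2\big),$$ $$D(l,r)=-\mu\nu\,\partial_x^2\partial_t(l-r)-\mu\epsilon\,\partial_t\big[\kappa_1(l\partial_x^2l-r\partial_x^2r)+\kappa_2(r\partial_x^2l-l\partial_x^2r)+(\kappa_1+\tfrac{\kappa_2}2)((\partial_xl)^2-(\partial_xr)^2)\big],$$ $f^l(l,r)=S(l,r)+D(l,r)$ and $f^r(l,r)=-S(r,l)+D(r,l)$. For $\tau\in[0,T)$ let $V_\pm(t,x)=v_\pm(\tau,x\mp t)$, and let $w_\pm(\tau,\cdot,\cdot)$ be the $C^1$ solutions, vanishing at $t=0$, of $$(\partial_t+\partial_x)w_++f^l(V_+,V_-)-f^l(V_+,0)=0,\qquad(\partial_t-\partial_x)w_-+f^r(V_+,V_-)-f^r(0,V_-)=0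 .$$ The corrector is $U^c(t,x)=\big(w_++w_-,(\gamma+\delta)(w_+-w_-)\big)(t,t,x)$. Put $U=U_{CL}+U^c$, $$m=\max(\epsilon|\delta^2-\gamma|,\epsilon^2,\mu),\qquad \boldsymbol\varepsilon=\max(\epsilon^2(\delta^2-\gamma)^2,\epsilon^4,\mu^2).$$ **Statement.** All constants below depend only on $s,\mu_{\max},\epsilon_{\max},\delta_{\min},\delta_{\max}$, upper bounds for $|\lambda|$ and $|\theta|$, and the quantities indicated; they do not depend on $\mathfrak p\in\mathcal P$, $T$, or the solution. 1. Let $M>0$. There are $C=C(M)$ and, for every $B>0$, $C'=C'(M,B)$ and $e_0=e_0(M,B)>0$, such that, whenever $$|U_{CL}(t)|_{H^{s+6}}+|\partial_tU_{CL}(t)|_{H^{s+5}}\le M\quad\text{for all }t\in[0,T),$$ the corrector $U^c$ exists and, for all $t\in[0,T)$, $$|U^c(t)|_{H^{s}}\le|U^c(t)|_{H^{s+3}}\le C\,m\,\min(t,\sqrt t),\qquad|\partial_tU^c(t)|_{H^s}\le C\,m\,(1+\sqrt t);$$ and $U$ is consistent with the Green–Naghdi system at precision $O(\boldsymbol\varepsilon(1+\sqrt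 t))$, of order $s$ on $[0,t]$: if $\boldsymbol\varepsilon(1+\sqrt t)<e_0$ and $|U|_{H^{s+3}}\le B$ on $[0,t]$, then on $[0,t]$ both depths $h_1,h_2$ of $U$ are positive and $|\mathcal R_1|_{H^s}+|\mathcal R_2|_{H^s}\le C'\,\boldsymbol\varepsilon\,(1+\sqrt t)$. 2. Let $\alpha>1/2$ and $M>0$. There are $C=C(M,\alpha)$ and $e_0=e_0(M,\alpha)>0$ such that, whenever $$\sum_{k=0}^6\big|(1+x^2)^\alpha\partial_x^kW(t)\big|_{H^s}+\sum_{k=0}^5\big|(1+x^2)^\alpha\partial_x^k\partial_tW(t)\big|_{H^s}\le M\quad\text{for all }t\in[0,T),$$ with either $W=U_{CL}$ or $W=(v_+,v_-)$ (each wave in its own moving frame), the corrector $U^c$ exists and, for all $t\in[0,T)$, $$|U^c(t)|_{H^{s}}\le|U^c(t)|_{H^{s+3}}\le C\,m\,\min(t,1),\qquad|\partial_tU^c(t)|_{H^s}\le C\,m;$$ and, if $\boldsymbol\varepsilon<e_0$, then on all of $[0,T)$ both depths $h_1,h_2$ of $U$ are positive and $|\mathcal R_1|_{H^s}+|\mathcal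 R_2|_{H^s}\le C\,\boldsymbol\varepsilon$. -/

import Mathlib

open MeasureTheory Set Filter Topology
open scoped ENNReal FourierTransform

namespace TwoLayer

noncomputable section

/-! ### Function spaces -/

/-- The norm of `f` in the `L²`-based Sobolev space `H^r(ℝ)`, for `r ≥ 0`, computed from the
`L²` Fourier transform; it is `∞` when `f` is not in `H^r(ℝ)`. -/
def sobNorm (r : ℝ) (f : ℝ → ℝ) : ℝ≥0∞ :=
  open Classical in
  if h : MemLp (fun x => (f x : ℂ)) 2 (volume : Measure ℝ) then
    (∫⁻ ξ : ℝ, ENNReal.ofReal ((1 + (2 * Real.pi * ξ) ^ 2) ^ r) *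
      ‖(𝓕 (h.toLp (fun x => (f x : ℂ))) : Lp ℂ 2 (volume : Measure ℝ)) ξ‖ₑ ^ 2) ^ (1 / 2 : ℝ)
  else ⊤

/-- The time interval `[0, T)`, with `T = ∞` allowed. -/
def timeIco (T : ℝ≥0∞) : Set ℝ := {t | 0 ≤ t ∧ ENNReal.ofReal t < T}

/-- The time derivative of a function of `(t, x)` on `[0, T)` (one-sided at `t = 0`). -/
def timeDeriv (T : ℝ≥0∞) (u : ℝ → ℝ → ℝ) (t x : ℝ) : ℝ :=
  derivWithin (fun τ => u τ x) (timeIco T) t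

/-- `u ∈ C¹([0, T); H^r)`. -/
def IsC1Sob (r : ℝ) (T : ℝ≥0∞) (u : ℝ → ℝ → ℝ) : Prop :=
  ∀ t ∈ timeIco T,
    sobNorm r (u t) < ⊤ ∧
    (∀ x, DifferentiableWithinAt ℝ (fun τ => u τ x) (timeIco T) t) ∧
    Tendsto (fun τ => sobNorm r (fun x => (τ - t)⁻¹ * (u τ x - u t x) - timeDeriv T u t x))
      (𝓝[timeIco T \ {t}] t) (𝓝 0) ∧
    Tendsto (fun τ => sobNorm r (fun x => timeDeriv T u τ x - timeDeriv T u t x))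
      (𝓝[timeIco T] t) (𝓝 0)

/-! ### Parameters -/

/-- The dimensionless parameters: shallowness, nonlinearity, depth ratio, density ratio. -/
structure Params where
  mu : ℝ
  eps : ℝ
  del : ℝ
  gam : ℝ

/-- The admissible parameters. -/
def Params.InRegime (p : Params) (muMax epsMax delMin delMax : ℝ) : Prop :=
  (0 ≤ p.mu ∧ p.mu ≤ muMax) ∧ (0 ≤ p.eps ∧ p.eps ≤ epsMax) ∧
    (delMin < p.del ∧ p.del < delMax) ∧ (0 ≤ p.gam ∧ p.gam < 1)

namespace Params

variable (p : Params)

def alpha1 : ℝ := 3 / 2 * ((p.del ^ 2 - p.gam) / (p.gam + p.del))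

def alpha2 : ℝ := -3 * (p.gam * p.del * (p.del + 1) ^ 2 / (p.gam + p.del) ^ 2)

def alpha3 : ℝ :=
  -5 * (p.del ^ 2 * (p.del + 1) ^ 2 * p.gam * (1 - p.gam) / (p.gam + p.del) ^ 3)

def nu : ℝ := 1 / 6 * ((1 + p.gam * p.del) / (p.del * (p.del + p.gam)))

def kap1 : ℝ :=
  (1 + p.gam * p.del) * (p.del ^ 2 - p.gam) / (3 * p.del * (p.gam + p.del) ^ 2)

def kap2 : ℝ := (1 - p.gam) / (3 * (p.gam + p.del))

def kap3 : ℝ := (p.gam - 1) / (2 * (p.gam + p.del))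

/-- `ν_t^{θ,λ}` -/
def nuT (th lam : ℝ) : ℝ :=
  th / 6 * ((1 + p.gam * p.del) / (p.del * (p.del + p.gam))) + lam

/-- `ν_x^{θ,λ}` -/
def nuX (th lam : ℝ) : ℝ :=
  (1 - th) / 6 * ((1 + p.gam * p.del) / (p.del * (p.del + p.gam))) - lam

/-- `κ₁^{θ,λ}` -/
def kapCL1 (th lam : ℝ) : ℝ :=
  (1 + p.gam * p.del) * (p.del ^ 2 - p.gam) / (3 * p.del * (p.gam + p.del) ^ 2)
      * (1 + (1 - th) / 4)
    - (1 - p.gam) / (6 * (p.gam + p.del))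
    + lam * (3 / 2) * ((p.del ^ 2 - p.gam) / (p.gam + p.del))

/-- `κ₂^θ` -/
def kapCL2 (th : ℝ) : ℝ :=
  (1 + p.gam * p.del) * (p.del ^ 2 - p.gam) / (3 * p.del * (p.gam + p.del) ^ 2)
      * (1 + (1 - th) / 4)
    - (1 - p.gam) / (12 * (p.gam + p.del))

/-- The size `max(ε|δ²-γ|, ε², μ)` of the coupling effects. -/
def couplingSize : ℝ := max (max (p.eps * |p.del ^ 2 - p.gam|) (p.eps ^ 2)) p.mu

/-- The precision `max(ε²(δ²-γ)², ε⁴, μ²)`. -/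
def precision : ℝ :=
  max (max (p.eps ^ 2 * (p.del ^ 2 - p.gam) ^ 2) (p.eps ^ 4)) (p.mu ^ 2)

/-! ### The Green–Naghdi system -/

/-- The depth `h₁` of the upper layer. -/
def h1 (z : ℝ → ℝ) (x : ℝ) : ℝ := 1 - p.eps * z x

/-- The depth `h₂` of the lower layer. -/
def h2 (z : ℝ → ℝ) (x : ℝ) : ℝ := 1 / p.del + p.eps * z x

/-- `∂ₓ(h₂³ ∂ₓ(h₁ V / (h₁ + γ h₂)))` -/
def lowerTerm (z V : ℝ → ℝ) (x : ℝ) : ℝ :=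
  deriv (fun y => p.h2 z y ^ 3 *
    deriv (fun w => p.h1 z w * V w / (p.h1 z w + p.gam * p.h2 z w)) y) x

/-- `∂ₓ(h₁³ ∂ₓ(h₂ V / (h₁ + γ h₂)))` -/
def upperTerm (z V : ℝ → ℝ) (x : ℝ) : ℝ :=
  deriv (fun y => p.h1 z y ^ 3 *
    deriv (fun w => p.h2 z w * V w / (p.h1 z w + p.gam * p.h2 z w)) y) x

/-- The operator `Q̄[h₁,h₂]V`. -/
def Qbar (z V : ℝ → ℝ) (x : ℝ) : ℝ :=
  -1 / (3 * p.h1 z x * p.h2 z x) *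
    (p.h1 z x * p.lowerTerm z V x + p.gam * p.h2 z x * p.upperTerm z V x)

/-- The operator `R̄[h₁,h₂]V`. -/
def Rbar (z V : ℝ → ℝ) (x : ℝ) : ℝ :=
  1 / 2 *
      ((p.h2 z x * deriv (fun w => p.h1 z w * V w / (p.h1 z w + p.gam * p.h2 z w)) x) ^ 2
        - p.gam *
          (p.h1 z x * deriv (fun w => p.h2 z w * V w / (p.h1 z w + p.gam * p.h2 z w)) x) ^ 2)
    + 1 / 3 * (V x / (p.h1 z x + p.gam * p.h2 z x)) *
      (p.h1 z x / p.h2 z x * p.lowerTerm z V x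
        - p.gam * (p.h2 z x / p.h1 z x) * p.upperTerm z V x)

/-- `v + μ Q̄[h₁,h₂]v` as a function of `(t, x)`. -/
def momentum (z v : ℝ → ℝ → ℝ) (t x : ℝ) : ℝ := v t x + p.mu * p.Qbar (z t) (v t) x

/-- What the first Green–Naghdi equation leaves over when `(z, v)` is plugged in. -/
def residual1 (T : ℝ≥0∞) (z v : ℝ → ℝ → ℝ) (t x : ℝ) : ℝ :=
  timeDeriv T z t x
    + deriv (fun y => p.h1 (z t) y * p.h2 (z t) y / (p.h1 (z t) y + p.gam * p.h2 (z t) y)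
        * v t y) x

/-- What the second Green–Naghdi equation leaves over when `(z, v)` is plugged in. -/
def residual2 (T : ℝ≥0∞) (z v : ℝ → ℝ → ℝ) (t x : ℝ) : ℝ :=
  timeDeriv T (p.momentum z v) t x
    + (p.gam + p.del) * deriv (z t) x
    + p.eps / 2 * deriv (fun y => (p.h1 (z t) y ^ 2 - p.gam * p.h2 (z t) y ^ 2)
        / (p.h1 (z t) y + p.gam * p.h2 (z t) y) ^ 2 * v t y ^ 2) x
    - p.mu * p.eps * deriv (p.Rbar (z t) (v t)) x

/-- At time `t ∈ [0, T)` the pair `(z, v)` is regular enough to be plugged into the Green–Naghdi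
system, the layers have positive depth, and the residuals have `H^s` norm at most `K`. -/
structure GNConsistentAt (s : ℝ) (T : ℝ≥0∞) (z v : ℝ → ℝ → ℝ) (K t : ℝ) : Prop where
  smooth_z : ContDiff ℝ 3 (z t)
  smooth_v : ContDiff ℝ 3 (v t)
  depth1 : ∀ x, 0 < p.h1 (z t) x
  depth2 : ∀ x, 0 < p.h2 (z t) x
  diff_z : ∀ x, DifferentiableWithinAt ℝ (fun τ => z τ x) (timeIco T) t
  diff_m : ∀ x, DifferentiableWithinAt ℝ (fun τ => p.momentum z v τ x) (timeIco T) t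
  bound : sobNorm s (p.residual1 T z v t) + sobNorm s (p.residual2 T z v t) ≤ ENNReal.ofReal K

/-! ### The Constantin–Lannes decoupled approximation -/

/-- `v^λ = (1 + a μ λ ∂ₓ²) v`, with `a = 1` for `v₊` and `a = -1` for `v₋`. -/
def nearId (a lam : ℝ) (v : ℝ → ℝ → ℝ) (t x : ℝ) : ℝ :=
  v t x + a * p.mu * lam * iteratedDeriv 2 (v t) x

/-- The Constantin–Lannes equation for `w`, in the frame moving with the wave (velocity `a = ±1`),
on `[0, T)`. In the frame at rest, `u(t, x) = w(t, x - a t)` solves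
`∂ₜu + a(∂ₓu + ε α₁ u ∂ₓu + ε² α₂ u² ∂ₓu + ε³ α₃ u³ ∂ₓu + μ ν_x ∂ₓ³u
  + μ ε ∂ₓ(κ₁ u ∂ₓ²u + κ₂ (∂ₓu)²)) - μ ν_t ∂ₓ²∂ₜu = 0`. -/
def SolvesCL (a lam th : ℝ) (T : ℝ≥0∞) (w : ℝ → ℝ → ℝ) : Prop :=
  ∀ t ∈ timeIco T, ∀ x,
    timeDeriv T w t x - p.mu * p.nuT th lam * iteratedDeriv 2 (timeDeriv T w t) x
      + a * (p.eps * p.alpha1 * w t x * deriv (w t) x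
        + p.eps ^ 2 * p.alpha2 * w t x ^ 2 * deriv (w t) x
        + p.eps ^ 3 * p.alpha3 * w t x ^ 3 * deriv (w t) x
        + p.mu * (p.nuX th lam + p.nuT th lam) * iteratedDeriv 3 (w t) x
        + p.mu * p.eps * deriv (fun y => p.kapCL1 th lam * w t y * iteratedDeriv 2 (w t) y
            + p.kapCL2 th * deriv (w t) y ^ 2) x) = 0

/-- `(v₊, v₋)` are the two waves, each in its own moving frame, of the Constantin–Lannes decoupled
approximation on `[0, T)` with initial data `(z0, v0)`. -/
structure IsCLWaves (s lam th : ℝ) (T : ℝ≥0∞) (z0 v0 : ℝ → ℝ) (vp vm : ℝ → ℝ → ℝ) : Prop where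
  data_z : sobNorm (s + 6) z0 < ⊤
  data_v : sobNorm (s + 6) v0 < ⊤
  init_p : ∀ x, vp 0 x = 1 / 2 * (z0 x + v0 x / (p.gam + p.del))
  init_m : ∀ x, vm 0 x = 1 / 2 * (z0 x - v0 x / (p.gam + p.del))
  /-- The function `v₊(t)` is the smooth representative of its class in `H^{s+6}`. -/
  smooth_p : ∀ t ∈ timeIco T, ContDiff ℝ 7 (vp t)
  /-- The function `v₋(t)` is the smooth representative of its class in `H^{s+6}`. -/
  smooth_m : ∀ t ∈ timeIco T, ContDiff ℝ 7 (vm t)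
  c1_p : IsC1Sob (s + 5) T vp
  c1_m : IsC1Sob (s + 5) T vm
  eq_p : p.SolvesCL 1 lam th T (p.nearId 1 lam vp)
  eq_m : p.SolvesCL (-1) lam th T (p.nearId (-1) lam vm)

/-- First component of the decoupled approximation: `v₊(t, x-t) + v₋(t, x+t)`. -/
def zCL (vp vm : ℝ → ℝ → ℝ) (t x : ℝ) : ℝ := vp t (x - t) + vm t (x + t)

/-- Second component of the decoupled approximation:
`(γ+δ)(v₊(t, x-t) - v₋(t, x+t))`. -/
def vCL (vp vm : ℝ → ℝ → ℝ) (t x : ℝ) : ℝ := (p.gam + p.del) * (vp t (x - t) - vm t (x + t))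

/-- `|U_CL(t)|_{H^{s+6}} + |∂ₜU_CL(t)|_{H^{s+5}} ≤ M` for all `t ∈ [0, T)`. -/
def UniformBound (s : ℝ) (T : ℝ≥0∞) (vp vm : ℝ → ℝ → ℝ) (M : ℝ) : Prop :=
  ∀ t ∈ timeIco T,
    sobNorm (s + 6) (zCL vp vm t) + sobNorm (s + 6) (p.vCL vp vm t)
      + sobNorm (s + 5) (timeDeriv T (zCL vp vm) t)
      + sobNorm (s + 5) (timeDeriv T (p.vCL vp vm) t) ≤ ENNReal.ofReal M

/-- `∑_{k ≤ K} |(1+x²)^a ∂ₓᵏ f|_{H^s}` -/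
def weightedNorm (s a : ℝ) (K : ℕ) (f : ℝ → ℝ) : ℝ≥0∞ :=
  ∑ k ∈ Finset.range (K + 1), sobNorm s (fun x => (1 + x ^ 2) ^ a * iteratedDeriv k f x)

/-- `∑_{k≤6} |(1+x²)^a ∂ₓᵏ U(t)|_{H^s} + ∑_{k≤5} |(1+x²)^a ∂ₓᵏ∂ₜU(t)|_{H^s} ≤ M` for all
`t ∈ [0, T)`, where `U` is the pair `(f, g)`. -/
def LocalizedBound (s a : ℝ) (T : ℝ≥0∞) (f g : ℝ → ℝ → ℝ) (M : ℝ) : Prop :=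
  ∀ t ∈ timeIco T,
    weightedNorm s a 6 (f t) + weightedNorm s a 6 (g t)
      + weightedNorm s a 5 (timeDeriv T f t) + weightedNorm s a 5 (timeDeriv T g t)
      ≤ ENNReal.ofReal M

/-! ### The first-order coupling corrector -/

/-- `∂ₓ` of a function of `(t, x)`. -/
def dx (u : ℝ → ℝ → ℝ) (t x : ℝ) : ℝ := deriv (u t) x

/-- `∂ₜ` of a function of `(t, x)`. -/
def dt (u : ℝ → ℝ → ℝ) (t x : ℝ) : ℝ := deriv (fun τ => u τ x) t

/-- The part of the nonlinear term `f^l` without time derivatives. -/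
def couplingSpace (l r : ℝ → ℝ → ℝ) (t x : ℝ) : ℝ :=
  p.eps * (p.alpha1 / 2) * dx (fun t x => (l t x + 1 / 3 * r t x) * (l t x - r t x)) t x
    + p.eps ^ 2 * (p.alpha2 / 3)
      * dx (fun t x => (l t x - r t x) * l t x * (l t x + r t x)) t x
    + p.eps ^ 3 * (p.alpha3 / 4)
      * dx (fun t x => (l t x - 1 / 5 * r t x) * (l t x - r t x) * (l t x + r t x) ^ 2) t x
    + p.mu * p.eps * p.kap3
      * dx (fun t x => 1 / 3 * (l t x - r t x) * (dx (dx l) t x - dx (dx r) t x)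
          + 1 / 2 * (dx l t x - dx r t x) ^ 2) t x

/-- The part of the nonlinear term `f^l` with time derivatives. -/
def couplingTime (l r : ℝ → ℝ → ℝ) (t x : ℝ) : ℝ :=
  -(p.mu * p.nu) * dx (dx (dt (fun t x => l t x - r t x))) t x
    - p.mu * p.eps
      * dt (fun t x => p.kap1 * (l t x * dx (dx l) t x - r t x * dx (dx r) t x)
          + p.kap2 * (r t x * dx (dx l) t x - l t x * dx (dx r) t x)
          + (p.kap1 + p.kap2 / 2) * (dx l t x ^ 2 - dx r t x ^ 2)) t x

/-- `f^l(u_l, u_r)`. Written in `u_l = (ζ + v/(γ+δ))/2`, `u_r = (ζ - v/(γ+δ))/2`, the Green–Naghdi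
system is, up to terms of order `ε⁴` and `μ ε²`, the system
`∂ₜu_l + ∂ₓu_l + f^l(u_l, u_r) = 0`, `∂ₜu_r - ∂ₓu_r + f^r(u_l, u_r) = 0`. -/
def fl (ul ur : ℝ → ℝ → ℝ) (t x : ℝ) : ℝ :=
  p.couplingSpace ul ur t x + p.couplingTime ul ur t x

/-- `f^r(u_l, u_r)` -/
def fr (ul ur : ℝ → ℝ → ℝ) (t x : ℝ) : ℝ :=
  -p.couplingSpace ur ul t x + p.couplingTime ur ul t x

/-- `w` is the `C¹` solution of `(∂ₜ + c ∂ₓ) w + g = 0`, `w(0, ·) = 0`. -/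
structure SolvesTransport (c : ℝ) (g w : ℝ → ℝ → ℝ) : Prop where
  smooth : ContDiff ℝ 1 (fun q : ℝ × ℝ => w q.1 q.2)
  init : ∀ x, w 0 x = 0
  eq : ∀ t x, dt w t x + c * dx w t x + g t x = 0

/-- `(zc, vc)` is the coupling corrector `U^c` on `[0, T)`: with the profiles frozen at time `τ` and
transported at velocities `±1`, the functions `wp τ`, `wm τ` of `(t, x)` are driven by the coupling
terms, and `U^c` is built from their values at `τ = t`. -/
def IsCorrector (T : ℝ≥0∞) (vp vm zc vc : ℝ → ℝ → ℝ) : Prop :=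
  ∃ wp wm : ℝ → ℝ → ℝ → ℝ,
    (∀ τ ∈ timeIco T,
      SolvesTransport 1
        (fun t x => p.fl (fun t x => vp τ (x - t)) (fun t x => vm τ (x + t)) t x
          - p.fl (fun t x => vp τ (x - t)) (fun _ _ => 0) t x) (wp τ) ∧
      SolvesTransport (-1)
        (fun t x => p.fr (fun t x => vp τ (x - t)) (fun t x => vm τ (x + t)) t x
          - p.fr (fun _ _ => 0) (fun t x => vm τ (x + t)) t x) (wm τ)) ∧
    ∀ t ∈ timeIco T, ∀ x,
      zc t x = wp t t x + wm t t x ∧ vc t x = (p.gam + p.del) * (wp t t x - wm t t x)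

end Params

/-- At time `t ∈ [0, T)`, the pair `(zc, vc)` is differentiable in time, with `H^{s+3}` norm at most
`K` and with a time derivative of `H^s` norm at most `K'`. -/
structure CorrectorBoundAt (s : ℝ) (T : ℝ≥0∞) (zc vc : ℝ → ℝ → ℝ) (K K' t : ℝ) : Prop where
  diff_z : ∀ x, DifferentiableWithinAt ℝ (fun τ => zc τ x) (timeIco T) t
  diff_v : ∀ x, DifferentiableWithinAt ℝ (fun τ => vc τ x) (timeIco T) t
  bound : sobNorm (s + 3) (zc t) + sobNorm (s + 3) (vc t) ≤ ENNReal.ofReal K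
  bound_dt : sobNorm s (timeDeriv T zc t) + sobNorm s (timeDeriv T vc t) ≤ ENNReal.ofReal K'

end

end TwoLayer

open TwoLayer TwoLayer.Params

open MeasureTheory Set Filter Topology
open scoped ENNReal FourierTransform

namespace TwoLayer

noncomputable section

set_option linter.unusedSectionVars false

open scoped SchwartzMap ContDiff

/-! ### The `L²` Fourier transform on the line -/

/-- The `L²` Fourier transform of `u`, as a function; `0` if `u ∉ L²`. -/
def ftL (u : ℝ → ℂ) : ℝ → ℂ :=
  open Classical in
  if h : MemLp u 2 (volume : Measure ℝ) then (𝓕 (h.toLp u) : Lp ℂ 2 (volume : Measure ℝ)) else 0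

theorem ftL_eq {u : ℝ → ℂ} (h : MemLp u 2) :
    ftL u = (𝓕 (h.toLp u) : Lp ℂ 2 (volume : Measure ℝ)) := by
  simp [ftL, h]

theorem memLp_ftL (u : ℝ → ℂ) : MemLp (ftL u) 2 := by
  by_cases h : MemLp u 2
  · rw [ftL_eq h]; exact Lp.memLp _
  · simp [ftL, h]

theorem eLpNorm_ftL {u : ℝ → ℂ} (h : MemLp u 2) : eLpNorm (ftL u) 2 = eLpNorm u 2 := by
  rw [ftL_eq h]
  have h1 := Lp.norm_fourier_eq (h.toLp u)
  rw [Lp.norm_def, Lp.norm_def] at h1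
  rw [ENNReal.toReal_eq_toReal_iff' (Lp.eLpNorm_ne_top _) (Lp.eLpNorm_ne_top _)] at h1
  rw [h1]
  exact eLpNorm_congr_ae h.coeFn_toLp

theorem ftL_congr {u v : ℝ → ℂ} (h : u =ᵐ[volume] v) : ftL u = ftL v := by
  by_cases hu : MemLp u 2
  · have hv : MemLp v 2 := (memLp_congr_ae h).1 hu
    rw [ftL_eq hu, ftL_eq hv, (MemLp.toLp_eq_toLp_iff hu hv).2 h]
  · have hv : ¬ MemLp v 2 := fun h' => hu ((memLp_congr_ae h).2 h')
    simp [ftL, hu, hv]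

theorem ftL_add {u v : ℝ → ℂ} (hu : MemLp u 2) (hv : MemLp v 2) :
    ftL (fun x => u x + v x) =ᵐ[volume] fun ξ => ftL u ξ + ftL v ξ := by
  have : ftL (fun x => u x + v x) = (𝓕 (hu.toLp u + hv.toLp v) : Lp ℂ 2 (volume : Measure ℝ)) := by
    rw [ftL_eq (hu.add hv : MemLp (fun x => u x + v x) 2)]; rfl
  rw [this, FourierTransform.fourier_add, ftL_eq hu, ftL_eq hv]
  exact Lp.coeFn_add _ _

theorem ftL_const_mul (c : ℂ) {u : ℝ → ℂ} (hu : MemLp u 2) :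
    ftL (fun x => c * u x) =ᵐ[volume] fun ξ => c * ftL u ξ := by
  have : ftL (fun x => c * u x) = (𝓕 (c • hu.toLp u) : Lp ℂ 2 (volume : Measure ℝ)) := by
    rw [ftL_eq (hu.const_mul c)]; rfl
  rw [this, FourierTransform.fourier_smul, ftL_eq hu]
  exact Lp.coeFn_smul _ _

theorem ftL_sub {u v : ℝ → ℂ} (hu : MemLp u 2) (hv : MemLp v 2) :
    ftL (fun x => u x - v x) =ᵐ[volume] fun ξ => ftL u ξ - ftL v ξ := by
  have : ftL (fun x => u x - v x) = ftL (fun x => u x + (-1) * v x) := by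
    congr 1; ext; ring
  rw [this]
  filter_upwards [ftL_add hu (hv.const_mul (-1)), ftL_const_mul (-1) hv] with ξ h1 h2
  rw [h1, h2]; ring

theorem integral_fourier_mul_ftL {u : ℝ → ℂ} (hu : MemLp u 2) (φ : 𝓢(ℝ, ℂ)) :
    ∫ x, 𝓕 φ x * u x = ∫ ξ, φ ξ * ftL u ξ := by
  have h := congrArg (fun T : 𝓢'(ℝ, ℂ) => T φ) (Lp.fourier_toTemperedDistribution_eq (hu.toLp u))
  simp only [TemperedDistribution.fourier_apply, Lp.toTemperedDistribution_apply, smul_eq_mul] at h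
  rw [ftL_eq hu, ← h]
  refine integral_congr_ae ?_
  filter_upwards [hu.coeFn_toLp] with x hx
  rw [hx]

theorem ae_eq_of_integral_schwartz_eq {u v : ℝ → ℂ} (hu : LocallyIntegrable u)
    (hv : LocallyIntegrable v) (h : ∀ φ : 𝓢(ℝ, ℂ), ∫ x, φ x * u x = ∫ x, φ x * v x) :
    u =ᵐ[volume] v := by
  refine ae_eq_of_integral_contDiff_smul_eq hu hv ?_
  intro g hg hc
  have hg₁ : HasCompactSupport (Complex.ofRealCLM ∘ g) := hc.comp_left rfl
  have hg₂ : ContDiff ℝ ∞ (Complex.ofRealCLM ∘ g) := by fun_prop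
  simpa using h (hg₁.toSchwartzMap hg₂)

theorem locallyIntegrable_of_memLp {u : ℝ → ℂ} (hu : MemLp u 2) : LocallyIntegrable u :=
  hu.locallyIntegrable (by norm_num)

/-- The `L²` Fourier transform is characterised by its pairings with Schwartz functions. -/
theorem ftL_ae_eq_of_pairing {u v : ℝ → ℂ} (hu : MemLp u 2) (hv : LocallyIntegrable v)
    (h : ∀ φ : 𝓢(ℝ, ℂ), ∫ x, 𝓕 φ x * u x = ∫ x, φ x * v x) : ftL u =ᵐ[volume] v :=
  ae_eq_of_integral_schwartz_eq (locallyIntegrable_of_memLp (memLp_ftL u)) hv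
    fun φ => by rw [← integral_fourier_mul_ftL hu, h]

/-- Fourier inversion: an `L²` function whose Fourier transform is given. -/
theorem exists_ftL_eq {v : ℝ → ℂ} (hv : MemLp v 2) : ∃ u, MemLp u 2 ∧ ftL u =ᵐ[volume] v := by
  refine ⟨(𝓕⁻ (hv.toLp v) : Lp ℂ 2 (volume : Measure ℝ)), Lp.memLp _, ?_⟩
  rw [ftL_eq (Lp.memLp _), Lp.toLp_coeFn, FourierTransform.fourier_fourierInv_eq]
  exact hv.coeFn_toLp

theorem continuous_fourierInv {v : ℝ → ℂ} (hv : Integrable v) : Continuous (𝓕⁻ v) := by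
  rw [Real.fourierInv_eq_fourier_comp_neg]
  exact VectorFourier.fourierIntegral_continuous Real.continuous_fourierChar
    (by exact continuous_inner) hv.comp_neg

theorem integral_fourierInv_mul {v : ℝ → ℂ} (hv : Integrable v) (φ : 𝓢(ℝ, ℂ)) :
    ∫ ξ, (𝓕⁻ φ) ξ * v ξ = ∫ x, φ x * 𝓕⁻ v x := by
  have h2 := VectorFourier.integral_fourierIntegral_smul_eq_flip (L := innerₗ ℝ) (μ := volume)
    (ν := volume) (f := fun x : ℝ => φ (-x)) (g := v) Real.continuous_fourierChar
    (by exact continuous_inner) φ.integrable.comp_neg hv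
  have h3 : ∀ ξ, (𝓕⁻ φ) ξ = 𝓕 (fun x : ℝ => φ (-x)) ξ := fun ξ => by
    rw [SchwartzMap.fourierInv_coe, Real.fourierInv_eq_fourier_comp_neg]
  have h4 : ∫ ξ, (𝓕⁻ φ) ξ * v ξ = ∫ x, φ (-x) * 𝓕 v x := by
    rw [flip_innerₗ] at h2
    simp only [h3]; exact h2
  rw [h4, ← integral_neg_eq_self]
  simp only [neg_neg, Real.fourierInv_eq_fourier_neg]

/-- If the `L²` Fourier transform is integrable, then the function is its inverse Fourier
integral almost everywhere. -/
theorem ae_eq_fourierInv_ftL {u : ℝ → ℂ} (hu : MemLp u 2) (hi : Integrable (ftL u)) :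
    u =ᵐ[volume] 𝓕⁻ (ftL u) := by
  refine ae_eq_of_integral_schwartz_eq (locallyIntegrable_of_memLp hu)
    (continuous_fourierInv hi).locallyIntegrable fun φ => ?_
  have h1 := integral_fourier_mul_ftL hu (𝓕⁻ φ)
  rw [FourierTransform.fourier_fourierInv_eq] at h1
  rw [h1, integral_fourierInv_mul hi]

theorem fourierInv_compSub (f : 𝓢(ℝ, ℂ)) (h ξ : ℝ) :
    (𝓕⁻ (f.compSubConstCLM ℂ h)) ξ = Complex.exp (2 * Real.pi * Complex.I * h * ξ) * (𝓕⁻ f) ξ := by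
  rw [SchwartzMap.fourierInv_coe, SchwartzMap.fourierInv_coe, Real.fourierInv_eq',
    Real.fourierInv_eq', ← integral_const_mul, ← integral_add_right_eq_self _ h]
  congr 1; ext x
  simp only [SchwartzMap.compSubConstCLM_apply, add_sub_cancel_right, smul_eq_mul, ← mul_assoc,
    ← Complex.exp_add]
  congr 2
  simp
  ring

theorem locallyIntegrable_continuous_mul {v w : ℝ → ℂ} (hw : Continuous w) (hv : MemLp v 2) :
    LocallyIntegrable (fun ξ => w ξ * v ξ) := by
  have := (locallyIntegrable_of_memLp hv).locallyIntegrableOn univ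
  have := this.continuousOn_mul (g := w) hw.continuousOn isOpen_univ.isLocallyClosed
  simpa using locallyIntegrableOn_univ.1 this

theorem ftL_translate {u : ℝ → ℂ} (hu : MemLp u 2) (h : ℝ) :
    ftL (fun x => u (x + h)) =ᵐ[volume]
      fun ξ => Complex.exp (2 * Real.pi * Complex.I * h * ξ) * ftL u ξ := by
  have hu' : MemLp (fun x => u (x + h)) 2 :=
    hu.comp_measurePreserving (measurePreserving_add_right volume h)
  refine ftL_ae_eq_of_pairing hu' (locallyIntegrable_continuous_mul (by fun_prop)
    (memLp_ftL u)) fun φ => ?_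
  have h1 := integral_fourier_mul_ftL hu (𝓕⁻ ((𝓕 φ).compSubConstCLM ℂ h))
  rw [FourierTransform.fourier_fourierInv_eq] at h1
  simp only [fourierInv_compSub, FourierTransform.fourierInv_fourier_eq,
    SchwartzMap.compSubConstCLM_apply] at h1
  rw [← integral_sub_right_eq_self _ h]
  simp only [sub_add_cancel]
  rw [h1]
  congr 1; ext ξ; ring

theorem fourier_deriv_schwartz (φ : 𝓢(ℝ, ℂ)) :
    ∃ ψ : 𝓢(ℝ, ℂ), (∀ x, HasDerivAt (𝓕 φ : 𝓢(ℝ, ℂ)) ((𝓕 ψ : 𝓢(ℝ, ℂ)) x) x) ∧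
      ∀ ξ, ψ ξ = -(2 * Real.pi * Complex.I * ξ) * φ ξ := by
  have hx : ∀ ξ : ℝ, SchwartzMap.smulLeftCLM ℂ (fun x : ℝ => (x : ℂ)) φ ξ = ξ * φ ξ := fun ξ => by
    rw [SchwartzMap.smulLeftCLM_apply_apply (by fun_prop)]; simp
  have h2 : Integrable (fun x : ℝ => x • φ x) := by
    refine ((SchwartzMap.smulLeftCLM ℂ (fun x : ℝ => (x : ℂ)) φ).integrable
      (μ := volume)).congr (ae_of_all _ fun x => ?_)
    simp [hx]
  refine ⟨-(2 * Real.pi * Complex.I) • SchwartzMap.smulLeftCLM ℂ (fun x : ℝ => (x : ℂ)) φ,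
    fun x => ?_, fun ξ => ?_⟩
  · have h3 := Real.hasDerivAt_fourier (f := (φ : ℝ → ℂ)) φ.integrable h2 x
    rw [SchwartzMap.fourier_coe, SchwartzMap.fourier_coe]
    convert! h3 using 2
    ext ξ
    simp only [smul_apply, hx, smul_eq_mul]; ring
  · simp only [smul_apply, hx, smul_eq_mul]; ring

theorem ftL_deriv {u u' : ℝ → ℂ} (hu : MemLp u 2) (hu' : MemLp u' 2)
    (hd : ∀ x, HasDerivAt u (u' x) x) :
    ftL u' =ᵐ[volume] fun ξ => (2 * Real.pi * Complex.I * ξ) * ftL u ξ := by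
  refine ftL_ae_eq_of_pairing hu' (locallyIntegrable_continuous_mul (by fun_prop)
    (memLp_ftL u)) fun φ => ?_
  obtain ⟨ψ, hψ, hψ'⟩ := fourier_deriv_schwartz φ
  have h2 : ∀ χ : 𝓢(ℝ, ℂ), MemLp χ 2 := fun χ => χ.memLp 2
  have h1 := integral_mul_deriv_eq_deriv_mul_of_integrable (u := (𝓕 φ : 𝓢(ℝ, ℂ)))
    (u' := (𝓕 ψ : 𝓢(ℝ, ℂ))) (v := u) (v' := u') (fun x _ => hψ x) (fun x _ => hd x)
    ((h2 _).integrable_mul hu') ((h2 _).integrable_mul hu) ((h2 _).integrable_mul hu)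
  rw [h1, integral_fourier_mul_ftL hu, ← integral_neg]
  simp only [hψ']
  congr 1; ext ξ; ring

theorem memLp_deriv {u u' : ℝ → ℂ} (hu : MemLp u 2) (hc : Continuous u')
    (hd : ∀ x, HasDerivAt u (u' x) x)
    (hw : MemLp (fun ξ : ℝ => (2 * Real.pi * Complex.I * ξ) * ftL u ξ) 2) : MemLp u' 2 := by
  obtain ⟨g, hg, hg'⟩ := exists_ftL_eq hw
  refine (memLp_congr_ae ?_).1 hg
  refine ae_eq_of_integral_contDiff_smul_eq (locallyIntegrable_of_memLp hg)
    hc.locallyIntegrable ?_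
  intro f hf hfc
  have hg₁ : HasCompactSupport (Complex.ofRealCLM ∘ f) := hfc.comp_left rfl
  have hg₂ : ContDiff ℝ ∞ (Complex.ofRealCLM ∘ f) := by fun_prop
  set φ : 𝓢(ℝ, ℂ) := 𝓕⁻ (hg₁.toSchwartzMap hg₂) with hφ
  have hφf : ∀ x, (𝓕 φ) x = (f x : ℂ) := fun x => by
    rw [hφ, FourierTransform.fourier_fourierInv_eq]; rfl
  have hφf' : ((𝓕 φ : 𝓢(ℝ, ℂ)) : ℝ → ℂ) = fun x => (f x : ℂ) := funext hφf
  obtain ⟨ψ, hψ, hψ'⟩ := fourier_deriv_schwartz φ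
  have hcs : HasCompactSupport (fun x => (f x : ℂ)) := hg₁
  have e1 : ∫ x, f x • g x = ∫ x, 𝓕 φ x * g x := by
    simp only [hφf, Complex.real_smul]
  have e2 : ∫ x, f x • u' x = ∫ x, 𝓕 φ x * u' x := by
    simp only [hφf, Complex.real_smul]
  have e3 : ∫ x, 𝓕 φ x * g x = - ∫ x, 𝓕 ψ x * u x := by
    rw [integral_fourier_mul_ftL hg, integral_fourier_mul_ftL hu, ← integral_neg]
    refine integral_congr_ae ?_
    filter_upwards [hg'] with ξ hξ
    rw [hξ, hψ']; ring
  have hcu : Continuous u := continuous_iff_continuousAt.2 fun x => (hd x).continuousAt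
  have e4 : ∫ x, 𝓕 φ x * u' x = - ∫ x, 𝓕 ψ x * u x := by
    refine integral_mul_deriv_eq_deriv_mul_of_integrable (u := (𝓕 φ : 𝓢(ℝ, ℂ)))
      (u' := (𝓕 ψ : 𝓢(ℝ, ℂ))) (v := u) (v' := u') (fun x _ => hψ x) (fun x _ => hd x) ?_ ?_ ?_
    · refine Continuous.integrable_of_hasCompactSupport ((𝓕 φ).continuous.mul hc) ?_
      rw [hφf']; exact hcs.mul_right
    · exact ((𝓕 ψ : 𝓢(ℝ, ℂ)).memLp 2).integrable_mul hu
    · refine Continuous.integrable_of_hasCompactSupport ((𝓕 φ).continuous.mul hcu) ?_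
      rw [hφf']; exact hcs.mul_right
  rw [e1, e2, e3, e4]

/-! ### Sobolev norms of complex-valued functions -/

/-- The Fourier weight `(1 + |2πξ|²)^{r/2}`. -/
def wt (r ξ : ℝ) : ℝ := (1 + (2 * Real.pi * ξ) ^ 2) ^ (r / 2)

theorem one_le_base (ξ : ℝ) : 1 ≤ 1 + (2 * Real.pi * ξ) ^ 2 := by nlinarith [sq_nonneg (2 * Real.pi * ξ)]

theorem wt_pos (r ξ : ℝ) : 0 < wt r ξ := Real.rpow_pos_of_pos (by linarith [one_le_base ξ]) _

theorem wt_mono {r r' : ℝ} (h : r ≤ r') (ξ : ℝ) : wt r ξ ≤ wt r' ξ :=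
  Real.rpow_le_rpow_of_exponent_le (one_le_base ξ) (by linarith)

theorem wt_zero (ξ : ℝ) : wt 0 ξ = 1 := by simp [wt]

theorem wt_add (r r' ξ : ℝ) : wt (r + r') ξ = wt r ξ * wt r' ξ := by
  rw [wt, wt, wt, ← Real.rpow_add (by linarith [one_le_base ξ])]; ring_nf

theorem wt_two (ξ : ℝ) : wt 2 ξ = 1 + (2 * Real.pi * ξ) ^ 2 := by simp [wt]

theorem wt_one_sq (ξ : ℝ) : wt 1 ξ ^ 2 = 1 + (2 * Real.pi * ξ) ^ 2 := by
  rw [sq, ← wt_add]; norm_num [wt_two]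

theorem abs_le_wt_one (ξ : ℝ) : |2 * Real.pi * ξ| ≤ wt 1 ξ := by
  refine abs_le_of_sq_le_sq ?_ (wt_pos _ _).le
  rw [wt_one_sq]; linarith

theorem wt_one_le (ξ : ℝ) : wt 1 ξ ≤ 1 + |2 * Real.pi * ξ| := by
  refine le_of_sq_le_sq ?_ (by positivity)
  rw [wt_one_sq]
  nlinarith [abs_nonneg (2 * Real.pi * ξ), sq_abs (2 * Real.pi * ξ)]

theorem one_le_wt {r : ℝ} (hr : 0 ≤ r) (ξ : ℝ) : 1 ≤ wt r ξ :=
  (wt_zero ξ).symm.le.trans (wt_mono hr ξ)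

theorem continuous_wt (r : ℝ) : Continuous (wt r) := by
  unfold wt
  refine Continuous.rpow_const (by fun_prop) fun ξ => Or.inl ?_
  linarith [one_le_base ξ]

/-- The `H^r` norm of a complex-valued function, `∞` if it is not in `L²`. -/
def sobC (r : ℝ) (u : ℝ → ℂ) : ℝ≥0∞ :=
  open Classical in
  if MemLp u 2 (volume : Measure ℝ) then eLpNorm (fun ξ => (wt r ξ : ℂ) * ftL u ξ) 2 else ⊤

theorem sobC_eq (r : ℝ) {u : ℝ → ℂ} (hu : MemLp u 2) :
    sobC r u = eLpNorm (fun ξ => (wt r ξ : ℂ) * ftL u ξ) 2 := by simp [sobC, hu]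

theorem memLp_of_sobC {r : ℝ} {u : ℝ → ℂ} (h : sobC r u ≠ ⊤) : MemLp u 2 := by
  by_contra h'; simp [sobC, h'] at h

theorem aesm_wt_mul (r : ℝ) (u : ℝ → ℂ) :
    AEStronglyMeasurable (fun ξ => (wt r ξ : ℂ) * ftL u ξ) volume :=
  (Complex.continuous_ofReal.comp (continuous_wt r)).aestronglyMeasurable.mul (memLp_ftL u).1

theorem sobNorm_eq_sobC (r : ℝ) (f : ℝ → ℝ) : sobNorm r f = sobC r (fun x => (f x : ℂ)) := by
  unfold sobNorm
  split_ifs with h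
  · rw [sobC_eq r h, eLpNorm_eq_lintegral_rpow_enorm_toReal (by norm_num) (by norm_num), ftL_eq h]
    simp only [ENNReal.toReal_ofNat]
    congr 2
    ext ξ
    rw [enorm_mul, ENNReal.mul_rpow_of_nonneg _ _ (by norm_num)]
    congr 1
    · rw [← ofReal_norm, Complex.norm_real, Real.norm_of_nonneg (wt_pos _ _).le,
        ENNReal.ofReal_rpow_of_nonneg (wt_pos _ _).le (by norm_num), wt,
        ← Real.rpow_mul (by linarith [one_le_base ξ])]
      norm_num
    · norm_num
  · simp [sobC, h]

theorem sobC_congr (r : ℝ) {u v : ℝ → ℂ} (h : u =ᵐ[volume] v) : sobC r u = sobC r v := by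
  unfold sobC
  rw [memLp_congr_ae h, ftL_congr h]

/-- Comparison of Sobolev norms through a pointwise comparison of Fourier transforms. -/
theorem sobC_le_mul {r r' : ℝ} {u v : ℝ → ℂ} (hu : MemLp u 2) (hv : MemLp v 2) {K : ℝ}
    (h : ∀ᵐ ξ, wt r ξ * ‖ftL u ξ‖ ≤ K * (wt r' ξ * ‖ftL v ξ‖)) :
    sobC r u ≤ ENNReal.ofReal K * sobC r' v := by
  rw [sobC_eq r hu, sobC_eq r' hv]
  refine eLpNorm_le_mul_eLpNorm_of_ae_le_mul ?_ 2
  filter_upwards [h] with ξ hξ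
  simpa [abs_of_pos (wt_pos _ _)] using hξ

theorem sobC_add_le (r : ℝ) (u v : ℝ → ℂ) :
    sobC r (fun x => u x + v x) ≤ sobC r u + sobC r v := by
  by_cases hu : MemLp u 2
  · by_cases hv : MemLp v 2
    · rw [sobC_eq r (hu.add hv : MemLp (fun x => u x + v x) 2), sobC_eq r hu, sobC_eq r hv]
      refine le_trans (le_of_eq (eLpNorm_congr_ae ?_))
        (eLpNorm_add_le (aesm_wt_mul r u) (aesm_wt_mul r v) (by norm_num))
      filter_upwards [ftL_add hu hv] with ξ hξ
      rw [hξ, Pi.add_apply, mul_add]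
    · simp [sobC, hv]
  · simp [sobC, hu]

theorem sobC_zero (r : ℝ) : sobC r (fun _ => 0) = 0 := by
  rw [sobC_eq r MemLp.zero', eLpNorm_congr_ae (g := fun _ => (0 : ℂ)) ?_]
  · simp
  · have := ftL_const_mul 0 (u := fun _ => 0) MemLp.zero'
    filter_upwards [this] with ξ hξ
    simp only [mul_zero, zero_mul] at hξ ⊢
    rw [hξ, mul_zero]

theorem sobC_const_mul (r : ℝ) (c : ℂ) (u : ℝ → ℂ) :
    sobC r (fun x => c * u x) = ‖c‖ₑ * sobC r u := by
  by_cases hc : c = 0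
  · simp [hc, sobC_zero]
  by_cases hu : MemLp u 2
  · rw [sobC_eq r (hu.const_mul c), sobC_eq r hu, ← eLpNorm_const_smul]
    refine eLpNorm_congr_ae ?_
    filter_upwards [ftL_const_mul c hu] with ξ hξ
    simp only [Pi.smul_apply, smul_eq_mul]
    rw [hξ]; ring
  · have : ¬ MemLp (fun x => c * u x) 2 := fun h => hu (by
      have := h.const_mul c⁻¹
      simpa [← mul_assoc, inv_mul_cancel₀ hc] using this)
    simp [sobC, hu, this, hc, ENNReal.mul_top]

theorem sobC_mono {r r' : ℝ} (h : r ≤ r') (u : ℝ → ℂ) : sobC r u ≤ sobC r' u := by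
  by_cases hu : MemLp u 2
  · simpa using sobC_le_mul (K := 1) hu hu (ae_of_all _ fun ξ => by
      rw [one_mul]; gcongr; exact wt_mono h ξ)
  · simp [sobC, hu]

theorem sobC_zero_eq {u : ℝ → ℂ} (hu : MemLp u 2) : sobC 0 u = eLpNorm u 2 := by
  rw [sobC_eq 0 hu, ← eLpNorm_ftL hu]; simp [wt_zero]

theorem eLpNorm_le_sobC {r : ℝ} (hr : 0 ≤ r) (u : ℝ → ℂ) : eLpNorm u 2 ≤ sobC r u := by
  by_cases hu : MemLp u 2
  · rw [← sobC_zero_eq hu]; exact sobC_mono hr u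
  · simp [sobC, hu]

theorem memLp_translate {u : ℝ → ℂ} (hu : MemLp u 2) (h : ℝ) : MemLp (fun x => u (x + h)) 2 :=
  hu.comp_measurePreserving (measurePreserving_add_right volume h)

theorem norm_exp_translate (h ξ : ℝ) :
    ‖Complex.exp (2 * Real.pi * Complex.I * h * ξ)‖ = 1 := by
  rw [Complex.norm_exp]; simp

theorem sobC_translate_le (r : ℝ) (u : ℝ → ℂ) (h : ℝ) : sobC r (fun x => u (x + h)) ≤ sobC r u := by
  by_cases hu : MemLp u 2
  · simpa using sobC_le_mul (K := 1) (memLp_translate hu h) hu (by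
      filter_upwards [ftL_translate hu h] with ξ hξ
      rw [hξ, norm_mul, norm_exp_translate]; simp)
  · simp [sobC, hu]

theorem sobC_translate (r : ℝ) (u : ℝ → ℂ) (h : ℝ) : sobC r (fun x => u (x + h)) = sobC r u := by
  refine le_antisymm (sobC_translate_le r u h) ?_
  have := sobC_translate_le r (fun x => u (x + h)) (-h)
  simpa using this

theorem norm_exp_sub_one_le (h ξ : ℝ) :
    ‖Complex.exp (2 * Real.pi * Complex.I * h * ξ) - 1‖ ≤ |h| * |2 * Real.pi * ξ| := by
  have := Real.norm_exp_I_mul_ofReal_sub_one_le (x := 2 * Real.pi * h * ξ)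
  have e : Complex.I * ((2 * Real.pi * h * ξ : ℝ) : ℂ) = 2 * Real.pi * Complex.I * h * ξ := by
    push_cast; ring
  rw [e] at this
  refine this.trans (le_of_eq ?_)
  rw [Real.norm_eq_abs, ← abs_mul]; ring_nf

theorem sobC_translate_sub_le (r : ℝ) (u : ℝ → ℂ) (h : ℝ) :
    sobC r (fun x => u (x + h) - u x) ≤ ENNReal.ofReal |h| * sobC (r + 1) u := by
  by_cases hh : h = 0
  · simp [hh, sobC_zero]
  by_cases hu : MemLp u 2
  · refine sobC_le_mul (u := fun x => u (x + h) - u x) ((memLp_translate hu h).sub hu) hu ?_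
    filter_upwards [ftL_translate hu h, ftL_sub (memLp_translate hu h) hu] with ξ h1 h2
    rw [h2, h1, show ∀ a b : ℂ, a * b - b = (a - 1) * b by intros; ring, norm_mul, wt_add]
    have h3 := (norm_exp_sub_one_le h ξ).trans
      (mul_le_mul_of_nonneg_left (abs_le_wt_one ξ) (abs_nonneg h))
    have := mul_le_mul_of_nonneg_left h3 (wt_pos r ξ).le
    have := mul_le_mul_of_nonneg_right this (norm_nonneg (ftL u ξ))
    linarith
  · simp [sobC, hu, ENNReal.mul_top, hh]

theorem sobC_deriv_le {r : ℝ} (hr : 0 ≤ r) {u u' : ℝ → ℂ} (hc : Continuous u')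
    (hd : ∀ x, HasDerivAt u (u' x) x) : sobC r u' ≤ sobC (r + 1) u := by
  by_cases hs : sobC (r + 1) u = ⊤
  · simp [hs]
  have hu := memLp_of_sobC hs
  have key : ∀ ξ : ℝ, ‖(2 * Real.pi * Complex.I * ξ : ℂ)‖ = |2 * Real.pi * ξ| := fun ξ => by
    simp [abs_mul]
  have hw : MemLp (fun ξ : ℝ => (2 * Real.pi * Complex.I * ξ) * ftL u ξ) 2 := by
    have h1 : MemLp (fun ξ => (wt (r + 1) ξ : ℂ) * ftL u ξ) 2 :=
      ⟨aesm_wt_mul _ _, by rw [← sobC_eq _ hu]; exact lt_top_iff_ne_top.2 hs⟩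
    refine h1.mono ((by fun_prop : Continuous fun ξ : ℝ =>
      (2 * Real.pi * Complex.I * ξ : ℂ)).aestronglyMeasurable.mul (memLp_ftL u).1)
      (ae_of_all _ fun ξ => ?_)
    rw [norm_mul, key, norm_mul, Complex.norm_real, Real.norm_of_nonneg (wt_pos _ _).le]
    gcongr
    exact (abs_le_wt_one ξ).trans (wt_mono (by linarith) ξ)
  have hu' := memLp_deriv hu hc hd hw
  simpa using sobC_le_mul (K := 1) hu' hu (by
    filter_upwards [ftL_deriv hu hu' hd] with ξ h1
    rw [h1, norm_mul, key, wt_add, one_mul, ← mul_assoc]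
    have := (wt_pos r ξ).le
    gcongr
    exact abs_le_wt_one ξ)

theorem sobC_succ_le (r : ℝ) {u u' : ℝ → ℂ} (hd : ∀ x, HasDerivAt u (u' x) x) :
    sobC (r + 1) u ≤ sobC r u + sobC r u' := by
  by_cases hu : MemLp u 2
  swap
  · simp [sobC, hu]
  by_cases hu' : MemLp u' 2
  swap
  · simp [sobC, hu']
  rw [sobC_eq _ hu, sobC_eq _ hu, sobC_eq _ hu']
  have h1 : eLpNorm (fun ξ => (wt (r + 1) ξ : ℂ) * ftL u ξ) 2 ≤
      eLpNorm (fun ξ => ‖(wt r ξ : ℂ) * ftL u ξ‖ + ‖(wt r ξ : ℂ) * ftL u' ξ‖) 2 := by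
    refine eLpNorm_mono_ae ?_
    filter_upwards [ftL_deriv hu hu' hd] with ξ h1
    rw [h1]
    simp only [norm_mul, Complex.norm_real, Real.norm_of_nonneg (wt_pos _ _).le, wt_add,
      Real.norm_eq_abs]
    refine le_trans ?_ (le_abs_self _)
    have := mul_le_mul_of_nonneg_left (wt_one_le ξ) (wt_pos r ξ).le
    have := mul_le_mul_of_nonneg_right this (norm_nonneg (ftL u ξ))
    refine this.trans (le_of_eq ?_)
    simp [abs_mul]
    ring
  refine h1.trans ?_
  refine (eLpNorm_add_le (aesm_wt_mul r u).norm (aesm_wt_mul r u').norm (by norm_num)).trans ?_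
  rw [eLpNorm_norm, eLpNorm_norm]

open scoped SchwartzMap ContDiff

/-! ### Sobolev embedding -/

theorem eLpNorm_two_sq {E : Type*} [ENorm E] (f : ℝ → E) :
    eLpNorm f 2 volume ^ 2 = ∫⁻ x, ‖f x‖ₑ ^ 2 := by
  rw [eLpNorm_eq_lintegral_rpow_enorm_toReal (by norm_num) (by norm_num), ← ENNReal.rpow_natCast,
    ← ENNReal.rpow_mul]
  norm_num

theorem le_of_sq_le_sq_ennreal {a b : ℝ≥0∞} (h : a ^ 2 ≤ b ^ 2) : a ≤ b :=
  (ENNReal.pow_le_pow_left_iff (two_ne_zero)).1 h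

theorem memLp_wt_neg {r : ℝ} (hr : 1 / 2 < r) : MemLp (fun ξ => (wt (-r) ξ : ℂ)) 2 := by
  have h1 : Integrable (fun x : ℝ => (1 + ‖x‖ ^ 2) ^ (-(2 * r) / 2)) :=
    integrable_rpow_neg_one_add_norm_sq (by simp; linarith)
  have h2 := h1.comp_mul_left' (R := 2 * Real.pi) (by positivity)
  have hm : AEStronglyMeasurable (fun ξ => (wt (-r) ξ : ℂ)) volume :=
    (Complex.continuous_ofReal.comp (continuous_wt _)).aestronglyMeasurable
  rw [memLp_two_iff_integrable_sq_norm hm]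
  refine h2.congr (ae_of_all _ fun ξ => ?_)
  simp only [Complex.norm_real, Real.norm_eq_abs, sq_abs]
  rw [wt, ← Real.rpow_mul_natCast (by linarith [one_le_base ξ])]
  congr 1
  push_cast; ring

/-- The constant of the embedding of `H^r` into the continuous functions. -/
def cSob (r : ℝ) : ℝ≥0∞ := eLpNorm (fun ξ => (wt (-r) ξ : ℂ)) 2

theorem cSob_ne_top {r : ℝ} (hr : 1 / 2 < r) : cSob r ≠ ⊤ := (memLp_wt_neg hr).2.ne

theorem wt_neg_mul (r ξ : ℝ) : wt (-r) ξ * wt r ξ = 1 := by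
  rw [← wt_add, neg_add_cancel, wt_zero]

theorem lintegral_wt_ftL_le {r q : ℝ} {u : ℝ → ℂ} (hu : MemLp u 2) :
    ∫⁻ ξ, ‖(wt q ξ : ℂ) * ftL u ξ‖ₑ ≤ cSob r * sobC (r + q) u := by
  rw [sobC_eq _ hu, cSob]
  have h := ENNReal.lintegral_mul_le_Lp_mul_Lq (volume : Measure ℝ) Real.HolderConjugate.two_two
    (f := fun ξ => ‖(wt (-r) ξ : ℂ)‖ₑ) (g := fun ξ => ‖(wt (r + q) ξ : ℂ) * ftL u ξ‖ₑ)
    ((Complex.continuous_ofReal.comp (continuous_wt _)).aestronglyMeasurable.enorm)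
    ((aesm_wt_mul _ _).enorm)
  rw [eLpNorm_eq_lintegral_rpow_enorm_toReal (by norm_num) (by norm_num),
    eLpNorm_eq_lintegral_rpow_enorm_toReal (by norm_num) (by norm_num)]
  simp only [ENNReal.toReal_ofNat]
  refine le_trans (le_of_eq ?_) h
  congr 1; ext ξ
  rw [Pi.mul_apply, ← enorm_mul, ← mul_assoc, ← Complex.ofReal_mul, wt_add, ← mul_assoc,
    wt_neg_mul, one_mul]

theorem integrable_wt_ftL {r q : ℝ} (hr : 1 / 2 < r) {u : ℝ → ℂ} (h : sobC (r + q) u ≠ ⊤) :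
    Integrable (fun ξ => (wt q ξ : ℂ) * ftL u ξ) :=
  ⟨aesm_wt_mul _ _, (lintegral_wt_ftL_le (r := r) (memLp_of_sobC h)).trans_lt
    (ENNReal.mul_lt_top (lt_top_iff_ne_top.2 (cSob_ne_top hr)) (lt_top_iff_ne_top.2 h))⟩

theorem lintegral_ftL_le {r : ℝ} {u : ℝ → ℂ} (hu : MemLp u 2) :
    ∫⁻ ξ, ‖ftL u ξ‖ₑ ≤ cSob r * sobC r u := by
  simpa [wt_zero] using lintegral_wt_ftL_le (r := r) (q := 0) hu

theorem integrable_ftL {r : ℝ} (hr : 1 / 2 < r) {u : ℝ → ℂ} (h : sobC r u ≠ ⊤) :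
    Integrable (ftL u) := by
  simpa [wt_zero] using integrable_wt_ftL (r := r) (q := 0) hr (u := u) (by simpa using h)

theorem eq_fourierInv_ftL {r : ℝ} (hr : 1 / 2 < r) {u : ℝ → ℂ} (h : sobC r u ≠ ⊤)
    (hc : Continuous u) : u = 𝓕⁻ (ftL u) :=
  (hc.ae_eq_iff_eq volume (continuous_fourierInv (integrable_ftL hr h))).1
    (ae_eq_fourierInv_ftL (memLp_of_sobC h) (integrable_ftL hr h))

theorem enorm_fourierInv_le (v : ℝ → ℂ) (x : ℝ) : ‖𝓕⁻ v x‖ₑ ≤ ∫⁻ ξ, ‖v ξ‖ₑ := by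
  rw [Real.fourierInv_eq]
  refine (enorm_integral_le_lintegral_enorm _).trans (le_of_eq ?_)
  congr 1; ext ξ
  rw [Circle.smul_def, ← ofReal_norm, ← ofReal_norm, norm_smul, Circle.norm_coe, one_mul]

theorem enorm_le_sobC {r : ℝ} (hr : 1 / 2 < r) {u : ℝ → ℂ} (hc : Continuous u) (x : ℝ) :
    ‖u x‖ₑ ≤ cSob r * sobC r u := by
  by_cases h : sobC r u = ⊤
  · have : cSob r ≠ 0 := by
      rw [cSob, Ne, eLpNorm_eq_zero_iff (memLp_wt_neg hr).1 (by norm_num)]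
      intro h0
      have : (fun ξ => (wt (-r) ξ : ℂ)) = fun _ => 0 :=
        ((Complex.continuous_ofReal.comp (continuous_wt (-r))).ae_eq_iff_eq volume
          continuous_const).1 h0
      have := congrFun this 0
      simp [(wt_pos (-r) 0).ne'] at this
    simp [h, ENNReal.mul_top this]
  · rw [eq_fourierInv_ftL hr h hc]
    refine (enorm_fourierInv_le _ _).trans ?_
    rw [← eq_fourierInv_ftL hr h hc]
    exact lintegral_ftL_le (memLp_of_sobC h)

theorem wt_natCast_ge (n : ℕ) (ξ : ℝ) : |ξ| ^ n ≤ wt n ξ := by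
  have h1 : |ξ| ≤ wt 1 ξ := by
    refine le_trans ?_ (abs_le_wt_one ξ)
    rw [abs_mul, abs_of_pos (by positivity : (0 : ℝ) < 2 * Real.pi)]
    nlinarith [abs_nonneg ξ, Real.pi_gt_three]
  have h2 : wt n ξ = wt 1 ξ ^ n := by
    rw [wt, wt, ← Real.rpow_mul_natCast (by linarith [one_le_base ξ])]
    congr 1; ring
  rw [h2]; gcongr

theorem contDiff_fourierInv_ftL {r : ℝ} {n : ℕ} (hr : n + 1 / 2 < r) {u : ℝ → ℂ}
    (h : sobC r u ≠ ⊤) : ContDiff ℝ n (𝓕⁻ (ftL u)) := by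
  rw [Real.fourierInv_eq_fourier_comp_neg]
  refine Real.contDiff_fourier (N := n) fun k hk => ?_
  have hk : k ≤ n := by exact_mod_cast hk
  have hk' : (k : ℝ) ≤ n := by exact_mod_cast hk
  have h1 : Integrable (fun ξ => (wt k ξ : ℂ) * ftL u ξ) :=
    integrable_wt_ftL (r := r - k) (by linarith) (by simpa using h)
  have h2 : Integrable (fun ξ : ℝ => ‖ξ‖ ^ k * ‖ftL u ξ‖) := by
    refine h1.norm.mono ((by fun_prop : Continuous fun ξ : ℝ => ‖ξ‖ ^ k).aestronglyMeasurable.mul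
      (memLp_ftL u).1.norm) (ae_of_all _ fun ξ => ?_)
    simp only [norm_mul, norm_norm, norm_pow, Complex.norm_real, Real.norm_of_nonneg (wt_pos _ _).le]
    gcongr
    exact wt_natCast_ge k ξ
  simpa using h2.comp_neg

theorem contDiff_of_sobC {r : ℝ} {n : ℕ} (hr : n + 1 / 2 < r) {u : ℝ → ℂ} (h : sobC r u ≠ ⊤)
    (hc : Continuous u) : ContDiff ℝ n u := by
  rw [eq_fourierInv_ftL (by have : (0 : ℝ) ≤ n := n.cast_nonneg
                            linarith) h hc]
  exact contDiff_fourierInv_ftL hr h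

/-! ### Limits and splittings -/

theorem sobC_le_of_tendsto {r : ℝ} {u : ℕ → ℝ → ℂ} {v : ℝ → ℂ} {K : ℝ≥0∞}
    (hu : ∀ n, MemLp (u n) 2) (hv : MemLp v 2)
    (hl : Tendsto (fun n => eLpNorm (fun x => u n x - v x) 2) atTop (𝓝 0))
    (hK : ∀ n, sobC r (u n) ≤ K) : sobC r v ≤ K := by
  have h1 : Tendsto (fun n => eLpNorm (ftL (u n) - ftL v) 2) atTop (𝓝 0) := by
    refine hl.congr fun n => ?_
    rw [← eLpNorm_ftL ((hu n).sub hv : MemLp (fun x => u n x - v x) 2)]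
    exact eLpNorm_congr_ae (ftL_sub (hu n) hv)
  obtain ⟨ns, -, hns⟩ := (tendstoInMeasure_of_tendsto_eLpNorm (by norm_num)
    (fun n => (memLp_ftL (u n)).1) (memLp_ftL v).1 h1).exists_seq_tendsto_ae
  rw [sobC_eq r hv]
  refine Lp.eLpNorm_le_of_ae_tendsto (u := atTop)
    (f := fun n ξ => (wt r ξ : ℂ) * ftL (u (ns n)) ξ) (Eventually.of_forall fun n => ?_)
    (fun n => aesm_wt_mul _ _) ?_
  · rw [← sobC_eq r (hu _)]; exact hK _
  · filter_upwards [hns] with ξ hξ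
    exact hξ.const_mul _

theorem eLpNorm_le_of_three {f a b e : ℝ → ℂ} {c d : ℝ} (hc : 0 ≤ c) (hd : 0 ≤ d)
    (ha : AEStronglyMeasurable a) (hb : AEStronglyMeasurable b) (he : AEStronglyMeasurable e)
    (h : ∀ᵐ x, ‖f x‖ ≤ ‖a x‖ + c * ‖b x‖ + d * ‖e x‖) :
    eLpNorm f 2 ≤ eLpNorm a 2 + ENNReal.ofReal c * eLpNorm b 2
      + ENNReal.ofReal d * eLpNorm e 2 := by
  have hB : AEStronglyMeasurable (fun x => c * ‖b x‖) := hb.norm.const_mul c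
  have hE : AEStronglyMeasurable (fun x => d * ‖e x‖) := he.norm.const_mul d
  have e1 : eLpNorm (fun x => c * ‖b x‖) 2 = ENNReal.ofReal c * eLpNorm b 2 := by
    rw [← Real.enorm_of_nonneg hc, ← eLpNorm_norm b, ← eLpNorm_const_smul]; rfl
  have e2 : eLpNorm (fun x => d * ‖e x‖) 2 = ENNReal.ofReal d * eLpNorm e 2 := by
    rw [← Real.enorm_of_nonneg hd, ← eLpNorm_norm e, ← eLpNorm_const_smul]; rfl
  have h1 : eLpNorm f 2 ≤ eLpNorm (fun x => ‖a x‖ + c * ‖b x‖ + d * ‖e x‖) 2 :=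
    eLpNorm_mono_ae (h.mono fun x hx => hx.trans (le_abs_self _))
  have h2 := eLpNorm_add_le (ha.norm.add hB) hE (p := 2) (by norm_num)
  have h3 := eLpNorm_add_le ha.norm hB (p := 2) (by norm_num)
  rw [e1] at h3
  rw [e2] at h2
  rw [eLpNorm_norm] at h3
  exact h1.trans (h2.trans (by gcongr))

/-- If `f = a + b`, the `H^r` norm of `f` is controlled by `a` in `H^r`, by `b` in the weaker
space `H^{r-2}` at low frequencies and by `f` in `H^{r+2}` at high frequencies. -/
theorem sobC_split {r μ : ℝ} (hμ : 0 < μ) {f a b : ℝ → ℂ} (ha : MemLp a 2) (hb : MemLp b 2)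
    (hf : ∀ x, f x = a x + b x) :
    sobC r f ≤ sobC r a + ENNReal.ofReal (1 + μ⁻¹) * sobC (r - 2) b
      + ENNReal.ofReal μ * sobC (r + 2) f := by
  have hf' : f = fun x => a x + b x := funext hf
  have hfm : MemLp f 2 := by rw [hf']; exact ha.add hb
  have key : ∀ᵐ ξ, ‖(wt r ξ : ℂ) * ftL f ξ‖ ≤ ‖(wt r ξ : ℂ) * ftL a ξ‖ +
      (1 + μ⁻¹) * ‖(wt (r - 2) ξ : ℂ) * ftL b ξ‖ + μ * ‖(wt (r + 2) ξ : ℂ) * ftL f ξ‖ := by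
    have hadd := ftL_add ha hb
    rw [← hf'] at hadd
    filter_upwards [hadd] with ξ hξ
    simp only [norm_mul, Complex.norm_real, Real.norm_of_nonneg (wt_pos _ _).le]
    have e1 : wt r ξ = wt (r - 2) ξ * wt 2 ξ := by rw [← wt_add]; ring_nf
    have e2 : wt (r + 2) ξ = wt r ξ * wt 2 ξ := wt_add _ _ _
    have p1 := wt_pos r ξ
    have p2 := wt_pos (r - 2) ξ
    have n1 := norm_nonneg (ftL a ξ)
    have n2 := norm_nonneg (ftL b ξ)
    have n3 := norm_nonneg (ftL f ξ)
    have hμ' : 0 < μ⁻¹ := by positivity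
    rcases le_total (wt 2 ξ) (1 + μ⁻¹) with h | h
    · have : wt r ξ * ‖ftL f ξ‖ ≤ wt r ξ * ‖ftL a ξ‖ + wt r ξ * ‖ftL b ξ‖ := by
        rw [hξ, ← mul_add]; gcongr; exact norm_add_le _ _
      have h3 : wt r ξ * ‖ftL b ξ‖ ≤ (1 + μ⁻¹) * (wt (r - 2) ξ * ‖ftL b ξ‖) := by
        rw [e1]
        have := mul_le_mul_of_nonneg_right h (mul_nonneg p2.le n2)
        linarith
      have h4 : 0 ≤ μ * (wt (r + 2) ξ * ‖ftL f ξ‖) := by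
        have := wt_pos (r + 2) ξ; positivity
      linarith
    · have h3 : 1 ≤ μ * wt 2 ξ := by
        have := mul_le_mul_of_nonneg_left h hμ.le
        rw [mul_add, mul_inv_cancel₀ hμ.ne'] at this
        linarith
      have h4 : wt r ξ * ‖ftL f ξ‖ ≤ μ * (wt (r + 2) ξ * ‖ftL f ξ‖) := by
        rw [e2]
        have := mul_le_mul_of_nonneg_right h3 (mul_nonneg p1.le n3)
        linarith
      have h5 : 0 ≤ wt r ξ * ‖ftL a ξ‖ := by positivity
      have h6 : 0 ≤ (1 + μ⁻¹) * (wt (r - 2) ξ * ‖ftL b ξ‖) := by positivity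
      linarith
  rw [sobC_eq _ hfm, sobC_eq _ hfm, sobC_eq _ ha, sobC_eq _ hb]
  exact eLpNorm_le_of_three (by positivity) hμ.le (aesm_wt_mul _ _) (aesm_wt_mul _ _)
    (aesm_wt_mul _ _) key

/-! ### The algebra property -/

theorem eLpNorm_lconv_le {f g : ℝ → ℝ≥0∞} (hf : AEMeasurable f) (hg : AEMeasurable g) :
    eLpNorm (fun ξ => ∫⁻ η, f η * g (ξ - η)) 2 ≤ (∫⁻ η, f η) * eLpNorm g 2 := by
  refine le_of_sq_le_sq_ennreal ?_
  rw [mul_pow, eLpNorm_two_sq, eLpNorm_two_sq]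
  simp only [enorm_eq_self]
  have hg' : ∀ ξ, AEMeasurable (fun η => g (ξ - η)) := fun ξ =>
    hg.comp_quasiMeasurePreserving (quasiMeasurePreserving_sub_left volume ξ)
  have h1 : ∀ ξ, (∫⁻ η, f η * g (ξ - η)) ^ 2 ≤ (∫⁻ η, f η) * ∫⁻ η, f η * g (ξ - η) ^ 2 := by
    intro ξ
    have h := ENNReal.lintegral_mul_le_Lp_mul_Lq (volume : Measure ℝ) Real.HolderConjugate.two_two
      (f := fun η => f η ^ (1 / 2 : ℝ)) (g := fun η => f η ^ (1 / 2 : ℝ) * g (ξ - η))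
      (hf.pow_const _) ((hf.pow_const _).mul (hg' ξ))
    have e1 : ∀ η, f η ^ (1 / 2 : ℝ) * f η ^ (1 / 2 : ℝ) = f η := fun η => by
      rw [← ENNReal.rpow_add_of_nonneg _ _ (by norm_num) (by norm_num)]; norm_num
    have e2 : ∀ η, (f η ^ (1 / 2 : ℝ)) ^ (2 : ℝ) = f η := fun η => by
      rw [← ENNReal.rpow_mul]; norm_num
    simp only [Pi.mul_apply, ← mul_assoc, e1, e2] at h
    simp only [ENNReal.mul_rpow_of_nonneg _ _ (zero_le_two : (0:ℝ) ≤ 2), e2] at h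
    have h' := pow_le_pow_left' h 2
    refine h'.trans (le_of_eq ?_)
    rw [mul_pow, ← ENNReal.rpow_natCast, ← ENNReal.rpow_natCast, ← ENNReal.rpow_mul,
      ← ENNReal.rpow_mul]
    norm_num
  have hm : AEMeasurable (fun p : ℝ × ℝ => f p.2 * g (p.1 - p.2) ^ 2) (volume.prod volume) :=
    (hf.comp_quasiMeasurePreserving Measure.quasiMeasurePreserving_snd).mul
      ((hg.comp_quasiMeasurePreserving
        (quasiMeasurePreserving_sub_of_right_invariant volume volume)).pow_const 2)
  calc ∫⁻ ξ, (∫⁻ η, f η * g (ξ - η)) ^ 2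
      ≤ ∫⁻ ξ, (∫⁻ η, f η) * ∫⁻ η, f η * g (ξ - η) ^ 2 := lintegral_mono h1
    _ = (∫⁻ η, f η) * ∫⁻ ξ, ∫⁻ η, f η * g (ξ - η) ^ 2 :=
        lintegral_const_mul'' _ hm.lintegral_prod_right'
    _ = (∫⁻ η, f η) * ∫⁻ η, ∫⁻ ξ, f η * g (ξ - η) ^ 2 := by
        rw [lintegral_lintegral_swap hm]
    _ = (∫⁻ η, f η) * ∫⁻ η, f η * ∫⁻ ξ, g ξ ^ 2 := by
        congr 1
        refine lintegral_congr fun η => ?_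
        have : AEMeasurable (fun ξ => g (ξ - η) ^ 2) :=
          (hg.comp_quasiMeasurePreserving
            (measurePreserving_sub_right volume η).quasiMeasurePreserving).pow_const 2
        rw [lintegral_const_mul'' _ this, lintegral_sub_right_eq_self (fun ξ => g ξ ^ 2)]
    _ = (∫⁻ η, f η) ^ 2 * ∫⁻ ξ, g ξ ^ 2 := by
        rw [lintegral_mul_const'' _ hf]; ring

theorem wt_sub_add_le {r : ℝ} (hr : 0 ≤ r) (ξ η : ℝ) :
    wt r ξ ≤ 2 ^ r * (wt r η + wt r (ξ - η)) := by
  have h1 := one_le_base η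
  have h2 := one_le_base (ξ - η)
  set A := 1 + (2 * Real.pi * η) ^ 2 with hA
  set B := 1 + (2 * Real.pi * (ξ - η)) ^ 2 with hB
  have h3 : 1 + (2 * Real.pi * ξ) ^ 2 ≤ 4 * max A B := by
    have : 1 + (2 * Real.pi * ξ) ^ 2 ≤ 2 * A + 2 * B := by
      nlinarith [sq_nonneg (2 * Real.pi * η - 2 * Real.pi * (ξ - η))]
    linarith [le_max_left A B, le_max_right A B]
  have h4 : (0 : ℝ) ≤ max A B := by linarith [le_max_left A B]
  have h5 : (4 : ℝ) ^ (r / 2) = 2 ^ r := by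
    rw [show (4 : ℝ) = 2 ^ (2 : ℝ) by norm_num, ← Real.rpow_mul (by norm_num)]; congr 1; ring
  calc wt r ξ ≤ (4 * max A B) ^ (r / 2) :=
        Real.rpow_le_rpow (by linarith [one_le_base ξ]) h3 (by linarith)
    _ = 2 ^ r * (max A B) ^ (r / 2) := by rw [Real.mul_rpow (by norm_num) h4, h5]
    _ ≤ 2 ^ r * (wt r η + wt r (ξ - η)) := by
        gcongr
        have p1 := wt_pos r η
        have p2 := wt_pos r (ξ - η)
        rcases max_choice A B with h | h <;> rw [h]
        · change wt r η ≤ _; linarith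
        · change wt r (ξ - η) ≤ _; linarith

theorem fourierInv_convolution {U V : ℝ → ℂ} (hU : Integrable U) (hV : Integrable V) (x : ℝ) :
    𝓕⁻ (convolution U V (ContinuousLinearMap.mul ℂ ℂ)) x = 𝓕⁻ U x * 𝓕⁻ V x := by
  simp only [Real.fourierInv_eq_fourier_neg]
  exact Real.fourier_mul_convolution_eq hU hV (-x)

theorem ftL_mul {u v : ℝ → ℂ} (hu : MemLp u 2) (hv : MemLp v 2) (hU : Integrable (ftL u))
    (hV : Integrable (ftL v)) : MemLp (fun x => u x * v x) 2 ∧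
      ftL (fun x => u x * v x) =ᵐ[volume]
        convolution (ftL u) (ftL v) (ContinuousLinearMap.mul ℂ ℂ) := by
  have hvi := ae_eq_fourierInv_ftL hv hV
  have hui := ae_eq_fourierInv_ftL hu hU
  have hm : MemLp (fun x => u x * v x) 2 := by
    have hb : MemLp (𝓕⁻ (ftL v)) ⊤ := by
      refine memLp_top_of_bound (continuous_fourierInv hV).aestronglyMeasurable
        (∫⁻ ξ, ‖ftL v ξ‖ₑ).toReal (ae_of_all _ fun x => ?_)
      rw [← toReal_enorm]
      exact ENNReal.toReal_mono hV.2.ne (enorm_fourierInv_le _ _)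
    have : MemLp (fun x => 𝓕⁻ (ftL v) x * u x) 2 := hu.mul hb
    refine (memLp_congr_ae ?_).1 this
    filter_upwards [hvi] with x hx
    rw [← hx, mul_comm]
  refine ⟨hm, ?_⟩
  have hc : Integrable (convolution (ftL u) (ftL v) (ContinuousLinearMap.mul ℂ ℂ)) :=
    hU.integrable_convolution _ hV
  refine ftL_ae_eq_of_pairing hm hc.locallyIntegrable fun φ => ?_
  have h1 := integral_fourierInv_mul hc (𝓕 φ)
  rw [FourierTransform.fourierInv_fourier_eq] at h1
  rw [h1]
  refine integral_congr_ae ?_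
  filter_upwards [hvi, hui] with x h2 h3
  rw [fourierInv_convolution hU hV, ← h2, ← h3]

/-- `H^r(ℝ)` is an algebra for `r > 1/2`. -/
theorem sobC_mul_le {r : ℝ} (hr : 1 / 2 < r) {u v : ℝ → ℂ} (hu' : sobC r u ≠ ⊤)
    (hv' : sobC r v ≠ ⊤) :
    sobC r (fun x => u x * v x) ≤ ENNReal.ofReal (2 ^ r) * (2 * cSob r) * (sobC r u * sobC r v) := by
  have hu := memLp_of_sobC hu'
  have hv := memLp_of_sobC hv'
  have hU := integrable_ftL hr hu'
  have hV := integrable_ftL hr hv'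
  obtain ⟨hm, hft⟩ := ftL_mul hu hv hU hV
  set a : ℝ → ℝ≥0∞ := fun ξ => ‖(wt r ξ : ℂ) * ftL u ξ‖ₑ with ha
  set b : ℝ → ℝ≥0∞ := fun ξ => ‖(wt r ξ : ℂ) * ftL v ξ‖ₑ with hb
  have ham : AEMeasurable a := (aesm_wt_mul r u).enorm
  have hbm : AEMeasurable b := (aesm_wt_mul r v).enorm
  have hUm : AEMeasurable (fun ξ => ‖ftL u ξ‖ₑ) := hU.1.enorm
  have hVm : AEMeasurable (fun ξ => ‖ftL v ξ‖ₑ) := hV.1.enorm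
  have hwe : ∀ ξ, ‖(wt r ξ : ℂ)‖ₑ = ENNReal.ofReal (wt r ξ) := fun ξ => by
    rw [← ofReal_norm, Complex.norm_real, Real.norm_of_nonneg (wt_pos _ _).le]
  have hsub : ∀ {f : ℝ → ℝ≥0∞}, AEMeasurable f → ∀ ξ, AEMeasurable (fun η => f (ξ - η)) :=
    fun hf ξ => hf.comp_quasiMeasurePreserving (quasiMeasurePreserving_sub_left volume ξ)
  have key : ∀ᵐ ξ, ‖(wt r ξ : ℂ) * ftL (fun x => u x * v x) ξ‖ₑ ≤ ENNReal.ofReal (2 ^ r) *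
      ((∫⁻ η, ‖ftL v η‖ₑ * a (ξ - η)) + ∫⁻ η, ‖ftL u η‖ₑ * b (ξ - η)) := by
    filter_upwards [hft] with ξ hξ
    rw [hξ, enorm_mul, hwe]
    calc ENNReal.ofReal (wt r ξ) * ‖convolution (ftL u) (ftL v) (ContinuousLinearMap.mul ℂ ℂ) volume ξ‖ₑ
        ≤ ENNReal.ofReal (wt r ξ) * ∫⁻ η, ‖ftL u η * ftL v (ξ - η)‖ₑ := by
          gcongr
          exact enorm_integral_le_lintegral_enorm _
      _ = ∫⁻ η, ENNReal.ofReal (wt r ξ) * (‖ftL u η‖ₑ * ‖ftL v (ξ - η)‖ₑ) := by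
          rw [← lintegral_const_mul' _ _ ENNReal.ofReal_ne_top]
          simp only [enorm_mul]
      _ ≤ ∫⁻ η, ENNReal.ofReal (2 ^ r) *
            (‖ftL v (ξ - η)‖ₑ * a η + ‖ftL u η‖ₑ * b (ξ - η)) := by
          refine lintegral_mono fun η => ?_
          have h1 : ENNReal.ofReal (wt r ξ) ≤ ENNReal.ofReal (2 ^ r) *
              (ENNReal.ofReal (wt r η) + ENNReal.ofReal (wt r (ξ - η))) := by
            rw [← ENNReal.ofReal_add (wt_pos _ _).le (wt_pos _ _).le,
              ← ENNReal.ofReal_mul (by positivity)]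
            exact ENNReal.ofReal_le_ofReal (wt_sub_add_le (by linarith) ξ η)
          refine (mul_le_mul_left h1 _).trans (le_of_eq ?_)
          simp only [ha, hb, enorm_mul, hwe]
          ring
      _ = _ := by
          rw [lintegral_const_mul' _ _ ENNReal.ofReal_ne_top,
            lintegral_add_left' (f := fun η => ‖ftL v (ξ - η)‖ₑ * a η) ((hsub hVm ξ).mul ham)]
          congr 2
          rw [← lintegral_sub_left_eq_self _ ξ]
          simp
  have hA : AEStronglyMeasurable (fun ξ => ∫⁻ η, ‖ftL v η‖ₑ * a (ξ - η)) :=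
    (AEMeasurable.lintegral_prod_right' (f := fun p : ℝ × ℝ => ‖ftL v p.2‖ₑ * a (p.1 - p.2))
      ((hVm.comp_quasiMeasurePreserving Measure.quasiMeasurePreserving_snd).mul
      (ham.comp_quasiMeasurePreserving
        (quasiMeasurePreserving_sub_of_right_invariant volume volume)))).aestronglyMeasurable
  have hB : AEStronglyMeasurable (fun ξ => ∫⁻ η, ‖ftL u η‖ₑ * b (ξ - η)) :=
    (AEMeasurable.lintegral_prod_right' (f := fun p : ℝ × ℝ => ‖ftL u p.2‖ₑ * b (p.1 - p.2))
      ((hUm.comp_quasiMeasurePreserving Measure.quasiMeasurePreserving_snd).mul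
      (hbm.comp_quasiMeasurePreserving
        (quasiMeasurePreserving_sub_of_right_invariant volume volume)))).aestronglyMeasurable
  have ea : eLpNorm a 2 = sobC r u := by rw [sobC_eq r hu]; exact eLpNorm_enorm _
  have eb : eLpNorm b 2 = sobC r v := by rw [sobC_eq r hv]; exact eLpNorm_enorm _
  rw [sobC_eq r hm]
  have h1 := eLpNorm_add_le hA hB (p := 2) (by norm_num)
  have h2 := eLpNorm_lconv_le hVm ham
  have h3 := eLpNorm_lconv_le hUm hbm
  rw [ea] at h2
  rw [eb] at h3
  have h4 : eLpNorm (fun ξ => (wt r ξ : ℂ) * ftL (fun x => u x * v x) ξ) 2 ≤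
      ENNReal.ofReal (2 ^ r) * eLpNorm ((fun ξ => ∫⁻ η, ‖ftL v η‖ₑ * a (ξ - η)) +
        fun ξ => ∫⁻ η, ‖ftL u η‖ₑ * b (ξ - η)) 2 := by
    refine le_of_sq_le_sq_ennreal ?_
    rw [mul_pow, eLpNorm_two_sq, eLpNorm_two_sq,
      ← lintegral_const_mul' _ _ (ENNReal.pow_ne_top ENNReal.ofReal_ne_top)]
    refine lintegral_mono_ae ?_
    filter_upwards [key] with ξ hξ
    rw [← mul_pow]
    exact pow_le_pow_left' hξ 2
  refine h4.trans ?_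
  rw [mul_assoc]
  gcongr
  refine h1.trans ((add_le_add h2 h3).trans ?_)
  have h5 := lintegral_ftL_le (r := r) hu
  have h6 := lintegral_ftL_le (r := r) hv
  calc _ ≤ cSob r * sobC r v * sobC r u + cSob r * sobC r u * sobC r v := by gcongr
    _ = _ := by ring

open scoped SchwartzMap ContDiff

/-! ### Multiplication by bounded functions with Sobolev derivative -/

theorem hasDerivAt_wt (r ξ : ℝ) :
    HasDerivAt (wt r) (r * (2 * Real.pi) * (2 * Real.pi * ξ) * wt (r - 2) ξ) ξ := by
  have h1 : HasDerivAt (fun ξ : ℝ => 1 + (2 * Real.pi * ξ) ^ 2)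
      (2 * (2 * Real.pi * ξ) * (2 * Real.pi)) ξ := by
    have := (((hasDerivAt_id ξ).const_mul (2 * Real.pi)).pow 2).const_add 1
    refine this.congr_deriv ?_
    simp
  have h2 := h1.rpow_const (p := r / 2) (Or.inl (by linarith [one_le_base ξ]))
  refine h2.congr_deriv ?_
  have : wt (r - 2) ξ = (1 + (2 * Real.pi * ξ) ^ 2) ^ (r / 2 - 1) := by
    rw [wt]; congr 1; ring
  rw [this]; ring

theorem abs_deriv_wt_le {r : ℝ} (hr : 0 ≤ r) (ξ : ℝ) :
    |r * (2 * Real.pi) * (2 * Real.pi * ξ) * wt (r - 2) ξ| ≤ r * (2 * Real.pi) * wt (r - 1) ξ := by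
  have e : wt (r - 1) ξ = wt 1 ξ * wt (r - 2) ξ := by rw [← wt_add]; ring_nf
  have hp : 0 ≤ r * (2 * Real.pi) := by positivity
  rw [abs_mul, abs_mul, abs_of_nonneg hp, abs_of_pos (wt_pos (r - 2) ξ), e]
  have := mul_le_mul_of_nonneg_left (mul_le_mul_of_nonneg_right (abs_le_wt_one ξ)
    (wt_pos (r - 2) ξ).le) hp
  linarith

theorem wt_le_of_abs_le {r : ℝ} (hr : 0 ≤ r) {ξ η : ℝ} (h : |ξ| ≤ |η|) : wt r ξ ≤ wt r η := by
  refine Real.rpow_le_rpow (by linarith [one_le_base ξ]) ?_ (by linarith)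
  have := sq_le_sq.2 h
  have h2 : 0 ≤ (2 * Real.pi) ^ 2 := by positivity
  nlinarith

theorem abs_wt_sub_le {r : ℝ} (hr : 1 ≤ r) (ξ η : ℝ) :
    |wt r ξ - wt r η| ≤
      (2 * r * 2 ^ (r - 1)) * (wt (r - 1) η * (wt (r - 1) (ξ - η) * |2 * Real.pi * (ξ - η)|)) := by
  have hb : ∀ x ∈ uIcc η ξ, ‖r * (2 * Real.pi) * (2 * Real.pi * x) * wt (r - 2) x‖ ≤
      r * (2 * Real.pi) * (2 ^ (r - 1) * (2 * (wt (r - 1) η * wt (r - 1) (ξ - η)))) := by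
    intro x hx
    refine (abs_deriv_wt_le (by linarith) x).trans ?_
    have h0 : 0 ≤ r * (2 * Real.pi) := by have := Real.pi_pos; positivity
    refine mul_le_mul_of_nonneg_left ?_ h0
    refine (wt_sub_add_le (by linarith) x η).trans ?_
    refine mul_le_mul_of_nonneg_left ?_ (by positivity)
    have h1 : wt (r - 1) (x - η) ≤ wt (r - 1) (ξ - η) :=
      wt_le_of_abs_le (by linarith) (abs_sub_left_of_mem_uIcc hx)
    have h2 := one_le_wt (r := r - 1) (by linarith) η
    have h3 := one_le_wt (r := r - 1) (by linarith) (ξ - η)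
    nlinarith
  have := Convex.norm_image_sub_le_of_norm_hasDerivWithin_le (f := wt r) (s := uIcc η ξ)
    (fun x _ => (hasDerivAt_wt r x).hasDerivWithinAt) hb (convex_uIcc η ξ) left_mem_uIcc
    right_mem_uIcc
  rw [Real.norm_eq_abs, Real.norm_eq_abs] at this
  refine this.trans (le_of_eq ?_)
  rw [abs_mul (2 * Real.pi), abs_of_pos (by have := Real.pi_pos; positivity : 0 < 2 * Real.pi)]
  ring

/-- Commutator estimate: multiplication by a bounded function `G` with `G' ∈ H^r`, for functions
whose Fourier transform has enough decay. -/
theorem sobC_mul_bounded_aux {r : ℝ} (hr : 1 ≤ r) {f G G' : ℝ → ℂ} {Γ : ℝ}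
    (hGb : ∀ x, ‖G x‖ ≤ Γ) (hd : ∀ x, HasDerivAt G (G' x) x) (hG : sobC r G ≠ ⊤)
    (hG' : sobC r G' ≠ ⊤) (hf : sobC r f ≠ ⊤)
    (hfi : Integrable (fun ξ => (wt r ξ : ℂ) * ftL f ξ)) :
    sobC r (fun x => f x * G x) ≤
      (ENNReal.ofReal Γ + ENNReal.ofReal (2 * r * 2 ^ (r - 1)) * cSob 1 * sobC r G') * sobC r f := by
  have hfm := memLp_of_sobC hf
  have hGm := memLp_of_sobC hG
  have hGm' := memLp_of_sobC hG'
  have hF := integrable_ftL (by linarith) hf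
  have hGi := integrable_ftL (by linarith) hG
  have hwm : MemLp (fun ξ => (wt r ξ : ℂ) * ftL f ξ) 2 :=
    ⟨aesm_wt_mul _ _, by rw [← sobC_eq _ hfm]; exact lt_top_iff_ne_top.2 hf⟩
  obtain ⟨g, hg, hgf⟩ := exists_ftL_eq hwm
  have hgi : Integrable (ftL g) := hfi.congr hgf.symm
  obtain ⟨hm, hft⟩ := ftL_mul hfm hGm hF hGi
  obtain ⟨hgm, hgft⟩ := ftL_mul hg hGm hgi hGi
  set a : ℝ → ℝ≥0∞ := fun ξ => ‖(wt (r - 1) ξ : ℂ) * ftL f ξ‖ₑ with ha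
  set b : ℝ → ℝ≥0∞ := fun ξ => ‖(wt (r - 1) ξ : ℂ) * ftL G' ξ‖ₑ with hb
  have ham : AEMeasurable a := (aesm_wt_mul _ f).enorm
  have hbm : AEMeasurable b := (aesm_wt_mul _ G').enorm
  have hC : 0 ≤ 2 * r * 2 ^ (r - 1) := by positivity
  have hb' : ∀ᵐ ξ, b ξ = ENNReal.ofReal (wt (r - 1) ξ * |2 * Real.pi * ξ|) * ‖ftL G ξ‖ₑ := by
    filter_upwards [ftL_deriv hGm hGm' hd] with ξ hξ
    simp only [hb, hξ]
    rw [enorm_mul, enorm_mul, ← mul_assoc, ENNReal.ofReal_mul (wt_pos _ _).le]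
    congr 2
    · rw [← ofReal_norm, Complex.norm_real, Real.norm_of_nonneg (wt_pos _ _).le]
    · rw [← ofReal_norm]; simp [abs_mul]
  have key : ∀ᵐ ξ, ‖(wt r ξ : ℂ) * ftL (fun x => f x * G x) ξ - ftL (fun x => g x * G x) ξ‖ₑ ≤
      ENNReal.ofReal (2 * r * 2 ^ (r - 1)) * ∫⁻ η, b η * a (ξ - η) := by
    filter_upwards [hft, hgft, hF.ae_convolution_exists (ContinuousLinearMap.mul ℂ ℂ) hGi,
      hgi.ae_convolution_exists (ContinuousLinearMap.mul ℂ ℂ) hGi] with ξ h1 h2 h3 h4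
    have e1 : convolution (ftL g) (ftL G) (ContinuousLinearMap.mul ℂ ℂ) volume ξ =
        ∫ η, (wt r η : ℂ) * ftL f η * ftL G (ξ - η) := by
      refine integral_congr_ae ?_
      filter_upwards [hgf] with η hη
      simp only [ContinuousLinearMap.mul_apply', hη]
    have h4' : Integrable (fun η => (wt r η : ℂ) * ftL f η * ftL G (ξ - η)) := by
      refine h4.integrable.congr ?_
      filter_upwards [hgf] with η hη
      simp only [ContinuousLinearMap.mul_apply', hη]
    have h3' : Integrable (fun η => ftL f η * ftL G (ξ - η)) := h3.integrable
    have e2 : convolution (ftL f) (ftL G) (ContinuousLinearMap.mul ℂ ℂ) volume ξ =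
        ∫ η, ftL f η * ftL G (ξ - η) := rfl
    rw [h1, h2, e1, e2, ← integral_const_mul, ← integral_sub (h3'.const_mul _) h4']
    refine (enorm_integral_le_lintegral_enorm _).trans ?_
    rw [← lintegral_const_mul' _ _ ENNReal.ofReal_ne_top, ← lintegral_sub_left_eq_self _ ξ]
    refine lintegral_mono_ae ?_
    filter_upwards [hb'] with η hη
    rw [hη]
    have e3 : (wt r ξ : ℂ) * (ftL f (ξ - η) * ftL G (ξ - (ξ - η))) -
        (wt r (ξ - η) : ℂ) * ftL f (ξ - η) * ftL G (ξ - (ξ - η)) =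
        ((wt r ξ - wt r (ξ - η) : ℝ) : ℂ) * (ftL f (ξ - η) * ftL G η) := by
      rw [sub_sub_cancel]; push_cast; ring
    rw [e3, enorm_mul, enorm_mul]
    have h5 := abs_wt_sub_le hr ξ (ξ - η)
    rw [sub_sub_cancel] at h5
    have h6 : ‖((wt r ξ - wt r (ξ - η) : ℝ) : ℂ)‖ₑ ≤ ENNReal.ofReal (2 * r * 2 ^ (r - 1)) *
        (ENNReal.ofReal (wt (r - 1) (ξ - η)) * ENNReal.ofReal (wt (r - 1) η * |2 * Real.pi * η|)) := by
      rw [← ofReal_norm, Complex.norm_real, Real.norm_eq_abs, ← ENNReal.ofReal_mul (wt_pos _ _).le,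
        ← ENNReal.ofReal_mul hC]
      exact ENNReal.ofReal_le_ofReal h5
    refine (mul_le_mul_left h6 _).trans (le_of_eq ?_)
    have e4 : a (ξ - η) = ENNReal.ofReal (wt (r - 1) (ξ - η)) * ‖ftL f (ξ - η)‖ₑ := by
      simp only [ha]
      rw [enorm_mul, ← ofReal_norm (wt (r - 1) (ξ - η) : ℂ), Complex.norm_real,
        Real.norm_of_nonneg (wt_pos _ _).le]
    rw [e4]; ring
  have hg2 : eLpNorm (fun x => g x * G x) 2 ≤ ENNReal.ofReal Γ * sobC r f := by
    have : eLpNorm g 2 = sobC r f := by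
      rw [← eLpNorm_ftL hg, eLpNorm_congr_ae hgf, sobC_eq r hfm]
    rw [← this]
    refine eLpNorm_le_mul_eLpNorm_of_ae_le_mul (ae_of_all _ fun x => ?_) 2
    rw [norm_mul, mul_comm]
    gcongr
    exact hGb x
  have hdm : AEStronglyMeasurable (fun ξ => (wt r ξ : ℂ) * ftL (fun x => f x * G x) ξ
      - ftL (fun x => g x * G x) ξ) := (aesm_wt_mul _ _).sub (memLp_ftL _).1
  have hdiff : eLpNorm (fun ξ => (wt r ξ : ℂ) * ftL (fun x => f x * G x) ξ
      - ftL (fun x => g x * G x) ξ) 2 ≤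
      ENNReal.ofReal (2 * r * 2 ^ (r - 1)) * eLpNorm (fun ξ => ∫⁻ η, b η * a (ξ - η)) 2 := by
    refine le_of_sq_le_sq_ennreal ?_
    rw [mul_pow, eLpNorm_two_sq, eLpNorm_two_sq,
      ← lintegral_const_mul' _ _ (ENNReal.pow_ne_top ENNReal.ofReal_ne_top)]
    refine lintegral_mono_ae ?_
    filter_upwards [key] with ξ hξ
    rw [← mul_pow]
    exact pow_le_pow_left' hξ 2
  have hy := eLpNorm_lconv_le hbm ham
  have ea : eLpNorm a 2 ≤ sobC r f := by
    refine le_trans (le_of_eq ?_) (sobC_mono (by linarith : r - 1 ≤ r) f)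
    rw [sobC_eq _ hfm]; exact eLpNorm_enorm _
  have eb : ∫⁻ η, b η ≤ cSob 1 * sobC r G' := by
    have := lintegral_wt_ftL_le (r := 1) (q := r - 1) hGm'
    rwa [add_sub_cancel] at this
  rw [sobC_eq r hm]
  have hsum : (fun ξ => (wt r ξ : ℂ) * ftL (fun x => f x * G x) ξ) =
      (ftL (fun x => g x * G x)) + (fun ξ => (wt r ξ : ℂ) * ftL (fun x => f x * G x) ξ
      - ftL (fun x => g x * G x) ξ) := by
    ext ξ; simp
  rw [hsum]
  refine (eLpNorm_add_le (memLp_ftL _).1 hdm (by norm_num)).trans ?_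
  rw [eLpNorm_ftL hgm, add_mul]
  refine add_le_add hg2 (hdiff.trans ?_)
  rw [mul_assoc (ENNReal.ofReal _), mul_assoc (ENNReal.ofReal _)]
  refine mul_le_mul_right (hy.trans ?_) _
  gcongr

/-- Multiplication by a bounded function `G` with `G' ∈ H^r`. -/
theorem sobC_mul_bounded {r : ℝ} (hr : 1 ≤ r) {f G G' : ℝ → ℂ} {Γ : ℝ}
    (hGb : ∀ x, ‖G x‖ ≤ Γ) (hd : ∀ x, HasDerivAt G (G' x) x) (hG : sobC r G ≠ ⊤)
    (hG' : sobC r G' ≠ ⊤) (hf : sobC r f ≠ ⊤) :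
    sobC r (fun x => f x * G x) ≤
      (ENNReal.ofReal Γ + ENNReal.ofReal (2 * r * 2 ^ (r - 1)) * cSob 1 * sobC r G') * sobC r f := by
  have hfm := memLp_of_sobC hf
  have hGc : Continuous G := continuous_iff_continuousAt.2 fun x => (hd x).continuousAt
  have hcut : ∀ N : ℕ, MemLp (indicator (Icc (-(N : ℝ)) N) (ftL f)) 2 := fun N =>
    (memLp_ftL f).indicator measurableSet_Icc
  choose u hu huf using fun N => exists_ftL_eq (hcut N)
  have hle : ∀ N, sobC r (u N) ≤ sobC r f := fun N => by
    simpa using sobC_le_mul (K := 1) (hu N) hfm (by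
      filter_upwards [huf N] with ξ hξ
      rw [hξ, one_mul]
      have := (wt_pos r ξ).le
      gcongr
      exact norm_indicator_le_norm_self _ _)
  have hne : ∀ N, sobC r (u N) ≠ ⊤ := fun N => ne_top_of_le_ne_top hf (hle N)
  have hinteg : ∀ N, Integrable (fun ξ => (wt r ξ : ℂ) * ftL (u N) ξ) := by
    intro N
    have h1 : IntegrableOn (fun ξ => (wt r ξ : ℂ) * ftL f ξ) (Icc (-(N : ℝ)) N) := by
      have := (locallyIntegrable_continuous_mul (w := fun ξ => (wt r ξ : ℂ))
        (Complex.continuous_ofReal.comp (continuous_wt r)) (memLp_ftL f))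
      exact this.integrableOn_isCompact isCompact_Icc
    refine ((integrable_indicator_iff measurableSet_Icc).2 h1).congr ?_
    filter_upwards [huf N] with ξ hξ
    rw [hξ, Set.indicator_mul_right]
  have hlim : Tendsto (fun N => eLpNorm (fun x => u N x - f x) 2) atTop (𝓝 0) := by
    have h1 : ∀ N, eLpNorm (fun x => u N x - f x) 2 =
        eLpNorm (indicator (Icc (-(N : ℝ)) N)ᶜ (ftL f)) 2 := by
      intro N
      rw [← eLpNorm_ftL ((hu N).sub hfm : MemLp (fun x => u N x - f x) 2),
        ← eLpNorm_neg (indicator (Icc (-(N : ℝ)) N)ᶜ (ftL f))]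
      refine eLpNorm_congr_ae ?_
      filter_upwards [ftL_sub (hu N) hfm, huf N] with ξ h2 h3
      rw [h2, h3, Pi.neg_apply]
      by_cases h : ξ ∈ Icc (-(N : ℝ)) N
      · rw [indicator_of_mem h, indicator_of_notMem (by simpa using h)]; simp
      · rw [indicator_of_notMem h, indicator_of_mem (by exact h)]; simp
    simp only [h1]
    have h2 : Tendsto (fun N : ℕ => ∫⁻ ξ, ‖indicator (Icc (-(N : ℝ)) N)ᶜ (ftL f) ξ‖ₑ ^ 2) atTop
        (𝓝 (∫⁻ _ : ℝ, 0)) := by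
      refine tendsto_lintegral_of_dominated_convergence' (fun ξ => ‖ftL f ξ‖ₑ ^ 2)
        (fun N => (((memLp_ftL f).1.indicator measurableSet_Icc.compl).enorm.pow_const 2))
        (fun N => ae_of_all _ fun ξ => ?_) ?_ (ae_of_all _ fun ξ => ?_)
      · exact pow_le_pow_left' (enorm_indicator_le_enorm_self _ _) 2
      · rw [← eLpNorm_two_sq]; exact ENNReal.pow_ne_top (memLp_ftL f).2.ne
      · refine tendsto_const_nhds.congr' ?_
        obtain ⟨N, hN⟩ := exists_nat_ge |ξ|
        filter_upwards [eventually_ge_atTop N] with n hn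
        have : ξ ∈ Icc (-(n : ℝ)) n := by
          have h3 : (N : ℝ) ≤ n := by exact_mod_cast hn
          exact ⟨by linarith [neg_abs_le ξ], by linarith [le_abs_self ξ]⟩
        rw [indicator_of_notMem (by simpa using this)]; simp
    rw [lintegral_zero] at h2
    have h3 := h2.ennrpow_const (1 / 2)
    rw [ENNReal.zero_rpow_of_pos (by norm_num)] at h3
    refine h3.congr fun N => ?_
    rw [← eLpNorm_two_sq, ← ENNReal.rpow_natCast, ← ENNReal.rpow_mul]
    norm_num
  have hGtop : MemLp G ⊤ := memLp_top_of_bound hGc.aestronglyMeasurable Γ (ae_of_all _ hGb)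
  refine sobC_le_of_tendsto (u := fun N x => u N x * G x) ?_ ?_ ?_ fun N =>
    (sobC_mul_bounded_aux hr hGb hd hG hG' (hne N) (hinteg N)).trans (by gcongr; exact hle N)
  · intro N
    exact hGtop.mul (hu N)
  · exact hGtop.mul hfm
  · have h0 : Tendsto (fun N => ENNReal.ofReal Γ * eLpNorm (fun x => u N x - f x) 2) atTop
        (𝓝 0) := by
      simpa using ENNReal.Tendsto.const_mul hlim (Or.inr ENNReal.ofReal_ne_top)
    refine tendsto_of_tendsto_of_tendsto_of_le_of_le tendsto_const_nhds h0 (fun _ => zero_le)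
      fun N => ?_
    refine eLpNorm_le_mul_eLpNorm_of_ae_le_mul (ae_of_all _ fun x => ?_) 2
    rw [← sub_mul, norm_mul, mul_comm]
    gcongr
    exact hGb x

/-! ### Sobolev norms of real-valued functions -/

theorem sobNorm_add_le (r : ℝ) (f g : ℝ → ℝ) :
    sobNorm r (fun x => f x + g x) ≤ sobNorm r f + sobNorm r g := by
  simp only [sobNorm_eq_sobC]
  push_cast
  exact sobC_add_le r _ _

theorem sobNorm_const_mul (r c : ℝ) (f : ℝ → ℝ) :
    sobNorm r (fun x => c * f x) = ENNReal.ofReal |c| * sobNorm r f := by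
  simp only [sobNorm_eq_sobC]
  push_cast
  rw [sobC_const_mul, ← ofReal_norm, Complex.norm_real, Real.norm_eq_abs]

theorem sobNorm_zero (r : ℝ) : sobNorm r (fun _ => 0) = 0 := by
  simp [sobNorm_eq_sobC, sobC_zero]

theorem sobNorm_mono {r r' : ℝ} (h : r ≤ r') (f : ℝ → ℝ) : sobNorm r f ≤ sobNorm r' f := by
  simp only [sobNorm_eq_sobC]; exact sobC_mono h _

theorem sobNorm_translate (r : ℝ) (f : ℝ → ℝ) (h : ℝ) :
    sobNorm r (fun x => f (x + h)) = sobNorm r f := by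
  simp only [sobNorm_eq_sobC]; exact sobC_translate r (fun x => (f x : ℂ)) h

theorem sobNorm_translate_sub_le (r : ℝ) (f : ℝ → ℝ) (h : ℝ) :
    sobNorm r (fun x => f (x + h) - f x) ≤ ENNReal.ofReal |h| * sobNorm (r + 1) f := by
  simp only [sobNorm_eq_sobC]
  push_cast
  exact sobC_translate_sub_le r (fun x => (f x : ℂ)) h

theorem sobNorm_deriv_le {r : ℝ} (hr : 0 ≤ r) {f : ℝ → ℝ} (hf : ContDiff ℝ 1 f) :
    sobNorm r (deriv f) ≤ sobNorm (r + 1) f := by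
  simp only [sobNorm_eq_sobC]
  exact sobC_deriv_le hr (Complex.continuous_ofReal.comp (hf.continuous_deriv le_rfl))
    fun x => ((hf.differentiable one_ne_zero) x).hasDerivAt.ofReal_comp

theorem sobNorm_succ_le (r : ℝ) {f : ℝ → ℝ} (hf : Differentiable ℝ f) :
    sobNorm (r + 1) f ≤ sobNorm r f + sobNorm r (deriv f) := by
  simp only [sobNorm_eq_sobC]
  exact sobC_succ_le r fun x => (hf x).hasDerivAt.ofReal_comp

/-- The constant of the product estimate in `H^r`. -/
def cMul (r : ℝ) : ℝ := (ENNReal.ofReal (2 ^ r) * (2 * cSob r)).toReal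

theorem sobNorm_mul_le {r : ℝ} (hr : 1 / 2 < r) {f g : ℝ → ℝ} {a b : ℝ} (ha : 0 ≤ a)
    (hf : sobNorm r f ≤ ENNReal.ofReal a) (hg : sobNorm r g ≤ ENNReal.ofReal b) :
    sobNorm r (fun x => f x * g x) ≤ ENNReal.ofReal (cMul r * (a * b)) := by
  have hf' := ne_top_of_le_ne_top ENNReal.ofReal_ne_top hf
  have hg' := ne_top_of_le_ne_top ENNReal.ofReal_ne_top hg
  simp only [sobNorm_eq_sobC] at *
  push_cast
  refine (sobC_mul_le hr hf' hg').trans ?_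
  have hc : ENNReal.ofReal (2 ^ r) * (2 * cSob r) ≠ ⊤ := by
    have := cSob_ne_top hr
    finiteness
  rw [cMul, ENNReal.ofReal_mul ENNReal.toReal_nonneg, ENNReal.ofReal_toReal hc,
    ENNReal.ofReal_mul ha]
  gcongr

theorem cMul_nonneg (r : ℝ) : 0 ≤ cMul r := ENNReal.toReal_nonneg

theorem abs_le_of_sobNorm {r : ℝ} (hr : 1 / 2 < r) {f : ℝ → ℝ} (hc : Continuous f) {a : ℝ}
    (hf : sobNorm r f ≤ ENNReal.ofReal a) (ha : 0 ≤ a) (x : ℝ) :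
    |f x| ≤ (cSob r).toReal * a := by
  rw [sobNorm_eq_sobC] at hf
  have h := enorm_le_sobC hr (Complex.continuous_ofReal.comp hc) x
  have h2 : ‖(f x : ℂ)‖ₑ ≤ cSob r * ENNReal.ofReal a := h.trans (by gcongr; exact hf)
  rw [← ofReal_norm, Complex.norm_real, Real.norm_eq_abs] at h2
  have h3 := ENNReal.toReal_mono (ENNReal.mul_ne_top (cSob_ne_top hr) ENNReal.ofReal_ne_top) h2
  rwa [ENNReal.toReal_ofReal (abs_nonneg _), ENNReal.toReal_mul, ENNReal.toReal_ofReal ha] at h3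

theorem contDiff_of_sobNorm {r : ℝ} {n : ℕ} (hr : n + 1 / 2 < r) {f : ℝ → ℝ}
    (h : sobNorm r f ≠ ⊤) (hc : Continuous f) : ContDiff ℝ n f := by
  rw [sobNorm_eq_sobC] at h
  have h1 := contDiff_of_sobC hr h (Complex.continuous_ofReal.comp hc)
  have h2 : f = fun x => Complex.reCLM (f x : ℂ) := by ext; simp
  rw [h2]
  exact Complex.reCLM.contDiff.comp h1

/-- The constant of the estimate for multiplication by bounded functions. -/
def cBdd (r : ℝ) : ℝ := (ENNReal.ofReal (2 * r * 2 ^ (r - 1)) * cSob 1).toReal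

theorem sobNorm_mul_bounded {r : ℝ} (hr : 1 ≤ r) {f G : ℝ → ℝ} {Γ a b : ℝ} (hΓ : 0 ≤ Γ)
    (ha : 0 ≤ a) (hGb : ∀ x, |G x| ≤ Γ) (hd : Differentiable ℝ G) (hG : sobNorm r G ≠ ⊤)
    (hG' : sobNorm r (deriv G) ≤ ENNReal.ofReal a) (hf : sobNorm r f ≤ ENNReal.ofReal b) :
    sobNorm r (fun x => f x * G x) ≤ ENNReal.ofReal ((Γ + cBdd r * a) * b) := by
  have hf' := ne_top_of_le_ne_top ENNReal.ofReal_ne_top hf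
  have hg' := ne_top_of_le_ne_top ENNReal.ofReal_ne_top hG'
  simp only [sobNorm_eq_sobC] at *
  push_cast
  refine (sobC_mul_bounded hr (Γ := Γ) (by simpa using hGb) (fun x => (hd x).hasDerivAt.ofReal_comp)
    hG hg' hf').trans ?_
  have hc : ENNReal.ofReal (2 * r * 2 ^ (r - 1)) * cSob 1 ≠ ⊤ := by
    have := cSob_ne_top (r := 1) (by norm_num)
    finiteness
  have h0 : 0 ≤ cBdd r := ENNReal.toReal_nonneg
  have e : ENNReal.ofReal ((Γ + cBdd r * a) * b) = (ENNReal.ofReal Γ +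
      ENNReal.ofReal (2 * r * 2 ^ (r - 1)) * cSob 1 * ENNReal.ofReal a) * ENNReal.ofReal b := by
    rw [ENNReal.ofReal_mul (p := Γ + cBdd r * a) (by positivity),
      ENNReal.ofReal_add hΓ (by positivity), ENNReal.ofReal_mul h0, cBdd, ENNReal.ofReal_toReal hc]
  rw [e]
  gcongr

theorem memLp_of_sobNorm {r : ℝ} {f : ℝ → ℝ} (h : sobNorm r f ≠ ⊤) :
    MemLp (fun x => (f x : ℂ)) 2 := by
  rw [sobNorm_eq_sobC] at h; exact memLp_of_sobC h

theorem eLpNorm_le_sobNorm {r : ℝ} (hr : 0 ≤ r) (f : ℝ → ℝ) : eLpNorm f 2 ≤ sobNorm r f := by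
  rw [sobNorm_eq_sobC]
  refine le_trans (le_of_eq ?_) (eLpNorm_le_sobC hr _)
  refine eLpNorm_congr_norm_ae (ae_of_all _ fun x => ?_)
  simp

theorem sobNorm_split {r μ : ℝ} (hμ : 0 < μ) {f a b : ℝ → ℝ}
    (hf : ∀ x, f x = a x + b x) :
    sobNorm r f ≤ sobNorm r a + ENNReal.ofReal (1 + μ⁻¹) * sobNorm (r - 2) b
      + ENNReal.ofReal μ * sobNorm (r + 2) f := by
  by_cases ha : sobNorm r a = ⊤
  · simp [ha]
  have hμ' : ENNReal.ofReal (1 + μ⁻¹) ≠ 0 := by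
    rw [Ne, ENNReal.ofReal_eq_zero, not_le]; positivity
  by_cases hb : sobNorm (r - 2) b = ⊤
  · simp [hb, ENNReal.mul_top hμ']
  have h1 := memLp_of_sobNorm ha
  have h2 := memLp_of_sobNorm hb
  simp only [sobNorm_eq_sobC]
  exact sobC_split hμ h1 h2 fun x => by rw [hf x]; push_cast; rfl

/-! ### Families of functions and their sizes -/

/-- `c = O(φ)` uniformly over the index set. -/
def SO {ι : Type*} (c φ : ι → ℝ) : Prop := ∃ C : ℝ, 0 < C ∧ ∀ i, |c i| ≤ C * φ i

/-- The functions `f i` are of class `C^j` and `O(φ i)` in `H^{s+j}`, uniformly. -/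
structure HO {ι : Type*} (s : ℝ) (j : ℕ) (f : ι → ℝ → ℝ) (φ : ι → ℝ) : Prop where
  smooth : ∀ i, ContDiff ℝ j (f i)
  nonneg : ∀ i, 0 ≤ φ i
  bound : ∃ C : ℝ, 0 < C ∧ ∀ i, sobNorm (s + j) (f i) ≤ ENNReal.ofReal (C * φ i)

/-- The functions `G i` are bounded by `O(φ i)`, with derivative `O(φ i)` in `H^{s+j}`. -/
structure MO {ι : Type*} (s : ℝ) (j : ℕ) (G : ι → ℝ → ℝ) (φ : ι → ℝ) : Prop where
  smooth : ∀ i, ContDiff ℝ (j + 1) (G i)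
  mem : ∀ i, sobNorm (s + j) (G i) ≠ ⊤
  sup : ∃ C : ℝ, 0 < C ∧ ∀ i x, |G i x| ≤ C * φ i
  deriv : HO s j (fun i => deriv (G i)) φ

section Families

variable {ι : Type*} {s : ℝ} {j : ℕ} {f g f' g' : ι → ℝ → ℝ} {c d φ ψ : ι → ℝ}

theorem SO.mul (h : SO c φ) (h' : SO d ψ) : SO (fun i => c i * d i) (φ * ψ) := by
  obtain ⟨C, hC, hc⟩ := h
  obtain ⟨D, hD, hd⟩ := h'
  refine ⟨C * D, by positivity, fun i => ?_⟩
  rw [abs_mul, Pi.mul_apply]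
  calc |c i| * |d i| ≤ (C * φ i) * (D * ψ i) :=
        mul_le_mul (hc i) (hd i) (abs_nonneg _) ((abs_nonneg _).trans (hc i))
    _ = _ := by ring

theorem SO.nonneg (h : SO c φ) (i : ι) : 0 ≤ φ i := by
  obtain ⟨C, hC, hc⟩ := h
  have := (abs_nonneg _).trans (hc i)
  exact nonneg_of_mul_nonneg_right this hC

theorem SO.add (h : SO c φ) (h' : SO d φ) : SO (fun i => c i + d i) φ := by
  obtain ⟨C, hC, hc⟩ := h
  obtain ⟨D, hD, hd⟩ := h'
  exact ⟨C + D, by positivity, fun i => by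
    rw [add_mul]; exact (abs_add_le _ _).trans (add_le_add (hc i) (hd i))⟩

theorem SO.neg (h : SO c φ) : SO (fun i => -c i) φ := by
  obtain ⟨C, hC, hc⟩ := h
  exact ⟨C, hC, fun i => by rw [abs_neg]; exact hc i⟩

theorem SO.sub (h : SO c φ) (h' : SO d φ) : SO (fun i => c i - d i) φ := by
  simpa [sub_eq_add_neg] using h.add h'.neg

theorem SO.const (a : ℝ) : SO (fun _ : ι => a) 1 :=
  ⟨|a| + 1, by positivity, fun i => by simp⟩

theorem SO.of_le {C : ℝ} (h : ∀ i, |c i| ≤ C) : SO c 1 :=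
  ⟨|C| + 1, by positivity, fun i => by
    simp only [Pi.one_apply, mul_one]; linarith [h i, le_abs_self C]⟩

theorem SO.trans (h : SO c φ) (h' : SO φ ψ) : SO c ψ := by
  obtain ⟨C, hC, hc⟩ := h
  obtain ⟨D, hD, hd⟩ := h'
  refine ⟨C * D, by positivity, fun i => (hc i).trans ?_⟩
  rw [mul_assoc]
  exact mul_le_mul_of_nonneg_left ((le_abs_self _).trans (hd i)) hC.le

theorem SO.refl (h : ∀ i, 0 ≤ φ i) : SO φ φ := ⟨1, one_pos, fun i => by rw [abs_of_nonneg (h i), one_mul]⟩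

theorem SO.mul_one_left (h : SO c 1) (h' : SO d φ) : SO (fun i => c i * d i) φ := by
  simpa using h.mul h'

theorem SO.mul_one_right (h : SO c φ) (h' : SO d 1) : SO (fun i => c i * d i) φ := by
  simpa using h.mul h'

theorem SO.comp {κ : Type*} (h : SO c φ) (e : κ → ι) : SO (fun i => c (e i)) (fun i => φ (e i)) := by
  obtain ⟨C, hC, hc⟩ := h
  exact ⟨C, hC, fun i => hc (e i)⟩

theorem half_lt (hs : 3 / 2 < s) (j : ℕ) : 1 / 2 < s + j := by
  have : (0 : ℝ) ≤ j := j.cast_nonneg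
  linarith

namespace HO

theorem congr (h : HO s j f φ) (he : ∀ i x, g i x = f i x) : HO s j g φ := by
  have : g = f := by ext i x; exact he i x
  rw [this]; exact h

theorem comp {κ : Type*} (h : HO s j f φ) (e : κ → ι) : HO s j (fun i => f (e i)) (fun i => φ (e i)) :=
  ⟨fun _ => h.smooth _, fun _ => h.nonneg _, let ⟨C, hC, hc⟩ := h.bound
    ⟨C, hC, fun i => hc (e i)⟩⟩

theorem trans (h : HO s j f φ) (h' : SO φ ψ) : HO s j f ψ := by
  obtain ⟨C, hC, hc⟩ := h.bound
  obtain ⟨D, hD, hd⟩ := id h'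
  refine ⟨h.smooth, h'.nonneg, C * D, by positivity, fun i => (hc i).trans ?_⟩
  refine ENNReal.ofReal_le_ofReal ?_
  rw [mul_assoc]
  exact mul_le_mul_of_nonneg_left ((le_abs_self _).trans (hd i)) hC.le

theorem add (h : HO s j f φ) (h' : HO s j g φ) : HO s j (fun i x => f i x + g i x) φ := by
  obtain ⟨C, hC, hc⟩ := h.bound
  obtain ⟨D, hD, hd⟩ := h'.bound
  refine ⟨fun i => (h.smooth i).add (h'.smooth i), h.nonneg, C + D, by positivity, fun i => ?_⟩
  have := h.nonneg i
  rw [add_mul, ENNReal.ofReal_add (by positivity) (by positivity)]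
  exact (sobNorm_add_le _ _ _).trans (add_le_add (hc i) (hd i))

theorem smul (hc : SO c φ) (h : HO s j f ψ) : HO s j (fun i x => c i * f i x) (φ * ψ) := by
  have hφ := hc.nonneg
  obtain ⟨C, hC, hc⟩ := hc
  obtain ⟨D, hD, hd⟩ := h.bound
  refine ⟨fun i => contDiff_const.mul (h.smooth i), fun i => mul_nonneg (hφ i) (h.nonneg i),
    C * D, by positivity, fun i => ?_⟩
  rw [sobNorm_const_mul]
  calc _ ≤ ENNReal.ofReal (C * φ i) * ENNReal.ofReal (D * ψ i) :=
        mul_le_mul' (ENNReal.ofReal_le_ofReal (hc i)) (hd i)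
    _ = _ := by
      rw [← ENNReal.ofReal_mul (mul_nonneg hC.le (hφ i)), Pi.mul_apply]; congr 1; ring

theorem smul_one (hc : SO c φ) (h : HO s j f 1) : HO s j (fun i x => c i * f i x) φ := by
  simpa using h.smul hc

theorem one_smul (hc : SO c 1) (h : HO s j f φ) : HO s j (fun i x => c i * f i x) φ := by
  simpa using h.smul hc

theorem const_mul (a : ℝ) (h : HO s j f φ) : HO s j (fun i x => a * f i x) φ :=
  one_smul (SO.const a) h

theorem neg (h : HO s j f φ) : HO s j (fun i x => -f i x) φ :=
  (h.const_mul (-1)).congr fun i x => by ring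

theorem sub (h : HO s j f φ) (h' : HO s j g φ) : HO s j (fun i x => f i x - g i x) φ :=
  (h.add h'.neg).congr fun i x => by ring

theorem zero (hφ : ∀ i, 0 ≤ φ i) : HO s j (fun _ _ => 0) φ :=
  ⟨fun _ => contDiff_const, hφ, 1, one_pos, fun i => by rw [sobNorm_zero]; exact zero_le⟩

theorem mono {k : ℕ} (h : HO s j f φ) (hk : k ≤ j) : HO s k f φ :=
  ⟨fun i => (h.smooth i).of_le (by exact_mod_cast hk), h.nonneg, let ⟨C, hC, hc⟩ := h.bound
    ⟨C, hC, fun i => (sobNorm_mono (by gcongr) _).trans (hc i)⟩⟩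

theorem translate (h : HO s j f φ) (c : ι → ℝ) : HO s j (fun i x => f i (x + c i)) φ :=
  ⟨fun i => (h.smooth i).comp (by fun_prop), h.nonneg, let ⟨C, hC, hc⟩ := h.bound
    ⟨C, hC, fun i => by rw [sobNorm_translate]; exact hc i⟩⟩

theorem translate_sub (h : HO s (j + 1) f φ) (c : ι → ℝ) :
    HO s j (fun i x => f i (x + c i) - f i x) (fun i => |c i| * φ i) := by
  obtain ⟨C, hC, hc⟩ := h.bound
  refine ⟨fun i => (((h.mono j.le_succ).translate c).smooth i).sub ((h.mono j.le_succ).smooth i),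
    fun i => mul_nonneg (abs_nonneg _) (h.nonneg i), C, hC, fun i => ?_⟩
  refine (sobNorm_translate_sub_le _ _ _).trans ?_
  calc _ ≤ ENNReal.ofReal |c i| * ENNReal.ofReal (C * φ i) := by
        gcongr
        have := hc i
        push_cast at this
        rwa [← add_assoc] at this
    _ = _ := by rw [← ENNReal.ofReal_mul (abs_nonneg _)]; congr 1; ring

section

variable [hs : Fact (3 / 2 < s)]

theorem mul (h : HO s j f φ) (h' : HO s j g ψ) : HO s j (fun i x => f i x * g i x) (φ * ψ) := by
  obtain ⟨C, hC, hc⟩ := h.bound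
  obtain ⟨D, hD, hd⟩ := h'.bound
  have h0 := cMul_nonneg (s + j)
  refine ⟨fun i => (h.smooth i).mul (h'.smooth i), fun i => mul_nonneg (h.nonneg i) (h'.nonneg i),
    (cMul (s + j) + 1) * (C * D), by positivity, fun i => ?_⟩
  have h1 := h.nonneg i
  have h2 := h'.nonneg i
  refine (sobNorm_mul_le (half_lt hs.out j) (by positivity) (hc i) (hd i)).trans ?_
  refine ENNReal.ofReal_le_ofReal ?_
  rw [Pi.mul_apply]
  have : 0 ≤ C * D * (φ i * ψ i) := by positivity
  nlinarith

theorem mul_one_left (h : HO s j f 1) (h' : HO s j g φ) : HO s j (fun i x => f i x * g i x) φ := by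
  simpa using h.mul h'

theorem mul_one_right (h : HO s j f φ) (h' : HO s j g 1) : HO s j (fun i x => f i x * g i x) φ := by
  simpa using h.mul h'

theorem deriv (h : HO s (j + 1) f φ) : HO s j (fun i => deriv (f i)) φ := by
  obtain ⟨C, hC, hc⟩ := h.bound
  refine ⟨fun i => ?_, h.nonneg, C, hC, fun i => ?_⟩
  · have := h.smooth i
    exact (contDiff_succ_iff_deriv.1 (by exact_mod_cast this)).2.2
  · have hs := hs.out
    refine (sobNorm_deriv_le (by linarith [half_lt hs j]) ((h.smooth i).of_le ?_)).trans ?_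
    · exact_mod_cast Nat.le_add_left 1 j
    · have := hc i
      push_cast at this
      rwa [← add_assoc] at this

theorem sup (h : HO s j f φ) : ∃ C : ℝ, 0 < C ∧ ∀ i x, |f i x| ≤ C * φ i := by
  obtain ⟨C, hC, hc⟩ := h.bound
  refine ⟨((cSob (s + j)).toReal + 1) * C, by positivity, fun i x => ?_⟩
  have h1 := h.nonneg i
  refine (abs_le_of_sobNorm (half_lt hs.out j) (h.smooth i).continuous (hc i) (by positivity)
    x).trans ?_
  have : 0 ≤ C * φ i := by positivity
  nlinarith

theorem mul_bounded {G : ι → ℝ → ℝ} (h : HO s j f φ) (h' : MO s j G ψ) :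
    HO s j (fun i x => f i x * G i x) (φ * ψ) := by
  obtain ⟨C, hC, hc⟩ := h.bound
  obtain ⟨D, hD, hd⟩ := h'.deriv.bound
  obtain ⟨E, hE, he⟩ := h'.sup
  have h0 : 0 ≤ cBdd (s + j) := ENNReal.toReal_nonneg
  refine ⟨fun i => (h.smooth i).mul ((h'.smooth i).of_le (by exact_mod_cast j.le_succ)),
    fun i => mul_nonneg (h.nonneg i) (h'.deriv.nonneg i), (E + cBdd (s + j) * D) * C,
    by positivity, fun i => ?_⟩
  have h1 := h.nonneg i
  have h2 := h'.deriv.nonneg i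
  have hr : 1 ≤ s + j := by
    have := hs.out
    have : (0 : ℝ) ≤ j := j.cast_nonneg
    linarith
  refine (sobNorm_mul_bounded hr (by positivity) (by positivity) (he i)
    ((h'.smooth i).differentiable (by norm_cast)) (h'.mem i) (hd i) (hc i)).trans (le_of_eq ?_)
  rw [Pi.mul_apply]; congr 1; ring

/-- Products of close functions are close. -/
theorem mul_sub_mul (hf' : HO s j f' 1) (hg : HO s j g 1)
    (hff : HO s j (fun i x => f i x - f' i x) φ) (hgg : HO s j (fun i x => g i x - g' i x) φ) :
    HO s j (fun i x => f i x * g i x - f' i x * g' i x) φ :=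
  ((hff.mul_one_right hg).add (hf'.mul_one_left hgg)).congr fun i x => by ring

end

end HO

end Families

/-! ### Time derivatives on `[0, T)` -/

theorem convex_timeIco (T : ℝ≥0∞) : Convex ℝ (timeIco T) := by
  refine OrdConnected.convex ⟨fun x hx y hy z hz => ⟨hx.1.trans hz.1, ?_⟩⟩
  exact (ENNReal.ofReal_le_ofReal hz.2).trans_lt hy.2

theorem exists_Icc_subset_timeIco {T : ℝ≥0∞} {t : ℝ} (ht : t ∈ timeIco T) :
    ∃ t', t < t' ∧ Icc 0 t' ⊆ timeIco T := by
  obtain ⟨q, hq, hqT⟩ := ENNReal.lt_iff_exists_nnreal_btwn.1 ht.2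
  refine ⟨q, (ENNReal.ofReal_lt_coe_iff ht.1).1 hq, fun x hx => ⟨hx.1, lt_of_le_of_lt ?_ hqT⟩⟩
  rw [← ENNReal.ofReal_coe_nnreal]
  exact ENNReal.ofReal_le_ofReal hx.2

theorem uniqueDiffOn_timeIco (T : ℝ≥0∞) : UniqueDiffOn ℝ (timeIco T) := by
  intro t ht
  obtain ⟨t', htt', hsub⟩ := exists_Icc_subset_timeIco ht
  have h0 : 0 < t' := ht.1.trans_lt htt'
  exact (uniqueDiffOn_Icc h0 t ⟨ht.1, htt'.le⟩).mono hsub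

theorem neBot_timeIco {T : ℝ≥0∞} {t : ℝ} (ht : t ∈ timeIco T) :
    (𝓝[timeIco T \ {t}] t).NeBot :=
  mem_closure_iff_nhdsWithin_neBot.1
    ((accPt_principal_iff_clusterPt.1 (uniqueDiffOn_timeIco T t ht).accPt).mem_closure)

theorem HasDerivWithinAt.timeDeriv_eq {T : ℝ≥0∞} {t x a : ℝ} {u : ℝ → ℝ → ℝ} (ht : t ∈ timeIco T)
    (h : HasDerivWithinAt (fun τ => u τ x) a (timeIco T) t) : timeDeriv T u t x = a :=
  h.derivWithin (uniqueDiffOn_timeIco T t ht)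

/-- `u'` is the time derivative of `u` at `t`, and the same holds for the first `n` derivatives
in space. -/
def TD (T : ℝ≥0∞) (t : ℝ) : ℕ → (ℝ → ℝ → ℝ) → (ℝ → ℝ) → Prop
  | 0, u, u' => ∀ x, HasDerivWithinAt (fun τ => u τ x) (u' x) (timeIco T) t
  | n + 1, u, u' => (∀ x, HasDerivWithinAt (fun τ => u τ x) (u' x) (timeIco T) t) ∧
      (∀ᶠ τ in 𝓝[timeIco T] t, Differentiable ℝ (u τ)) ∧ Differentiable ℝ u' ∧
      TD T t n (fun τ => deriv (u τ)) (deriv u')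

namespace TD

variable {T : ℝ≥0∞} {t : ℝ} {n : ℕ} {u w : ℝ → ℝ → ℝ} {u' w' : ℝ → ℝ}

theorem hasDeriv (h : TD T t n u u') (x : ℝ) :
    HasDerivWithinAt (fun τ => u τ x) (u' x) (timeIco T) t := by
  cases n with
  | zero => exact h x
  | succ n => exact h.1 x

theorem of_succ (h : TD T t (n + 1) u u') : TD T t n u u' := by
  induction n generalizing u u' with
  | zero => exact h.1
  | succ n ih => exact ⟨h.1, h.2.1, h.2.2.1, ih h.2.2.2⟩

theorem mono {k : ℕ} (h : TD T t n u u') (hk : k ≤ n) : TD T t k u u' := by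
  induction n with
  | zero => rw [Nat.le_zero.1 hk]; exact h
  | succ n ih =>
    rcases Nat.lt_or_ge k (n + 1) with h1 | h1
    · exact ih h.of_succ (Nat.lt_succ_iff.1 h1)
    · rw [le_antisymm hk h1]; exact h

theorem deriv (h : TD T t (n + 1) u u') : TD T t n (fun τ => deriv (u τ)) (deriv u') := h.2.2.2

theorem congr (ht : t ∈ timeIco T) (h : TD T t n u u')
    (he : ∀ᶠ τ in 𝓝[timeIco T] t, w τ = u τ) (he' : ∀ x, w' x = u' x) : TD T t n w w' := by
  induction n generalizing u w u' w' with
  | zero =>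
    intro x
    rw [he' x]
    refine (h x).congr_of_eventuallyEq (he.mono fun τ hτ => congrFun hτ x) ?_
    exact congrFun (he.self_of_nhdsWithin ht) x
  | succ n ih =>
    have e0 : w' = u' := funext he'
    rw [e0]
    refine ⟨fun x => (h.1 x).congr_of_eventuallyEq (he.mono fun τ hτ => congrFun hτ x)
      (congrFun (he.self_of_nhdsWithin ht) x), ?_, h.2.2.1, ih h.2.2.2 (he.mono fun τ hτ => ?_)
        fun _ => rfl⟩
    · filter_upwards [he, h.2.1] with τ h1 h2
      rw [h1]; exact h2
    · rw [hτ]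

theorem congr' (ht : t ∈ timeIco T) (h : TD T t n u u')
    (he : ∀ τ ∈ timeIco T, ∀ x, w τ x = u τ x) (he' : ∀ x, w' x = u' x) : TD T t n w w' :=
  h.congr ht (eventually_nhdsWithin_of_forall fun τ hτ => funext (he τ hτ)) he'

theorem add (ht : t ∈ timeIco T) (h : TD T t n u u') (h' : TD T t n w w') :
    TD T t n (fun τ x => u τ x + w τ x) (fun x => u' x + w' x) := by
  induction n generalizing u w u' w' with
  | zero => exact fun x => (h x).add (h' x)
  | succ n ih =>
    refine ⟨fun x => (h.1 x).add (h'.1 x), ?_, h.2.2.1.add h'.2.2.1, ?_⟩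
    · filter_upwards [h.2.1, h'.2.1] with τ h1 h2 using h1.add h2
    · refine (ih h.2.2.2 h'.2.2.2).congr ht ?_ fun x => deriv_fun_add (h.2.2.1 x) (h'.2.2.1 x)
      filter_upwards [h.2.1, h'.2.1] with τ h1 h2
      ext x; exact deriv_fun_add (h1 x) (h2 x)

theorem mul (ht : t ∈ timeIco T) (h : TD T t n u u') (h' : TD T t n w w') :
    TD T t n (fun τ x => u τ x * w τ x) (fun x => u' x * w t x + u t x * w' x) := by
  induction n generalizing u w u' w' with
  | zero => exact fun x => (h x).mul (h' x)
  | succ n ih =>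
    have hu := h.2.1.self_of_nhdsWithin ht
    have hw := h'.2.1.self_of_nhdsWithin ht
    refine ⟨fun x => (h.1 x).mul (h'.1 x), ?_,
      (h.2.2.1.mul hw).add (hu.mul h'.2.2.1), ?_⟩
    · filter_upwards [h.2.1, h'.2.1] with τ h1 h2 using h1.mul h2
    · refine ((ih h.2.2.2 h'.of_succ).add ht (ih h.of_succ h'.2.2.2)).congr ht ?_ fun x => ?_
      · filter_upwards [h.2.1, h'.2.1] with τ h1 h2
        ext x; exact deriv_fun_mul (h1 x) (h2 x)
      · have h1 : HasDerivAt (fun x => u' x * w t x + u t x * w' x)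
            ((_root_.deriv u' x * w t x + u' x * _root_.deriv (w t) x) +
              (_root_.deriv (u t) x * w' x + u t x * _root_.deriv w' x)) x :=
          ((h.2.2.1 x).hasDerivAt.mul (hw x).hasDerivAt).add
            ((hu x).hasDerivAt.mul (h'.2.2.1 x).hasDerivAt)
        rw [h1.deriv]; ring

theorem const (a : ℝ) : TD T t n (fun _ _ => a) (fun _ => 0) := by
  induction n generalizing a with
  | zero => exact fun x => hasDerivWithinAt_const _ _ _
  | succ n ih =>
    refine ⟨fun x => hasDerivWithinAt_const _ _ _, Eventually.of_forall fun τ => by fun_prop,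
      by fun_prop, ?_⟩
    simpa using ih 0

theorem const_mul (ht : t ∈ timeIco T) (a : ℝ) (h : TD T t n u u') :
    TD T t n (fun τ x => a * u τ x) (fun x => a * u' x) :=
  ((const a).mul ht h).congr' ht (fun _ _ _ => rfl) fun x => by ring

theorem neg (ht : t ∈ timeIco T) (h : TD T t n u u') :
    TD T t n (fun τ x => -u τ x) (fun x => -u' x) :=
  (h.const_mul ht (-1)).congr' ht (fun _ _ _ => by ring) fun x => by ring

theorem sub (ht : t ∈ timeIco T) (h : TD T t n u u') (h' : TD T t n w w') :
    TD T t n (fun τ x => u τ x - w τ x) (fun x => u' x - w' x) :=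
  (h.add ht (h'.neg ht)).congr' ht (fun _ _ _ => by ring) fun x => by ring

/-- Division, away from the zeros of the denominator. -/
theorem inv (ht : t ∈ timeIco T) (h : TD T t n u u')
    (h0 : ∀ᶠ τ in 𝓝[timeIco T] t, ∀ x, u τ x ≠ 0) :
    TD T t n (fun τ x => (u τ x)⁻¹) (fun x => -u' x * (u t x)⁻¹ * (u t x)⁻¹) := by
  have h0' := h0.self_of_nhdsWithin ht
  have key : ∀ x, HasDerivWithinAt (fun τ => (u τ x)⁻¹) (-u' x * (u t x)⁻¹ * (u t x)⁻¹)
      (timeIco T) t := fun x => by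
    refine ((h.hasDeriv x).inv (h0' x)).congr_deriv ?_
    field_simp
  induction n with
  | zero => exact key
  | succ n ih =>
    have hi := ih h.of_succ
    have hu := h.2.1.self_of_nhdsWithin ht
    refine ⟨key, ?_, ?_, ?_⟩
    · filter_upwards [h.2.1, h0] with τ h1 h2 using h1.inv h2
    · exact (h.2.2.1.neg.mul (hu.inv h0')).mul (hu.inv h0')
    · have h1 := ((h.deriv.neg ht).mul ht hi).mul ht hi
      refine h1.congr ht ?_ fun x => ?_
      · filter_upwards [h.2.1, h0] with τ h2 h3
        ext x
        rw [deriv_fun_inv'' (h2 x) (h3 x)]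
        have := h3 x
        field_simp
      · have hdu := (hu x).hasDerivAt.inv (h0' x)
        have h2 : HasDerivAt (fun x => -u' x * (u t x)⁻¹ * (u t x)⁻¹) _ x :=
          ((h.2.2.1 x).hasDerivAt.neg.mul hdu).mul hdu
        rw [h2.deriv]
        have := h0' x
        simp only [Pi.neg_apply, Pi.mul_apply, Pi.inv_apply]
        field_simp

end TD

/-! ### Uniform time differentiability -/

/-- `u'` is the time derivative of `u` at `t`, uniformly in space. -/
def UQ (T : ℝ≥0∞) (t : ℝ) (u : ℝ → ℝ → ℝ) (u' : ℝ → ℝ) : Prop :=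
  ∀ ε > 0, ∀ᶠ τ in 𝓝[timeIco T] t, ∀ x, |u τ x - u t x - (τ - t) * u' x| ≤ ε * |τ - t|

theorem hasDerivWithinAt_of_remainder {S : Set ℝ} {t a : ℝ} {F R A K : ℝ → ℝ} (ht : t ∈ S)
    (hF : ∀ τ ∈ S, F τ = R τ + A τ + (τ - t) * K τ)
    (hR : ∀ ε > 0, ∀ᶠ τ in 𝓝[S] t, |R τ| ≤ ε * |τ - t|)
    (hA : HasDerivAt A a t) (hK : ContinuousAt K t) : HasDerivWithinAt F (a + K t) S t := by
  have hR0 : R t = 0 := by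
    have := (hR 1 one_pos).self_of_nhdsWithin ht
    simpa using this
  have h1 : HasDerivWithinAt R 0 S t := by
    rw [hasDerivWithinAt_iff_isLittleO, Asymptotics.isLittleO_iff]
    intro ε hε
    filter_upwards [hR ε hε] with τ hτ
    simpa [hR0] using hτ
  have h2 : HasDerivWithinAt (fun τ => (τ - t) * K τ) (K t) S t := by
    refine HasDerivAt.hasDerivWithinAt ?_
    rw [hasDerivAt_iff_tendsto_slope]
    refine (hK.tendsto.mono_left nhdsWithin_le_nhds).congr' ?_
    filter_upwards [self_mem_nhdsWithin] with τ hτ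
    have : τ - t ≠ 0 := sub_ne_zero.2 hτ
    simp [slope, this]
  have h3 := (h1.add hA.hasDerivWithinAt).add h2
  rw [zero_add] at h3
  exact h3.congr (fun τ hτ => hF τ hτ) (hF t ht)

namespace UQ

variable {T : ℝ≥0∞} {t : ℝ} {u w : ℝ → ℝ → ℝ} {u' w' : ℝ → ℝ}

theorem hasDeriv_shift (ht : t ∈ timeIco T) (h : UQ T t u u') (hd : Differentiable ℝ (u t))
    (hc : Continuous u') (e x : ℝ) :
    HasDerivWithinAt (fun τ => u τ (x + e * τ)) (u' (x + e * t) + e * deriv (u t) (x + e * t))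
      (timeIco T) t := by
  have h1 : HasDerivAt (fun τ => u t (x + e * τ)) (deriv (u t) (x + e * t) * e) t := by
    have h2 : HasDerivAt (fun τ => x + e * τ) e t := by
      simpa using ((hasDerivAt_id t).const_mul e).const_add x
    exact (hd (x + e * t)).hasDerivAt.comp t h2
  refine (hasDerivWithinAt_of_remainder ht
    (R := fun τ => u τ (x + e * τ) - u t (x + e * τ) - (τ - t) * u' (x + e * τ))
    (A := fun τ => u t (x + e * τ)) (K := fun τ => u' (x + e * τ)) (fun τ _ => by ring)
    (fun ε hε => (h ε hε).mono fun τ hτ => hτ _) h1 (by fun_prop)).congr_deriv ?_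
  ring

theorem hasDeriv_primitive (ht : t ∈ timeIco T) (h : UQ T t u u')
    (hu : ∀ τ ∈ timeIco T, Continuous (u τ)) (hc : Continuous u') (e x : ℝ) :
    HasDerivWithinAt (fun τ => ∫ y in (x - e * τ)..(x + e * τ), u τ y)
      ((∫ y in (x - e * t)..(x + e * t), u' y) + e * (u t (x + e * t) + u t (x - e * t)))
      (timeIco T) t := by
  have hA : HasDerivAt (fun τ => ∫ y in (x - e * τ)..(x + e * τ), u t y)
      (e * (u t (x + e * t) + u t (x - e * t))) t := by
    have h1 : HasDerivAt (fun τ => ∫ y in (0)..(x + e * τ), u t y) (u t (x + e * t) * e) t := by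
      have h2 : HasDerivAt (fun τ => x + e * τ) e t := by
        simpa using ((hasDerivAt_id t).const_mul e).const_add x
      exact ((hu t ht).integral_hasStrictDerivAt 0 (x + e * t)).hasDerivAt.comp t h2
    have h2 : HasDerivAt (fun τ => ∫ y in (0)..(x - e * τ), u t y) (u t (x - e * t) * (-e)) t := by
      have h2 : HasDerivAt (fun τ => x - e * τ) (-e) t := by
        simpa using ((hasDerivAt_id t).const_mul e).const_sub x
      exact ((hu t ht).integral_hasStrictDerivAt 0 (x - e * t)).hasDerivAt.comp t h2
    refine ((h1.sub h2).congr_deriv (by ring)).congr_of_eventuallyEq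
      (Eventually.of_forall fun τ => ?_)
    exact (intervalIntegral.integral_interval_sub_left ((hu t ht).intervalIntegrable _ _)
      ((hu t ht).intervalIntegrable _ _)).symm
  have hK : Continuous (fun τ => ∫ y in (x - e * τ)..(x + e * τ), u' y) := by
    have : (fun τ => ∫ y in (x - e * τ)..(x + e * τ), u' y) = fun τ =>
        (∫ y in (0)..(x + e * τ), u' y) - ∫ y in (0)..(x - e * τ), u' y := by
      ext τ
      exact (intervalIntegral.integral_interval_sub_left (hc.intervalIntegrable _ _)
        (hc.intervalIntegrable _ _)).symm
    rw [this]
    have hP : Continuous (fun z => ∫ y in (0)..z, u' y) :=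
      intervalIntegral.continuous_primitive (fun _ _ => hc.intervalIntegrable _ _) 0
    exact (hP.comp (by fun_prop)).sub (hP.comp (by fun_prop))
  refine (hasDerivWithinAt_of_remainder ht
    (R := fun τ => ∫ y in (x - e * τ)..(x + e * τ), (u τ y - u t y - (τ - t) * u' y))
    (A := fun τ => ∫ y in (x - e * τ)..(x + e * τ), u t y)
    (K := fun τ => ∫ y in (x - e * τ)..(x + e * τ), u' y) (fun τ hτ => ?_)
    (fun ε hε => ?_) hA hK.continuousAt).congr_deriv (by ring)
  · rw [intervalIntegral.integral_sub, intervalIntegral.integral_sub,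
      intervalIntegral.integral_const_mul]
    · ring
    · exact (hu τ hτ).intervalIntegrable _ _
    · exact (hu t ht).intervalIntegrable _ _
    · exact ((hu τ hτ).sub (hu t ht)).intervalIntegrable _ _
    · exact (continuous_const.mul hc).intervalIntegrable _ _
  · have h2 : ∀ᶠ τ in 𝓝[timeIco T] t, |2 * e * τ| < |2 * e * t| + 1 := by
      refine nhdsWithin_le_nhds ?_
      have : ContinuousAt (fun τ : ℝ => |2 * e * τ|) t := by fun_prop
      exact this.eventually_lt_const (by linarith)
    have hpos : 0 < |2 * e * t| + 1 := by positivity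
    filter_upwards [h (ε / (|2 * e * t| + 1)) (by positivity), h2] with τ h3 h4
    have h5 := intervalIntegral.norm_integral_le_of_norm_le_const (a := x - e * τ)
      (b := x + e * τ) (f := fun y => u τ y - u t y - (τ - t) * u' y)
      (C := ε / (|2 * e * t| + 1) * |τ - t|) fun y _ => h3 y
    rw [Real.norm_eq_abs] at h5
    refine h5.trans ?_
    have e1 : x + e * τ - (x - e * τ) = 2 * e * τ := by ring
    rw [e1]
    calc ε / (|2 * e * t| + 1) * |τ - t| * |2 * e * τ|
        ≤ ε / (|2 * e * t| + 1) * |τ - t| * (|2 * e * t| + 1) := by gcongr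
      _ = ε * |τ - t| := by field_simp

theorem mul (h : UQ T t u u') (h' : UQ T t w w') {K : ℝ} (hK : 0 ≤ K) (hu : ∀ x, |u t x| ≤ K)
    (hw : ∀ x, |w t x| ≤ K) (hu' : ∀ x, |u' x| ≤ K) (hw' : ∀ x, |w' x| ≤ K) :
    UQ T t (fun τ x => u τ x * w τ x) (fun x => u' x * w t x + u t x * w' x) := by
  intro ε hε
  have hδ : 0 < ε / (4 * (K + 1)) := by positivity
  have h3 : ∀ᶠ τ in 𝓝[timeIco T] t, |τ - t| < ε / (4 * (K + 1) ^ 2) := by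
    refine nhdsWithin_le_nhds ?_
    have : ContinuousAt (fun τ : ℝ => |τ - t|) t := by fun_prop
    refine this.eventually_lt_const ?_
    simp only [sub_self, abs_zero]; positivity
  filter_upwards [h _ hδ, h' _ hδ, h3, h 1 one_pos, h' 1 one_pos] with τ h1 h2 h3 h4 h5 x
  set d := τ - t
  have a1 := h1 x
  have a2 := h2 x
  have b1 : |u τ x - u t x| ≤ (K + 1) * |d| := by
    have : u τ x - u t x = (u τ x - u t x - d * u' x) + d * u' x := by ring
    rw [this]
    refine (abs_add_le _ _).trans ?_
    rw [abs_mul]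
    have := h4 x
    have := mul_le_mul_of_nonneg_left (hu' x) (abs_nonneg d)
    linarith
  have b2 : |w τ x - w t x| ≤ (K + 1) * |d| := by
    have : w τ x - w t x = (w τ x - w t x - d * w' x) + d * w' x := by ring
    rw [this]
    refine (abs_add_le _ _).trans ?_
    rw [abs_mul]
    have := h5 x
    have := mul_le_mul_of_nonneg_left (hw' x) (abs_nonneg d)
    linarith
  have e1 : u τ x * w τ x - u t x * w t x - d * (u' x * w t x + u t x * w' x) =
      (u τ x - u t x - d * u' x) * w t x + u t x * (w τ x - w t x - d * w' x)
        + (u τ x - u t x) * (w τ x - w t x) := by ring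
  rw [e1]
  have c1 : |(u τ x - u t x - d * u' x) * w t x| ≤ ε / 4 * |d| := by
    rw [abs_mul]
    calc _ ≤ (ε / (4 * (K + 1)) * |d|) * (K + 1) :=
          mul_le_mul a1 ((hw x).trans (by linarith)) (abs_nonneg _) (by positivity)
      _ = _ := by field_simp
  have c2 : |u t x * (w τ x - w t x - d * w' x)| ≤ ε / 4 * |d| := by
    rw [abs_mul]
    calc _ ≤ (K + 1) * (ε / (4 * (K + 1)) * |d|) :=
          mul_le_mul ((hu x).trans (by linarith)) a2 (abs_nonneg _) (by positivity)
      _ = _ := by field_simp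
  have c3 : |(u τ x - u t x) * (w τ x - w t x)| ≤ ε / 4 * |d| := by
    rw [abs_mul]
    calc _ ≤ ((K + 1) * |d|) * ((K + 1) * |d|) :=
          mul_le_mul b1 b2 (abs_nonneg _) (by positivity)
      _ = (K + 1) ^ 2 * |d| * |d| := by ring
      _ ≤ (K + 1) ^ 2 * (ε / (4 * (K + 1) ^ 2)) * |d| := by gcongr
      _ = _ := by field_simp
  have := abs_add_le ((u τ x - u t x - d * u' x) * w t x + u t x * (w τ x - w t x - d * w' x))
    ((u τ x - u t x) * (w τ x - w t x))
  have := abs_add_le ((u τ x - u t x - d * u' x) * w t x) (u t x * (w τ x - w t x - d * w' x))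
  have : 0 ≤ ε * |d| := by positivity
  linarith

end UQ

/-! ### Curves in Sobolev spaces -/

theorem sobNorm_sub_le (r : ℝ) (f g : ℝ → ℝ) :
    sobNorm r (fun x => f x - g x) ≤ sobNorm r f + sobNorm r g := by
  have h := sobNorm_add_le r f (fun x => (-1) * g x)
  rw [sobNorm_const_mul] at h
  simpa [sub_eq_add_neg] using h

theorem contDiff_iteratedDeriv {f : ℝ → ℝ} {n k : ℕ} (hf : ContDiff ℝ (n + k : ℕ) f) :
    ContDiff ℝ n (iteratedDeriv k f) := by
  rw [iteratedDeriv_eq_iterate]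
  exact ContDiff.iterate_deriv' n k (by exact_mod_cast hf)

theorem sobNorm_iteratedDeriv_le {r : ℝ} (hr : 0 ≤ r) {f : ℝ → ℝ} {k : ℕ} (hf : ContDiff ℝ k f) :
    sobNorm r (iteratedDeriv k f) ≤ sobNorm (r + k) f := by
  induction k generalizing r with
  | zero => simp [iteratedDeriv_zero]
  | succ k ih =>
    rw [iteratedDeriv_succ]
    refine (sobNorm_deriv_le hr ?_).trans ?_
    · exact_mod_cast contDiff_iteratedDeriv (n := 1) (k := k) (by rwa [add_comm])
    · refine (ih (by linarith) (hf.of_le (by exact_mod_cast k.le_succ))).trans (le_of_eq ?_)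
      congr 1; push_cast; ring

theorem HO.iteratedDeriv {ι : Type*} {s : ℝ} [hs : Fact (3 / 2 < s)] {j : ℕ} {f : ι → ℝ → ℝ}
    {φ : ι → ℝ} (k : ℕ) (h : HO s (j + k) f φ) : HO s j (fun i => iteratedDeriv k (f i)) φ := by
  obtain ⟨C, hC, hc⟩ := h.bound
  refine ⟨fun i => contDiff_iteratedDeriv (h.smooth i), h.nonneg, C, hC, fun i => ?_⟩
  refine (sobNorm_iteratedDeriv_le (by linarith [half_lt hs.out j])
    ((h.smooth i).of_le (by exact_mod_cast Nat.le_add_left k j))).trans ?_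
  refine le_trans (le_of_eq ?_) (hc i)
  congr 1; push_cast; ring

theorem eventually_nhdsWithin_of_diff {S : Set ℝ} {t : ℝ} {P : ℝ → Prop} (h0 : P t)
    (h : ∀ᶠ τ in 𝓝[S \ {t}] t, P τ) : ∀ᶠ τ in 𝓝[S] t, P τ := by
  rw [eventually_nhdsWithin_iff] at h ⊢
  filter_upwards [h] with τ hτ hS
  by_cases e : τ = t
  · rw [e]; exact h0
  · exact hτ ⟨hS, e⟩

namespace IsC1Sob

variable {r : ℝ} {T : ℝ≥0∞} {u : ℝ → ℝ → ℝ} {t : ℝ}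

theorem sobNorm_quotient_ne_top (h : IsC1Sob r T u) (ht : t ∈ timeIco T) {τ : ℝ}
    (hτ : τ ∈ timeIco T) : sobNorm r (fun x => (τ - t)⁻¹ * (u τ x - u t x)) ≠ ⊤ := by
  rw [sobNorm_const_mul]
  refine ENNReal.mul_ne_top ENNReal.ofReal_ne_top (ne_top_of_le_ne_top ?_ (sobNorm_sub_le _ _ _))
  exact ENNReal.add_ne_top.2 ⟨(h τ hτ).1.ne, (h t ht).1.ne⟩

theorem sobNorm_timeDeriv_ne_top (h : IsC1Sob r T u) (ht : t ∈ timeIco T) :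
    sobNorm r (timeDeriv T u t) ≠ ⊤ := by
  have := neBot_timeIco ht
  have h1 := (h t ht).2.2.1.eventually_lt_const (u := 1) (by norm_num)
  obtain ⟨τ, hτ, hτT⟩ := (h1.and self_mem_nhdsWithin).exists
  have e : timeDeriv T u t = fun x => (τ - t)⁻¹ * (u τ x - u t x) -
      ((τ - t)⁻¹ * (u τ x - u t x) - timeDeriv T u t x) := by ext x; ring
  rw [e]
  refine ne_top_of_le_ne_top ?_ (sobNorm_sub_le _ _ _)
  exact ENNReal.add_ne_top.2 ⟨h.sobNorm_quotient_ne_top ht hτT.1,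
    (hτ.trans ENNReal.one_lt_top).ne⟩

theorem continuous_timeDeriv (hr : 1 / 2 < r) (h : IsC1Sob r T u) (ht : t ∈ timeIco T)
    (hc : ∀ τ ∈ timeIco T, Continuous (u τ)) : Continuous (timeDeriv T u t) := by
  have := neBot_timeIco ht
  have hfin := h.sobNorm_timeDeriv_ne_top ht
  rw [sobNorm_eq_sobC] at hfin
  have hi := integrable_ftL hr hfin
  set F : ℝ → ℂ := 𝓕⁻ (ftL fun x => (timeDeriv T u t x : ℂ)) with hF
  have hFc : Continuous F := continuous_fourierInv hi
  have hae := ae_eq_fourierInv_ftL (memLp_of_sobC hfin) hi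
  have key : ∀ x, (timeDeriv T u t x : ℂ) = F x := by
    intro x
    have h1 : Tendsto (fun τ => (((τ - t)⁻¹ * (u τ x - u t x) : ℝ) : ℂ))
        (𝓝[timeIco T \ {t}] t) (𝓝 (timeDeriv T u t x : ℂ)) := by
      refine (Complex.continuous_ofReal.tendsto _).comp ?_
      have h2 := ((h t ht).2.1 x).hasDerivWithinAt
      rw [hasDerivWithinAt_iff_tendsto_slope] at h2
      exact h2
    refine tendsto_nhds_unique h1 ?_
    rw [tendsto_iff_edist_tendsto_0]
    have h3 : Tendsto (fun τ => cSob r * sobNorm r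
        (fun x => (τ - t)⁻¹ * (u τ x - u t x) - timeDeriv T u t x))
        (𝓝[timeIco T \ {t}] t) (𝓝 0) := by
      simpa using ENNReal.Tendsto.const_mul (h t ht).2.2.1 (Or.inr (cSob_ne_top hr))
    refine tendsto_of_tendsto_of_tendsto_of_le_of_le' tendsto_const_nhds h3
      (Eventually.of_forall fun _ => zero_le) ?_
    filter_upwards [self_mem_nhdsWithin] with τ hτ
    have hcq : Continuous fun x => (((τ - t)⁻¹ * (u τ x - u t x) : ℝ) : ℂ) - F x := by
      refine (Complex.continuous_ofReal.comp ?_).sub hFc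
      exact continuous_const.mul ((hc τ hτ.1).sub (hc t ht))
    have h4 := enorm_le_sobC hr hcq x
    rw [edist_eq_enorm_sub]
    refine h4.trans (le_of_eq ?_)
    rw [sobNorm_eq_sobC]
    congr 1
    refine sobC_congr r ?_
    filter_upwards [hae] with y hy
    push_cast
    rw [hF, ← hy]
  have e : timeDeriv T u t = fun x => (F x).re := by ext x; rw [← key x, Complex.ofReal_re]
  rw [e]
  exact Complex.continuous_re.comp hFc

theorem contDiff_timeDeriv {n : ℕ} (hr : n + 1 / 2 < r) (h : IsC1Sob r T u) (ht : t ∈ timeIco T)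
    (hc : ∀ τ ∈ timeIco T, Continuous (u τ)) : ContDiff ℝ n (timeDeriv T u t) :=
  contDiff_of_sobNorm hr (h.sobNorm_timeDeriv_ne_top ht) (h.continuous_timeDeriv
    (by have : (0 : ℝ) ≤ n := n.cast_nonneg
        linarith) ht hc)

theorem uniform_iteratedDeriv {k : ℕ} (hr : k + 1 / 2 < r) (h : IsC1Sob r T u)
    (ht : t ∈ timeIco T) (hc : ∀ τ ∈ timeIco T, ContDiff ℝ k (u τ)) :
    UQ T t (fun τ => iteratedDeriv k (u τ)) (iteratedDeriv k (timeDeriv T u t)) := by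
  intro ε hε
  refine eventually_nhdsWithin_of_diff (by simp) ?_
  have hC := cSob_ne_top (r := r - k) (by linarith)
  have hpos : 0 < ENNReal.ofReal (ε / ((cSob (r - k)).toReal + 1)) := by
    rw [ENNReal.ofReal_pos]; positivity
  filter_upwards [(h t ht).2.2.1.eventually_lt_const hpos, self_mem_nhdsWithin] with τ hτ hτT x
  have hne : τ - t ≠ 0 := sub_ne_zero.2 hτT.2
  have hut := h.contDiff_timeDeriv hr ht fun τ hτ => (hc τ hτ).continuous
  have hq : ContDiff ℝ k (fun x => (τ - t)⁻¹ * (u τ x - u t x) - timeDeriv T u t x) :=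
    (contDiff_const.mul ((hc τ hτT.1).sub (hc t ht))).sub hut
  have h1 := sobNorm_iteratedDeriv_le (r := r - k) (by linarith) hq
  rw [sub_add_cancel] at h1
  have hcont : Continuous (iteratedDeriv k
      (fun x => (τ - t)⁻¹ * (u τ x - u t x) - timeDeriv T u t x)) :=
    hq.continuous_iteratedDeriv k le_rfl
  have h2 := abs_le_of_sobNorm (by linarith) hcont (h1.trans hτ.le) (by positivity) x
  have e : iteratedDeriv k (fun x => (τ - t)⁻¹ * (u τ x - u t x) - timeDeriv T u t x) x =
      (τ - t)⁻¹ * (iteratedDeriv k (u τ) x - iteratedDeriv k (u t) x)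
        - iteratedDeriv k (timeDeriv T u t) x := by
    rw [iteratedDeriv_fun_sub (contDiff_const.mul ((hc τ hτT.1).sub (hc t ht))).contDiffAt
      hut.contDiffAt, iteratedDeriv_const_mul_field,
      iteratedDeriv_fun_sub (hc τ hτT.1).contDiffAt (hc t ht).contDiffAt]
  rw [e] at h2
  have e2 : iteratedDeriv k (u τ) x - iteratedDeriv k (u t) x
      - (τ - t) * iteratedDeriv k (timeDeriv T u t) x = (τ - t) *
      ((τ - t)⁻¹ * (iteratedDeriv k (u τ) x - iteratedDeriv k (u t) x)
        - iteratedDeriv k (timeDeriv T u t) x) := by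
    field_simp
  rw [e2, abs_mul, mul_comm]
  refine mul_le_mul_of_nonneg_right (h2.trans ?_) (abs_nonneg _)
  have hc0 : 0 ≤ (cSob (r - k)).toReal := ENNReal.toReal_nonneg
  rw [mul_div_assoc', div_le_iff₀ (by positivity)]
  nlinarith

end IsC1Sob

/-! ### Waves and their transport -/

/-- A unidirectional wave of the decoupled approximation, bounded by `M`. -/
structure IsWave (p : Params) (s lam th M c : ℝ) (T : ℝ≥0∞) (v : ℝ → ℝ → ℝ) : Prop where
  smooth : ∀ t ∈ timeIco T, ContDiff ℝ 7 (v t)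
  c1 : IsC1Sob (s + 5) T v
  eq : p.SolvesCL c lam th T (p.nearId c lam v)
  bound : ∀ t ∈ timeIco T, sobNorm (s + 6) (v t) ≤ ENNReal.ofReal M
  bound_t : ∀ t ∈ timeIco T, sobNorm (s + 5) (timeDeriv T v t) ≤ ENNReal.ofReal M

/-- A curve of smooth functions that is `C¹` in time with values in `H^{s+5}`. -/
structure IsCurve (s : ℝ) (T : ℝ≥0∞) (v : ℝ → ℝ → ℝ) : Prop where
  smooth : ∀ t ∈ timeIco T, ContDiff ℝ 7 (v t)
  c1 : IsC1Sob (s + 5) T v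

theorem IsWave.isCurve {p : Params} {s lam th M c : ℝ} {T : ℝ≥0∞} {v : ℝ → ℝ → ℝ}
    (h : IsWave p s lam th M c T v) : IsCurve s T v := ⟨h.smooth, h.c1⟩

theorem deriv_iteratedDeriv_add (k : ℕ) (f : ℝ → ℝ) (d : ℝ) :
    deriv (fun x => iteratedDeriv k f (x + d)) = fun x => iteratedDeriv (k + 1) f (x + d) := by
  ext x
  rw [deriv_comp_add_const, iteratedDeriv_succ]

theorem IsCurve.differentiable_iteratedDeriv {s : ℝ} {T : ℝ≥0∞} {v : ℝ → ℝ → ℝ} {t : ℝ}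
    (h : IsCurve s T v) (ht : t ∈ timeIco T) {k : ℕ}
    (hk : k ≤ 6) : Differentiable ℝ (iteratedDeriv k (v t)) :=
  (h.smooth t ht).differentiable_iteratedDeriv k (by exact_mod_cast Nat.lt_succ_of_le hk)

namespace IsCurve

variable {s : ℝ} [hs : Fact (3 / 2 < s)] {T : ℝ≥0∞} {v : ℝ → ℝ → ℝ} {t : ℝ}

theorem contDiff_timeDeriv (h : IsCurve s T v) (ht : t ∈ timeIco T) :
    ContDiff ℝ 6 (timeDeriv T v t) :=
  h.c1.contDiff_timeDeriv (n := 6) (by push_cast; linarith [hs.out]) ht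
    fun τ hτ => (h.smooth τ hτ).continuous

theorem differentiable_iteratedDeriv_timeDeriv (h : IsCurve s T v) (ht : t ∈ timeIco T) {k : ℕ}
    (hk : k ≤ 5) : Differentiable ℝ (iteratedDeriv k (timeDeriv T v t)) :=
  (h.contDiff_timeDeriv ht).differentiable_iteratedDeriv k
    (by exact_mod_cast Nat.lt_succ_of_le hk)

theorem uniform (h : IsCurve s T v) (ht : t ∈ timeIco T) {k : ℕ} (hk : k ≤ 5) :
    UQ T t (fun τ => iteratedDeriv k (v τ)) (iteratedDeriv k (timeDeriv T v t)) := by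
  have hk' : (k : ℝ) ≤ 5 := by exact_mod_cast hk
  exact h.c1.uniform_iteratedDeriv (by linarith [hs.out]) ht fun τ hτ =>
    (h.smooth τ hτ).of_le (by exact_mod_cast hk.trans (by norm_num))

/-- The transported derivatives `∂ₓᵏv(τ, x + eτ)`. -/
theorem td_shift (h : IsCurve s T v) (ht : t ∈ timeIco T) (e : ℝ) {n k : ℕ} (hk : n + k ≤ 5) :
    TD T t n (fun τ x => iteratedDeriv k (v τ) (x + e * τ))
      (fun x => iteratedDeriv k (timeDeriv T v t) (x + e * t)
        + e * iteratedDeriv (k + 1) (v t) (x + e * t)) := by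
  have key : ∀ k ≤ 5, ∀ x, HasDerivWithinAt (fun τ => iteratedDeriv k (v τ) (x + e * τ))
      (iteratedDeriv k (timeDeriv T v t) (x + e * t)
        + e * iteratedDeriv (k + 1) (v t) (x + e * t)) (timeIco T) t := fun k hk x => by
    rw [iteratedDeriv_succ]
    exact (h.uniform ht hk).hasDeriv_shift ht (h.differentiable_iteratedDeriv ht (by omega))
      (h.differentiable_iteratedDeriv_timeDeriv ht hk).continuous e x
  induction n generalizing k with
  | zero => exact key k (by omega)
  | succ n ih =>
    have d1 : Differentiable ℝ fun x => iteratedDeriv k (timeDeriv T v t) (x + e * t) :=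
      (h.differentiable_iteratedDeriv_timeDeriv ht (by omega)).comp (by fun_prop)
    have d2 : Differentiable ℝ fun x => e * iteratedDeriv (k + 1) (v t) (x + e * t) :=
      ((h.differentiable_iteratedDeriv ht (by omega)).comp (by fun_prop)).const_mul e
    refine ⟨key k (by omega), eventually_nhdsWithin_of_forall fun τ hτ =>
      (h.differentiable_iteratedDeriv hτ (by omega)).comp (by fun_prop), d1.add d2, ?_⟩
    refine (ih (k := k + 1) (by omega)).congr' ht (fun τ hτ x => ?_) fun x => ?_
    · rw [deriv_iteratedDeriv_add]
    · have := deriv_fun_add (d1 x) (d2 x)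
      rw [this, deriv_iteratedDeriv_add, deriv_const_mul_field, deriv_iteratedDeriv_add]

theorem td_shift_sub (h : IsCurve s T v) (ht : t ∈ timeIco T) (e : ℝ) {n k : ℕ}
    (hk : n + k ≤ 5) :
    TD T t n (fun τ x => iteratedDeriv k (v τ) (x - e * τ))
      (fun x => iteratedDeriv k (timeDeriv T v t) (x - e * t)
        - e * iteratedDeriv (k + 1) (v t) (x - e * t)) :=
  (h.td_shift ht (-e) hk).congr' ht (fun τ _ x => by rw [neg_mul, ← sub_eq_add_neg])
    fun x => by rw [neg_mul, ← sub_eq_add_neg, neg_mul, ← sub_eq_add_neg]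

theorem exists_bound (h : IsCurve s T v) (ht : t ∈ timeIco T) :
    ∃ K : ℝ, 0 ≤ K ∧ (∀ x, |v t x| ≤ K) ∧ ∀ x, |timeDeriv T v t x| ≤ K := by
  have key : ∀ f : ℝ → ℝ, sobNorm (s + 5) f ≠ ⊤ → Continuous f → ∃ K, ∀ x, |f x| ≤ K :=
    fun f hf hc => ⟨_, abs_le_of_sobNorm (r := s + 5) (by linarith [hs.out]) hc
      (ENNReal.ofReal_toReal hf).ge ENNReal.toReal_nonneg⟩
  obtain ⟨K, hK⟩ := key _ (h.c1 t ht).1.ne (h.smooth t ht).continuous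
  obtain ⟨K', hK'⟩ := key _ (h.c1.sobNorm_timeDeriv_ne_top ht) (h.contDiff_timeDeriv ht).continuous
  exact ⟨max K K', ((abs_nonneg _).trans (hK 0)).trans (le_max_left _ _),
    fun x => (hK x).trans (le_max_left _ _), fun x => (hK' x).trans (le_max_right _ _)⟩

/-- Powers of a curve are uniformly differentiable in time. -/
theorem uniform_pow (h : IsCurve s T v) (ht : t ∈ timeIco T) (j : ℕ) :
    UQ T t (fun τ x => v τ x ^ (j + 1))
      (fun x => (j + 1) * v t x ^ j * timeDeriv T v t x) := by
  obtain ⟨K, hK, h1, h2⟩ := h.exists_bound ht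
  have h0 : UQ T t v (timeDeriv T v t) := by simpa using h.uniform ht (k := 0) (by norm_num)
  induction j with
  | zero => simpa using h0
  | succ j ih =>
    have hp : ∀ n : ℕ, ∀ x, |v t x| ^ n ≤ (K + 1) ^ n := fun n x =>
      pow_le_pow_left₀ (abs_nonneg _) ((h1 x).trans (by linarith)) n
    have h3 : (K + 1) ^ (j + 1) ≤ (j + 2) * (K + 1) ^ (j + 1) := by
      have : 0 ≤ (K + 1) ^ (j + 1) := by positivity
      nlinarith [this, mul_nonneg (j.cast_nonneg : (0 : ℝ) ≤ j) this]
    have h4 : K + 1 ≤ (K + 1) ^ (j + 1) := le_self_pow₀ (by linarith) (by omega)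
    have h5 := ih.mul h0 (K := (j + 2) * (K + 1) ^ (j + 1)) (by positivity)
      (fun x => by rw [abs_pow]; exact (hp _ x).trans h3)
      (fun x => (h1 x).trans (by linarith)) (fun x => ?_) (fun x => (h2 x).trans (by linarith))
    · refine cast (congrArg₂ _ ?_ ?_) h5
      · ext τ x; ring
      · ext x; push_cast; ring
    · rw [abs_mul, abs_mul, abs_pow, pow_succ, abs_of_nonneg (by positivity : (0 : ℝ) ≤ j + 1)]
      have := hp j x
      have h6 : (0 : ℝ) ≤ (K + 1) ^ j := by positivity
      calc (↑j + 1) * |v t x| ^ j * |timeDeriv T v t x| ≤ (↑j + 1) * (K + 1) ^ j * (K + 1) := by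
            gcongr; exact (h2 x).trans (by linarith)
        _ ≤ _ := by nlinarith [mul_nonneg h6 (by linarith : 0 ≤ K + 1)]

end IsCurve

/-- The integral over the interval between the characteristics through `(t, x)`. -/
def window (c t : ℝ) (f : ℝ → ℝ) (x : ℝ) : ℝ := ∫ y in (x - c * t)..(x + c * t), f y

theorem hasDerivAt_window {f : ℝ → ℝ} (hf : Continuous f) (c t x : ℝ) :
    HasDerivAt (window c t f) (f (x + c * t) - f (x - c * t)) x := by
  have e : window c t f = fun x => (∫ y in (0)..(x + c * t), f y) - ∫ y in (0)..(x - c * t), f y := by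
    ext x
    exact (intervalIntegral.integral_interval_sub_left (hf.intervalIntegrable _ _)
      (hf.intervalIntegrable _ _)).symm
  rw [e]
  have h1 : HasDerivAt (fun x => ∫ y in (0)..(x + c * t), f y) (f (x + c * t)) x := by
    exact (hf.integral_hasStrictDerivAt 0 (x + c * t)).hasDerivAt.comp_add_const x (c * t)
  have h2 : HasDerivAt (fun x => ∫ y in (0)..(x - c * t), f y) (f (x - c * t)) x := by
    exact (hf.integral_hasStrictDerivAt 0 (x - c * t)).hasDerivAt.comp_sub_const x (c * t)
  exact h1.sub h2

theorem TD.window {T : ℝ≥0∞} {t : ℝ} {n : ℕ} {u : ℝ → ℝ → ℝ} {u' up um : ℝ → ℝ} {c : ℝ}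
    (ht : t ∈ timeIco T) (h : UQ T t u u') (hu : ∀ τ ∈ timeIco T, Continuous (u τ))
    (hd : Differentiable ℝ (u t)) (hc : Continuous u')
    (hp : TD T t n (fun τ x => u τ (x + c * τ)) up)
    (hm : TD T t n (fun τ x => u τ (x - c * τ)) um) :
    TD T t (n + 1) (fun τ => window c τ (u τ))
      (fun x => window c t u' x + c * (u t (x + c * t) + u t (x - c * t))) := by
  have ep : ∀ x, up x = u' (x + c * t) + c * _root_.deriv (u t) (x + c * t) := fun x =>
    (uniqueDiffOn_timeIco T t ht).eq_deriv _ (hp.hasDeriv x) (h.hasDeriv_shift ht hd hc c x)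
  have em : ∀ x, um x = u' (x - c * t) - c * _root_.deriv (u t) (x - c * t) := fun x => by
    have h1 := h.hasDeriv_shift ht hd hc (-c) x
    simp only [neg_mul, ← sub_eq_add_neg] at h1
    exact (uniqueDiffOn_timeIco T t ht).eq_deriv _ (hm.hasDeriv x) h1
  have hdw : ∀ x, HasDerivAt
      (fun x => TwoLayer.window c t u' x + c * (u t (x + c * t) + u t (x - c * t)))
      (u' (x + c * t) - u' (x - c * t) +
        c * (_root_.deriv (u t) (x + c * t) + _root_.deriv (u t) (x - c * t))) x := fun x => by
    refine (hasDerivAt_window hc c t x).add (HasDerivAt.const_mul c (HasDerivAt.add ?_ ?_))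
    · simpa using (hd (x + c * t)).hasDerivAt.comp_add_const x (c * t)
    · simpa using (hd (x - c * t)).hasDerivAt.comp_sub_const x (c * t)
  refine ⟨fun x => h.hasDeriv_primitive ht hu hc c x, ?_, fun x => (hdw x).differentiableAt, ?_⟩
  · exact eventually_nhdsWithin_of_forall fun τ hτ x =>
      (hasDerivAt_window (hu τ hτ) c τ x).differentiableAt
  · refine (hp.sub ht hm).congr' ht (fun τ hτ x => ?_) fun x => ?_
    · exact (hasDerivAt_window (hu τ hτ) c τ x).deriv
    · rw [(hdw x).deriv, ep, em]; ring

theorem TD.pow {T : ℝ≥0∞} {t : ℝ} {n : ℕ} {u : ℝ → ℝ → ℝ} {u' : ℝ → ℝ} (ht : t ∈ timeIco T)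
    (h : TD T t n u u') (j : ℕ) :
    TD T t n (fun τ x => u τ x ^ (j + 1)) (fun x => (j + 1) * u t x ^ j * u' x) := by
  induction j with
  | zero => exact h.congr' ht (fun _ _ _ => by ring) fun x => by simp
  | succ j ih => exact (ih.mul ht h).congr' ht (fun _ _ _ => by ring) fun x => by push_cast; ring

theorem IsCurve.td_window {s : ℝ} [hs : Fact (3 / 2 < s)] {T : ℝ≥0∞} {v : ℝ → ℝ → ℝ} {t : ℝ}
    (h : IsCurve s T v) (ht : t ∈ timeIco T) (c : ℝ) (j : ℕ) {n : ℕ} (hn : n ≤ 5) :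
    TD T t n (fun τ => window c τ (fun y => v τ y ^ (j + 1)))
      (fun x => window c t (fun y => (j + 1) * v t y ^ j * timeDeriv T v t y) x
        + c * (v t (x + c * t) ^ (j + 1) + v t (x - c * t) ^ (j + 1))) := by
  have hv := (h.smooth t ht).continuous
  have hv' := (h.contDiff_timeDeriv ht).continuous
  have h1 := (h.td_shift ht c (k := 0) (n := 5) le_rfl)
  have h2 := (h.td_shift_sub ht c (k := 0) (n := 5) le_rfl)
  simp only [iteratedDeriv_zero] at h1 h2
  refine (TD.window ht (h.uniform_pow ht j) (fun τ hτ => (h.smooth τ hτ).continuous.pow _)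
    (((h.smooth t ht).differentiable (by norm_num)).pow _) (by fun_prop) (h1.pow ht j)
    (h2.pow ht j)).mono (by omega)

/-! ### The coupling terms as polynomials in jets -/

/-- `f^l` without time derivatives, as a polynomial in the jets of `l` and `r`. -/
def Spoly (p : Params) (l0 l1 l2 l3 r0 r1 r2 r3 : ℝ) : ℝ :=
  p.eps * (p.alpha1 / 2) * ((l1 + 1 / 3 * r1) * (l0 - r0) + (l0 + 1 / 3 * r0) * (l1 - r1))
    + p.eps ^ 2 * (p.alpha2 / 3) * ((l1 - r1) * l0 * (l0 + r0) + (l0 - r0) * l1 * (l0 + r0)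
      + (l0 - r0) * l0 * (l1 + r1))
    + p.eps ^ 3 * (p.alpha3 / 4) * ((l1 - 1 / 5 * r1) * (l0 - r0) * (l0 + r0) ^ 2
      + (l0 - 1 / 5 * r0) * (l1 - r1) * (l0 + r0) ^ 2
      + (l0 - 1 / 5 * r0) * (l0 - r0) * (2 * (l0 + r0) * (l1 + r1)))
    + p.mu * p.eps * p.kap3 * (1 / 3 * (l0 - r0) * (l3 - r3) + 4 / 3 * (l1 - r1) * (l2 - r2))

/-- The part of `f^l` with time derivatives, as a polynomial in the jets of `l`, `r` and of their
time derivatives. -/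
def Dpoly (p : Params) (l0 l1 l2 r0 r1 r2 m0 m1 m2 q0 q1 q2 : ℝ) : ℝ :=
  -(p.mu * p.nu) * (m2 - q2)
    - p.mu * p.eps * (p.kap1 * (m0 * l2 + l0 * m2 - (q0 * r2 + r0 * q2))
      + p.kap2 * (q0 * l2 + r0 * m2 - (m0 * r2 + l0 * q2))
      + (p.kap1 + p.kap2 / 2) * (2 * l1 * m1 - 2 * r1 * q1))

/-! ### Families of wave configurations -/

/-- Bounds on the parameters and on the waves. -/
structure Bounds where
  muMax : ℝ
  epsMax : ℝ
  delMin : ℝ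
  delMax : ℝ
  Lam : ℝ
  Th : ℝ
  M : ℝ
  hdel : 0 < delMin
  hM : 0 < M

/-- A wave `a` of velocity `c = ±1` and a counter-propagating wave `b`, at time `t`, whose
primitives between the characteristics are at most of size `k`. -/
structure Ctx (s : ℝ) (κ : Bounds) where
  p : Params
  lam : ℝ
  th : ℝ
  c : ℝ
  T : ℝ≥0∞
  a : ℝ → ℝ → ℝ
  b : ℝ → ℝ → ℝ
  t : ℝ
  k : ℝ
  regime : p.InRegime κ.muMax κ.epsMax κ.delMin κ.delMax
  hlam : |lam| ≤ κ.Lam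
  hth : |th| ≤ κ.Th
  hc : c = 1 ∨ c = -1
  ht : t ∈ timeIco T
  hk : 1 ≤ k
  wa : IsWave p s lam th κ.M c T a
  wb : IsWave p s lam th κ.M (-c) T b
  prim_a : ∀ x y, |y - x| ≤ 2 * t → |∫ z in x..y, a t z| ≤ κ.M * k
  prim_b : ∀ x y, |y - x| ≤ 2 * t → |∫ z in x..y, b t z| ≤ κ.M * k

theorem SO.div {ι : Type*} {c d φ : ι → ℝ} (h : SO c φ) {η : ℝ} (hη : 0 < η)
    (hd : ∀ i, η ≤ d i) : SO (fun i => c i / d i) φ := by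
  have h1 : SO (fun i => (d i)⁻¹) (1 : ι → ℝ) := SO.of_le (C := η⁻¹) fun i => by
    rw [abs_of_pos (inv_pos.2 (hη.trans_le (hd i)))]
    exact inv_anti₀ hη (hd i)
  simpa [div_eq_mul_inv] using h.mul_one_right h1

theorem SO.congr {ι : Type*} {c d φ : ι → ℝ} (h : SO c φ) (e : ∀ i, d i = c i) : SO d φ := by
  obtain ⟨C, hC, hc⟩ := h
  exact ⟨C, hC, fun i => by rw [e i]; exact hc i⟩

theorem SO.pow {ι : Type*} {c : ι → ℝ} (h : SO c 1) (n : ℕ) : SO (fun i => c i ^ n) 1 := by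
  induction n with
  | zero => simpa using SO.const 1
  | succ n ih => simpa [pow_succ] using ih.mul_one_left h

theorem HO.split {ι : Type*} {s : ℝ} {f a b : ι → ℝ → ℝ} {μ m : ι → ℝ}
    (hμ : ∀ i, 0 ≤ μ i) (hμ1 : SO μ 1) (hμm : SO μ m) (hf : HO s 5 f 1)
    (ha : HO s 3 a m) (hb : HO s 1 b (μ * μ)) (he : ∀ i x, f i x = a i x + b i x) :
    HO s 3 f m := by
  obtain ⟨F, hF, hf'⟩ := hf.bound
  obtain ⟨A, hA, ha'⟩ := ha.bound
  obtain ⟨B, hB, hb'⟩ := hb.bound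
  obtain ⟨D, hD, hd⟩ := hμm
  obtain ⟨D1, hD1, hd1⟩ := hμ1
  refine ⟨(hf.mono (by norm_num)).smooth, ha.nonneg, A + (D1 + 1) * B * D + D * F, by positivity,
    fun i => ?_⟩
  have hm := ha.nonneg i
  have hmi := hμ i
  have e1 : (s + (3 : ℕ) - 2 : ℝ) = s + (1 : ℕ) := by push_cast; ring
  have e2 : (s + (3 : ℕ) + 2 : ℝ) = s + (5 : ℕ) := by push_cast; ring
  have hμle : μ i ≤ D * m i := (le_abs_self _).trans (hd i)
  have hμle1 : μ i ≤ D1 := by simpa using (le_abs_self _).trans (hd1 i)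
  have hfi := hf' i
  rw [Pi.one_apply, mul_one] at hfi
  rcases hmi.eq_or_lt with h0 | h0
  · have hb0 : sobNorm (s + (1 : ℕ)) (b i) = 0 := by
      have := hb' i
      rw [Pi.mul_apply, ← h0] at this
      simpa using this
    have h1 : sobNorm (s + (3 : ℕ)) (f i) ≤ ENNReal.ofReal (A * m i) := by
      refine ENNReal.le_of_forall_pos_le_add fun η hη _ => ?_
      have h2 := sobNorm_split (r := s + (3 : ℕ)) (μ := η / F)
        (by positivity) (he i)
      rw [e1, e2, hb0, mul_zero, add_zero] at h2
      refine h2.trans (add_le_add (ha' i) ?_)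
      calc _ ≤ ENNReal.ofReal (η / F) * ENNReal.ofReal F := by gcongr
        _ = _ := by
          rw [← ENNReal.ofReal_mul (by positivity), div_mul_cancel₀ _ hF.ne',
            ENNReal.ofReal_coe_nnreal]
    refine h1.trans (ENNReal.ofReal_le_ofReal ?_)
    have : 0 ≤ ((D1 + 1) * B * D + D * F) * m i := by positivity
    nlinarith
  · have h2 := sobNorm_split (r := s + (3 : ℕ)) h0 (he i)
    rw [e1, e2] at h2
    refine h2.trans ?_
    calc _ ≤ ENNReal.ofReal (A * m i) + ENNReal.ofReal (1 + (μ i)⁻¹) *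
          ENNReal.ofReal (B * (μ * μ) i) + ENNReal.ofReal (μ i) * ENNReal.ofReal F := by
          gcongr
          · exact ha' i
          · exact hb' i
      _ = ENNReal.ofReal (A * m i + (1 + (μ i)⁻¹) * (B * (μ i * μ i)) + μ i * F) := by
          rw [← ENNReal.ofReal_mul (by positivity), ← ENNReal.ofReal_mul (by positivity),
            ← ENNReal.ofReal_add (by positivity) (by simp only [Pi.mul_apply]; positivity),
            ← ENNReal.ofReal_add (by simp only [Pi.mul_apply]; positivity) (by positivity)]
          simp only [Pi.mul_apply]
      _ ≤ _ := by
          refine ENNReal.ofReal_le_ofReal ?_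
          have e3 : (1 + (μ i)⁻¹) * (B * (μ i * μ i)) = (μ i + 1) * B * μ i := by
            field_simp
          have e4 : (μ i + 1) * B * μ i ≤ (D1 + 1) * B * (D * m i) := by gcongr
          have e5 : μ i * F ≤ D * m i * F := by gcongr
          rw [e3]
          nlinarith

theorem iteratedDeriv_eq_of_hasDerivAt {n : ℕ} {F : ℕ → ℝ → ℝ}
    (h : ∀ k < n, ∀ x, HasDerivAt (F k) (F (k + 1) x) x) {k : ℕ} (hk : k ≤ n) :
    iteratedDeriv k (F 0) = F k := by
  induction k with
  | zero => exact iteratedDeriv_zero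
  | succ k ih =>
    rw [iteratedDeriv_succ, ih (by omega)]
    ext x
    exact (h k (by omega) x).deriv

theorem hasDerivAt_iteratedDeriv {f : ℝ → ℝ} {n : ℕ} (hf : ContDiff ℝ n f) {k : ℕ} (hk : k < n)
    (x : ℝ) : HasDerivAt (iteratedDeriv k f) (iteratedDeriv (k + 1) f x) x := by
  rw [iteratedDeriv_succ]
  exact (hf.differentiable_iteratedDeriv k (by exact_mod_cast hk) x).hasDerivAt

namespace Ctx

variable {s : ℝ} {κ : Bounds}

/-- The configuration with the two waves exchanged. -/
def swap (i : Ctx s κ) : Ctx s κ where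
  p := i.p
  lam := i.lam
  th := i.th
  c := -i.c
  T := i.T
  a := i.b
  b := i.a
  t := i.t
  k := i.k
  regime := i.regime
  hlam := i.hlam
  hth := i.hth
  hc := i.hc.symm.imp (fun h => by rw [h, neg_neg]) (fun h => by rw [h])
  ht := i.ht
  hk := i.hk
  wa := i.wb
  wb := by rw [neg_neg]; exact i.wa
  prim_a := i.prim_b
  prim_b := i.prim_a

/-- The size of the coupling effects. -/
def m (i : Ctx s κ) : ℝ := i.p.couplingSize

/-- The `k`-th derivative of the first wave at time `t`, in its moving frame. -/
def D (k : ℕ) (i : Ctx s κ) : ℝ → ℝ := iteratedDeriv k (i.a i.t)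

/-- The `k`-th derivative of the time derivative of the first wave at time `t`, in its moving
frame. -/
def E (k : ℕ) (i : Ctx s κ) : ℝ → ℝ := iteratedDeriv k (timeDeriv i.T i.a i.t)

theorem mu_nonneg (i : Ctx s κ) : 0 ≤ i.p.mu := i.regime.1.1
theorem eps_nonneg (i : Ctx s κ) : 0 ≤ i.p.eps := i.regime.2.1.1
theorem del_ge (i : Ctx s κ) : κ.delMin ≤ i.p.del := i.regime.2.2.1.1.le
theorem gam_nonneg (i : Ctx s κ) : 0 ≤ i.p.gam := i.regime.2.2.2.1
theorem del_pos (i : Ctx s κ) : 0 < i.p.del := κ.hdel.trans_le i.del_ge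
theorem sum_ge (i : Ctx s κ) : κ.delMin ≤ i.p.gam + i.p.del := by
  linarith [i.del_ge, i.gam_nonneg]
theorem sum_pos (i : Ctx s κ) : 0 < i.p.gam + i.p.del := κ.hdel.trans_le i.sum_ge
theorem m_nonneg (i : Ctx s κ) : 0 ≤ i.m := i.mu_nonneg.trans (le_max_right _ _)
theorem c_sq (i : Ctx s κ) : i.c * i.c = 1 := by rcases i.hc with h | h <;> simp [h]
theorem precision_eq (i : Ctx s κ) : i.p.precision = i.m * i.m := by
  have h1 := i.mu_nonneg
  have h2 := i.eps_nonneg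
  unfold Params.precision m couplingSize
  have key : ∀ x y : ℝ, 0 ≤ x → 0 ≤ y → max (x * x) (y * y) = max x y * max x y := fun x y hx hy => by
    rcases le_total x y with h | h
    · rw [max_eq_right h, max_eq_right (mul_le_mul h h hx hy)]
    · rw [max_eq_left h, max_eq_left (mul_le_mul h h hy hx)]
  rw [← key _ _ (by positivity) h1, ← key _ _ (by positivity) (by positivity)]
  congr 2
  · rw [← sq_abs (i.p.del ^ 2 - i.p.gam)]; ring
  · ring
  · ring

section Sizes

theorem so_c : SO (fun i : Ctx s κ => i.c) 1 := SO.of_le (C := 1) fun i => by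
  rcases i.hc with h | h <;> simp [h]
theorem so_lam : SO (fun i : Ctx s κ => i.lam) 1 := SO.of_le fun i => i.hlam
theorem so_th : SO (fun i : Ctx s κ => i.th) 1 := SO.of_le fun i => i.hth
theorem so_mu : SO (fun i : Ctx s κ => i.p.mu) 1 := SO.of_le (C := κ.muMax) fun i => by
  rw [abs_of_nonneg i.mu_nonneg]; exact i.regime.1.2
theorem so_eps : SO (fun i : Ctx s κ => i.p.eps) 1 := SO.of_le (C := κ.epsMax) fun i => by
  rw [abs_of_nonneg i.eps_nonneg]; exact i.regime.2.1.2
theorem so_del : SO (fun i : Ctx s κ => i.p.del) 1 := SO.of_le (C := κ.delMax) fun i => by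
  rw [abs_of_nonneg i.del_pos.le]; exact i.regime.2.2.1.2.le
theorem so_gam : SO (fun i : Ctx s κ => i.p.gam) 1 := SO.of_le (C := 1) fun i => by
  rw [abs_of_nonneg i.gam_nonneg]; exact i.regime.2.2.2.2.le
theorem so_m : SO (m : Ctx s κ → ℝ) m := SO.refl m_nonneg
theorem so_mu_m : SO (fun i : Ctx s κ => i.p.mu) m := ⟨1, one_pos, fun i => by
  rw [abs_of_nonneg i.mu_nonneg, one_mul]; exact le_max_right _ _⟩
theorem so_eps_sq : SO (fun i : Ctx s κ => i.p.eps ^ 2) m := ⟨1, one_pos, fun i => by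
  rw [abs_of_nonneg (by positivity), one_mul]
  exact (le_max_right _ _).trans (le_max_left _ _)⟩
theorem so_eps_diff : SO (fun i : Ctx s κ => i.p.eps * (i.p.del ^ 2 - i.p.gam)) m :=
  ⟨1, one_pos, fun i => by
    rw [abs_mul, abs_of_nonneg i.eps_nonneg, one_mul]
    exact (le_max_left _ _).trans (le_max_left _ _)⟩
theorem so_m_one : SO (m : Ctx s κ → ℝ) 1 := by
  obtain ⟨A, hA, ha⟩ := (so_eps (s := s) (κ := κ)).mul_one_left
    ((so_del.pow 2).sub so_gam)
  obtain ⟨B, hB, hb⟩ := (so_eps (s := s) (κ := κ)).pow 2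
  obtain ⟨D, hD, hd⟩ := (so_mu (s := s) (κ := κ))
  refine ⟨A + B + D, by positivity, fun i => ?_⟩
  have h1 := ha i
  have h2 := (le_abs_self _).trans (hb i)
  have h3 := (le_abs_self _).trans (hd i)
  rw [abs_of_nonneg i.m_nonneg]
  rw [abs_mul, abs_of_nonneg i.eps_nonneg] at h1
  simp only [Pi.one_apply, mul_one] at *
  exact max_le (max_le (by linarith) (by linarith)) (by linarith)
theorem so_eps_cube : SO (fun i : Ctx s κ => i.p.eps ^ 3) m :=
  by simpa [pow_succ] using so_eps_sq.mul_one_right (so_eps (s := s) (κ := κ))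
theorem so_inv_sum : SO (fun i : Ctx s κ => 1 / (i.p.gam + i.p.del)) 1 :=
  (SO.const 1).div κ.hdel sum_ge
theorem so_inv_del : SO (fun i : Ctx s κ => 1 / i.p.del) 1 := (SO.const 1).div κ.hdel del_ge

theorem so_alpha1 : SO (fun i : Ctx s κ => i.p.alpha1) 1 :=
  (SO.const _).mul_one_left (((so_del.pow 2).sub so_gam).div κ.hdel sum_ge)
theorem so_eps_alpha1 : SO (fun i : Ctx s κ => i.p.eps * i.p.alpha1) m := by
  have := (SO.const (3 / 2)).mul_one_left (so_eps_diff.mul_one_right (so_inv_sum (s := s) (κ := κ)))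
  refine this.congr fun i => ?_
  unfold alpha1; ring
theorem so_alpha2 : SO (fun i : Ctx s κ => i.p.alpha2) 1 := by
  have := (SO.const (-3)).mul_one_left ((((so_gam (s := s) (κ := κ)).mul_one_left so_del).mul_one_left
    ((so_del.add (SO.const 1)).pow 2)).mul_one_left (so_inv_sum.pow 2))
  refine this.congr fun i => ?_
  have := i.sum_pos
  unfold alpha2; field_simp
theorem so_alpha3 : SO (fun i : Ctx s κ => i.p.alpha3) 1 := by
  have := (SO.const (-5)).mul_one_left (((((so_del (s := s) (κ := κ)).pow 2).mul_one_left
    ((so_del.add (SO.const 1)).pow 2)).mul_one_left (so_gam.mul_one_left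
      ((SO.const 1).sub so_gam))).mul_one_left (so_inv_sum.pow 3))
  refine this.congr fun i => ?_
  have := i.sum_pos
  unfold alpha3; field_simp
theorem so_nu : SO (fun i : Ctx s κ => i.p.nu) 1 := by
  have := (SO.const (1 / 6)).mul_one_left (((SO.const 1).add
    ((so_gam (s := s) (κ := κ)).mul_one_left so_del)).mul_one_left
    (so_inv_del.mul_one_left so_inv_sum))
  refine this.congr fun i => ?_
  have := i.del_pos; have := i.sum_pos
  unfold nu; rw [add_comm i.p.del i.p.gam]; field_simp
theorem so_kap2 : SO (fun i : Ctx s κ => i.p.kap2) 1 := by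
  have := (SO.const (1 / 3)).mul_one_left (((SO.const 1).sub
    (so_gam (s := s) (κ := κ))).mul_one_left so_inv_sum)
  refine this.congr fun i => ?_
  have := i.sum_pos
  unfold kap2; field_simp
theorem so_kap3 : SO (fun i : Ctx s κ => i.p.kap3) 1 := by
  have := (SO.const (1 / 2)).mul_one_left (((so_gam (s := s) (κ := κ)).sub
    (SO.const 1)).mul_one_left so_inv_sum)
  refine this.congr fun i => ?_
  have := i.sum_pos
  unfold kap3; field_simp

/-- `κ₁` is a bounded multiple of `δ² - γ`. -/
theorem kap1_eq (i : Ctx s κ) :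
    i.p.kap1 = 2 * i.p.nu * (1 / (i.p.gam + i.p.del)) * (i.p.del ^ 2 - i.p.gam) := by
  have := i.del_pos; have := i.sum_pos
  have : i.p.del + i.p.gam ≠ 0 := by linarith
  unfold kap1 nu; field_simp; ring
theorem so_kap1 : SO (fun i : Ctx s κ => i.p.kap1) 1 := by
  have := (((SO.const 2).mul_one_left (so_nu (s := s) (κ := κ))).mul_one_left
    so_inv_sum).mul_one_left ((so_del.pow 2).sub so_gam)
  exact this.congr kap1_eq
theorem so_eps_kap1 : SO (fun i : Ctx s κ => i.p.eps * i.p.kap1) m := by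
  have := (((SO.const 2).mul_one_left (so_nu (s := s) (κ := κ))).mul_one_left
    so_inv_sum).mul_one_left so_eps_diff
  refine this.congr fun i => ?_
  rw [i.kap1_eq]; ring
theorem nuT_eq (i : Ctx s κ) : i.p.nuT i.th i.lam = i.th * i.p.nu + i.lam := by
  unfold nuT nu; ring
theorem nuX_add_nuT (i : Ctx s κ) : i.p.nuX i.th i.lam + i.p.nuT i.th i.lam = i.p.nu := by
  unfold nuX nuT nu; ring
theorem so_nuT : SO (fun i : Ctx s κ => i.p.nuT i.th i.lam) 1 := by
  simp only [nuT_eq]; exact (so_th.mul_one_left so_nu).add so_lam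
theorem kapCL1_eq (i : Ctx s κ) : i.p.kapCL1 i.th i.lam =
    i.p.kap3 / 3 + (i.p.kap1 * (1 + (1 - i.th) / 4) + i.lam * i.p.alpha1) := by
  have := i.sum_pos
  unfold kapCL1 kap1 kap3 alpha1; field_simp; ring
theorem kapCL2_eq (i : Ctx s κ) : i.p.kapCL2 i.th =
    i.p.kap3 / 2 + i.p.kap2 / 2 + i.p.kap1 * (1 + (1 - i.th) / 4) := by
  have := i.sum_pos
  unfold kapCL2 kap1 kap2 kap3; field_simp; ring

end Sizes

end Ctx

/-! ### Asymptotics of the waves -/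

namespace Ctx

variable {s : ℝ} [hs : Fact (3 / 2 < s)] {κ : Bounds}

theorem ho_D {j k : ℕ} (h : j + k ≤ 6) : HO s j (D k : Ctx s κ → ℝ → ℝ) 1 := by
  have h6 : HO s 6 (fun i : Ctx s κ => i.a i.t) 1 :=
    ⟨fun i => (i.wa.smooth i.t i.ht).of_le (by norm_num), fun _ => zero_le_one, κ.M, κ.hM,
      fun i => by simpa using i.wa.bound i.t i.ht⟩
  exact (h6.mono h).iteratedDeriv k

theorem ho_E {j k : ℕ} (h : j + k ≤ 5) : HO s j (E k : Ctx s κ → ℝ → ℝ) 1 := by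
  have h5 : HO s 5 (fun i : Ctx s κ => timeDeriv i.T i.a i.t) 1 :=
    ⟨fun i => (i.wa.isCurve.contDiff_timeDeriv i.ht).of_le (by norm_num), fun _ => zero_le_one,
      κ.M, κ.hM, fun i => by simpa using i.wa.bound_t i.t i.ht⟩
  exact (h5.mono h).iteratedDeriv k

theorem hasDerivAt_D {k : ℕ} (hk : k < 7) (i : Ctx s κ) (x : ℝ) :
    HasDerivAt (D k i) (D (k + 1) i x) x :=
  hasDerivAt_iteratedDeriv (n := 7) (i.wa.smooth i.t i.ht) hk x

theorem hasDerivAt_E {k : ℕ} (hk : k < 6) (i : Ctx s κ) (x : ℝ) :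
    HasDerivAt (E k i) (E (k + 1) i x) x :=
  hasDerivAt_iteratedDeriv (n := 6) (i.wa.isCurve.contDiff_timeDeriv i.ht) hk x

/-- The coefficient of the near-identity transform. -/
def sig (i : Ctx s κ) : ℝ := i.c * i.p.mu * i.lam

/-- The derivatives of the transformed wave. -/
def N (k : ℕ) (i : Ctx s κ) (x : ℝ) : ℝ := D k i x + i.sig * D (k + 2) i x

theorem so_sig : SO (sig : Ctx s κ → ℝ) (fun i => i.p.mu) :=
  ((so_c.mul_one_left (SO.refl mu_nonneg)).mul_one_right so_lam)

theorem so_sig_one : SO (sig : Ctx s κ → ℝ) 1 := so_sig.trans so_mu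

theorem ho_N {j k : ℕ} (h : j + k ≤ 4) : HO s j (N k : Ctx s κ → ℝ → ℝ) 1 :=
  (ho_D (by omega)).add (HO.one_smul so_sig_one (ho_D (by omega)))

theorem ho_N_sub {j k : ℕ} (h : j + k ≤ 4) :
    HO s j (fun (i : Ctx s κ) x => N k i x - D k i x) (fun i => i.p.mu) :=
  (HO.smul_one so_sig (ho_D (j := j) (k := k + 2) (by omega))).congr fun i x => by simp [N]

theorem hasDerivAt_N {k : ℕ} (hk : k < 5) (i : Ctx s κ) (x : ℝ) :
    HasDerivAt (N k i) (N (k + 1) i x) x :=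
  (hasDerivAt_D (by omega) i x).add ((hasDerivAt_D (by omega) i x).const_mul _)

theorem cl_eq (i : Ctx s κ) (x : ℝ) :
    E 0 i x + i.sig * E 2 i x - i.p.mu * i.p.nuT i.th i.lam * (E 2 i x + i.sig * E 4 i x)
      + i.c * (i.p.eps * i.p.alpha1 * N 0 i x * N 1 i x
        + i.p.eps ^ 2 * i.p.alpha2 * N 0 i x ^ 2 * N 1 i x
        + i.p.eps ^ 3 * i.p.alpha3 * N 0 i x ^ 3 * N 1 i x
        + i.p.mu * i.p.nu * N 3 i x
        + i.p.mu * i.p.eps * (i.p.kapCL1 i.th i.lam * (N 1 i x * N 2 i x + N 0 i x * N 3 i x)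
            + i.p.kapCL2 i.th * (2 * N 1 i x * N 2 i x))) = 0 := by
  have h := i.wa.eq i.t i.ht x
  have e0 : i.p.nearId i.c i.lam i.a i.t = N 0 i := by
    ext y; simp [nearId, N, D, sig]
  have e1 : timeDeriv i.T (i.p.nearId i.c i.lam i.a) i.t = fun y => E 0 i y + i.sig * E 2 i y := by
    ext y
    refine HasDerivWithinAt.timeDeriv_eq i.ht ?_
    have h0 := (i.wa.isCurve.td_shift i.ht 0 (n := 0) (k := 0) (by norm_num)) y
    have h2 := (i.wa.isCurve.td_shift i.ht 0 (n := 0) (k := 2) (by norm_num)) y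
    simp only [zero_mul, add_zero, iteratedDeriv_zero] at h0 h2
    exact (h0.add (h2.const_mul i.sig)).congr_deriv (by simp [E])
  have hN : ∀ k ≤ 3, iteratedDeriv k (N 0 i) = N k i := fun k hk =>
    iteratedDeriv_eq_of_hasDerivAt (F := fun k => N k i) (n := 3)
      (fun k hk x => hasDerivAt_N (by omega) i x) hk
  have hE : iteratedDeriv 2 (fun y => E 0 i y + i.sig * E 2 i y) =
      fun y => E 2 i y + i.sig * E 4 i y :=
    iteratedDeriv_eq_of_hasDerivAt (F := fun k y => E k i y + i.sig * E (k + 2) i y) (n := 2)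
      (fun k hk x => (hasDerivAt_E (by omega) i x).add
        ((hasDerivAt_E (by omega) i x).const_mul _)) le_rfl
  have hd : deriv (N 0 i) = N 1 i := by ext y; exact (hasDerivAt_N (by norm_num) i y).deriv
  have hf : deriv (fun y => i.p.kapCL1 i.th i.lam * N 0 i y * N 2 i y
      + i.p.kapCL2 i.th * N 1 i y ^ 2) x =
      i.p.kapCL1 i.th i.lam * (N 1 i x * N 2 i x + N 0 i x * N 3 i x)
            + i.p.kapCL2 i.th * (2 * N 1 i x * N 2 i x) := by
    have h1 := ((hasDerivAt_N (by norm_num) i x (k := 0)).const_mul (i.p.kapCL1 i.th i.lam)).mul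
      (hasDerivAt_N (by norm_num) i x (k := 2))
    have h2 := ((hasDerivAt_N (by norm_num) i x (k := 1)).pow 2).const_mul (i.p.kapCL2 i.th)
    refine ((h1.add h2).congr_deriv ?_).deriv
    push_cast; ring
  rw [e1, e0, hE, hd, hN 2 (by norm_num), hN 3 le_rfl, hf, nuX_add_nuT] at h
  exact h

theorem so_kapCL1 : SO (fun i : Ctx s κ => i.p.kapCL1 i.th i.lam) 1 := by
  have h1 := (so_kap1 (s := s) (κ := κ)).mul_one_left ((SO.const 1).add
    (((SO.const 1).sub so_th).mul_one_right (SO.const (1 / 4))))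
  have h2 := ((so_kap3 (s := s) (κ := κ)).mul_one_right (SO.const (1 / 3))).add
    (h1.add (so_lam.mul_one_left so_alpha1))
  exact h2.congr fun i => by rw [kapCL1_eq]; ring

theorem so_kapCL2 : SO (fun i : Ctx s κ => i.p.kapCL2 i.th) 1 := by
  have h1 := (so_kap1 (s := s) (κ := κ)).mul_one_left ((SO.const 1).add
    (((SO.const 1).sub so_th).mul_one_right (SO.const (1 / 4))))
  have h2 := (((so_kap3 (s := s) (κ := κ)).add so_kap2).mul_one_right (SO.const (1 / 2))).add h1
  exact h2.congr fun i => by rw [kapCL2_eq]; ring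

theorem so_mu_eps : SO (fun i : Ctx s κ => i.p.mu * i.p.eps) m := so_mu_m.mul_one_right so_eps

/-- The waves vary slowly in their moving frames. -/
theorem ho_E_m : HO s 3 (E 0 : Ctx s κ → ℝ → ℝ) m := by
  have a1 : HO s 3 (fun (i : Ctx s κ) x => (-(i.c * i.lam - i.p.nuT i.th i.lam) * i.p.mu) * E 2 i x) m :=
    HO.smul_one (((so_c.mul_one_left so_lam).sub so_nuT).neg.mul_one_left so_mu_m)
      (ho_E (by norm_num))
  have hN0 : HO s 3 (N 0 : Ctx s κ → ℝ → ℝ) 1 := ho_N (by norm_num)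
  have hN1 : HO s 3 (N 1 : Ctx s κ → ℝ → ℝ) 1 := ho_N (by norm_num)
  have a2 := HO.smul_one (so_c.mul_one_left (so_eps_alpha1 (s := s) (κ := κ)))
    (hN0.mul_one_left hN1)
  have a3 := HO.smul_one (so_c.mul_one_left ((so_eps_sq (s := s) (κ := κ)).mul_one_right so_alpha2))
    ((hN0.mul_one_left hN0).mul_one_left hN1)
  have a4 := HO.smul_one (so_c.mul_one_left ((so_eps_cube (s := s) (κ := κ)).mul_one_right so_alpha3))
    (((hN0.mul_one_left hN0).mul_one_left hN0).mul_one_left hN1)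
  have hD : ∀ k ≤ 3, HO s 3 (D k : Ctx s κ → ℝ → ℝ) 1 := fun k hk => ho_D (by omega)
  have a5 := HO.smul_one (so_c.mul_one_left ((so_mu_m (s := s) (κ := κ)).mul_one_right so_nu))
    (hD 3 le_rfl)
  have h12 := (hD 1 (by norm_num)).mul_one_left (hD 2 (by norm_num))
  have h03 := (hD 0 (by norm_num)).mul_one_left (hD 3 (by norm_num))
  have a6 := HO.smul_one (so_c.mul_one_left (so_mu_eps (s := s) (κ := κ)))
    ((HO.one_smul so_kapCL1 (h12.add h03)).add (HO.one_smul so_kapCL2 (h12.const_mul 2)))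
  have hD' : ∀ k ≤ 5, HO s 1 (D k : Ctx s κ → ℝ → ℝ) 1 := fun k hk => ho_D (by omega)
  have hmm : SO (fun i : Ctx s κ => i.p.mu * i.p.mu)
      ((fun i : Ctx s κ => i.p.mu) * fun i : Ctx s κ => i.p.mu) :=
    (SO.refl mu_nonneg).mul (SO.refl mu_nonneg)
  have b1 := HO.smul_one (hmm.mul_one_right
    ((so_c.mul_one_left (so_lam (s := s) (κ := κ))).mul_one_left so_nuT))
    (ho_E (s := s) (κ := κ) (j := 1) (k := 4) (by norm_num))
  have b2 := HO.smul_one (hmm.mul_one_right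
    ((so_c.mul_one_left (so_lam (s := s) (κ := κ))).mul_one_left (so_c.mul_one_left so_nu)))
    (hD' 5 le_rfl)
  have hP : ∀ k l, k ≤ 5 → l ≤ 5 → HO s 1 (fun (i : Ctx s κ) x => D k i x * D l i x) 1 :=
    fun k l hk hl => (hD' k hk).mul_one_left (hD' l hl)
  have hR1 := ((hP 1 4 (by norm_num) (by norm_num)).add (hP 3 2 (by norm_num) (by norm_num))).add
    (HO.one_smul so_sig_one (hP 3 4 (by norm_num) (by norm_num)))
  have hR2 := ((hP 0 5 (by norm_num) (by norm_num)).add (hP 2 3 (by norm_num) (by norm_num))).add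
    (HO.one_smul so_sig_one (hP 2 5 (by norm_num) (by norm_num)))
  have b3 := HO.smul_one (hmm.mul_one_right
    ((so_c.mul_one_left (so_lam (s := s) (κ := κ))).mul_one_left (so_c.mul_one_left so_eps)))
    ((HO.one_smul so_kapCL1 (hR1.add hR2)).add (HO.one_smul so_kapCL2 (hR1.const_mul 2)))
  refine HO.split (f := (E 0 : Ctx s κ → ℝ → ℝ)) mu_nonneg so_mu so_mu_m (ho_E le_rfl)
    (((((a1.sub a2).sub a3).sub a4).sub a5).sub a6) ((b1.sub b2).sub b3) fun i x => ?_
  have h := cl_eq i x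
  simp only [N, sig] at h ⊢
  linear_combination h

theorem ho_E_m' {j k : ℕ} (h : j + k ≤ 3) : HO s j (E k : Ctx s κ → ℝ → ℝ) m := by
  have h1 := (ho_E_m (s := s) (κ := κ)).mono h
  have h2 := h1.iteratedDeriv k
  refine h2.congr fun i x => ?_
  simp [E]

/-- The waves solve the unidirectional part of the coupled equations, up to `m²`. -/
theorem ho_wave_residual : HO s 0 (fun (i : Ctx s κ) x => E 0 i x
    + i.c * Spoly i.p (D 0 i x) (D 1 i x) (D 2 i x) (D 3 i x) 0 0 0 0
    + Dpoly i.p (D 0 i x) (D 1 i x) (D 2 i x) 0 0 0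
      (-i.c * D 1 i x) (-i.c * D 2 i x) (-i.c * D 3 i x) 0 0 0) (m * m) := by
  have t1 := HO.one_smul (((so_c.mul_one_left so_lam).sub so_nuT).neg)
    (HO.smul (so_mu_m (s := s) (κ := κ)) (ho_E_m' (j := 0) (k := 2) (by norm_num)))
  have hmm := (so_mu_m (s := s) (κ := κ)).mul so_mu_m
  have t2 := HO.smul_one (hmm.mul_one_right
    ((so_c.mul_one_left (so_lam (s := s) (κ := κ))).mul_one_left so_nuT))
    (ho_E (s := s) (κ := κ) (j := 0) (k := 4) (by norm_num))
  have hN : ∀ k ≤ 3, HO s 0 (N k : Ctx s κ → ℝ → ℝ) 1 := fun k hk => ho_N (by omega)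
  have hD : ∀ k ≤ 3, HO s 0 (D k : Ctx s κ → ℝ → ℝ) 1 := fun k hk => ho_D (by omega)
  have hS : ∀ k ≤ 3, HO s 0 (fun (i : Ctx s κ) x => N k i x - D k i x) m := fun k hk =>
    (ho_N_sub (by omega)).trans so_mu_m
  have q01 := HO.mul_sub_mul (hD 0 (by norm_num)) (hN 1 (by norm_num)) (hS 0 (by norm_num))
    (hS 1 (by norm_num))
  have p01 := (hN 0 (by norm_num)).mul_one_left (hN 1 (by norm_num))
  have p001 := (hN 0 (by norm_num)).mul_one_left p01
  have q001 := HO.mul_sub_mul (hD 0 (by norm_num)) p01 (hS 0 (by norm_num)) q01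
  have q0001 := HO.mul_sub_mul (hD 0 (by norm_num)) p001 (hS 0 (by norm_num)) q001
  have q03 := HO.mul_sub_mul (hD 0 (by norm_num)) (hN 3 (by norm_num)) (hS 0 (by norm_num))
    (hS 3 (by norm_num))
  have q12 := HO.mul_sub_mul (hD 1 (by norm_num)) (hN 2 (by norm_num)) (hS 1 (by norm_num))
    (hS 2 (by norm_num))
  have t3 := HO.smul (so_c.mul_one_left (so_eps_alpha1 (s := s) (κ := κ))) q01
  have t4 := HO.smul (so_c.mul_one_left ((so_eps_sq (s := s) (κ := κ)).mul_one_right so_alpha2)) q001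
  have t5 := HO.smul (so_c.mul_one_left ((so_eps_cube (s := s) (κ := κ)).mul_one_right so_alpha3))
    q0001
  have t6 := HO.smul (so_c.mul_one_left ((so_mu_m (s := s) (κ := κ)).mul_one_right so_nu))
    (hS 3 (by norm_num))
  have t7 := HO.smul (so_c.mul_one_left (so_mu_eps (s := s) (κ := κ)))
    ((HO.one_smul so_kapCL1 (q12.add q03)).add (HO.one_smul so_kapCL2 (q12.const_mul 2)))
  have d12 := (hD 1 (by norm_num)).mul_one_left (hD 2 (by norm_num))
  have d03 := (hD 0 (by norm_num)).mul_one_left (hD 3 (by norm_num))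
  have hth : SO (fun i : Ctx s κ => (1 - i.th) * (1 / 4)) 1 :=
    ((SO.const 1).sub so_th).mul_one_right (SO.const (1 / 4))
  have hk : SO (fun i : Ctx s κ => i.p.mu * (i.p.eps * i.p.kap1)) (m * m) :=
    so_mu_m.mul so_eps_kap1
  have hk1 := (so_c.mul_one_left ((hk.mul_one_right hth).add
    (so_mu_m.mul (so_lam.mul_one_left so_eps_alpha1))))
  have t8 := HO.smul_one hk1 (d12.add d03)
  have t9 := HO.smul_one (so_c.mul_one_left (hk.mul_one_right hth)) (d12.const_mul 2)
  refine ((((((((t1.add t2).sub t3).sub t4).sub t5).sub t6).sub t7).sub t8).sub t9).congr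
    fun i x => ?_
  have h := cl_eq i x
  have hc := i.c_sq
  rw [kapCL1_eq, kapCL2_eq] at *
  simp only [Spoly, Dpoly, sig] at h ⊢
  linear_combination h

/-- The time derivative of a wave, in its moving frame, is an exact derivative. -/
theorem abs_integral_E_le : ∃ C : ℝ, 0 < C ∧ ∀ (i : Ctx s κ) (x y : ℝ),
    |∫ z in x..y, E 0 i z| ≤ C * i.m := by
  have hN : ∀ k ≤ 3, HO s 1 (N k : Ctx s κ → ℝ → ℝ) 1 := fun k hk => ho_N (by omega)
  have a1 := HO.smul_one ((((so_c.mul_one_left so_lam).sub so_nuT).neg.mul_one_left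
    (so_mu_m (s := s) (κ := κ)))) (ho_E (j := 1) (k := 1) (by norm_num))
  have a2 := HO.smul_one ((((so_c.mul_one_left so_lam).mul_one_left so_nuT).mul_one_left
    (so_mu_m (s := s) (κ := κ))).mul_one_right so_mu) (ho_E (j := 1) (k := 3) (by norm_num))
  have h0 := hN 0 (by norm_num)
  have a3 := HO.smul_one (so_c.mul_one_left (so_eps_alpha1 (s := s) (κ := κ)))
    ((h0.mul_one_left h0).const_mul (1 / 2))
  have a4 := HO.smul_one (so_c.mul_one_left ((so_eps_sq (s := s) (κ := κ)).mul_one_right so_alpha2))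
    (((h0.mul_one_left h0).mul_one_left h0).const_mul (1 / 3))
  have a5 := HO.smul_one (so_c.mul_one_left ((so_eps_cube (s := s) (κ := κ)).mul_one_right so_alpha3))
    ((((h0.mul_one_left h0).mul_one_left h0).mul_one_left h0).const_mul (1 / 4))
  have a6 := HO.smul_one (so_c.mul_one_left ((so_mu_m (s := s) (κ := κ)).mul_one_right so_nu))
    (hN 2 (by norm_num))
  have a7 := HO.smul_one (so_c.mul_one_left (so_mu_eps (s := s) (κ := κ)))
    ((HO.one_smul so_kapCL1 (h0.mul_one_left (hN 2 (by norm_num)))).add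
      (HO.one_smul so_kapCL2 ((hN 1 (by norm_num)).mul_one_left (hN 1 (by norm_num)))))
  have hΦ := ((((((a1.add a2).sub a3).sub a4).sub a5).sub a6).sub a7)
  obtain ⟨C, hC, hb⟩ := hΦ.sup
  refine ⟨2 * C, by positivity, fun i x y => ?_⟩
  have hd : ∀ z, HasDerivAt (fun x => (-(i.c * i.lam - i.p.nuT i.th i.lam) * i.p.mu) * E 1 i x
      + i.c * i.lam * i.p.nuT i.th i.lam * i.p.mu * i.p.mu * E 3 i x
      - i.c * (i.p.eps * i.p.alpha1) * (1 / 2 * (N 0 i x * N 0 i x))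
      - i.c * (i.p.eps ^ 2 * i.p.alpha2) * (1 / 3 * (N 0 i x * N 0 i x * N 0 i x))
      - i.c * (i.p.eps ^ 3 * i.p.alpha3) * (1 / 4 * (N 0 i x * N 0 i x * N 0 i x * N 0 i x))
      - i.c * (i.p.mu * i.p.nu) * N 2 i x
      - i.c * (i.p.mu * i.p.eps) * (i.p.kapCL1 i.th i.lam * (N 0 i x * N 2 i x)
        + i.p.kapCL2 i.th * (N 1 i x * N 1 i x))) (E 0 i z) z := fun z => by
    have n0 := hasDerivAt_N (k := 0) (by norm_num) i z
    have n1 := hasDerivAt_N (k := 1) (by norm_num) i z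
    have n2 := hasDerivAt_N (k := 2) (by norm_num) i z
    have e1 := hasDerivAt_E (k := 1) (by norm_num) i z
    have e3 := hasDerivAt_E (k := 3) (by norm_num) i z
    refine (((((((e1.const_mul _).add (e3.const_mul _)).sub (((n0.mul n0).const_mul _).const_mul _)).sub
      ((((n0.mul n0).mul n0).const_mul _).const_mul _)).sub
      (((((n0.mul n0).mul n0).mul n0).const_mul _).const_mul _)).sub (n2.const_mul _)).sub
      ((((n0.mul n2).const_mul _).add ((n1.mul n1).const_mul _)).const_mul _)).congr_deriv ?_
    have h := cl_eq i z
    simp only [sig, Pi.mul_apply] at h ⊢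
    linear_combination -h
  rw [intervalIntegral.integral_eq_sub_of_hasDerivAt (fun z _ => hd z)
    (((ho_E (s := s) (κ := κ) (j := 0) (k := 0) (by norm_num)).smooth i).continuous.intervalIntegrable
      _ _)]
  refine (abs_sub _ _).trans ?_
  have h1 := hb i x
  have h2 := hb i y
  linarith

end Ctx

/-! ### The coupling terms for smooth functions -/

theorem couplingSpace_eq (p : Params) {l r : ℝ → ℝ → ℝ} {t : ℝ} (hl : ContDiff ℝ 3 (l t))
    (hr : ContDiff ℝ 3 (r t)) (x : ℝ) :
    p.couplingSpace l r t x = Spoly p (l t x) (iteratedDeriv 1 (l t) x) (iteratedDeriv 2 (l t) x)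
      (iteratedDeriv 3 (l t) x) (r t x) (iteratedDeriv 1 (r t) x) (iteratedDeriv 2 (r t) x)
      (iteratedDeriv 3 (r t) x) := by
  have e1 : ∀ u : ℝ → ℝ → ℝ, ∀ y, dx u t y = iteratedDeriv 1 (u t) y := fun u y => by
    rw [iteratedDeriv_one]; rfl
  have e2 : ∀ u : ℝ → ℝ → ℝ, ∀ y, dx (dx u) t y = iteratedDeriv 2 (u t) y := fun u y => by
    rw [iteratedDeriv_succ, iteratedDeriv_one]; rfl
  have hl' : ∀ k < 3, HasDerivAt (iteratedDeriv k (l t)) (iteratedDeriv (k + 1) (l t) x) x :=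
    fun k hk => hasDerivAt_iteratedDeriv hl hk x
  have hr' : ∀ k < 3, HasDerivAt (iteratedDeriv k (r t)) (iteratedDeriv (k + 1) (r t) x) x :=
    fun k hk => hasDerivAt_iteratedDeriv hr hk x
  have l0 : HasDerivAt (fun y => l t y) (iteratedDeriv 1 (l t) x) x := by
    simpa only [iteratedDeriv_zero] using hl' 0 (by norm_num)
  have r0 : HasDerivAt (fun y => r t y) (iteratedDeriv 1 (r t) x) x := by
    simpa only [iteratedDeriv_zero] using hr' 0 (by norm_num)
  have l1 := hl' 1 (by norm_num)
  have l2 := hl' 2 (by norm_num)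
  have r1 := hr' 1 (by norm_num)
  have r2 := hr' 2 (by norm_num)
  have d1 : dx (fun t x => (l t x + 1 / 3 * r t x) * (l t x - r t x)) t x = _ :=
    ((l0.add (r0.const_mul (1 / 3))).mul (l0.sub r0)).deriv
  have d2 : dx (fun t x => (l t x - r t x) * l t x * (l t x + r t x)) t x = _ :=
    (((l0.sub r0).mul l0).mul (l0.add r0)).deriv
  have d3 : dx (fun t x => (l t x - 1 / 5 * r t x) * (l t x - r t x) * (l t x + r t x) ^ 2) t x = _ :=
    (((l0.sub (r0.const_mul (1 / 5))).mul (l0.sub r0)).mul ((l0.add r0).pow 2)).deriv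
  have d4 : dx (fun t x => 1 / 3 * (l t x - r t x) * (dx (dx l) t x - dx (dx r) t x)
          + 1 / 2 * (dx l t x - dx r t x) ^ 2) t x =
      1 / 3 * (l t x - r t x) * (iteratedDeriv 3 (l t) x - iteratedDeriv 3 (r t) x)
        + 4 / 3 * (iteratedDeriv 1 (l t) x - iteratedDeriv 1 (r t) x)
          * (iteratedDeriv 2 (l t) x - iteratedDeriv 2 (r t) x) := by
    change deriv (fun x => 1 / 3 * (l t x - r t x) * (dx (dx l) t x - dx (dx r) t x)
          + 1 / 2 * (dx l t x - dx r t x) ^ 2) x = _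
    simp only [e2]
    simp only [e1]
    refine (((((l0.sub r0).const_mul (1 / 3)).mul (l2.sub r2)).add
      (((l1.sub r1).pow 2).const_mul (1 / 2))).congr_deriv ?_).deriv
    simp only [Pi.sub_apply]
    push_cast
    ring
  unfold couplingSpace Spoly
  rw [d1, d2, d3, d4]
  simp only [Pi.add_apply, Pi.sub_apply, Pi.mul_apply, Pi.pow_apply]
  push_cast
  ring

/-- Derivatives along the characteristics. -/
theorem hasDerivAt_iteratedDeriv_time {f : ℝ → ℝ} {n : ℕ} (hf : ContDiff ℝ n f) {k : ℕ}
    (hk : k < n) (e x t : ℝ) :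
    HasDerivAt (fun τ => iteratedDeriv k f (x + e * τ)) (e * iteratedDeriv (k + 1) f (x + e * t)) t := by
  have h2 : HasDerivAt (fun τ => x + e * τ) e t := by
    simpa using ((hasDerivAt_id t).const_mul e).const_add x
  exact ((hasDerivAt_iteratedDeriv hf hk (x + e * t)).comp t h2).congr_deriv (mul_comm _ _)

theorem hasDerivAt_iteratedDeriv_time_sub {f : ℝ → ℝ} {n : ℕ} (hf : ContDiff ℝ n f) {k : ℕ}
    (hk : k < n) (e x t : ℝ) :
    HasDerivAt (fun τ => iteratedDeriv k f (x - e * τ))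
      (-e * iteratedDeriv (k + 1) f (x - e * t)) t := by
  have h := hasDerivAt_iteratedDeriv_time hf hk (-e) x t
  simpa only [neg_mul, ← sub_eq_add_neg] using h

theorem iteratedDeriv_shift (k : ℕ) (f : ℝ → ℝ) (d : ℝ) :
    iteratedDeriv k (fun x => f (x + d)) = fun x => iteratedDeriv k f (x + d) := by
  ext x; rw [iteratedDeriv_comp_add_const]

theorem iteratedDeriv_shift_sub (k : ℕ) (f : ℝ → ℝ) (d : ℝ) :
    iteratedDeriv k (fun x => f (x - d)) = fun x => iteratedDeriv k f (x - d) := by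
  simpa only [← sub_eq_add_neg] using iteratedDeriv_shift k f (-d)

theorem couplingTime_eq (p : Params) {a b : ℝ → ℝ} (ha : ContDiff ℝ 3 a) (hb : ContDiff ℝ 3 b)
    (c t x : ℝ) :
    p.couplingTime (fun t x => a (x - c * t)) (fun t x => b (x + c * t)) t x =
      Dpoly p (a (x - c * t)) (iteratedDeriv 1 a (x - c * t)) (iteratedDeriv 2 a (x - c * t))
      (b (x + c * t)) (iteratedDeriv 1 b (x + c * t)) (iteratedDeriv 2 b (x + c * t))
      (-c * iteratedDeriv 1 a (x - c * t)) (-c * iteratedDeriv 2 a (x - c * t))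
      (-c * iteratedDeriv 3 a (x - c * t)) (c * iteratedDeriv 1 b (x + c * t))
      (c * iteratedDeriv 2 b (x + c * t)) (c * iteratedDeriv 3 b (x + c * t)) := by
  have e1 : ∀ u : ℝ → ℝ → ℝ, ∀ t y, dx u t y = iteratedDeriv 1 (u t) y := fun u t y => by
    rw [iteratedDeriv_one]; rfl
  have e2 : ∀ u : ℝ → ℝ → ℝ, ∀ t y, dx (dx u) t y = iteratedDeriv 2 (u t) y := fun u t y => by
    rw [iteratedDeriv_succ, iteratedDeriv_one]; rfl
  have at0 : ∀ x, HasDerivAt (fun τ => a (x - c * τ)) (-c * iteratedDeriv 1 a (x - c * t)) t :=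
    fun x => by
      simpa only [iteratedDeriv_zero] using hasDerivAt_iteratedDeriv_time_sub ha
        (k := 0) (by norm_num) c x t
  have bt0 : ∀ x, HasDerivAt (fun τ => b (x + c * τ)) (c * iteratedDeriv 1 b (x + c * t)) t :=
    fun x => by
      simpa only [iteratedDeriv_zero] using hasDerivAt_iteratedDeriv_time hb
        (k := 0) (by norm_num) c x t
  have at1 := hasDerivAt_iteratedDeriv_time_sub ha (k := 1) (by norm_num) c x t
  have at2 := hasDerivAt_iteratedDeriv_time_sub ha (k := 2) (by norm_num) c x t
  have bt1 := hasDerivAt_iteratedDeriv_time hb (k := 1) (by norm_num) c x t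
  have bt2 := hasDerivAt_iteratedDeriv_time hb (k := 2) (by norm_num) c x t
  have d0 : dt (fun t x => a (x - c * t) - b (x + c * t)) t =
      fun x => -c * iteratedDeriv 1 a (x - c * t) - c * iteratedDeriv 1 b (x + c * t) := by
    ext y
    exact ((at0 y).sub (bt0 y)).deriv
  have d1 : dx (dx (dt (fun t x => a (x - c * t) - b (x + c * t)))) t x =
      -c * iteratedDeriv 3 a (x - c * t) - c * iteratedDeriv 3 b (x + c * t) := by
    rw [e2, d0]
    have h := iteratedDeriv_eq_of_hasDerivAt (n := 2) (k := 2)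
      (F := fun k x => -c * iteratedDeriv (k + 1) a (x - c * t)
        - c * iteratedDeriv (k + 1) b (x + c * t)) (fun k hk y => ?_) le_rfl
    · exact congrFun h x
    · refine HasDerivAt.sub (HasDerivAt.const_mul _ ?_) (HasDerivAt.const_mul _ ?_)
      · exact (hasDerivAt_iteratedDeriv (n := 3) ha (by omega) (y - c * t)).comp_sub_const y (c * t)
      · exact (hasDerivAt_iteratedDeriv (n := 3) hb (by omega) (y + c * t)).comp_add_const y (c * t)
  unfold couplingTime Dpoly
  rw [d1]
  simp only [e2]
  simp only [e1, iteratedDeriv_shift, iteratedDeriv_shift_sub]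
  have d2 := (((((((at0 x).mul at2).sub ((bt0 x).mul bt2)).const_mul p.kap1).add
    ((((bt0 x).mul at2).sub ((at0 x).mul bt2)).const_mul p.kap2)).add
    (((at1.pow 2).sub (bt1.pow 2)).const_mul (p.kap1 + p.kap2 / 2)))).deriv
  have d3 : dt (fun t x => p.kap1 * (a (x - c * t) * iteratedDeriv 2 a (x - c * t)
        - b (x + c * t) * iteratedDeriv 2 b (x + c * t))
      + p.kap2 * (b (x + c * t) * iteratedDeriv 2 a (x - c * t)
        - a (x - c * t) * iteratedDeriv 2 b (x + c * t))
      + (p.kap1 + p.kap2 / 2) * (iteratedDeriv 1 a (x - c * t) ^ 2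
        - iteratedDeriv 1 b (x + c * t) ^ 2)) t x = _ := d2
  rw [d3]
  push_cast
  ring

/-! ### The explicit corrector -/

/-- The quantities entering the corrector: derivatives of the two waves on the characteristics,
and integrals of powers of the second one between them. -/
structure Atoms where
  a0 : ℝ
  a1 : ℝ
  a2 : ℝ
  a3 : ℝ
  b0 : ℝ
  b1 : ℝ
  b2 : ℝ
  B0 : ℝ
  B1 : ℝ
  B2 : ℝ
  J1 : ℝ
  J2 : ℝ
  J3 : ℝ

/-- The corrector as a polynomial. -/
def corrPoly (p : Params) (A : Atoms) : ℝ :=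
  -1 / 2 * (
    p.eps * p.alpha1 * (-(1 / 3) * (A.a1 * A.J1 + A.a0 * (A.b0 - A.B0))
      - 1 / 6 * (A.b0 * A.b0 - A.B0 * A.B0))
    + p.eps ^ 2 * p.alpha2 * (-(1 / 3) * (A.a1 * A.J2 + A.a0 * (A.b0 * A.b0 - A.B0 * A.B0)))
    + p.eps ^ 3 * p.alpha3 * (1 / 5 * (3 * (A.a0 * A.a0 * A.a1 * A.J1)
        + A.a0 * A.a0 * A.a0 * (A.b0 - A.B0))
      - 3 / 10 * (2 * (A.a0 * A.a1 * A.J2) + A.a0 * A.a0 * (A.b0 * A.b0 - A.B0 * A.B0))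
      - 1 / 5 * (A.a1 * A.J3 + A.a0 * (A.b0 * (A.b0 * A.b0) - A.B0 * (A.B0 * A.B0)))
      + 1 / 20 * (A.b0 * (A.b0 * (A.b0 * A.b0)) - A.B0 * (A.B0 * (A.B0 * A.B0))))
    + p.mu * p.eps * (p.kap3 * (-(4 / 3) * (A.a1 * (A.b1 - A.B1)) - 1 / 3 * (A.a0 * (A.b2 - A.B2))
        - 4 / 3 * (A.a2 * (A.b0 - A.B0)) - 1 / 3 * (A.a3 * A.J1)
        + 1 / 3 * (A.b0 * A.b2 - A.B0 * A.B2) + 1 / 2 * (A.b1 * A.b1 - A.B1 * A.B1))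
      + p.kap1 * (A.b0 * A.b2 - A.B0 * A.B2)
      + p.kap2 * (A.a3 * A.J1 - A.a2 * (A.b0 - A.B0) + A.a0 * (A.b2 - A.B2) - A.a1 * (A.b1 - A.B1))
      + (p.kap1 + p.kap2 / 2) * (A.b1 * A.b1 - A.B1 * A.B1))
    + p.mu * p.nu * (A.b2 - A.B2))

/-- The derivative of `corrPoly` at `A` in the direction `d`. -/
def corrPolyD (p : Params) (A d : Atoms) : ℝ :=
  -1 / 2 * (
    p.eps * p.alpha1 * (-(1 / 3) * (d.a1 * A.J1 + A.a1 * d.J1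
        + (d.a0 * (A.b0 - A.B0) + A.a0 * (d.b0 - d.B0)))
      - 1 / 3 * (A.b0 * d.b0 - A.B0 * d.B0))
    + p.eps ^ 2 * p.alpha2 * (-(1 / 3) * (d.a1 * A.J2 + A.a1 * d.J2
        + (d.a0 * (A.b0 * A.b0 - A.B0 * A.B0) + 2 * (A.a0 * (A.b0 * d.b0 - A.B0 * d.B0)))))
    + p.eps ^ 3 * p.alpha3 * (1 / 5 * (3 * (2 * (A.a0 * d.a0 * A.a1 * A.J1)
          + A.a0 * A.a0 * d.a1 * A.J1 + A.a0 * A.a0 * A.a1 * d.J1)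
        + (3 * (A.a0 * A.a0 * d.a0 * (A.b0 - A.B0)) + A.a0 * A.a0 * A.a0 * (d.b0 - d.B0)))
      - 3 / 10 * (2 * (d.a0 * A.a1 * A.J2 + A.a0 * d.a1 * A.J2 + A.a0 * A.a1 * d.J2)
        + (2 * (A.a0 * d.a0 * (A.b0 * A.b0 - A.B0 * A.B0))
          + 2 * (A.a0 * A.a0 * (A.b0 * d.b0 - A.B0 * d.B0))))
      - 1 / 5 * (d.a1 * A.J3 + A.a1 * d.J3
        + (d.a0 * (A.b0 * (A.b0 * A.b0) - A.B0 * (A.B0 * A.B0))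
          + 3 * (A.a0 * (A.b0 * (A.b0 * d.b0) - A.B0 * (A.B0 * d.B0)))))
      + 1 / 5 * (A.b0 * (A.b0 * (A.b0 * d.b0)) - A.B0 * (A.B0 * (A.B0 * d.B0))))
    + p.mu * p.eps * (p.kap3 * (-(4 / 3) * (d.a1 * (A.b1 - A.B1) + A.a1 * (d.b1 - d.B1))
        - 1 / 3 * (d.a0 * (A.b2 - A.B2) + A.a0 * (d.b2 - d.B2))
        - 4 / 3 * (d.a2 * (A.b0 - A.B0) + A.a2 * (d.b0 - d.B0))
        - 1 / 3 * (d.a3 * A.J1 + A.a3 * d.J1)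
        + 1 / 3 * (d.b0 * A.b2 + A.b0 * d.b2 - (d.B0 * A.B2 + A.B0 * d.B2))
        + (A.b1 * d.b1 - A.B1 * d.B1))
      + p.kap1 * (d.b0 * A.b2 + A.b0 * d.b2 - (d.B0 * A.B2 + A.B0 * d.B2))
      + p.kap2 * (d.a3 * A.J1 + A.a3 * d.J1 - (d.a2 * (A.b0 - A.B0) + A.a2 * (d.b0 - d.B0))
        + (d.a0 * (A.b2 - A.B2) + A.a0 * (d.b2 - d.B2))
        - (d.a1 * (A.b1 - A.B1) + A.a1 * (d.b1 - d.B1)))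
      + (p.kap1 + p.kap2 / 2) * (2 * (A.b1 * d.b1 - A.B1 * d.B1)))
    + p.mu * p.nu * (d.b2 - d.B2))

/-- The coupling term that drives the corrector. -/
def gPoly (p : Params) (c a0 a1 a2 a3 b0 b1 b2 b3 : ℝ) : ℝ :=
  c * Spoly p a0 a1 a2 a3 b0 b1 b2 b3
    + Dpoly p a0 a1 a2 b0 b1 b2 (-c * a1) (-c * a2) (-c * a3) (c * b1) (c * b2) (c * b3)
    - (c * Spoly p a0 a1 a2 a3 0 0 0 0
      + Dpoly p a0 a1 a2 0 0 0 (-c * a1) (-c * a2) (-c * a3) 0 0 0)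

/-- The time derivative of the entries along the flow, when their derivative in the moving frames
is `d`. -/
def Atoms.total (c a4 b3 B3 : ℝ) (A d : Atoms) : Atoms where
  a0 := d.a0 - c * A.a1
  a1 := d.a1 - c * A.a2
  a2 := d.a2 - c * A.a3
  a3 := d.a3 - c * a4
  b0 := d.b0 + c * A.b1
  b1 := d.b1 + c * A.b2
  b2 := d.b2 + c * b3
  B0 := d.B0 - c * A.B1
  B1 := d.B1 - c * A.B2
  B2 := d.B2 - c * B3
  J1 := d.J1 + c * (A.b0 + A.B0)
  J2 := d.J2 + c * (A.b0 * A.b0 + A.B0 * A.B0)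
  J3 := d.J3 + c * (A.b0 * (A.b0 * A.b0) + A.B0 * (A.B0 * A.B0))

theorem corrPolyD_total (p : Params) (c a4 b3 B3 : ℝ) (A d : Atoms) :
    corrPolyD p A (A.total c a4 b3 B3 d) =
    corrPolyD p A d - c * corrPolyD p A ⟨A.a1, A.a2, A.a3, a4, A.b1, A.b2, b3, A.B1, A.B2, B3,
      A.b0 - A.B0, A.b0 * A.b0 - A.B0 * A.B0, A.b0 * (A.b0 * A.b0) - A.B0 * (A.B0 * A.B0)⟩
    - gPoly p c A.a0 A.a1 A.a2 A.a3 A.b0 A.b1 A.b2 b3 := by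
  simp only [corrPolyD, gPoly, Spoly, Dpoly, Atoms.total]
  ring

/-- A property of all the entries of `Atoms`. -/
structure Atoms.All (P : (Atoms → ℝ) → Prop) : Prop where
  a0 : P Atoms.a0
  a1 : P Atoms.a1
  a2 : P Atoms.a2
  a3 : P Atoms.a3
  b0 : P Atoms.b0
  b1 : P Atoms.b1
  b2 : P Atoms.b2
  B0 : P Atoms.B0
  B1 : P Atoms.B1
  B2 : P Atoms.B2
  J1 : P Atoms.J1
  J2 : P Atoms.J2
  J3 : P Atoms.J3

theorem contDiff_corrPoly {V : Type*} [NormedAddCommGroup V] [NormedSpace ℝ V] {n : ℕ} (p : Params)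
    {A : V → Atoms} (h : Atoms.All fun π => ContDiff ℝ n (fun y => π (A y))) :
    ContDiff ℝ n (fun y => corrPoly p (A y)) := by
  unfold corrPoly
  repeat' first
    | exact h.a0 | exact h.a1 | exact h.a2 | exact h.a3 | exact h.b0 | exact h.b1 | exact h.b2
    | exact h.B0 | exact h.B1 | exact h.B2 | exact h.J1 | exact h.J2 | exact h.J3
    | exact contDiff_const | apply ContDiff.sub | apply ContDiff.add | apply ContDiff.mul

theorem hasDerivAt_corrPoly (p : Params) {A : ℝ → Atoms} {d : Atoms} {x : ℝ}
    (h : Atoms.All fun π => HasDerivAt (fun y => π (A y)) (π d) x) :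
    HasDerivAt (fun y => corrPoly p (A y)) (corrPolyD p (A x) d) x := by
  apply HasDerivAt.congr_deriv
  · unfold corrPoly
    repeat' first
      | exact h.a0 | exact h.a1 | exact h.a2 | exact h.a3 | exact h.b0 | exact h.b1 | exact h.b2
      | exact h.B0 | exact h.B1 | exact h.B2 | exact h.J1 | exact h.J2 | exact h.J3
      | apply HasDerivAt.const_mul | apply HasDerivAt.fun_sub | apply HasDerivAt.fun_add
      | apply HasDerivAt.fun_mul
  · simp only [corrPolyD]; ring

theorem TD.congr_right {T : ℝ≥0∞} {t : ℝ} {n : ℕ} {u : ℝ → ℝ → ℝ} {u' w' : ℝ → ℝ}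
    (h : TD T t n u u') (e : ∀ x, w' x = u' x) : TD T t n u w' := by
  rwa [funext e]

theorem TD.corrPoly {T : ℝ≥0∞} {t : ℝ} {n : ℕ} (ht : t ∈ timeIco T) (p : Params)
    {A : ℝ → ℝ → Atoms} {d : ℝ → Atoms}
    (h : Atoms.All fun π => TD T t n (fun τ x => π (A τ x)) (fun x => π (d x))) :
    TD T t n (fun τ x => corrPoly p (A τ x)) (fun x => corrPolyD p (A t x) (d x)) := by
  apply TD.congr_right
  · unfold TwoLayer.corrPoly
    repeat' first
      | exact h.a0 | exact h.a1 | exact h.a2 | exact h.a3 | exact h.b0 | exact h.b1 | exact h.b2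
      | exact h.B0 | exact h.B1 | exact h.B2 | exact h.J1 | exact h.J2 | exact h.J3
      | apply TD.const_mul ht | apply TD.sub ht | apply TD.add ht | apply TD.mul ht
  · intro x; simp only [corrPolyD]; ring

/-- The entries for given profiles `a`, `b` at the point `(t, x)`. -/
def atoms (c t : ℝ) (a b : ℝ → ℝ) (x : ℝ) : Atoms where
  a0 := iteratedDeriv 0 a (x - c * t)
  a1 := iteratedDeriv 1 a (x - c * t)
  a2 := iteratedDeriv 2 a (x - c * t)
  a3 := iteratedDeriv 3 a (x - c * t)
  b0 := iteratedDeriv 0 b (x + c * t)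
  b1 := iteratedDeriv 1 b (x + c * t)
  b2 := iteratedDeriv 2 b (x + c * t)
  B0 := iteratedDeriv 0 b (x - c * t)
  B1 := iteratedDeriv 1 b (x - c * t)
  B2 := iteratedDeriv 2 b (x - c * t)
  J1 := window c t (fun y => b y ^ 1) x
  J2 := window c t (fun y => b y ^ 2) x
  J3 := window c t (fun y => b y ^ 3) x

/-- The derivatives in space of the entries. -/
def atomsDx (c t : ℝ) (a b : ℝ → ℝ) (x : ℝ) : Atoms :=
  let A := atoms c t a b x
  ⟨A.a1, A.a2, A.a3, iteratedDeriv 4 a (x - c * t), A.b1, A.b2, iteratedDeriv 3 b (x + c * t),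
    A.B1, A.B2, iteratedDeriv 3 b (x - c * t), A.b0 - A.B0, A.b0 * A.b0 - A.B0 * A.B0,
    A.b0 * (A.b0 * A.b0) - A.B0 * (A.B0 * A.B0)⟩

/-- The corrector for given profiles. -/
def corr (p : Params) (c : ℝ) (a b : ℝ → ℝ) (t x : ℝ) : ℝ := corrPoly p (atoms c t a b x)

theorem window_eq {f : ℝ → ℝ} (hf : Continuous f) (c t x : ℝ) :
    window c t f x = (∫ y in (0)..(x + c * t), f y) - ∫ y in (0)..(x - c * t), f y :=
  (intervalIntegral.integral_interval_sub_left (hf.intervalIntegrable _ _)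
    (hf.intervalIntegrable _ _)).symm

theorem hasDerivAt_window_time {f : ℝ → ℝ} (hf : Continuous f) (c t x : ℝ) :
    HasDerivAt (fun τ => window c τ f x) (c * (f (x + c * t) + f (x - c * t))) t := by
  simp only [window_eq hf]
  have h1 : HasDerivAt (fun τ => ∫ y in (0)..(x + c * τ), f y) (f (x + c * t) * c) t := by
    have h2 : HasDerivAt (fun τ => x + c * τ) c t := by
      simpa using ((hasDerivAt_id t).const_mul c).const_add x
    exact (hf.integral_hasStrictDerivAt 0 (x + c * t)).hasDerivAt.comp t h2
  have h2 : HasDerivAt (fun τ => ∫ y in (0)..(x - c * τ), f y) (f (x - c * t) * (-c)) t := by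
    have h2 : HasDerivAt (fun τ => x - c * τ) (-c) t := by
      simpa using ((hasDerivAt_id t).const_mul c).const_sub x
    exact (hf.integral_hasStrictDerivAt 0 (x - c * t)).hasDerivAt.comp t h2
  exact (h1.sub h2).congr_deriv (by ring)

theorem contDiff_primitive {f : ℝ → ℝ} {n : ℕ} (hf : ContDiff ℝ n f) :
    ContDiff ℝ (n + 1 : ℕ) (fun z => ∫ y in (0)..z, f y) := by
  have hd : ∀ z, HasDerivAt (fun z => ∫ y in (0)..z, f y) (f z) z := fun z =>
    (hf.continuous.integral_hasStrictDerivAt 0 z).hasDerivAt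
  have e : deriv (fun z => ∫ y in (0)..z, f y) = f := by ext z; exact (hd z).deriv
  push_cast
  rw [contDiff_succ_iff_deriv]
  exact ⟨fun z => (hd z).differentiableAt, by simp, by rw [e]; exact hf⟩

section Transport

variable {a b : ℝ → ℝ} (ha : ContDiff ℝ 7 a) (hb : ContDiff ℝ 7 b) (p : Params) (c : ℝ)

include ha hb in
theorem contDiff_corr_comp {V : Type*} [NormedAddCommGroup V] [NormedSpace ℝ V] {n : ℕ}
    (hn : n ≤ 4) {e f : V → ℝ} (he : ContDiff ℝ n e) (hf : ContDiff ℝ n f) :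
    ContDiff ℝ n (fun q => corr p c a b (e q) (f q)) := by
  have hA : ∀ k ≤ 3, ContDiff ℝ n (fun q => iteratedDeriv k a (f q - c * e q)) := fun k hk =>
    (contDiff_iteratedDeriv (n := n) (k := k)
      (ha.of_le (by exact_mod_cast (by omega : n + k ≤ 7)))).comp (hf.sub (contDiff_const.mul he))
  have hB : ∀ k ≤ 3, ContDiff ℝ n (fun q => iteratedDeriv k b (f q - c * e q)) := fun k hk =>
    (contDiff_iteratedDeriv (n := n) (k := k)
      (hb.of_le (by exact_mod_cast (by omega : n + k ≤ 7)))).comp (hf.sub (contDiff_const.mul he))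
  have hB' : ∀ k ≤ 3, ContDiff ℝ n (fun q => iteratedDeriv k b (f q + c * e q)) := fun k hk =>
    (contDiff_iteratedDeriv (n := n) (k := k)
      (hb.of_le (by exact_mod_cast (by omega : n + k ≤ 7)))).comp (hf.add (contDiff_const.mul he))
  have hJ : ∀ j, ContDiff ℝ n (fun q => window c (e q) (fun y => b y ^ j) (f q)) := fun j => by
    have hbj : ContDiff ℝ n (fun y => b y ^ j) :=
      (hb.of_le (by exact_mod_cast (by omega : n ≤ 7))).pow j
    simp only [window_eq hbj.continuous]
    have hP := (contDiff_primitive hbj).of_le (by exact_mod_cast n.le_succ : (n : WithTop ℕ∞) ≤ _)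
    exact (hP.comp (hf.add (contDiff_const.mul he))).sub
      (hP.comp (hf.sub (contDiff_const.mul he)))
  refine contDiff_corrPoly p (A := fun q => atoms c (e q) a b (f q)) ⟨hA 0 (by norm_num),
    hA 1 (by norm_num), hA 2 (by norm_num), hA 3 (by norm_num), hB' 0 (by norm_num),
    hB' 1 (by norm_num), hB' 2 (by norm_num), hB 0 (by norm_num), hB 1 (by norm_num),
    hB 2 (by norm_num), hJ 1, hJ 2, hJ 3⟩

include ha hb in
theorem hasDerivAt_corr_space (t x : ℝ) :
    HasDerivAt (corr p c a b t) (corrPolyD p (atoms c t a b x) (atomsDx c t a b x)) x := by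
  have hA : ∀ k ≤ 3, HasDerivAt (fun x => iteratedDeriv k a (x - c * t))
      (iteratedDeriv (k + 1) a (x - c * t)) x := fun k hk =>
    (hasDerivAt_iteratedDeriv (n := 7) ha (by omega) (x - c * t)).comp_sub_const x (c * t)
  have hB : ∀ k ≤ 3, HasDerivAt (fun x => iteratedDeriv k b (x - c * t))
      (iteratedDeriv (k + 1) b (x - c * t)) x := fun k hk =>
    (hasDerivAt_iteratedDeriv (n := 7) hb (by omega) (x - c * t)).comp_sub_const x (c * t)
  have hB' : ∀ k ≤ 3, HasDerivAt (fun x => iteratedDeriv k b (x + c * t))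
      (iteratedDeriv (k + 1) b (x + c * t)) x := fun k hk =>
    (hasDerivAt_iteratedDeriv (n := 7) hb (by omega) (x + c * t)).comp_add_const x (c * t)
  have hJ : ∀ j, HasDerivAt (window c t fun y => b y ^ j)
      (b (x + c * t) ^ j - b (x - c * t) ^ j) x := fun j =>
    hasDerivAt_window (hb.continuous.pow j) c t x
  refine hasDerivAt_corrPoly p ⟨hA 0 (by norm_num), hA 1 (by norm_num), hA 2 (by norm_num),
    hA 3 (by norm_num), hB' 0 (by norm_num), hB' 1 (by norm_num), hB' 2 (by norm_num),
    hB 0 (by norm_num), hB 1 (by norm_num), hB 2 (by norm_num), (hJ 1).congr_deriv ?_,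
    (hJ 2).congr_deriv ?_, (hJ 3).congr_deriv ?_⟩ <;>
  simp only [atomsDx, atoms, iteratedDeriv_zero] <;> ring

include ha hb in
theorem hasDerivAt_corr_time (t x : ℝ) :
    HasDerivAt (fun t => corr p c a b t x)
      (-c * corrPolyD p (atoms c t a b x) (atomsDx c t a b x)
        - gPoly p c (iteratedDeriv 0 a (x - c * t)) (iteratedDeriv 1 a (x - c * t))
          (iteratedDeriv 2 a (x - c * t)) (iteratedDeriv 3 a (x - c * t))
          (iteratedDeriv 0 b (x + c * t)) (iteratedDeriv 1 b (x + c * t))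
          (iteratedDeriv 2 b (x + c * t)) (iteratedDeriv 3 b (x + c * t))) t := by
  have hA : ∀ k ≤ 3, HasDerivAt (fun t => iteratedDeriv k a (x - c * t))
      (0 - c * iteratedDeriv (k + 1) a (x - c * t)) t := fun k hk => by
    simpa using hasDerivAt_iteratedDeriv_time_sub (n := 7) ha (k := k) (by omega) c x t
  have hB : ∀ k ≤ 3, HasDerivAt (fun t => iteratedDeriv k b (x - c * t))
      (0 - c * iteratedDeriv (k + 1) b (x - c * t)) t := fun k hk => by
    simpa using hasDerivAt_iteratedDeriv_time_sub (n := 7) hb (k := k) (by omega) c x t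
  have hB' : ∀ k ≤ 3, HasDerivAt (fun t => iteratedDeriv k b (x + c * t))
      (0 + c * iteratedDeriv (k + 1) b (x + c * t)) t := fun k hk => by
    simpa using hasDerivAt_iteratedDeriv_time (n := 7) hb (k := k) (by omega) c x t
  have hJ : ∀ j, HasDerivAt (fun t => window c t (fun y => b y ^ j) x)
      (c * (b (x + c * t) ^ j + b (x - c * t) ^ j)) t := fun j =>
    hasDerivAt_window_time (hb.continuous.pow j) c t x
  set o : Atoms := ⟨0, 0, 0, 0, 0, 0, 0, 0, 0, 0, 0, 0, 0⟩ with ho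
  have h0 : corrPolyD p (atoms c t a b x) o = 0 := by simp [corrPolyD, ho]
  refine (hasDerivAt_corrPoly p (A := fun t => atoms c t a b x)
    (d := (atoms c t a b x).total c (iteratedDeriv 4 a (x - c * t)) (iteratedDeriv 3 b (x + c * t))
      (iteratedDeriv 3 b (x - c * t)) o) ⟨hA 0 (by norm_num),
    hA 1 (by norm_num), hA 2 (by norm_num),
    hA 3 (by norm_num), hB' 0 (by norm_num), hB' 1 (by norm_num), hB' 2 (by norm_num),
    hB 0 (by norm_num), hB 1 (by norm_num), hB 2 (by norm_num), (hJ 1).congr_deriv ?_,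
    (hJ 2).congr_deriv ?_, (hJ 3).congr_deriv ?_⟩).congr_deriv ((corrPolyD_total ..).trans ?_)
  · simp only [atoms, Atoms.total, iteratedDeriv_zero, ho]; ring
  · simp only [atoms, Atoms.total, iteratedDeriv_zero, ho]; ring
  · simp only [atoms, Atoms.total, iteratedDeriv_zero, ho]; ring
  · rw [h0, atomsDx]; simp only [atoms]; ring

theorem corr_zero (x : ℝ) : corr p c a b 0 x = 0 := by
  simp [corr, corrPoly, atoms, window]

include ha hb in
theorem solvesTransport_corr : SolvesTransport c
    (fun t x => c * p.couplingSpace (fun t x => a (x - c * t)) (fun t x => b (x + c * t)) t x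
      + p.couplingTime (fun t x => a (x - c * t)) (fun t x => b (x + c * t)) t x
      - (c * p.couplingSpace (fun t x => a (x - c * t)) (fun _ _ => 0) t x
        + p.couplingTime (fun t x => a (x - c * t)) (fun _ _ => 0) t x)) (corr p c a b) := by
  refine ⟨contDiff_corr_comp ha hb p c (n := 1) (by norm_num) contDiff_fst contDiff_snd,
    corr_zero p c, fun t x => ?_⟩
  have h1 : dt (corr p c a b) t x = _ := (hasDerivAt_corr_time ha hb p c t x).deriv
  have h2 : dx (corr p c a b) t x = _ := (hasDerivAt_corr_space ha hb p c t x).deriv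
  have ha3 : ContDiff ℝ 3 a := ha.of_le (by norm_num)
  have hb3 : ContDiff ℝ 3 b := hb.of_le (by norm_num)
  have ha' : ContDiff ℝ 3 (fun x => a (x - c * t)) := ha3.comp (by fun_prop)
  have hb' : ContDiff ℝ 3 (fun x => b (x + c * t)) := hb3.comp (by fun_prop)
  have s1 := couplingSpace_eq p (l := fun t x => a (x - c * t)) (r := fun t x => b (x + c * t))
    ha' hb' x
  have s2 := couplingSpace_eq p (l := fun t x => a (x - c * t)) (r := fun _ _ => 0)
    ha' contDiff_const x
  have t1 := couplingTime_eq p ha3 hb3 c t x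
  have t2 := couplingTime_eq p ha3 (b := fun _ => 0) contDiff_const c t x
  have z : ∀ k, ∀ y : ℝ, iteratedDeriv k (fun _ : ℝ => (0 : ℝ)) y = 0 := fun k y => by simp
  simp only [iteratedDeriv_shift, iteratedDeriv_shift_sub, z, mul_zero] at s1 s2 t2
  rw [h1, h2]
  simp only [s1, s2, t1, t2, gPoly, iteratedDeriv_zero]
  ring

end Transport

theorem SolvesTransport.unique {c : ℝ} {g w w' : ℝ → ℝ → ℝ} (h : SolvesTransport c g w)
    (h' : SolvesTransport c g w') : w = w' := by
  have key : ∀ {w}, SolvesTransport c g w → ∀ x t, HasDerivAt (fun τ => w τ (x + c * τ))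
      (-g t (x + c * t)) t := fun {w} h x t => by
    have hd := (h.smooth.differentiable one_ne_zero) (t, x + c * t)
    have hf := hd.hasFDerivAt
    have h1 : HasDerivAt (fun τ => (τ, x + c * τ)) ((1 : ℝ), c) t := by
      refine (hasDerivAt_id t).prodMk ?_
      simpa using ((hasDerivAt_id t).const_mul c).const_add x
    have h2 : HasDerivAt (fun τ => (τ, x + c * t)) ((1 : ℝ), (0 : ℝ)) t :=
      (hasDerivAt_id t).prodMk (hasDerivAt_const _ _)
    have h3 : HasDerivAt (fun y => (t, y)) ((0 : ℝ), (1 : ℝ)) (x + c * t) :=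
      (hasDerivAt_const _ _).prodMk (hasDerivAt_id _)
    set L := fderiv ℝ (fun q : ℝ × ℝ => w q.1 q.2) (t, x + c * t)
    have k1 : HasDerivAt (fun τ => w τ (x + c * t)) (L (1, 0)) t :=
      HasFDerivAt.comp_hasDerivAt (l := fun q : ℝ × ℝ => w q.1 q.2) t hf h2
    have k2 : HasDerivAt (fun y => w t y) (L (0, 1)) (x + c * t) :=
      HasFDerivAt.comp_hasDerivAt (l := fun q : ℝ × ℝ => w q.1 q.2) (x + c * t) hf h3
    have e1 : dt w t (x + c * t) = L (1, 0) := k1.deriv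
    have e2 : dx w t (x + c * t) = L (0, 1) := k2.deriv
    refine (HasFDerivAt.comp_hasDerivAt (l := fun q : ℝ × ℝ => w q.1 q.2) t hf h1).congr_deriv ?_
    have e3 : ((1 : ℝ), c) = ((1 : ℝ), (0 : ℝ)) + c • ((0 : ℝ), (1 : ℝ)) := by simp
    rw [e3, map_add, map_smul, ← e1, ← e2, smul_eq_mul]
    linarith [h.eq t (x + c * t)]
  ext t x
  have hd : ∀ τ, HasDerivAt (fun τ => w τ (x - c * t + c * τ) - w' τ (x - c * t + c * τ)) 0 τ :=
    fun τ => ((key h _ τ).sub (key h' _ τ)).congr_deriv (by ring)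
  have hc := is_const_of_deriv_eq_zero (fun τ => (hd τ).differentiableAt) (fun τ => (hd τ).deriv)
    t 0
  simp only [sub_add_cancel, h.2, h'.2, sub_self] at hc
  linarith

/-! ### Integrals between the characteristics -/

theorem abs_integral_mul_le {f g : ℝ → ℝ} (hf : AEStronglyMeasurable f)
    (hg : AEStronglyMeasurable g) {K L : ℝ} (hK : 0 ≤ K) (hL : 0 ≤ L)
    (hf' : eLpNorm f 2 ≤ ENNReal.ofReal K) (hg' : eLpNorm g 2 ≤ ENNReal.ofReal L) (x y : ℝ) :
    |∫ z in x..y, f z * g z| ≤ K * L := by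
  rw [intervalIntegral.abs_integral_eq_abs_integral_uIoc]
  have h1 : ‖∫ z in uIoc x y, f z * g z‖ₑ ≤ ENNReal.ofReal K * ENNReal.ofReal L := by
    refine (enorm_integral_le_lintegral_enorm _).trans ?_
    refine (setLIntegral_le_lintegral _ _).trans ?_
    simp only [enorm_mul]
    have h := ENNReal.lintegral_mul_le_Lp_mul_Lq (volume : Measure ℝ) Real.HolderConjugate.two_two
      (f := fun ξ => ‖f ξ‖ₑ) (g := fun ξ => ‖g ξ‖ₑ) hf.enorm hg.enorm
    refine h.trans (mul_le_mul' ?_ ?_)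
    · refine le_trans (le_of_eq ?_) hf'
      rw [eLpNorm_eq_lintegral_rpow_enorm_toReal (by norm_num) (by norm_num)]
      simp
    · refine le_trans (le_of_eq ?_) hg'
      rw [eLpNorm_eq_lintegral_rpow_enorm_toReal (by norm_num) (by norm_num)]
      simp
  rw [← ENNReal.ofReal_mul hK, ← ofReal_norm, Real.norm_eq_abs] at h1
  exact (ENNReal.ofReal_le_ofReal_iff (by positivity)).1 h1

theorem HO.abs_integral_mul_le {ι : Type*} {s : ℝ} [hs : Fact (3 / 2 < s)] {j : ℕ}
    {f g : ι → ℝ → ℝ} {φ ψ : ι → ℝ} (hf : HO s j f φ) (hg : HO s j g ψ) :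
    ∃ C : ℝ, 0 < C ∧ ∀ i x y, |∫ z in x..y, f i z * g i z| ≤ C * (φ * ψ) i := by
  obtain ⟨C, hC, hc⟩ := hf.bound
  obtain ⟨D, hD, hd⟩ := hg.bound
  have h0 : 0 ≤ s + j := by linarith [half_lt hs.out j]
  refine ⟨C * D, by positivity, fun i x y => ?_⟩
  have h1 := hf.nonneg i
  have h2 := hg.nonneg i
  refine (TwoLayer.abs_integral_mul_le (hf.smooth i).continuous.aestronglyMeasurable
    (hg.smooth i).continuous.aestronglyMeasurable (by positivity) (by positivity)
    ((eLpNorm_le_sobNorm h0 _).trans (hc i)) ((eLpNorm_le_sobNorm h0 _).trans (hd i)) x y).trans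
    (le_of_eq ?_)
  rw [Pi.mul_apply]; ring

theorem memLp_window {f : ℝ → ℝ} (hf : Continuous f) (hf2 : eLpNorm f 2 ≠ ⊤) (c t : ℝ) :
    MemLp (window c t f) 2 := by
  have hcont : Continuous (window c t f) :=
    continuous_iff_continuousAt.2 fun x => (hasDerivAt_window hf c t x).continuousAt
  refine ⟨hcont.aestronglyMeasurable, ?_⟩
  set R := |c * t|
  have h1 : ∀ x, ‖window c t f x‖ₑ ≤
      ∫⁻ η, (Icc (-R) R).indicator (fun _ => 1) η * ‖f (x - η)‖ₑ := fun x => by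
    have e : window c t f x = ∫ η in (-(c * t))..(c * t), f (x - η) := by
      rw [window, intervalIntegral.integral_comp_sub_left (fun y => f y) x]
      congr 1; ring
    rw [e, ← ofReal_norm, Real.norm_eq_abs, intervalIntegral.abs_integral_eq_abs_integral_uIoc,
      ← Real.norm_eq_abs, ofReal_norm]
    refine (enorm_integral_le_lintegral_enorm _).trans ?_
    rw [← lintegral_indicator measurableSet_uIoc]
    refine lintegral_mono fun η => ?_
    by_cases h : η ∈ uIoc (-(c * t)) (c * t)
    · have h2 : η ∈ Icc (-R) R := by
        have := uIoc_subset_uIcc h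
        rw [uIcc, mem_Icc] at this
        refine ⟨le_trans ?_ this.1, this.2.trans ?_⟩
        · exact le_inf (neg_le_neg (le_abs_self _)) (neg_abs_le _)
        · exact sup_le (neg_le_abs _) (le_abs_self _)
      simp [h, h2]
    · simp [h]
  have h2 : eLpNorm (window c t f) 2 ≤
      eLpNorm (fun x => ∫⁻ η, (Icc (-R) R).indicator (fun _ => (1 : ℝ≥0∞)) η * ‖f (x - η)‖ₑ) 2 := by
    refine le_of_sq_le_sq_ennreal ?_
    rw [eLpNorm_two_sq, eLpNorm_two_sq]
    refine lintegral_mono fun x => ?_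
    simp only [enorm_eq_self]
    exact pow_le_pow_left' (h1 x) 2
  refine h2.trans_lt ((eLpNorm_lconv_le (g := fun x => ‖f x‖ₑ)
    ((measurable_const.indicator measurableSet_Icc).aemeasurable)
    hf.enorm.measurable.aemeasurable).trans_lt ?_)
  refine ENNReal.mul_lt_top ?_ ?_
  · rw [lintegral_indicator measurableSet_Icc]
    simp
  · rw [eLpNorm_enorm]; exact hf2.lt_top

theorem sobNorm_ne_top_of_deriv {r : ℝ} {f : ℝ → ℝ} (h0 : sobNorm 0 f ≠ ⊤)
    (hd : Differentiable ℝ f) (h1 : sobNorm r (deriv f) ≠ ⊤) : sobNorm r f ≠ ⊤ := by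
  have key : ∀ n : ℕ, ∀ q : ℝ, q ≤ n → q ≤ r → sobNorm q f ≠ ⊤ := by
    intro n
    induction n with
    | zero => exact fun q hq _ => ne_top_of_le_ne_top h0 (sobNorm_mono (by simpa using hq) f)
    | succ n ih =>
      intro q hq hqr
      have h2 := sobNorm_succ_le (q - 1) hd
      rw [sub_add_cancel] at h2
      refine ne_top_of_le_ne_top (ENNReal.add_ne_top.2 ⟨ih (q - 1) ?_ (by linarith), ?_⟩) h2
      · push_cast at hq; linarith
      · exact ne_top_of_le_ne_top h1 (sobNorm_mono (by linarith) _)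
  obtain ⟨n, hn⟩ := exists_nat_ge r
  exact key n r hn le_rfl

theorem sobNorm_zero_eq {f : ℝ → ℝ} (hf : MemLp f 2) : sobNorm 0 f = eLpNorm f 2 := by
  have h2 : MemLp (fun x => (f x : ℂ)) 2 := hf.ofReal (K := ℂ)
  rw [sobNorm_eq_sobC, sobC_zero_eq h2]
  refine eLpNorm_congr_norm_ae (ae_of_all _ fun x => ?_)
  simp

theorem HO.inf {ι : Type*} {s : ℝ} {j : ℕ} {f : ι → ℝ → ℝ} {φ ψ : ι → ℝ} (h : HO s j f φ)
    (h' : HO s j f ψ) : HO s j f (fun i => min (φ i) (ψ i)) := by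
  obtain ⟨C, hC, hc⟩ := h.bound
  obtain ⟨D, hD, hd⟩ := h'.bound
  refine ⟨h.smooth, fun i => le_min (h.nonneg i) (h'.nonneg i), max C D, lt_max_of_lt_left hC,
    fun i => ?_⟩
  rcases le_total (φ i) (ψ i) with h1 | h1
  · rw [min_eq_left h1]
    exact (hc i).trans (ENNReal.ofReal_le_ofReal
      (mul_le_mul_of_nonneg_right (le_max_left _ _) (h.nonneg i)))
  · rw [min_eq_right h1]
    exact (hd i).trans (ENNReal.ofReal_le_ofReal
      (mul_le_mul_of_nonneg_right (le_max_right _ _) (h'.nonneg i)))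

theorem HO.mul_bounded_one {ι : Type*} {s : ℝ} [Fact (3 / 2 < s)] {j : ℕ} {f G : ι → ℝ → ℝ}
    {φ : ι → ℝ} (h : HO s j f 1) (h' : MO s j G φ) : HO s j (fun i x => f i x * G i x) φ := by
  simpa using h.mul_bounded h'

theorem HO.pow {ι : Type*} {s : ℝ} [Fact (3 / 2 < s)] {j : ℕ} {f : ι → ℝ → ℝ}
    (h : HO s j f 1) (n : ℕ) : HO s j (fun i x => f i x ^ (n + 1)) 1 := by
  induction n with
  | zero => simpa using h
  | succ n ih => exact (ih.mul_one_left h).congr fun i x => by ring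

namespace Ctx

variable {s : ℝ} [hs : Fact (3 / 2 < s)] {κ : Bounds}

theorem t_nonneg (i : Ctx s κ) : 0 ≤ i.t := i.ht.1

/-- `min(t, k)` -/
def q (i : Ctx s κ) : ℝ := min i.t i.k

theorem k_pos (i : Ctx s κ) : 0 < i.k := zero_lt_one.trans_le i.hk

theorem so_one_k : SO (1 : Ctx s κ → ℝ) k := ⟨1, one_pos, fun i => by simpa using i.hk⟩

theorem so_k : SO (k : Ctx s κ → ℝ) k := SO.refl fun i => i.k_pos.le

theorem q_nonneg (i : Ctx s κ) : 0 ≤ i.q := le_min i.t_nonneg i.k_pos.le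

theorem so_q_k : SO (q : Ctx s κ → ℝ) k := ⟨1, one_pos, fun i => by
  rw [abs_of_nonneg i.q_nonneg, one_mul]; exact min_le_right _ _⟩

theorem abs_shift (i : Ctx s κ) : |i.c * i.t| = i.t := by
  rcases i.hc with h | h <;> simp [h, abs_of_nonneg i.t_nonneg]

theorem ho_plus {j : ℕ} {f : Ctx s κ → ℝ → ℝ} {φ : Ctx s κ → ℝ} (h : HO s j f φ) :
    HO s j (fun i x => f i (x + i.c * i.t)) φ := h.translate fun i => i.c * i.t

theorem ho_minus {j : ℕ} {f : Ctx s κ → ℝ → ℝ} {φ : Ctx s κ → ℝ} (h : HO s j f φ) :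
    HO s j (fun i x => f i (x - i.c * i.t)) φ :=
  (h.translate fun i => -(i.c * i.t)).congr fun i x => by rw [sub_eq_add_neg]

theorem ho_bracket {j : ℕ} {f : Ctx s κ → ℝ → ℝ} (h : HO s (j + 1) f 1) :
    HO s j (fun i x => f i (x + i.c * i.t) - f i (x - i.c * i.t)) q := by
  have h1 := ho_minus (h.translate_sub fun i => 2 * (i.c * i.t))
  have h2 : SO (fun i : Ctx s κ => |2 * (i.c * i.t)| * (1 : Ctx s κ → ℝ) i) (fun i => i.t) :=
    ⟨2, two_pos, fun i => by
      simp only [Pi.one_apply, mul_one, abs_abs]; rw [abs_mul, abs_shift, abs_two]⟩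
  refine HO.inf ((h1.trans h2).congr fun i x => ?_)
    (((ho_plus (h.mono j.le_succ)).sub (ho_minus (h.mono j.le_succ))).trans so_one_k)
  congr 2; ring

theorem mo_window {j : ℕ} {f : Ctx s κ → ℝ → ℝ} {φ ψ : Ctx s κ → ℝ} (hf : HO s j f ψ)
    (hd : HO s j (fun i x => f i (x + i.c * i.t) - f i (x - i.c * i.t)) φ)
    (hsup : ∃ C : ℝ, 0 < C ∧ ∀ i x, |window i.c i.t (f i) x| ≤ C * φ i) :
    MO s j (fun i => window i.c i.t (f i)) φ := by
  have e : ∀ i, deriv (window i.c i.t (f i)) =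
      fun x => f i (x + i.c * i.t) - f i (x - i.c * i.t) := fun i => by
    ext x; exact (hasDerivAt_window (hf.smooth i).continuous _ _ x).deriv
  have hdiff : ∀ i, Differentiable ℝ (window i.c i.t (f i)) := fun i x =>
    (hasDerivAt_window (hf.smooth i).continuous _ _ x).differentiableAt
  have hd' : HO s j (fun i => deriv (window i.c i.t (f i))) φ :=
    hd.congr fun i x => by rw [e]
  refine ⟨fun i => ?_, fun i => ?_, hsup, hd'⟩
  · rw [contDiff_succ_iff_deriv]
    exact ⟨hdiff i, by simp, hd'.smooth i⟩
  · have h0 : 0 ≤ s + j := by linarith [half_lt hs.out j]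
    obtain ⟨C, -, hc⟩ := hf.bound
    obtain ⟨D, -, hD⟩ := hd'.bound
    have hm := memLp_window (hf.smooth i).continuous (ne_top_of_le_ne_top ENNReal.ofReal_ne_top
      ((eLpNorm_le_sobNorm h0 _).trans (hc i))) i.c i.t
    exact sobNorm_ne_top_of_deriv (by rw [sobNorm_zero_eq hm]; exact hm.2.ne) (hdiff i)
      (ne_top_of_le_ne_top ENNReal.ofReal_ne_top (hD i))

/-- A primitive that is bounded by `k` is bounded by `min(t, k)`. -/
theorem window_le_q {j : ℕ} {f : Ctx s κ → ℝ → ℝ} (hf : HO s j f 1)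
    (hsup : ∃ C : ℝ, 0 < C ∧ ∀ i x, |window i.c i.t (f i) x| ≤ C * i.k) :
    ∃ C : ℝ, 0 < C ∧ ∀ i x, |window i.c i.t (f i) x| ≤ C * i.q := by
  obtain ⟨C, hC, hc⟩ := hsup
  obtain ⟨D, hD, hd⟩ := hf.sup
  refine ⟨max C (2 * D), lt_max_of_lt_left hC, fun i x => ?_⟩
  have h1 : |window i.c i.t (f i) x| ≤ 2 * D * i.t := by
    have h := intervalIntegral.norm_integral_le_of_norm_le_const (a := x - i.c * i.t)
      (b := x + i.c * i.t) (f := f i) (C := D) fun y _ => by simpa using hd i y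
    have e : x + i.c * i.t - (x - i.c * i.t) = 2 * (i.c * i.t) := by ring
    rw [e, abs_mul, abs_shift, abs_two, Real.norm_eq_abs] at h
    calc _ ≤ _ := h
      _ = _ := by ring
  rcases le_total i.t i.k with h2 | h2
  · rw [q, min_eq_left h2]
    exact h1.trans (mul_le_mul_of_nonneg_right (le_max_right _ _) i.t_nonneg)
  · rw [q, min_eq_right h2]
    exact (hc i x).trans (mul_le_mul_of_nonneg_right (le_max_left _ _) i.k_pos.le)

end Ctx

/-! ### Size of the corrector -/

/-- The entries are `O(φ)`, and the integrals `O(χ)` as multipliers. -/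
structure AtomsHO {ι : Type*} (s : ℝ) (j : ℕ) (A : ι → ℝ → Atoms) (φ χ : ι → ℝ) : Prop where
  a0 : HO s j (fun i x => (A i x).a0) φ
  a1 : HO s j (fun i x => (A i x).a1) φ
  a2 : HO s j (fun i x => (A i x).a2) φ
  a3 : HO s j (fun i x => (A i x).a3) φ
  b0 : HO s j (fun i x => (A i x).b0) φ
  b1 : HO s j (fun i x => (A i x).b1) φ
  b2 : HO s j (fun i x => (A i x).b2) φ
  B0 : HO s j (fun i x => (A i x).B0) φ
  B1 : HO s j (fun i x => (A i x).B1) φ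
  B2 : HO s j (fun i x => (A i x).B2) φ
  J1 : MO s j (fun i x => (A i x).J1) χ
  J2 : MO s j (fun i x => (A i x).J2) χ
  J3 : MO s j (fun i x => (A i x).J3) χ

theorem MO.trans {ι : Type*} {s : ℝ} {j : ℕ} {G : ι → ℝ → ℝ} {φ ψ : ι → ℝ} (h : MO s j G φ)
    (h' : SO φ ψ) : MO s j G ψ := by
  refine ⟨h.smooth, h.mem, ?_, h.deriv.trans h'⟩
  obtain ⟨C, hC, hc⟩ := h.sup
  obtain ⟨D, hD, hd⟩ := h'
  refine ⟨C * D, by positivity, fun i x => (hc i x).trans ?_⟩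
  rw [mul_assoc]
  exact mul_le_mul_of_nonneg_left ((le_abs_self _).trans (hd i)) hC.le

namespace Ctx

variable {s : ℝ} [hs : Fact (3 / 2 < s)] {κ : Bounds}

theorem so_mu_nu : SO (fun i : Ctx s κ => i.p.mu * i.p.nu) m := so_mu_m.mul_one_right so_nu
theorem so_eps_alpha2 : SO (fun i : Ctx s κ => i.p.eps ^ 2 * i.p.alpha2) m :=
  so_eps_sq.mul_one_right so_alpha2
theorem so_eps_alpha3 : SO (fun i : Ctx s κ => i.p.eps ^ 3 * i.p.alpha3) m :=
  so_eps_cube.mul_one_right so_alpha3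
theorem so_kap12 : SO (fun i : Ctx s κ => i.p.kap1 + i.p.kap2 / 2) 1 := by
  have := (so_kap1 (s := s) (κ := κ)).add (so_kap2.mul_one_right (SO.const (1 / 2)))
  exact this.congr fun i => by ring

theorem ho_corrPoly {j : ℕ} {φ : Ctx s κ → ℝ} {A : Ctx s κ → ℝ → Atoms} (h : AtomsHO s j A 1 φ)
    (h0 : HO s j (fun i x => (A i x).b0 - (A i x).B0) φ)
    (h1 : HO s j (fun i x => (A i x).b1 - (A i x).B1) φ)
    (h2 : HO s j (fun i x => (A i x).b2 - (A i x).B2) φ) :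
    HO s j (fun i x => corrPoly i.p (A i x)) (m * φ) := by
  have h00 := HO.mul_sub_mul h.B0 h.b0 h0 h0
  have h02 := HO.mul_sub_mul h.B0 h.b2 h0 h2
  have h11 := HO.mul_sub_mul h.B1 h.b1 h1 h1
  have h000 := HO.mul_sub_mul h.B0 (h.b0.mul_one_left h.b0) h0 h00
  have h0000 := HO.mul_sub_mul h.B0 (h.b0.mul_one_left (h.b0.mul_one_left h.b0)) h0 h000
  unfold corrPoly
  refine HO.const_mul _ (HO.add (HO.add (HO.add (HO.add (HO.smul so_eps_alpha1 ?_)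
    (HO.smul so_eps_alpha2 ?_)) (HO.smul so_eps_alpha3 ?_)) (HO.smul so_mu_eps ?_))
    (HO.smul so_mu_nu ?_))
  all_goals
    repeat' first
      | exact h.a0 | exact h.a1 | exact h.a2 | exact h.a3
      | exact h0 | exact h1 | exact h2 | exact h00 | exact h02 | exact h11 | exact h000
      | exact h0000 | apply HO.const_mul | apply HO.one_smul so_kap3 | apply HO.one_smul so_kap2
      | apply HO.one_smul so_kap1 | apply HO.one_smul so_kap12
      | refine HO.mul_bounded_one ?_ h.J1 | refine HO.mul_bounded_one ?_ h.J2
      | refine HO.mul_bounded_one ?_ h.J3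
      | apply HO.sub | apply HO.add | apply HO.mul_one_left

theorem ho_corrPolyD {j : ℕ} {ψ : Ctx s κ → ℝ} {A d : Ctx s κ → ℝ → Atoms}
    (hψ : ∀ i, 0 ≤ ψ i) (h : AtomsHO s j A 1 k) (h' : AtomsHO s j d ψ ψ) :
    HO s j (fun i x => corrPolyD i.p (A i x) (d i x)) (m * (ψ * k)) := by
  have hψk : SO ψ (ψ * k) := by
    have := (SO.refl hψ).mul (so_one_k (s := s) (κ := κ))
    exact this.congr fun i => by simp
  have one : ∀ {f : Ctx s κ → ℝ → ℝ}, HO s j f ψ → HO s j f (ψ * k) := fun h => h.trans hψk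
  have hb : ∀ {f g : Ctx s κ → ℝ → ℝ}, HO s j f ψ → MO s j g k →
      HO s j (fun i x => f i x * g i x) (ψ * k) := fun h1 h2 => h1.mul_bounded h2
  unfold corrPolyD
  refine HO.const_mul _ (HO.add (HO.add (HO.add (HO.add (HO.smul so_eps_alpha1 ?_)
    (HO.smul so_eps_alpha2 ?_)) (HO.smul so_eps_alpha3 ?_)) (HO.smul so_mu_eps ?_))
    (HO.smul so_mu_nu ?_))
  all_goals
    repeat' first
      | exact h'.a0 | exact h'.a1 | exact h'.a2 | exact h'.a3
      | exact h'.b0 | exact h'.b1 | exact h'.b2 | exact h'.B0 | exact h'.B1 | exact h'.B2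
      | exact h.a0 | exact h.a1 | exact h.a2 | exact h.a3
      | exact h.b0 | exact h.b1 | exact h.b2 | exact h.B0 | exact h.B1 | exact h.B2
      | refine hb ?_ h.J1 | refine hb ?_ h.J2 | refine hb ?_ h.J3
      | apply HO.const_mul | apply HO.one_smul so_kap3 | apply HO.one_smul so_kap2
      | apply HO.one_smul so_kap1 | apply HO.one_smul so_kap12
      | apply HO.sub | apply HO.add
      | refine one ?_
      | refine HO.mul_bounded_one ?_ h'.J1 | refine HO.mul_bounded_one ?_ h'.J2
      | refine HO.mul_bounded_one ?_ h'.J3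
      | refine HO.mul_one_right h'.a0 ?_ | refine HO.mul_one_right h'.a1 ?_
      | refine HO.mul_one_right h'.a2 ?_ | refine HO.mul_one_right h'.a3 ?_
      | refine HO.mul_one_right h'.b0 ?_ | refine HO.mul_one_right h'.B0 ?_
      | refine HO.mul_one_right (HO.mul_one_left h.a0 h'.a0) ?_
      | refine HO.mul_one_right (HO.mul_one_left (HO.mul_one_left h.a0 h.a0) h'.a0) ?_
      | apply HO.mul_one_left

/-- The entries of the corrector. -/
def At (i : Ctx s κ) (x : ℝ) : Atoms := atoms i.c i.t (i.a i.t) (i.b i.t) x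

/-- The derivatives in time of the entries, in the moving frames. -/
def AtT (i : Ctx s κ) (x : ℝ) : Atoms where
  a0 := E 0 i (x - i.c * i.t)
  a1 := E 1 i (x - i.c * i.t)
  a2 := E 2 i (x - i.c * i.t)
  a3 := E 3 i (x - i.c * i.t)
  b0 := E 0 i.swap (x + i.c * i.t)
  b1 := E 1 i.swap (x + i.c * i.t)
  b2 := E 2 i.swap (x + i.c * i.t)
  B0 := E 0 i.swap (x - i.c * i.t)
  B1 := E 1 i.swap (x - i.c * i.t)
  B2 := E 2 i.swap (x - i.c * i.t)
  J1 := window i.c i.t (E 0 i.swap) x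
  J2 := window i.c i.t (fun y => 2 * (D 0 i.swap y * E 0 i.swap y)) x
  J3 := window i.c i.t (fun y => 3 * (D 0 i.swap y ^ 2 * E 0 i.swap y)) x

theorem ho_D_swap {j k : ℕ} (h : j + k ≤ 6) : HO s j (fun i : Ctx s κ => D k i.swap) 1 :=
  (ho_D h).comp swap

theorem ho_E_swap {j k : ℕ} (h : j + k ≤ 5) : HO s j (fun i : Ctx s κ => E k i.swap) 1 :=
  (ho_E h).comp swap

theorem ho_E_m_swap {j k : ℕ} (h : j + k ≤ 3) : HO s j (fun i : Ctx s κ => E k i.swap) m :=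
  (ho_E_m' h).comp swap

theorem window_D_pow_le (n : ℕ) : ∃ C : ℝ, 0 < C ∧ ∀ (i : Ctx s κ) x,
    |window i.c i.t (fun y => D 0 i.swap y ^ (n + 1)) x| ≤ C * i.k := by
  cases n with
  | zero =>
    refine ⟨κ.M, κ.hM, fun i x => ?_⟩
    have h := i.prim_b (x - i.c * i.t) (x + i.c * i.t) (by
      have e : x + i.c * i.t - (x - i.c * i.t) = 2 * (i.c * i.t) := by ring
      rw [e, abs_mul, abs_shift, abs_two])
    simpa [window, D, swap] using h
  | succ n =>
    have h0 := ho_D_swap (s := s) (κ := κ) (j := 0) (k := 0) (by norm_num)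
    obtain ⟨C, hC, hc⟩ := (h0.pow n).abs_integral_mul_le h0
    refine ⟨C, hC, fun i x => ?_⟩
    have h1 := hc i (x - i.c * i.t) (x + i.c * i.t)
    have h2 : C * ((1 : Ctx s κ → ℝ) * 1) i ≤ C * i.k := by
      simpa using mul_le_mul_of_nonneg_left i.hk hC.le
    refine le_trans (le_of_eq ?_) (h1.trans h2)
    simp only [window, pow_succ]

theorem window_E_le (n : ℕ) : ∃ C : ℝ, 0 < C ∧ ∀ (i : Ctx s κ) x,
    |window i.c i.t (fun y => (n + 1) * (D 0 i.swap y ^ n * E 0 i.swap y)) x| ≤ C * i.m := by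
  cases n with
  | zero =>
    obtain ⟨C, hC, hc⟩ := abs_integral_E_le (s := s) (κ := κ)
    refine ⟨C, hC, fun i x => ?_⟩
    have h := hc i.swap (x - i.c * i.t) (x + i.c * i.t)
    have e : i.swap.m = i.m := rfl
    rw [e] at h
    simpa [window] using h
  | succ n =>
    have h0 := ho_D_swap (s := s) (κ := κ) (j := 0) (k := 0) (by norm_num)
    have h1 := ho_E_m_swap (s := s) (κ := κ) (j := 0) (k := 0) (by norm_num)
    obtain ⟨C, hC, hc⟩ := ((h0.pow n).const_mul ((n : ℝ) + 1 + 1)).abs_integral_mul_le h1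
    refine ⟨C, hC, fun i x => ?_⟩
    have h1 := hc i (x - i.c * i.t) (x + i.c * i.t)
    simp only [Pi.mul_apply, Pi.one_apply, one_mul] at h1
    refine le_trans (le_of_eq ?_) h1
    simp only [window, mul_assoc]
    push_cast
    rfl

theorem mo_J (n : ℕ) {j : ℕ} (hj : j ≤ 5) :
    MO s j (fun i : Ctx s κ => window i.c i.t (fun y => D 0 i.swap y ^ (n + 1))) q := by
  have h0 := (ho_D_swap (s := s) (κ := κ) (j := j + 1) (k := 0) (by omega)).pow n
  exact mo_window (h0.mono j.le_succ) (ho_bracket h0)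
    (window_le_q (h0.mono j.le_succ) (window_D_pow_le n))

theorem ho_DE (n : ℕ) {j : ℕ} {φ : Ctx s κ → ℝ} (hj : j ≤ 6)
    (hE : HO s j (fun i : Ctx s κ => E 0 i.swap) φ) :
    HO s j (fun (i : Ctx s κ) y => (n + 1) * (D 0 i.swap y ^ n * E 0 i.swap y)) φ := by
  have h0 := (ho_D_swap (s := s) (κ := κ) (j := j) (k := 0) (by omega))
  cases n with
  | zero => simpa using hE
  | succ n => exact ((h0.pow n).mul_one_left hE).const_mul _

theorem mo_Jt (n : ℕ) {j : ℕ} {φ : Ctx s κ → ℝ} (hj : j ≤ 6) (hφ : SO m φ)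
    (hE : HO s j (fun i : Ctx s κ => E 0 i.swap) φ) :
    MO s j (fun i : Ctx s κ => window i.c i.t
      (fun y => (n + 1) * (D 0 i.swap y ^ n * E 0 i.swap y))) φ := by
  have h0 := ho_DE n hj hE
  refine mo_window h0 ((ho_plus h0).sub (ho_minus h0)) ?_
  obtain ⟨C, hC, hc⟩ := window_E_le (s := s) (κ := κ) n
  obtain ⟨D, hD, hd⟩ := hφ
  refine ⟨C * D, by positivity, fun i x => (hc i x).trans ?_⟩
  rw [mul_assoc]
  exact mul_le_mul_of_nonneg_left ((le_abs_self _).trans (hd i)) hC.le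

theorem atomsHO_At : AtomsHO s 3 (At : Ctx s κ → ℝ → Atoms) 1 q := by
  have hD : ∀ k ≤ 3, HO s 3 (D k : Ctx s κ → ℝ → ℝ) 1 := fun k hk => ho_D (by omega)
  have hD' : ∀ k ≤ 3, HO s 3 (fun i : Ctx s κ => D k i.swap) 1 := fun k hk => ho_D_swap (by omega)
  have hJ : ∀ n, MO s 3 (fun i : Ctx s κ => window i.c i.t (fun y => i.b i.t y ^ (n + 1))) q :=
    fun n => by
      have := mo_J (s := s) (κ := κ) n (j := 3) (by norm_num)
      simpa only [D, swap, iteratedDeriv_zero] using this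
  exact ⟨ho_minus (hD 0 (by norm_num)), ho_minus (hD 1 (by norm_num)), ho_minus (hD 2 (by norm_num)),
    ho_minus (hD 3 (by norm_num)), ho_plus (hD' 0 (by norm_num)), ho_plus (hD' 1 (by norm_num)),
    ho_plus (hD' 2 (by norm_num)), ho_minus (hD' 0 (by norm_num)), ho_minus (hD' 1 (by norm_num)),
    ho_minus (hD' 2 (by norm_num)), hJ 0, hJ 1, hJ 2⟩

theorem AtomsHO.mono {ι : Type*} {j l : ℕ} {A : ι → ℝ → Atoms} {φ χ χ' : ι → ℝ}
    (h : AtomsHO s j A φ χ) (hl : l ≤ j) (hχ : SO χ χ') : AtomsHO s l A φ χ' := by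
  have hm : ∀ {G : ι → ℝ → ℝ}, MO s j G χ → MO s l G χ' := fun h =>
    MO.trans ⟨fun i => (h.smooth i).of_le (by exact_mod_cast Nat.succ_le_succ hl),
      fun i => ne_top_of_le_ne_top (h.mem i) (sobNorm_mono (by gcongr) _), h.sup,
      h.deriv.mono hl⟩ hχ
  exact ⟨h.a0.mono hl, h.a1.mono hl, h.a2.mono hl, h.a3.mono hl, h.b0.mono hl, h.b1.mono hl,
    h.b2.mono hl, h.B0.mono hl, h.B1.mono hl, h.B2.mono hl, hm h.J1, hm h.J2, hm h.J3⟩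

theorem atomsHO_AtT {j : ℕ} {φ : Ctx s κ → ℝ} (hj : j ≤ 2) (hφ : SO m φ)
    (hE : ∀ k ≤ 3, HO s j (E k : Ctx s κ → ℝ → ℝ) φ)
    (hE' : ∀ k ≤ 3, HO s j (fun i : Ctx s κ => E k i.swap) φ) :
    AtomsHO s j (AtT : Ctx s κ → ℝ → Atoms) φ φ := by
  have hJ := fun n => mo_Jt (s := s) (κ := κ) n (j := j) (by omega) hφ (hE' 0 (by norm_num))
  refine ⟨ho_minus (hE 0 (by norm_num)), ho_minus (hE 1 (by norm_num)),
    ho_minus (hE 2 (by norm_num)), ho_minus (hE 3 (by norm_num)), ho_plus (hE' 0 (by norm_num)),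
    ho_plus (hE' 1 (by norm_num)), ho_plus (hE' 2 (by norm_num)), ho_minus (hE' 0 (by norm_num)),
    ho_minus (hE' 1 (by norm_num)), ho_minus (hE' 2 (by norm_num)), ?_, ?_, ?_⟩
  · have := hJ 0; norm_num at this; exact this
  · have := hJ 1; norm_num at this; exact this
  · have := hJ 2; norm_num at this; exact this

/-- The corrector along the flow. -/
def W (i : Ctx s κ) (x : ℝ) : ℝ := corr i.p i.c (i.a i.t) (i.b i.t) i.t x

/-- The derivative of the corrector with respect to the time at which the profiles are frozen. -/
def Wτ (i : Ctx s κ) (x : ℝ) : ℝ := corrPolyD i.p (At i x) (AtT i x)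

theorem ho_W : HO s 3 (W : Ctx s κ → ℝ → ℝ) (m * q) := by
  refine ho_corrPoly (A := At) atomsHO_At ?_ ?_ ?_
  · exact ho_bracket (f := fun i => D 0 i.swap) (ho_D_swap (by norm_num))
  · exact ho_bracket (f := fun i => D 1 i.swap) (ho_D_swap (by norm_num))
  · exact ho_bracket (f := fun i => D 2 i.swap) (ho_D_swap (by norm_num))

theorem ho_Wτ_two : HO s 2 (Wτ : Ctx s κ → ℝ → ℝ) (m * k) := by
  have h := ho_corrPolyD (ψ := (1 : Ctx s κ → ℝ)) (fun _ => zero_le_one)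
    (AtomsHO.mono (atomsHO_At (s := s) (κ := κ)) (by norm_num : 2 ≤ 3) so_q_k)
    (atomsHO_AtT le_rfl so_m_one (fun k hk => ho_E (by omega)) fun k hk => ho_E_swap (by omega))
  rw [one_mul] at h
  exact h

theorem ho_Wτ_zero : HO s 0 (Wτ : Ctx s κ → ℝ → ℝ) (m * (m * k)) :=
  ho_corrPolyD m_nonneg
    (AtomsHO.mono (atomsHO_At (s := s) (κ := κ)) (by norm_num : 0 ≤ 3) so_q_k)
    (atomsHO_AtT (by norm_num) so_m (fun k hk => ho_E_m' (by omega))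
      fun k hk => ho_E_m_swap (by omega))

end Ctx

/-! ### Pairs of close functions -/

/-- `g` is bounded and `f` is `φ`-close to it. -/
structure Near {ι : Type*} (s : ℝ) (j : ℕ) (f g : ι → ℝ → ℝ) (φ : ι → ℝ) : Prop where
  right : HO s j g 1
  sub : HO s j (fun i x => f i x - g i x) φ

/-- `f` and `g` are bounded and `φ`-close. -/
structure Close {ι : Type*} (s : ℝ) (j : ℕ) (f g : ι → ℝ → ℝ) (φ : ι → ℝ) : Prop
    extends Near s j f g φ where
  left : HO s j f 1

section Pairs

variable {ι : Type*} {s : ℝ} [Fact (3 / 2 < s)] {j : ℕ} {f g u w : ι → ℝ → ℝ} {c φ ψ : ι → ℝ}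

namespace Near

theorem add (h : Near s j f g φ) (h' : Near s j u w φ) :
    Near s j (fun i x => f i x + u i x) (fun i x => g i x + w i x) φ :=
  ⟨h.right.add h'.right, (h.sub.add h'.sub).congr fun i x => by ring⟩

theorem sub' (h : Near s j f g φ) (h' : Near s j u w φ) :
    Near s j (fun i x => f i x - u i x) (fun i x => g i x - w i x) φ :=
  ⟨h.right.sub h'.right, (h.sub.sub h'.sub).congr fun i x => by ring⟩

theorem one_smul (hc : SO c 1) (h : Near s j f g φ) :
    Near s j (fun i x => c i * f i x) (fun i x => c i * g i x) φ :=
  ⟨HO.one_smul hc h.right, (HO.one_smul hc h.sub).congr fun i x => by ring⟩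

theorem const_mul (a : ℝ) (h : Near s j f g φ) :
    Near s j (fun i x => a * f i x) (fun i x => a * g i x) φ := h.one_smul (SO.const a)

theorem mul_close (h : Near s j f g φ) (h' : Close s j u w φ) :
    Near s j (fun i x => f i x * u i x) (fun i x => g i x * w i x) φ :=
  ⟨h.right.mul_one_left h'.right, HO.mul_sub_mul h.right h'.left h.sub h'.sub⟩

theorem close_mul (h' : Close s j u w φ) (h : Near s j f g φ) :
    Near s j (fun i x => u i x * f i x) (fun i x => w i x * g i x) φ := by
  simpa only [mul_comm] using h.mul_close h'

theorem smul (hc : SO c ψ) (h : Near s j f g φ) :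
    HO s j (fun i x => c i * f i x - c i * g i x) (ψ * φ) :=
  (HO.smul hc h.sub).congr fun i x => by ring

end Near

namespace Close

theorem add (h : Close s j f g φ) (h' : Close s j u w φ) :
    Close s j (fun i x => f i x + u i x) (fun i x => g i x + w i x) φ :=
  ⟨h.toNear.add h'.toNear, h.left.add h'.left⟩

theorem sub' (h : Close s j f g φ) (h' : Close s j u w φ) :
    Close s j (fun i x => f i x - u i x) (fun i x => g i x - w i x) φ :=
  ⟨h.toNear.sub' h'.toNear, h.left.sub h'.left⟩

theorem const_mul (a : ℝ) (h : Close s j f g φ) :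
    Close s j (fun i x => a * f i x) (fun i x => a * g i x) φ :=
  ⟨h.toNear.const_mul a, h.left.const_mul a⟩

theorem mul (h : Close s j f g φ) (h' : Close s j u w φ) :
    Close s j (fun i x => f i x * u i x) (fun i x => g i x * w i x) φ :=
  ⟨h.toNear.mul_close h', h.left.mul_one_left h'.left⟩

theorem pow_two (h : Close s j f g φ) :
    Close s j (fun i x => f i x ^ 2) (fun i x => g i x ^ 2) φ := by
  simpa only [sq] using h.mul h

end Close

end Pairs

namespace Ctx

variable {s : ℝ} [hs : Fact (3 / 2 < s)] {κ : Bounds}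

theorem swap_swap (i : Ctx s κ) : i.swap.swap = i := by
  cases i; simp [swap]

section Polynomials

variable {ι : Type*} {e : ι → Ctx s κ} {j : ℕ} {φ : ι → ℝ}

theorem spoly_sub {l0 l1 l2 l3 r0 r1 r2 r3 L0 L1 L2 L3 R0 R1 R2 R3 : ι → ℝ → ℝ}
    (hl0 : Close s j l0 L0 φ) (hl1 : Close s j l1 L1 φ) (hl2 : Close s j l2 L2 φ)
    (hl3 : Close s j l3 L3 φ) (hr0 : Close s j r0 R0 φ) (hr1 : Close s j r1 R1 φ)
    (hr2 : Close s j r2 R2 φ) (hr3 : Close s j r3 R3 φ) :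
    HO s j (fun i x => Spoly (e i).p (l0 i x) (l1 i x) (l2 i x) (l3 i x) (r0 i x) (r1 i x) (r2 i x)
        (r3 i x) - Spoly (e i).p (L0 i x) (L1 i x) (L2 i x) (L3 i x) (R0 i x) (R1 i x) (R2 i x)
        (R3 i x)) ((fun i => m (e i)) * φ) := by
  have t1 := (((hl1.add (hr1.const_mul (1 / 3))).mul (hl0.sub' hr0)).add
    ((hl0.add (hr0.const_mul (1 / 3))).mul (hl1.sub' hr1))).toNear.const_mul (1 / 2)
  have t2 := (((((hl1.sub' hr1).mul hl0).mul (hl0.add hr0)).add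
    (((hl0.sub' hr0).mul hl1).mul (hl0.add hr0))).add
    (((hl0.sub' hr0).mul hl0).mul (hl1.add hr1))).toNear.const_mul (1 / 3)
  have t3 := (((((hl1.sub' (hr1.const_mul (1 / 5))).mul (hl0.sub' hr0)).mul
    (hl0.add hr0).pow_two).add
    (((hl0.sub' (hr0.const_mul (1 / 5))).mul (hl1.sub' hr1)).mul (hl0.add hr0).pow_two)).add
    (((hl0.sub' (hr0.const_mul (1 / 5))).mul (hl0.sub' hr0)).mul
      (((hl0.add hr0).const_mul 2).mul (hl1.add hr1)))).toNear.const_mul (1 / 4)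
  have t4 := ((((hl0.sub' hr0).const_mul (1 / 3)).mul (hl3.sub' hr3)).add
    (((hl1.sub' hr1).const_mul (4 / 3)).mul (hl2.sub' hr2))).toNear.one_smul (so_kap3.comp e)
  refine ((((t1.smul ((so_eps_alpha1 (s := s) (κ := κ)).comp e)).add
    (t2.smul (so_eps_alpha2.comp e))).add (t3.smul (so_eps_alpha3.comp e))).add
    (t4.smul (so_mu_eps.comp e))).congr fun i x => ?_
  simp only [Spoly]
  ring

theorem dpoly_sub {l0 l1 l2 r0 r1 r2 L0 L1 L2 R0 R1 R2 m0 m1 m2 q0 q1 q2 M0 M1 M2 Q0 Q1 Q2 :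
      ι → ℝ → ℝ}
    (hl0 : Close s j l0 L0 φ) (hl1 : Close s j l1 L1 φ) (hl2 : Close s j l2 L2 φ)
    (hr0 : Close s j r0 R0 φ) (hr1 : Close s j r1 R1 φ) (hr2 : Close s j r2 R2 φ)
    (hm0 : Near s j m0 M0 φ) (hm1 : Near s j m1 M1 φ) (hm2 : Near s j m2 M2 φ)
    (hq0 : Near s j q0 Q0 φ) (hq1 : Near s j q1 Q1 φ) (hq2 : Near s j q2 Q2 φ) :
    HO s j (fun i x => Dpoly (e i).p (l0 i x) (l1 i x) (l2 i x) (r0 i x) (r1 i x) (r2 i x) (m0 i x)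
        (m1 i x) (m2 i x) (q0 i x) (q1 i x) (q2 i x)
      - Dpoly (e i).p (L0 i x) (L1 i x) (L2 i x) (R0 i x) (R1 i x) (R2 i x) (M0 i x)
        (M1 i x) (M2 i x) (Q0 i x) (Q1 i x) (Q2 i x)) ((fun i => m (e i)) * φ) := by
  have t1 := (hm2.sub' hq2).smul ((so_mu_nu (s := s) (κ := κ)).comp e)
  have t2 := (((hm0.mul_close hl2).add (Near.close_mul hl0 hm2)).sub'
    ((hq0.mul_close hr2).add (Near.close_mul hr0 hq2))).one_smul
    ((so_kap1 (s := s) (κ := κ)).comp e)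
  have t3 := (((hq0.mul_close hl2).add (Near.close_mul hr0 hm2)).sub'
    ((hm0.mul_close hr2).add (Near.close_mul hl0 hq2))).one_smul
    ((so_kap2 (s := s) (κ := κ)).comp e)
  have t4 := ((Near.close_mul (hl1.const_mul 2) hm1).sub'
    (Near.close_mul (hr1.const_mul 2) hq1)).one_smul ((so_kap12 (s := s) (κ := κ)).comp e)
  refine (t1.neg.sub (((t2.add t3).add t4).smul ((so_mu_eps (s := s) (κ := κ)).comp e))).congr
    fun i x => ?_
  simp only [Dpoly]
  ring

end Polynomials

/-! ### The corrector along the flow -/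

/-- The `k`-th derivative of the transported wave. -/
def Tr (k : ℕ) (i : Ctx s κ) (x : ℝ) : ℝ := D k i (x - i.c * i.t)

/-- The `k`-th derivative of the time derivative of the wave, transported. -/
def TrE (k : ℕ) (i : Ctx s κ) (x : ℝ) : ℝ := E k i (x - i.c * i.t)

theorem Tr_swap (k : ℕ) (i : Ctx s κ) (x : ℝ) : Tr k i.swap x = D k i.swap (x + i.c * i.t) := by
  simp [Tr, swap]

theorem ho_Tr {j k : ℕ} (h : j + k ≤ 6) : HO s j (Tr k : Ctx s κ → ℝ → ℝ) 1 := ho_minus (ho_D h)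

theorem ho_TrE {j k : ℕ} (h : j + k ≤ 5) : HO s j (TrE k : Ctx s κ → ℝ → ℝ) 1 := ho_minus (ho_E h)

theorem ho_TrE_m {j k : ℕ} (h : j + k ≤ 3) : HO s j (TrE k : Ctx s κ → ℝ → ℝ) m :=
  ho_minus (ho_E_m' h)

theorem hasDerivAt_Tr {k : ℕ} (hk : k < 7) (i : Ctx s κ) (x : ℝ) :
    HasDerivAt (Tr k i) (Tr (k + 1) i x) x :=
  (hasDerivAt_D hk i (x - i.c * i.t)).comp_sub_const x (i.c * i.t)

theorem hasDerivAt_TrE {k : ℕ} (hk : k < 6) (i : Ctx s κ) (x : ℝ) :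
    HasDerivAt (TrE k i) (TrE (k + 1) i x) x :=
  (hasDerivAt_E hk i (x - i.c * i.t)).comp_sub_const x (i.c * i.t)

/-- The coupling term that drives the corrector. -/
def drive (i : Ctx s κ) (x : ℝ) : ℝ :=
  gPoly i.p i.c (Tr 0 i x) (Tr 1 i x) (Tr 2 i x) (Tr 3 i x)
    (Tr 0 i.swap x) (Tr 1 i.swap x) (Tr 2 i.swap x) (Tr 3 i.swap x)

/-- The total time derivative of the corrector. -/
def Wd (i : Ctx s κ) (x : ℝ) : ℝ := Wτ i x - i.c * deriv (W i) x - drive i x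

theorem deriv_W (i : Ctx s κ) (x : ℝ) :
    deriv (W i) x = corrPolyD i.p (At i x) (atomsDx i.c i.t (i.a i.t) (i.b i.t) x) :=
  (hasDerivAt_corr_space (i.wa.smooth i.t i.ht) (i.wb.smooth i.t i.ht) i.p i.c i.t x).deriv

theorem td_W (i : Ctx s κ) : TD i.T i.t 2 (fun τ x => corr i.p i.c (i.a τ) (i.b τ) τ x) (Wd i) := by
  have hA : ∀ k ≤ 3, TD i.T i.t 2 (fun τ x => iteratedDeriv k (i.a τ) (x - i.c * τ)) _ := fun k hk =>
    i.wa.isCurve.td_shift_sub i.ht i.c (by omega)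
  have hB : ∀ k ≤ 3, TD i.T i.t 2 (fun τ x => iteratedDeriv k (i.b τ) (x - i.c * τ)) _ := fun k hk =>
    i.wb.isCurve.td_shift_sub i.ht i.c (by omega)
  have hB' : ∀ k ≤ 3, TD i.T i.t 2 (fun τ x => iteratedDeriv k (i.b τ) (x + i.c * τ)) _ := fun k hk =>
    i.wb.isCurve.td_shift i.ht i.c (by omega)
  have hJ : ∀ k, TD i.T i.t 2 (fun τ => window i.c τ (fun y => i.b τ y ^ (k + 1))) _ := fun k =>
    i.wb.isCurve.td_window i.ht i.c k (by norm_num)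
  have h := TD.corrPoly i.ht i.p (A := fun τ x => atoms i.c τ (i.a τ) (i.b τ) x)
    (d := fun x => (At i x).total i.c (D 4 i (x - i.c * i.t)) (D 3 i.swap (x + i.c * i.t))
      (D 3 i.swap (x - i.c * i.t)) (AtT i x)) ⟨hA 0 (by norm_num),
    hA 1 (by norm_num), hA 2 (by norm_num),
    hA 3 (by norm_num), hB' 0 (by norm_num), hB' 1 (by norm_num), hB' 2 (by norm_num),
    hB 0 (by norm_num), hB 1 (by norm_num), hB 2 (by norm_num), (hJ 0).congr_right ?_,
    (hJ 1).congr_right ?_, (hJ 2).congr_right ?_⟩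
  · refine h.congr_right fun x => ?_
    have h1 := corrPolyD_total i.p i.c (D 4 i (x - i.c * i.t)) (D 3 i.swap (x + i.c * i.t))
      (D 3 i.swap (x - i.c * i.t)) (At i x) (AtT i x)
    refine Eq.trans ?_ h1.symm
    rw [Wd, deriv_W, drive]
    simp only [Tr_swap]
    rfl
  all_goals
    intro x
    simp only [At, AtT, atoms, Atoms.total, iteratedDeriv_zero, D, E, swap]
    congr 1
    · congr 1
      ext y
      push_cast
      ring
    · ring

theorem so_m_mk : SO (m : Ctx s κ → ℝ) (m * k) :=
  ((SO.refl m_nonneg).mul so_one_k).congr fun i => by simp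

theorem ho_W_k : HO s 3 (W : Ctx s κ → ℝ → ℝ) (m * k) := ho_W.trans (so_m.mul so_q_k)

theorem ho_drive : HO s 3 (drive : Ctx s κ → ℝ → ℝ) m := by
  have hl : ∀ k ≤ 3, HO s 3 (Tr k : Ctx s κ → ℝ → ℝ) 1 := fun k hk => ho_Tr (by omega)
  have hr : ∀ k ≤ 3, HO s 3 (fun i : Ctx s κ => Tr k i.swap) 1 := fun k hk => (hl k hk).comp swap
  have z : HO s 3 (fun (_ : Ctx s κ) _ => (0 : ℝ)) 1 := HO.zero fun _ => zero_le_one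
  have cl : ∀ {f g : Ctx s κ → ℝ → ℝ}, HO s 3 f 1 → HO s 3 g 1 → Close s 3 f g 1 :=
    fun h h' => ⟨⟨h', h.sub h'⟩, h⟩
  have h0 := hl 0 (by norm_num); have h1 := hl 1 (by norm_num); have h2 := hl 2 (by norm_num)
  have h3 := hl 3 (by norm_num)
  have r0 := hr 0 (by norm_num); have r1 := hr 1 (by norm_num); have r2 := hr 2 (by norm_num)
  have r3 := hr 3 (by norm_num)
  have hc : ∀ {f : Ctx s κ → ℝ → ℝ}, HO s 3 f 1 → HO s 3 (fun i x => i.c * f i x) 1 :=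
    HO.one_smul so_c
  have hc' : ∀ {f : Ctx s κ → ℝ → ℝ}, HO s 3 f 1 → HO s 3 (fun i x => -i.c * f i x) 1 :=
    HO.one_smul so_c.neg
  have S := spoly_sub (e := id) (cl h0 h0) (cl h1 h1) (cl h2 h2) (cl h3 h3) (cl r0 z) (cl r1 z)
    (cl r2 z) (cl r3 z)
  have Dd := dpoly_sub (e := id) (cl h0 h0) (cl h1 h1) (cl h2 h2) (cl r0 z) (cl r1 z) (cl r2 z)
    (cl (hc' h1) (hc' h1)).toNear (cl (hc' h2) (hc' h2)).toNear (cl (hc' h3) (hc' h3)).toNear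
    (cl (hc r1) z).toNear (cl (hc r2) z).toNear (cl (hc r3) z).toNear
  have e1 : ((fun i : Ctx s κ => m (id i)) * 1) = m := by ext i; simp
  rw [e1] at S Dd
  refine ((HO.one_smul so_c S).add Dd).congr fun i x => ?_
  simp only [drive, gPoly, id]
  ring

theorem ho_Wd : HO s 2 (Wd : Ctx s κ → ℝ → ℝ) (m * k) :=
  (ho_Wτ_two.sub (HO.one_smul so_c ho_W_k.deriv)).sub ((ho_drive.mono (by norm_num)).trans so_m_mk)

/-- The `k`-th derivative of the wave with its corrector. -/
def X (k : ℕ) (i : Ctx s κ) (x : ℝ) : ℝ := Tr k i x + iteratedDeriv k (W i) x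

/-- The `k`-th derivative of the time derivative of the wave with its corrector. -/
def Y (k : ℕ) (i : Ctx s κ) (x : ℝ) : ℝ :=
  TrE k i x - i.c * Tr (k + 1) i x + iteratedDeriv k (Wd i) x

/-- What the corrected wave leaves over in the coupled equations. -/
def resid (i : Ctx s κ) (x : ℝ) : ℝ :=
  Y 0 i x + i.c * X 1 i x
    + i.c * Spoly i.p (X 0 i x) (X 1 i x) (X 2 i x) (X 3 i x)
      (X 0 i.swap x) (X 1 i.swap x) (X 2 i.swap x) (X 3 i.swap x)
    + Dpoly i.p (X 0 i x) (X 1 i x) (X 2 i x) (X 0 i.swap x) (X 1 i.swap x) (X 2 i.swap x)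
      (Y 0 i x) (Y 1 i x) (Y 2 i x) (Y 0 i.swap x) (Y 1 i.swap x) (Y 2 i.swap x)

section Total

variable {ι : Type*} {e : ι → Ctx s κ}

theorem ho_X (hW : HO s 3 (fun i => W (e i)) 1) {j k : ℕ} (h : j + k ≤ 3) :
    HO s j (fun i => X k (e i)) 1 :=
  ((ho_Tr (by omega)).comp e).add ((hW.mono h).iteratedDeriv k)

theorem close_X (hW : HO s 3 (fun i => W (e i)) 1) {k' : ℕ} (h : k' ≤ 3) :
    Close s 0 (fun i => X k' (e i)) (fun i => Tr k' (e i)) (fun i => (m * k : Ctx s κ → ℝ) (e i)) := by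
  refine ⟨⟨(ho_Tr (by omega)).comp e, ?_⟩, ho_X hW (by omega)⟩
  refine (((ho_W_k.mono (by omega : 0 + k' ≤ 3)).iteratedDeriv k').comp e).congr fun i x => ?_
  simp only [X]; ring

theorem near_Y {k' : ℕ} (h : k' ≤ 2) :
    Near s 0 (fun i => Y k' (e i)) (fun i x => -(e i).c * Tr (k' + 1) (e i) x)
      (fun i => (m * k : Ctx s κ → ℝ) (e i)) := by
  refine ⟨HO.one_smul (so_c.neg.comp e) ((ho_Tr (by omega)).comp e), ?_⟩
  have h1 := (ho_TrE_m (s := s) (κ := κ) (j := 0) (k := k') (by omega)).trans so_m_mk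
  have h2 := (ho_Wd (s := s) (κ := κ)).mono (by omega : 0 + k' ≤ 2)
  refine ((h1.add (h2.iteratedDeriv k')).comp e).congr fun i x => ?_
  simp only [Y]; ring

theorem ho_resid (hW : HO s 3 (fun i => W (e i)) 1) (hW' : HO s 3 (fun i => W (e i).swap) 1) :
    HO s 0 (fun i => resid (e i)) (fun i => (m * (m * k) : Ctx s κ → ℝ) (e i)) := by
  have h1 := (ho_minus (ho_wave_residual (s := s) (κ := κ))).trans (so_m.mul so_m_mk)
  have h2 := h1.add ho_Wτ_zero
  have hX := fun (k' : ℕ) (h : k' ≤ 3) => close_X hW h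
  have hX' : ∀ k' ≤ 3, Close s 0 (fun i => X k' (e i).swap) (fun i => Tr k' (e i).swap)
    (fun i => (m * k : Ctx s κ → ℝ) (e i)) := fun k' h => close_X (e := fun i => (e i).swap) hW' h
  have hY := fun (k' : ℕ) (h : k' ≤ 2) => near_Y (e := e) h
  have hY' : ∀ k' ≤ 2, Near s 0 (fun i => Y k' (e i).swap)
      (fun i x => (e i).c * Tr (k' + 1) (e i).swap x) (fun i => (m * k : Ctx s κ → ℝ) (e i)) := fun k' h => by
    have h1 := near_Y (e := fun i => (e i).swap) h
    have e1 : ∀ i, -(e i).swap.c = (e i).c := fun i => by simp [swap]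
    simp only [e1] at h1
    exact h1
  have h3 := spoly_sub (e := e) (hX 0 (by norm_num)) (hX 1 (by norm_num)) (hX 2 (by norm_num))
    (hX 3 (by norm_num)) (hX' 0 (by norm_num)) (hX' 1 (by norm_num)) (hX' 2 (by norm_num))
    (hX' 3 (by norm_num))
  have h4 := dpoly_sub (e := e) (hX 0 (by norm_num)) (hX 1 (by norm_num)) (hX 2 (by norm_num))
    (hX' 0 (by norm_num)) (hX' 1 (by norm_num)) (hX' 2 (by norm_num))
    (hY 0 (by norm_num)) (hY 1 (by norm_num)) (hY 2 (by norm_num))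
    (hY' 0 (by norm_num)) (hY' 1 (by norm_num)) (hY' 2 (by norm_num))
  refine (((h2.comp e).add (HO.one_smul (so_c.comp e) h3)).add h4).congr fun i x => ?_
  have e0 : Y 0 (e i) x + (e i).c * X 1 (e i) x = E 0 (e i) (x - (e i).c * (e i).t)
      + Wτ (e i) x - drive (e i) x := by
    simp only [Y, X, iteratedDeriv_zero, iteratedDeriv_one, Wd, TrE]; ring
  rw [resid, e0, drive, gPoly]
  simp only [Tr]
  ring

end Total

end Ctx

/-! ### Division -/

theorem tendsto_ofReal_geom_mul {K : ℝ≥0∞} (hK : K ≠ ⊤) :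
    Tendsto (fun n : ℕ => ENNReal.ofReal (2 * (1 / 2) ^ n) * K) atTop (𝓝 0) := by
  have h4 : Tendsto (fun n : ℕ => 2 * (1 / 2 : ℝ) ^ n) atTop (𝓝 (2 * 0)) :=
    (tendsto_pow_atTop_nhds_zero_of_lt_one (by norm_num) (by norm_num)).const_mul 2
  have h5 := ENNReal.tendsto_ofReal h4
  rw [mul_zero, ENNReal.ofReal_zero] at h5
  have := ENNReal.Tendsto.mul_const h5 (b := K) (Or.inr hK)
  rwa [zero_mul] at this

theorem geom_tail {y : ℝ} (hy : y ≠ 1) (n : ℕ) :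
    (∑ l ∈ Finset.range n, y ^ (l + 1)) - y * (1 - y)⁻¹ = -(y ^ n * (y * (1 - y)⁻¹)) := by
  have hne : 1 - y ≠ 0 := sub_ne_zero.2 hy.symm
  have h2 := mul_neg_geom_sum y n
  have e : ∑ l ∈ Finset.range n, y ^ (l + 1) = (∑ l ∈ Finset.range n, y ^ l) * y := by
    rw [Finset.sum_mul]; exact Finset.sum_congr rfl fun l _ => pow_succ _ _
  rw [e]
  field_simp
  linear_combination y * h2

/-- The geometric series in `H^r`. -/
theorem sobNorm_geom {r b : ℝ} (hr : 1 / 2 < r) {g : ℝ → ℝ} (hg : Continuous g) (hb : 0 ≤ b)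
    (h : sobNorm r g ≤ ENNReal.ofReal b) (hs : cMul r * b ≤ 1 / 2) (hg2 : ∀ x, |g x| ≤ 1 / 2) :
    sobNorm r (fun x => g x * (1 - g x)⁻¹) ≤ ENNReal.ofReal (2 * b) := by
  have hpow : ∀ l : ℕ, sobNorm r (fun x => g x ^ (l + 1)) ≤ ENNReal.ofReal (b * (1 / 2) ^ l) := by
    intro l
    induction l with
    | zero => simpa using h
    | succ l ih =>
      have h1 := sobNorm_mul_le hr (by positivity) ih h
      simp only [pow_succ _ (l + 1)]
      refine h1.trans (ENNReal.ofReal_le_ofReal ?_)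
      calc cMul r * (b * (1 / 2) ^ l * b) = cMul r * b * (b * (1 / 2) ^ l) := by ring
        _ ≤ 1 / 2 * (b * (1 / 2) ^ l) := by gcongr
        _ = _ := by rw [pow_succ]; ring
  have hsum : ∀ n : ℕ, sobNorm r (fun x => ∑ l ∈ Finset.range n, g x ^ (l + 1)) ≤
      ENNReal.ofReal (2 * b - 2 * b * (1 / 2) ^ n) := by
    intro n
    induction n with
    | zero => simp [sobNorm_zero]
    | succ n ih =>
      simp only [Finset.sum_range_succ]
      refine (sobNorm_add_le _ _ _).trans ((add_le_add ih (hpow n)).trans ?_)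
      have : (1 / 2 : ℝ) ^ n ≤ 1 := pow_le_one₀ (by norm_num) (by norm_num)
      rw [← ENNReal.ofReal_add (by nlinarith) (by positivity), pow_succ]
      refine ENNReal.ofReal_le_ofReal (le_of_eq ?_)
      ring
  have h1g : ∀ x, 1 / 2 ≤ 1 - g x := fun x => by linarith [(abs_le.1 (hg2 x)).2]
  have hinv : ∀ x, |(1 - g x)⁻¹| ≤ 2 := fun x => by
    rw [abs_of_pos (inv_pos.2 (by linarith [h1g x]))]
    exact (inv_anti₀ (by norm_num) (h1g x)).trans (by norm_num)
  have hgm := memLp_of_sobNorm (ne_top_of_le_ne_top ENNReal.ofReal_ne_top h)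
  have hcinv : Continuous (fun x => (1 - g x)⁻¹) :=
    (by fun_prop : Continuous fun x => 1 - g x).inv₀ fun x => by
      have := h1g x
      have : 0 < 1 - g x := by linarith
      exact this.ne'
  have hvm : MemLp (fun x => ((g x * (1 - g x)⁻¹ : ℝ) : ℂ)) 2 := by
    refine MemLp.of_le_mul (c := 2) hgm
      (Complex.continuous_ofReal.comp (hg.mul hcinv)).aestronglyMeasurable (ae_of_all _ fun x => ?_)
    simp only [Complex.norm_real, Real.norm_eq_abs, abs_mul]
    rw [mul_comm]
    exact mul_le_mul_of_nonneg_right (hinv x) (abs_nonneg _)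
  have hum := fun n => memLp_of_sobNorm (ne_top_of_le_ne_top ENNReal.ofReal_ne_top (hsum n))
  rw [sobNorm_eq_sobC]
  refine sobC_le_of_tendsto hum hvm ?_ fun n => ?_
  · have hle : ∀ n : ℕ, eLpNorm (fun x => ((∑ l ∈ Finset.range n, g x ^ (l + 1) : ℝ) : ℂ)
        - ((g x * (1 - g x)⁻¹ : ℝ) : ℂ)) 2 ≤ ENNReal.ofReal (2 * (1 / 2) ^ n) *
        eLpNorm (fun x => (g x : ℂ)) 2 := by
      intro n
      refine eLpNorm_le_mul_eLpNorm_of_ae_le_mul (ae_of_all _ fun x => ?_) 2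
      rw [← Complex.ofReal_sub, Complex.norm_real, Complex.norm_real, Real.norm_eq_abs,
        Real.norm_eq_abs]
      have e := geom_tail (y := g x) (by linarith [h1g x]) n
      rw [e, abs_neg, abs_mul, abs_mul, abs_pow]
      calc |g x| ^ n * (|g x| * |(1 - g x)⁻¹|) ≤ (1 / 2) ^ n * (|g x| * 2) := by
            gcongr
            · exact hg2 x
            · exact hinv x
        _ = _ := by ring
    refine tendsto_of_tendsto_of_tendsto_of_le_of_le tendsto_const_nhds ?_ (fun _ => zero_le) hle
    exact tendsto_ofReal_geom_mul hgm.2.ne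
  · have := hsum n
    rw [sobNorm_eq_sobC] at this
    refine this.trans (ENNReal.ofReal_le_ofReal ?_)
    have : 0 ≤ 2 * b * (1 / 2) ^ n := by positivity
    linarith

/-! ### Families with a time derivative -/

/-- The functions `f i (t i)` are `O(1)` in `H^{s+n}`, with time derivatives that are `O(φ i)`. -/
structure TB {ι : Type*} (s : ℝ) (T : ι → ℝ≥0∞) (t : ι → ℝ) (n : ℕ) (f : ι → ℝ → ℝ → ℝ)
    (φ : ι → ℝ) : Prop where
  value : HO s n (fun i => f i (t i)) 1
  rate : ∃ f' : ι → ℝ → ℝ, HO s n f' φ ∧ ∀ i, TD (T i) (t i) n (f i) (f' i)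

namespace TB

variable {ι : Type*} {s : ℝ} [Fact (3 / 2 < s)] {T : ι → ℝ≥0∞} {t : ι → ℝ} {n : ℕ}
  {f g : ι → ℝ → ℝ → ℝ} {φ c : ι → ℝ}

theorem mono {k : ℕ} (h : TB s T t n f φ) (hk : k ≤ n) : TB s T t k f φ := by
  obtain ⟨f', h1, h2⟩ := h.rate
  exact ⟨h.value.mono hk, f', h1.mono hk, fun i => (h2 i).mono hk⟩

theorem deriv (h : TB s T t (n + 1) f φ) : TB s T t n (fun i τ => _root_.deriv (f i τ)) φ := by
  obtain ⟨f', h1, h2⟩ := h.rate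
  exact ⟨h.value.deriv, _, h1.deriv, fun i => (h2 i).deriv⟩

variable (ht : ∀ i, t i ∈ timeIco (T i))
include ht

theorem add (h : TB s T t n f φ) (h' : TB s T t n g φ) :
    TB s T t n (fun i τ x => f i τ x + g i τ x) φ := by
  obtain ⟨f', h1, h2⟩ := h.rate
  obtain ⟨g', h3, h4⟩ := h'.rate
  exact ⟨h.value.add h'.value, _, h1.add h3, fun i => (h2 i).add (ht i) (h4 i)⟩

theorem mul (h : TB s T t n f φ) (h' : TB s T t n g φ) :
    TB s T t n (fun i τ x => f i τ x * g i τ x) φ := by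
  obtain ⟨f', h1, h2⟩ := h.rate
  obtain ⟨g', h3, h4⟩ := h'.rate
  exact ⟨h.value.mul_one_left h'.value, _, (h1.mul_one_right h'.value).add
    (h.value.mul_one_left h3), fun i => (h2 i).mul (ht i) (h4 i)⟩

theorem smul (hc : SO c 1) (h : TB s T t n f φ) : TB s T t n (fun i τ x => c i * f i τ x) φ := by
  obtain ⟨f', h1, h2⟩ := h.rate
  exact ⟨HO.one_smul hc h.value, _, HO.one_smul hc h1, fun i => (h2 i).const_mul (ht i) (c i)⟩

theorem sub (h : TB s T t n f φ) (h' : TB s T t n g φ) :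
    TB s T t n (fun i τ x => f i τ x - g i τ x) φ := by
  obtain ⟨f', h1, h2⟩ := h.rate
  obtain ⟨g', h3, h4⟩ := h'.rate
  exact ⟨h.value.sub h'.value, _, h1.sub h3, fun i => (h2 i).sub (ht i) (h4 i)⟩

end TB

/-! ### Expansion of the Green–Naghdi operators -/

namespace Params

variable (p : Params)

/-- The expansion parameter of `1 / (h₁ + γ h₂)`. -/
def bet : ℝ := (1 - p.gam) * p.del / (p.gam + p.del)

/-- The first coefficient in the expansion of `h₂ v / (h₁ + γ h₂)`. -/
def coef : ℝ := p.del * (1 + p.del) / (p.gam + p.del)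

/-- `1 / (1 - β ε ζ) - 1` -/
def quot (z : ℝ → ℝ) (x : ℝ) : ℝ := (1 - p.bet * p.eps * z x)⁻¹ - 1

/-- `ζ² u / (1 - β ε ζ)` -/
def quad (z u : ℝ → ℝ) (x : ℝ) : ℝ := z x * z x * u x * (1 + p.quot z x)

/-- The nonlinear part of `h₂ v / (h₁ + γ h₂)`. -/
def nl0 (z0 u0 K0 : ℝ) : ℝ := p.coef * (z0 * u0) + p.eps * (p.coef * p.bet * K0)

/-- The first derivative of `nl0`. -/
def nl1 (z0 z1 u0 u1 K1 : ℝ) : ℝ :=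
  p.coef * (z1 * u0 + z0 * u1) + p.eps * (p.coef * p.bet * K1)

/-- The second derivative of `nl0`. -/
def nl2 (z0 z1 z2 u0 u1 u2 K2 : ℝ) : ℝ :=
  p.coef * (z2 * u0 + 2 * (z1 * u1) + z0 * u2) + p.eps * (p.coef * p.bet * K2)

/-- The terms of order at most one of `Q̄`. -/
def qMain (z0 z1 z2 u0 u1 u2 : ℝ) : ℝ :=
  2 * (p.gam + p.del) * (-p.nu * u2 - p.eps * (p.kap1 * (1 / 2 * (z0 * u2 + u0 * z2))
    + p.kap2 * (1 / 2 * (z0 * u2 - u0 * z2)) + (p.kap1 + p.kap2 / 2) * (z1 * u1)))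

/-- The terms of higher order of `Q̄`. -/
def qRem (z0 z1 u1 u2 w1 w2 K2 : ℝ) : ℝ :=
  -1 / 3 * (z0 * z0 * (p.del * u2 - p.gam * (p.eps * w2)) - 2 * (p.gam * (1 / p.del * (z0 * w2)))
    - p.gam * (p.coef * (p.bet * (1 / p.del * (1 / p.del * K2))))
    + 3 * (z0 * z1 * (p.del * u1 - p.gam * (p.eps * w1)))
    - 3 * (p.gam * (1 / p.del * (z1 * w1)))
    + p.gam * (z0 * z0 * (u2 + p.eps * w2) - 2 * (z0 * w2) + p.coef * (p.bet * K2)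
      + 3 * (z0 * z1 * (u1 + p.eps * w1)) - 3 * (z1 * w1)))

/-- The nonlinear part of the first flux. -/
def fluxRem1 (z0 u0 K0 : ℝ) : ℝ :=
  p.coef * (p.bet * (p.bet * (p.bet * (z0 * (z0 * K0) - p.eps * (z0 * (z0 * (z0 * K0)))))))
    - p.coef * (p.bet * (p.bet * (z0 * (z0 * (z0 * (z0 * u0))))))

/-- The quadratic term of `nl0` and what follows. -/
def nlTail (z0 u0 K0 : ℝ) : ℝ :=
  p.coef * (p.bet * (z0 * z0 * u0 + p.bet * (p.eps * (z0 * K0))))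

/-- The terms of higher order of the second flux without dispersion. -/
def fluxRem2 (z0 u0 K0 : ℝ) : ℝ :=
  p.gam * ((p.gam - 1) * (p.coef * (z0 * u0 * p.nlTail z0 u0 K0)
      + 1 / 2 * (p.eps * (p.nlTail z0 u0 K0 * p.nlTail z0 u0 K0))))
    - p.gam * ((p.del + 1) * (p.coef * (p.bet * (p.bet * (u0 * (z0 * K0))))))

/-- The terms of higher order of `R̄`. -/
def rRem (z0 z1 u0 u1 u2 w0 w1 w2 : ℝ) : ℝ :=
  let p1 := -p.gam * (1 / p.del * w1) + z0 * (p.del * u1 - p.gam * (p.eps * w1))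
  let p2 := w1 - z0 * (u1 + p.eps * w1)
  let p3 := -p.gam * (1 / p.del * (1 / p.del * w2))
    + (2 * (1 / p.del * z0) + p.eps * (z0 * z0)) * (p.del * u2 - p.gam * (p.eps * w2))
    + 3 * ((1 / p.del * z1 + p.eps * (z0 * z1)) * (p.del * u1 - p.gam * (p.eps * w1)))
  let p4 := w2 + (p.eps * (z0 * z0) - 2 * z0) * (u2 + p.eps * w2)
    - 3 * ((z1 - p.eps * (z0 * z1)) * (u1 + p.eps * w1))
  u1 * p1 + 1 / 2 * (p.eps * (p1 * p1)) - p.gam * (u1 * p2 + 1 / 2 * (p.eps * (p2 * p2)))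
    + 1 / 3 * (p.del * (u0 * p3) - p.gam * (w0 * (1 / p.del * u2 + p.eps * p3))
      - p.gam * (u0 * p4 + w0 * (u2 + p.eps * p4)))

variable {p} {z u : ℝ → ℝ} (hδ : 0 < p.del) (hγ : 0 ≤ p.gam) (h1 : ∀ x, 0 < p.h1 z x)
  (h2 : ∀ x, 0 < p.h2 z x)

include hδ hγ in
theorem total_depth (x : ℝ) : p.h1 z x + p.gam * p.h2 z x =
    (p.gam + p.del) / p.del * (1 - p.bet * p.eps * z x) := by
  have : 0 < p.gam + p.del := by linarith
  unfold h1 h2 bet; field_simp; ring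

include hδ hγ h1 h2

theorem one_sub_pos (x : ℝ) : 0 < 1 - p.bet * p.eps * z x := by
  have h3 : 0 < p.h1 z x + p.gam * p.h2 z x := by
    have := h1 x; have := h2 x; positivity
  rw [total_depth hδ hγ] at h3
  have : 0 < (p.gam + p.del) / p.del := by have : 0 < p.gam + p.del := by linarith
                                           positivity
  exact pos_of_mul_pos_right h3 this.le

theorem one_add_quot (x : ℝ) : (1 - p.bet * p.eps * z x) * (1 + p.quot z x) = 1 := by
  have := (one_sub_pos hδ hγ h1 h2 x).ne'
  unfold quot; field_simp; ring

theorem upper_eq (x : ℝ) : p.h2 z x * ((p.gam + p.del) * u x) / (p.h1 z x + p.gam * p.h2 z x) =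
    u x + p.eps * p.nl0 (z x) (u x) (p.quad z u x) := by
  have hc : 0 < p.gam + p.del := by linarith
  have h0 := (one_sub_pos hδ hγ h1 h2 x).ne'
  rw [total_depth hδ hγ, div_eq_iff (by positivity)]
  have hI := one_add_quot hδ hγ h1 h2 x
  unfold nl0 quad
  have hb : p.coef = p.bet + p.del := by unfold coef bet; field_simp; ring
  have e : (1 - p.bet * p.eps * z x) * (u x + p.eps * (p.coef * (z x * u x)
      + p.eps * (p.coef * p.bet * (z x * z x * u x * (1 + p.quot z x))))) =
      u x * (1 + p.del * (p.eps * z x)) := by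
    rw [hb]
    linear_combination p.eps ^ 2 * (p.bet + p.del) * p.bet * z x ^ 2 * u x * hI
  have e2 := congrArg (fun y => (p.gam + p.del) / p.del * y) e

  unfold Params.h2
  field_simp at e2 ⊢
  linear_combination -e2

theorem lower_eq (x : ℝ) : p.h1 z x * ((p.gam + p.del) * u x) / (p.h1 z x + p.gam * p.h2 z x) =
    p.del * u x - p.gam * (p.eps * p.nl0 (z x) (u x) (p.quad z u x)) := by
  have h3 : 0 < p.h1 z x + p.gam * p.h2 z x := by
    have := h1 x; have := h2 x; positivity
  have e := upper_eq (u := u) hδ hγ h1 h2 x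
  rw [div_eq_iff h3.ne'] at e ⊢
  linear_combination -p.gam * e

omit h1 h2 in
theorem coef_identities : 2 / 3 * p.alpha1 = p.coef - 1 ∧ p.alpha2 / 3 = p.coef * (p.bet - 1) ∧
    p.alpha3 / 5 = p.coef * p.bet * (p.bet - 1) := by
  have hc : 0 < p.gam + p.del := by linarith
  unfold alpha1 alpha2 alpha3 coef bet
  refine ⟨?_, ?_, ?_⟩ <;> field_simp <;> ring

theorem flux1_eq (x : ℝ) : p.h1 z x * p.h2 z x / (p.h1 z x + p.gam * p.h2 z x)
      * ((p.gam + p.del) * u x) =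
    u x + 2 / 3 * (p.eps * p.alpha1) * (z x * u x) + p.eps ^ 2 * p.alpha2 / 3 * (z x * z x * u x)
      + p.eps ^ 3 * p.alpha3 / 5 * (z x * z x * z x * u x)
      + p.eps ^ 4 * p.fluxRem1 (z x) (u x) (p.quad z u x) := by
  have e := upper_eq (u := u) hδ hγ h1 h2 x
  have e2 : p.h1 z x * p.h2 z x / (p.h1 z x + p.gam * p.h2 z x) * ((p.gam + p.del) * u x) =
      p.h1 z x * (p.h2 z x * ((p.gam + p.del) * u x) / (p.h1 z x + p.gam * p.h2 z x)) := by ring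
  rw [e2, e]
  obtain ⟨c1, c2, c3⟩ := coef_identities hδ hγ
  have hI := one_add_quot hδ hγ h1 h2 x
  unfold Params.h1 nl0 fluxRem1 quad
  linear_combination -p.eps * z x * u x * c1 - p.eps ^ 2 * z x ^ 2 * u x * c2
    - p.eps ^ 3 * z x ^ 3 * u x * c3
    + p.eps ^ 2 * p.coef * p.bet * z x ^ 2 * u x * (1 - p.eps * z x)
      * (1 + p.bet * p.eps * z x) * hI
end Params

namespace Params

variable {p : Params} {z u : ℝ → ℝ} (hδ : 0 < p.del) (hγ : 0 ≤ p.gam) (h1 : ∀ x, 0 < p.h1 z x)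
  (h2 : ∀ x, 0 < p.h2 z x)

include hδ hγ h1 h2

theorem flux2_eq (x : ℝ) : (p.h1 z x ^ 2 - p.gam * p.h2 z x ^ 2)
      / (p.h1 z x + p.gam * p.h2 z x) ^ 2 * ((p.gam + p.del) * u x) ^ 2 =
    2 * (p.gam + p.del) * (p.alpha1 / 3 * (u x * u x) + p.eps * p.alpha2 / 3 * (z x * u x * u x)
      + p.eps ^ 2 * p.alpha3 * (3 / 10) * (z x * z x * u x * u x))
      + 2 * p.eps ^ 3 * p.fluxRem2 (z x) (u x) (p.quad z u x) := by
  have hc : 0 < p.gam + p.del := by linarith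
  have h3 : 0 < p.h1 z x + p.gam * p.h2 z x := by
    have := h1 x; have := h2 x; positivity
  have e : (p.h1 z x ^ 2 - p.gam * p.h2 z x ^ 2)
      / (p.h1 z x + p.gam * p.h2 z x) ^ 2 * ((p.gam + p.del) * u x) ^ 2 =
      (p.h1 z x * ((p.gam + p.del) * u x) / (p.h1 z x + p.gam * p.h2 z x)) ^ 2
      - p.gam * (p.h2 z x * ((p.gam + p.del) * u x) / (p.h1 z x + p.gam * p.h2 z x)) ^ 2 := by
    field_simp
  rw [e, upper_eq hδ hγ h1 h2, lower_eq hδ hγ h1 h2]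
  have c1 : 2 * (p.gam + p.del) * (p.alpha1 / 3) = p.del ^ 2 - p.gam := by
    unfold alpha1; field_simp
  have c2 : (p.gam + p.del) * (p.alpha2 / 3) = -p.gam * (p.del + 1) * p.coef := by
    unfold alpha2 coef; field_simp; ring
  have c3 : (p.gam + p.del) * (p.alpha3 * (3 / 10)) = -p.gam * (p.del + 1) * p.coef * p.bet
      + 1 / 2 * p.gam * (p.gam - 1) * p.coef ^ 2 := by
    unfold alpha3 coef bet; field_simp; ring
  have hI := one_add_quot hδ hγ h1 h2 x
  have hK : p.quad z u x = z x * z x * u x + p.bet * p.eps * z x * p.quad z u x := by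
    unfold quad; linear_combination z x ^ 2 * u x * hI
  have hn : p.nl0 (z x) (u x) (p.quad z u x) = p.coef * (z x * u x)
      + p.eps * p.nlTail (z x) (u x) (p.quad z u x) := by
    unfold nl0 nlTail; linear_combination p.eps * p.coef * p.bet * hK
  rw [hn]
  have ht : p.nlTail (z x) (u x) (p.quad z u x) = p.coef * p.bet * (z x * z x * u x)
      + p.eps * p.coef * p.bet ^ 2 * (z x * p.quad z u x) := by
    unfold nlTail; ring
  unfold fluxRem2
  linear_combination -u x ^ 2 * c1 - 2 * p.eps * z x * u x ^ 2 * c2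
    - 2 * p.eps ^ 2 * z x ^ 2 * u x ^ 2 * c3
    - 2 * p.gam * p.eps ^ 2 * (p.del + 1) * u x * ht

theorem contDiff_quot {n : ℕ} (hz : ContDiff ℝ n z) : ContDiff ℝ n (p.quot z) :=
  ((contDiff_const.sub (contDiff_const.mul hz)).inv fun x =>
    (one_sub_pos hδ hγ h1 h2 x).ne').sub contDiff_const

theorem contDiff_quad {n : ℕ} (hz : ContDiff ℝ n z) (hu : ContDiff ℝ n u) :
    ContDiff ℝ n (p.quad z u) :=
  ((hz.mul hz).mul hu).mul (contDiff_const.add (contDiff_quot hδ hγ h1 h2 hz))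

section Derivatives

variable (hz : ContDiff ℝ 2 z) (hu : ContDiff ℝ 2 u)

omit hδ hγ h1 h2 in
theorem hasDerivAt_jets {f : ℝ → ℝ} (hf : ContDiff ℝ 2 f) (x : ℝ) :
    HasDerivAt f (deriv f x) x ∧ HasDerivAt (deriv f) (deriv (deriv f) x) x := by
  refine ⟨(hf.differentiable (by norm_num) x).hasDerivAt, ?_⟩
  have h : ContDiff ℝ 1 (deriv f) := by
    have : ContDiff ℝ (1 + 1) f := by simpa [one_add_one_eq_two] using hf
    exact (contDiff_succ_iff_deriv.1 this).2.2
  exact (h.differentiable one_ne_zero x).hasDerivAt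

include hz hu

theorem hasDerivAt_nl (x : ℝ) :
    HasDerivAt (fun x => p.nl0 (z x) (u x) (p.quad z u x))
      (p.nl1 (z x) (deriv z x) (u x) (deriv u x) (deriv (p.quad z u) x)) x ∧
    HasDerivAt (fun x => p.nl1 (z x) (deriv z x) (u x) (deriv u x) (deriv (p.quad z u) x))
      (p.nl2 (z x) (deriv z x) (deriv (deriv z) x) (u x) (deriv u x) (deriv (deriv u) x)
        (deriv (deriv (p.quad z u)) x)) x := by
  obtain ⟨z1, z2⟩ := hasDerivAt_jets hz x
  obtain ⟨u1, u2⟩ := hasDerivAt_jets hu x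
  obtain ⟨k1, k2⟩ := hasDerivAt_jets (contDiff_quad hδ hγ h1 h2 (n := 2) hz hu) x
  constructor
  · exact ((z1.mul u1).const_mul p.coef).add ((k1.const_mul (p.coef * p.bet)).const_mul p.eps)
  · refine ((((z2.mul u1).add (z1.mul u2)).const_mul p.coef).add
      ((k2.const_mul (p.coef * p.bet)).const_mul p.eps)).congr_deriv ?_
    unfold nl2; ring

theorem deriv_upper : deriv (fun w => p.h2 z w * ((p.gam + p.del) * u w)
      / (p.h1 z w + p.gam * p.h2 z w)) = fun x => deriv u x
      + p.eps * p.nl1 (z x) (deriv z x) (u x) (deriv u x) (deriv (p.quad z u) x) := by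
  ext x
  rw [funext (upper_eq (u := u) hδ hγ h1 h2)]
  exact ((hasDerivAt_jets hu x).1.add
    ((hasDerivAt_nl hδ hγ h1 h2 hz hu x).1.const_mul p.eps)).deriv

theorem deriv_lower : deriv (fun w => p.h1 z w * ((p.gam + p.del) * u w)
      / (p.h1 z w + p.gam * p.h2 z w)) = fun x => p.del * deriv u x
      - p.gam * (p.eps * p.nl1 (z x) (deriv z x) (u x) (deriv u x) (deriv (p.quad z u) x)) := by
  ext x
  rw [funext (lower_eq (u := u) hδ hγ h1 h2)]
  exact (((hasDerivAt_jets hu x).1.const_mul p.del).sub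
    (((hasDerivAt_nl hδ hγ h1 h2 hz hu x).1.const_mul p.eps).const_mul p.gam)).deriv

theorem upperTerm_eq (x : ℝ) : p.upperTerm z (fun w => (p.gam + p.del) * u w) x =
    p.h1 z x * (p.h1 z x ^ 2 * (deriv (deriv u) x + p.eps * p.nl2 (z x) (deriv z x)
      (deriv (deriv z) x) (u x) (deriv u x) (deriv (deriv u) x) (deriv (deriv (p.quad z u)) x))
    - 3 * p.h1 z x * (p.eps * deriv z x) * (deriv u x
      + p.eps * p.nl1 (z x) (deriv z x) (u x) (deriv u x) (deriv (p.quad z u) x))) := by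
  unfold upperTerm
  rw [deriv_upper hδ hγ h1 h2 hz hu]
  have hh : HasDerivAt (p.h1 z) (-(p.eps * deriv z x)) x :=
    ((hasDerivAt_jets hz x).1.const_mul p.eps).const_sub 1
  refine (((hh.pow 3).mul ((hasDerivAt_jets hu x).2.add
    ((hasDerivAt_nl hδ hγ h1 h2 hz hu x).2.const_mul p.eps))).congr_deriv ?_).deriv
  simp only [Pi.pow_apply, Pi.add_apply]
  push_cast
  ring

theorem lowerTerm_eq (x : ℝ) : p.lowerTerm z (fun w => (p.gam + p.del) * u w) x =
    p.h2 z x * (p.h2 z x ^ 2 * (p.del * deriv (deriv u) x - p.gam * (p.eps * p.nl2 (z x) (deriv z x)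
      (deriv (deriv z) x) (u x) (deriv u x) (deriv (deriv u) x) (deriv (deriv (p.quad z u)) x)))
    + 3 * p.h2 z x * (p.eps * deriv z x) * (p.del * deriv u x - p.gam
      * (p.eps * p.nl1 (z x) (deriv z x) (u x) (deriv u x) (deriv (p.quad z u) x)))) := by
  unfold lowerTerm
  rw [deriv_lower hδ hγ h1 h2 hz hu]
  have hh : HasDerivAt (p.h2 z) (p.eps * deriv z x) x :=
    ((hasDerivAt_jets hz x).1.const_mul p.eps).const_add (1 / p.del)
  refine (((hh.pow 3).mul (((hasDerivAt_jets hu x).2.const_mul p.del).sub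
    (((hasDerivAt_nl hδ hγ h1 h2 hz hu x).2.const_mul p.eps).const_mul p.gam))).congr_deriv
      ?_).deriv
  simp only [Pi.pow_apply, Pi.sub_apply]
  push_cast
  ring

theorem Qbar_eq (x : ℝ) : p.Qbar z (fun w => (p.gam + p.del) * u w) x =
    p.qMain (z x) (deriv z x) (deriv (deriv z) x) (u x) (deriv u x) (deriv (deriv u) x)
    + p.eps ^ 2 * p.qRem (z x) (deriv z x) (deriv u x) (deriv (deriv u) x)
      (p.nl1 (z x) (deriv z x) (u x) (deriv u x) (deriv (p.quad z u) x))
      (p.nl2 (z x) (deriv z x) (deriv (deriv z) x) (u x) (deriv u x) (deriv (deriv u) x)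
        (deriv (deriv (p.quad z u)) x)) (deriv (deriv (p.quad z u)) x) := by
  have hc : 0 < p.gam + p.del := by linarith
  have a1 := (h1 x).ne'
  have a2 := (h2 x).ne'
  have key : ∀ A B : ℝ, -1 / (3 * p.h1 z x * p.h2 z x) * (p.h1 z x * (p.h2 z x * A)
      + p.gam * p.h2 z x * (p.h1 z x * B)) = -1 / 3 * (A + p.gam * B) := fun A B => by
    field_simp
  rw [Qbar, upperTerm_eq hδ hγ h1 h2 hz hu, lowerTerm_eq hδ hγ h1 h2 hz hu, key]
  have hd : p.del * (1 / p.del) = 1 := by field_simp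
  have c1 : 2 * (p.gam + p.del) * p.nu = 1 / 3 * (1 / p.del + p.gam) := by
    have : p.del + p.gam ≠ 0 := by linarith
    unfold nu; field_simp; ring
  have c2 : (p.gam + p.del) * p.kap2 = (1 - p.gam) / 3 := by
    unfold kap2; field_simp
  have c3 : (p.gam + p.del) * p.kap1 = (1 - p.gam) / 3
      + 1 / 3 * p.gam * p.coef * (1 - (1 / p.del) ^ 2) := by
    unfold kap1 coef; field_simp; ring
  unfold qMain qRem Params.h1 Params.h2
  generalize deriv (deriv (p.quad z u)) x = K2
  generalize deriv (p.quad z u) x = K1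
  generalize deriv (deriv z) x = z2
  generalize deriv (deriv u) x = u2
  generalize deriv u x = u1
  generalize deriv z x = z1
  generalize z x = z0
  generalize u x = u0
  generalize 1 / p.del = d at *
  have hw : p.nl2 z0 z1 z2 u0 u1 u2 K2 = p.coef * (z2 * u0 + 2 * (z1 * u1) + z0 * u2)
    + p.eps * (p.coef * p.bet * K2) := rfl
  generalize p.nl2 z0 z1 z2 u0 u1 u2 K2 = w2 at *
  generalize p.nl1 z0 z1 u0 u1 K1 = w1
  linear_combination -1 / 3 * (d * u2 + 2 * p.eps * z0 * u2 + 3 * p.eps * z1 * u1) * hd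
    + u2 * c1 + p.eps * (z0 * u2 - u0 * z2 + z1 * u1) * c2
    + p.eps * (z0 * u2 + u0 * z2 + 2 * z1 * u1) * c3
    - 1 / 3 * p.gam * p.eps * (1 - d ^ 2) * hw

theorem Rbar_eq (x : ℝ) : p.Rbar z (fun w => (p.gam + p.del) * u w) x =
    (1 - p.gam) * (1 / 2 * (deriv u x * deriv u x) + 1 / 3 * (u x * deriv (deriv u) x))
    + p.eps * p.rRem (z x) (deriv z x) (u x) (deriv u x) (deriv (deriv u) x)
      (p.nl0 (z x) (u x) (p.quad z u x))
      (p.nl1 (z x) (deriv z x) (u x) (deriv u x) (deriv (p.quad z u) x))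
      (p.nl2 (z x) (deriv z x) (deriv (deriv z) x) (u x) (deriv u x) (deriv (deriv u) x)
        (deriv (deriv (p.quad z u)) x)) := by
  have a1 := (h1 x).ne'
  have a2 := (h2 x).ne'
  have h3 : p.h1 z x + p.gam * p.h2 z x ≠ 0 := by
    have := h1 x; have := h2 x; positivity
  have hl := lower_eq (u := u) hδ hγ h1 h2 x
  have hu' := upper_eq (u := u) hδ hγ h1 h2 x
  have key : ∀ A B : ℝ, 1 / 3 * ((p.gam + p.del) * u x / (p.h1 z x + p.gam * p.h2 z x))
      * (p.h1 z x / p.h2 z x * (p.h2 z x * A) - p.gam * (p.h2 z x / p.h1 z x) * (p.h1 z x * B)) =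
      1 / 3 * ((p.h1 z x * ((p.gam + p.del) * u x) / (p.h1 z x + p.gam * p.h2 z x)) * A
        - p.gam * (p.h2 z x * ((p.gam + p.del) * u x) / (p.h1 z x + p.gam * p.h2 z x)) * B) :=
    fun A B => by field_simp
  rw [Rbar, upperTerm_eq hδ hγ h1 h2 hz hu, lowerTerm_eq hδ hγ h1 h2 hz hu, key, hl, hu',
    deriv_upper hδ hγ h1 h2 hz hu, deriv_lower hδ hγ h1 h2 hz hu]
  have hd : p.del * (1 / p.del) = 1 := by field_simp
  unfold rRem Params.h1 Params.h2
  dsimp only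
  generalize deriv (deriv (p.quad z u)) x = K2
  generalize deriv (p.quad z u) x = K1
  generalize deriv (deriv z) x = z2
  generalize deriv (deriv u) x = u2
  generalize deriv u x = u1
  generalize deriv z x = z1
  generalize p.quad z u x = K0
  generalize z x = z0
  generalize u x = u0
  generalize p.nl2 z0 z1 z2 u0 u1 u2 K2 = w2
  generalize p.nl1 z0 z1 u0 u1 K1 = w1
  generalize p.nl0 z0 u0 K0 = w0
  generalize 1 / p.del = d at *
  generalize p.del = δ at *
  have hs1 : (d + p.eps * z0) * (δ * u1 - p.gam * (p.eps * w1)) = u1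
      + p.eps * (-p.gam * (d * w1) + z0 * (δ * u1 - p.gam * (p.eps * w1))) := by
    linear_combination u1 * hd
  have hs3 : (d + p.eps * z0) ^ 2 * (δ * u2 - p.gam * (p.eps * w2))
      + 3 * (d + p.eps * z0) * (p.eps * z1) * (δ * u1 - p.gam * (p.eps * w1)) = d * u2 + p.eps *
      (-p.gam * (d * (d * w2)) + (2 * (d * z0) + p.eps * (z0 * z0))
        * (δ * u2 - p.gam * (p.eps * w2))
        + 3 * ((d * z1 + p.eps * (z0 * z1)) * (δ * u1 - p.gam * (p.eps * w1)))) := by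
    linear_combination d * u2 * hd
  rw [hs1, hs3]
  linear_combination 1 / 3 * u0 * u2 * hd

end Derivatives

end Params

namespace Ctx

variable {s : ℝ} [hs : Fact (3 / 2 < s)] {κ : Bounds}

/-! ### The corrected waves as functions of time -/

/-- The transported wave with its corrector. -/
def wv (i : Ctx s κ) (τ x : ℝ) : ℝ := i.a τ (x - i.c * τ) + corr i.p i.c (i.a τ) (i.b τ) τ x

/-- The corrected surface elevation. -/
def elev (i : Ctx s κ) (τ x : ℝ) : ℝ := wv i τ x + wv i.swap τ x

/-- The corrected velocity, divided by `γ + δ`. -/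
def vel (i : Ctx s κ) (τ x : ℝ) : ℝ := wv i τ x - wv i.swap τ x

theorem wv_eq (i : Ctx s κ) (x : ℝ) : wv i i.t x = X 0 i x := by
  simp [wv, X, Tr, D, W]

theorem contDiff_wv (i : Ctx s κ) {τ : ℝ} (hτ : τ ∈ timeIco i.T) : ContDiff ℝ 3 (wv i τ) := by
  have ha := i.wa.smooth τ hτ
  have hb := i.wb.smooth τ hτ
  exact ((ha.of_le (by norm_num)).comp (by fun_prop)).add
    (contDiff_corr_comp ha hb i.p i.c (n := 3) (by norm_num) contDiff_const contDiff_id)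

theorem contDiff_elev (i : Ctx s κ) {τ : ℝ} (hτ : τ ∈ timeIco i.T) : ContDiff ℝ 3 (elev i τ) :=
  (contDiff_wv i hτ).add (contDiff_wv i.swap hτ)

theorem contDiff_vel (i : Ctx s κ) {τ : ℝ} (hτ : τ ∈ timeIco i.T) : ContDiff ℝ 3 (vel i τ) :=
  (contDiff_wv i hτ).sub (contDiff_wv i.swap hτ)

theorem hasDerivAt_X {k : ℕ} (hk : k < 3) (i : Ctx s κ) (x : ℝ) :
    HasDerivAt (X k i) (X (k + 1) i x) x :=
  (hasDerivAt_Tr (by omega) i x).add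
    (hasDerivAt_iteratedDeriv (n := 3) (ho_W.smooth i) hk x)

theorem hasDerivAt_Y {k : ℕ} (hk : k < 2) (i : Ctx s κ) (x : ℝ) :
    HasDerivAt (Y k i) (Y (k + 1) i x) x :=
  ((hasDerivAt_TrE (by omega) i x).sub ((hasDerivAt_Tr (by omega) i x).const_mul i.c)).add
    (hasDerivAt_iteratedDeriv (n := 2) (ho_Wd.smooth i) hk x)

theorem td_wv (i : Ctx s κ) : TD i.T i.t 2 (wv i) (Y 0 i) := by
  have h := i.wa.isCurve.td_shift_sub i.ht i.c (n := 2) (k := 0) (by norm_num)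
  simp only [iteratedDeriv_zero] at h
  refine (h.add i.ht (td_W i)).congr_right fun x => ?_
  simp [Y, TrE, Tr, E, D]

theorem td_elev (i : Ctx s κ) : TD i.T i.t 2 (elev i) (fun x => Y 0 i x + Y 0 i.swap x) :=
  (td_wv i).add i.ht (td_wv i.swap)

theorem td_vel (i : Ctx s κ) : TD i.T i.t 2 (vel i) (fun x => Y 0 i x - Y 0 i.swap x) :=
  (td_wv i).sub i.ht (td_wv i.swap)

theorem elev_eq (i : Ctx s κ) : elev i i.t = fun x => X 0 i x + X 0 i.swap x := by
  ext x; exact congrArg₂ (· + ·) (wv_eq i x) (wv_eq i.swap x)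

theorem vel_eq (i : Ctx s κ) : vel i i.t = fun x => X 0 i x - X 0 i.swap x := by
  ext x; exact congrArg₂ (· - ·) (wv_eq i x) (wv_eq i.swap x)

theorem deriv_elev (i : Ctx s κ) : deriv (elev i i.t) = fun x => X 1 i x + X 1 i.swap x := by
  rw [elev_eq]; ext x
  exact ((hasDerivAt_X (by norm_num) i x).add (hasDerivAt_X (by norm_num) i.swap x)).deriv

theorem deriv_vel (i : Ctx s κ) : deriv (vel i i.t) = fun x => X 1 i x - X 1 i.swap x := by
  rw [vel_eq]; ext x
  exact ((hasDerivAt_X (by norm_num) i x).sub (hasDerivAt_X (by norm_num) i.swap x)).deriv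

theorem deriv2_elev (i : Ctx s κ) :
    deriv (deriv (elev i i.t)) = fun x => X 2 i x + X 2 i.swap x := by
  rw [deriv_elev]; ext x
  exact ((hasDerivAt_X (by norm_num) i x).add (hasDerivAt_X (by norm_num) i.swap x)).deriv

theorem deriv2_vel (i : Ctx s κ) :
    deriv (deriv (vel i i.t)) = fun x => X 2 i x - X 2 i.swap x := by
  rw [deriv_vel]; ext x
  exact ((hasDerivAt_X (by norm_num) i x).sub (hasDerivAt_X (by norm_num) i.swap x)).deriv

theorem td_elev1 (i : Ctx s κ) : TD i.T i.t 1 (fun τ => deriv (elev i τ))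
    (fun x => Y 1 i x + Y 1 i.swap x) :=
  (td_elev i).deriv.congr_right fun x =>
    ((hasDerivAt_Y (by norm_num) i x).add (hasDerivAt_Y (by norm_num) i.swap x)).deriv.symm

theorem td_vel1 (i : Ctx s κ) : TD i.T i.t 1 (fun τ => deriv (vel i τ))
    (fun x => Y 1 i x - Y 1 i.swap x) :=
  (td_vel i).deriv.congr_right fun x =>
    ((hasDerivAt_Y (by norm_num) i x).sub (hasDerivAt_Y (by norm_num) i.swap x)).deriv.symm

theorem td_elev2 (i : Ctx s κ) : TD i.T i.t 0 (fun τ => deriv (deriv (elev i τ)))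
    (fun x => Y 2 i x + Y 2 i.swap x) :=
  (td_elev1 i).deriv.congr_right fun x =>
    ((hasDerivAt_Y (by norm_num) i x).add (hasDerivAt_Y (by norm_num) i.swap x)).deriv.symm

theorem td_vel2 (i : Ctx s κ) : TD i.T i.t 0 (fun τ => deriv (deriv (vel i τ)))
    (fun x => Y 2 i x - Y 2 i.swap x) :=
  (td_vel1 i).deriv.congr_right fun x =>
    ((hasDerivAt_Y (by norm_num) i x).sub (hasDerivAt_Y (by norm_num) i.swap x)).deriv.symm

/-! ### Consistency -/

/-- A family of configurations for which the corrected waves are bounded and the depths do not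
vanish. -/
structure Regular {ι : Type*} (e : ι → Ctx s κ) : Prop where
  dir : ∀ i, (e i).c = 1
  corrector : HO s 3 (fun i => W (e i)) 1
  corrector_swap : HO s 3 (fun i => W (e i).swap) 1
  depth : ∀ i, ∀ᶠ τ in 𝓝[timeIco (e i).T] (e i).t, ∀ x,
    0 < (e i).p.h1 (elev (e i) τ) x ∧ 0 < (e i).p.h2 (elev (e i) τ) x
  quot : HO s 3 (fun i => (e i).p.quot (elev (e i) (e i).t)) 1

theorem so_bet : SO (fun i : Ctx s κ => i.p.bet) 1 :=
  ((((SO.const 1).sub so_gam).mul_one_left so_del).mul_one_left so_inv_sum).congr fun i => by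
    unfold bet; ring

theorem so_coef : SO (fun i : Ctx s κ => i.p.coef) 1 :=
  ((so_del.mul_one_left ((SO.const 1).add so_del)).mul_one_left so_inv_sum).congr fun i => by
    unfold coef; ring

theorem ho_Y {j k' : ℕ} (h : j + k' ≤ 2) : HO s j (Y k' : Ctx s κ → ℝ → ℝ) k := by
  have h1 := (ho_TrE (s := s) (κ := κ) (j := j) (k := k') (by omega)).sub
    (HO.one_smul so_c (ho_Tr (k := k' + 1) (by omega)))
  have h2 := ((ho_Wd (s := s) (κ := κ)).mono h).iteratedDeriv k'
  have h3 : SO (m * k : Ctx s κ → ℝ) k := (so_m_one.mul_one_left so_k)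
  exact (h1.trans so_one_k).add (h2.trans h3)

namespace Regular

variable {ι : Type*} {e : ι → Ctx s κ} (R : Regular e)
include R

theorem ho_elev : HO s 3 (fun i => elev (e i) (e i).t) 1 :=
  ((ho_X R.corrector (k := 0) (by norm_num)).add
    (ho_X (e := fun i => (e i).swap) R.corrector_swap (k := 0) (by norm_num))).congr
      fun i x => by rw [elev_eq]

theorem ho_vel : HO s 3 (fun i => vel (e i) (e i).t) 1 :=
  ((ho_X R.corrector (k := 0) (by norm_num)).sub
    (ho_X (e := fun i => (e i).swap) R.corrector_swap (k := 0) (by norm_num))).congr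
      fun i x => by rw [vel_eq]

omit R in
theorem ht (i : ι) : (e i).t ∈ timeIco (e i).T := (e i).ht

theorem tb_elev : TB s (fun i => (e i).T) (fun i => (e i).t) 2 (fun i => elev (e i))
    (fun i => (e i).k) :=
  ⟨R.ho_elev.mono (by norm_num), _,
    (((ho_Y (by norm_num)).add ((ho_Y (by norm_num)).comp swap)).comp e), fun i => td_elev (e i)⟩

theorem tb_vel : TB s (fun i => (e i).T) (fun i => (e i).t) 2 (fun i => vel (e i))
    (fun i => (e i).k) :=
  ⟨R.ho_vel.mono (by norm_num), _,
    (((ho_Y (by norm_num)).sub ((ho_Y (by norm_num)).comp swap)).comp e), fun i => td_vel (e i)⟩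

theorem depth1 (i : ι) (x : ℝ) : 0 < (e i).p.h1 (elev (e i) (e i).t) x :=
  ((R.depth i).self_of_nhdsWithin (e i).ht x).1

theorem depth2 (i : ι) (x : ℝ) : 0 < (e i).p.h2 (elev (e i) (e i).t) x :=
  ((R.depth i).self_of_nhdsWithin (e i).ht x).2

theorem tb_quot : TB s (fun i => (e i).T) (fun i => (e i).t) 2
    (fun i τ => (e i).p.quot (elev (e i) τ)) (fun i => (e i).k) := by
  refine ⟨R.quot.mono (by norm_num), ?_⟩
  have hq := R.quot.mono (by norm_num : 2 ≤ 3)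
  have hY := ((ho_Y (s := s) (κ := κ) (j := 2) (k' := 0) (by norm_num)).add
    ((ho_Y (k' := 0) (by norm_num)).comp swap)).comp e
  have h1 := HO.one_smul (((so_bet (s := s) (κ := κ)).mul_one_left so_eps).comp e) hY
  have h2 := h1.mul_one_right hq
  have h3 := h2.mul_one_right hq
  refine ⟨_, (h1.add (h2.const_mul 2)).add h3, fun i => ?_⟩
  have hz := td_elev (e i)
  have hd := (TD.const (T := (e i).T) (t := (e i).t) (n := 2) 1).sub (e i).ht
    (hz.const_mul (e i).ht ((e i).p.bet * (e i).p.eps))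
  have hi := (hd.inv (e i).ht ((R.depth i).mono fun τ hτ x =>
    (one_sub_pos (e i).del_pos (e i).gam_nonneg (fun y => (hτ y).1) (fun y => (hτ y).2) x).ne')).sub
      (e i).ht (TD.const 1)
  refine hi.congr_right fun x => ?_
  have e1 : (1 - (e i).p.bet * (e i).p.eps * elev (e i) (e i).t x)⁻¹ =
      1 + (e i).p.quot (elev (e i) (e i).t) x := by unfold Params.quot; ring
  rw [e1]
  ring

theorem tb_quad : TB s (fun i => (e i).T) (fun i => (e i).t) 2
    (fun i τ => (e i).p.quad (elev (e i) τ) (vel (e i) τ)) (fun i => (e i).k) := by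
  have h := TB.mul ht (TB.mul ht R.tb_elev R.tb_elev) R.tb_vel
  have h2 := TB.add ht h (TB.mul ht h R.tb_quot)
  have e1 : (fun (i : ι) τ => (e i).p.quad (elev (e i) τ) (vel (e i) τ)) = fun i τ x =>
      elev (e i) τ x * elev (e i) τ x * vel (e i) τ x
        + elev (e i) τ x * elev (e i) τ x * vel (e i) τ x * (e i).p.quot (elev (e i) τ) x := by
    funext i τ x; simp only [quad]; ring
  rw [e1]
  exact h2

theorem ho_quad : HO s 3 (fun i => (e i).p.quad (elev (e i) (e i).t) (vel (e i) (e i).t)) 1 := by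
  have h := (R.ho_elev.mul_one_left R.ho_elev).mul_one_left R.ho_vel
  exact (h.add (h.mul_one_left R.quot)).congr fun i x => by simp only [quad]; ring

theorem tb_qRem : TB s (fun i => (e i).T) (fun i => (e i).t) 0
    (fun i τ x => (e i).p.qRem (elev (e i) τ x) (deriv (elev (e i) τ) x)
      (deriv (vel (e i) τ) x) (deriv (deriv (vel (e i) τ)) x)
      ((e i).p.nl1 (elev (e i) τ x) (deriv (elev (e i) τ) x) (vel (e i) τ x)
        (deriv (vel (e i) τ) x) (deriv ((e i).p.quad (elev (e i) τ) (vel (e i) τ)) x))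
      ((e i).p.nl2 (elev (e i) τ x) (deriv (elev (e i) τ) x) (deriv (deriv (elev (e i) τ)) x)
        (vel (e i) τ x) (deriv (vel (e i) τ) x) (deriv (deriv (vel (e i) τ)) x)
        (deriv (deriv ((e i).p.quad (elev (e i) τ) (vel (e i) τ))) x))
      (deriv (deriv ((e i).p.quad (elev (e i) τ) (vel (e i) τ))) x)) (fun i => (e i).k) := by
  have z0 := R.tb_elev.mono (by norm_num : 0 ≤ 2)
  have z1 := R.tb_elev.deriv.mono (by norm_num : 0 ≤ 1)
  have z2 := R.tb_elev.deriv.deriv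
  have u0 := R.tb_vel.mono (by norm_num : 0 ≤ 2)
  have u1 := R.tb_vel.deriv.mono (by norm_num : 0 ≤ 1)
  have u2 := R.tb_vel.deriv.deriv
  have k1 := R.tb_quad.deriv.mono (by norm_num : 0 ≤ 1)
  have k2 := R.tb_quad.deriv.deriv
  have c1 := (so_coef (s := s) (κ := κ)).comp e
  have c2 := ((so_coef (s := s) (κ := κ)).mul_one_left so_bet).comp e
  have c3 := (so_bet (s := s) (κ := κ)).comp e
  have c4 := (so_eps (s := s) (κ := κ)).comp e
  have c5 := (so_gam (s := s) (κ := κ)).comp e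
  have c6 := (so_del (s := s) (κ := κ)).comp e
  have c7 := (so_inv_del (s := s) (κ := κ)).comp e
  have w1 := TB.add ht (TB.smul ht c1 (TB.add ht (TB.mul ht z1 u0) (TB.mul ht z0 u1)))
    (TB.smul ht c4 (TB.smul ht c2 k1))
  have w2 := TB.add ht (TB.smul ht c1 (TB.add ht (TB.add ht (TB.mul ht z2 u0)
    (TB.smul ht (SO.const 2) (TB.mul ht z1 u1))) (TB.mul ht z0 u2)))
    (TB.smul ht c4 (TB.smul ht c2 k2))
  unfold qRem nl1 nl2
  repeat' first
    | exact z0 | exact z1 | exact u1 | exact u2 | exact w1 | exact w2 | exact k2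
    | apply TB.smul ht c1 | apply TB.smul ht c3 | apply TB.smul ht c4 | apply TB.smul ht c5
    | apply TB.smul ht c6 | apply TB.smul ht c7 | apply TB.smul ht (SO.const _)
    | apply TB.sub ht | apply TB.add ht | apply TB.mul ht

theorem ho_fluxRem1 : HO s 1 (fun i x => (e i).p.fluxRem1 (elev (e i) (e i).t x)
    (vel (e i) (e i).t x) ((e i).p.quad (elev (e i) (e i).t) (vel (e i) (e i).t) x)) 1 := by
  have z0 := R.ho_elev.mono (by norm_num : 1 ≤ 3)
  have u0 := R.ho_vel.mono (by norm_num : 1 ≤ 3)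
  have k0 := R.ho_quad.mono (by norm_num : 1 ≤ 3)
  have c1 := (so_coef (s := s) (κ := κ)).comp e
  have c3 := (so_bet (s := s) (κ := κ)).comp e
  have c4 := (so_eps (s := s) (κ := κ)).comp e
  unfold fluxRem1
  repeat' first
    | exact z0 | exact u0 | exact k0
    | apply HO.one_smul c1 | apply HO.one_smul c3 | apply HO.one_smul c4
    | apply HO.sub | apply HO.add | apply HO.mul_one_left

theorem ho_fluxRem2 : HO s 1 (fun i x => (e i).p.fluxRem2 (elev (e i) (e i).t x)
    (vel (e i) (e i).t x) ((e i).p.quad (elev (e i) (e i).t) (vel (e i) (e i).t) x)) 1 := by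
  have z0 := R.ho_elev.mono (by norm_num : 1 ≤ 3)
  have u0 := R.ho_vel.mono (by norm_num : 1 ≤ 3)
  have k0 := R.ho_quad.mono (by norm_num : 1 ≤ 3)
  have c1 := (so_coef (s := s) (κ := κ)).comp e
  have c3 := (so_bet (s := s) (κ := κ)).comp e
  have c4 := (so_eps (s := s) (κ := κ)).comp e
  have c5 := (so_gam (s := s) (κ := κ)).comp e
  have c8 := ((so_gam (s := s) (κ := κ)).sub (SO.const 1)).comp e
  have c9 := ((so_del (s := s) (κ := κ)).add (SO.const 1)).comp e
  unfold fluxRem2 nlTail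
  repeat' first
    | exact z0 | exact u0 | exact k0
    | apply HO.one_smul c1 | apply HO.one_smul c3 | apply HO.one_smul c4 | apply HO.one_smul c5
    | apply HO.one_smul c8 | apply HO.one_smul c9 | apply HO.const_mul
    | apply HO.sub | apply HO.add | apply HO.mul_one_left

theorem ho_rRem : HO s 1 (fun i x => (e i).p.rRem (elev (e i) (e i).t x)
      (deriv (elev (e i) (e i).t) x) (vel (e i) (e i).t x)
      (deriv (vel (e i) (e i).t) x) (deriv (deriv (vel (e i) (e i).t)) x)
      ((e i).p.nl0 (elev (e i) (e i).t x) (vel (e i) (e i).t x)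
        ((e i).p.quad (elev (e i) (e i).t) (vel (e i) (e i).t) x))
      ((e i).p.nl1 (elev (e i) (e i).t x) (deriv (elev (e i) (e i).t) x) (vel (e i) (e i).t x)
        (deriv (vel (e i) (e i).t) x)
        (deriv ((e i).p.quad (elev (e i) (e i).t) (vel (e i) (e i).t)) x))
      ((e i).p.nl2 (elev (e i) (e i).t x) (deriv (elev (e i) (e i).t) x)
        (deriv (deriv (elev (e i) (e i).t)) x) (vel (e i) (e i).t x) (deriv (vel (e i) (e i).t) x)
        (deriv (deriv (vel (e i) (e i).t)) x)
        (deriv (deriv ((e i).p.quad (elev (e i) (e i).t) (vel (e i) (e i).t))) x))) 1 := by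
  have z0 := R.ho_elev.mono (by norm_num : 1 ≤ 3)
  have z1 := R.ho_elev.deriv.mono (by norm_num : 1 ≤ 2)
  have z2 := R.ho_elev.deriv.deriv
  have u0 := R.ho_vel.mono (by norm_num : 1 ≤ 3)
  have u1 := R.ho_vel.deriv.mono (by norm_num : 1 ≤ 2)
  have u2 := R.ho_vel.deriv.deriv
  have k0 := R.ho_quad.mono (by norm_num : 1 ≤ 3)
  have k1 := R.ho_quad.deriv.mono (by norm_num : 1 ≤ 2)
  have k2 := R.ho_quad.deriv.deriv
  have c1 := (so_coef (s := s) (κ := κ)).comp e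
  have c2 := ((so_coef (s := s) (κ := κ)).mul_one_left so_bet).comp e
  have c4 := (so_eps (s := s) (κ := κ)).comp e
  have c5 := (so_gam (s := s) (κ := κ)).comp e
  have c6 := (so_del (s := s) (κ := κ)).comp e
  have c7 := (so_inv_del (s := s) (κ := κ)).comp e
  have w0 := (HO.one_smul c1 (z0.mul_one_left u0)).add (HO.one_smul c4 (HO.one_smul c2 k0))
  have w1 := (HO.one_smul c1 ((z1.mul_one_left u0).add (z0.mul_one_left u1))).add
    (HO.one_smul c4 (HO.one_smul c2 k1))
  have w2 := (HO.one_smul c1 (((z2.mul_one_left u0).add ((z1.mul_one_left u1).const_mul 2)).add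
    (z0.mul_one_left u2))).add (HO.one_smul c4 (HO.one_smul c2 k2))
  have n1 := (HO.one_smul c6 u1).sub (HO.one_smul c5 (HO.one_smul c4 w1))
  have n2 := (HO.one_smul c6 u2).sub (HO.one_smul c5 (HO.one_smul c4 w2))
  have l1 := u1.add (HO.one_smul c4 w1)
  have l2 := u2.add (HO.one_smul c4 w2)
  have p1 := (HO.one_smul c5.neg (HO.one_smul c7 w1)).add (z0.mul_one_left n1)
  have p2 := w1.sub (z0.mul_one_left l1)
  have p3 := ((HO.one_smul c5.neg (HO.one_smul c7 (HO.one_smul c7 w2))).add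
    ((((HO.one_smul c7 z0).const_mul 2).add (HO.one_smul c4 (z0.mul_one_left z0))).mul_one_left
      n2)).add ((((HO.one_smul c7 z1).add
        (HO.one_smul c4 (z0.mul_one_left z1))).mul_one_left n1).const_mul 3)
  have p4 := (w2.add (((HO.one_smul c4 (z0.mul_one_left z0)).sub (z0.const_mul 2)).mul_one_left
    l2)).sub (((z1.sub (HO.one_smul c4 (z0.mul_one_left z1))).mul_one_left l1).const_mul 3)
  refine ((((u1.mul_one_left p1).add ((HO.one_smul c4 (p1.mul_one_left p1)).const_mul (1 / 2))).sub
    (HO.one_smul c5 ((u1.mul_one_left p2).add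
      ((HO.one_smul c4 (p2.mul_one_left p2)).const_mul (1 / 2))))).add
    ((((HO.one_smul c6 (u0.mul_one_left p3)).sub (HO.one_smul c5 (w0.mul_one_left
      ((HO.one_smul c7 u2).add (HO.one_smul c4 p3))))).sub (HO.one_smul c5
      ((u0.mul_one_left p4).add (w0.mul_one_left (u2.add (HO.one_smul c4 p4)))))).const_mul
        (1 / 3))).congr fun i x => ?_
  rfl

end Regular

end Ctx

namespace Ctx

variable {s : ℝ} [hs : Fact (3 / 2 < s)] {κ : Bounds}

/-- The corrected velocity. -/
def velo (i : Ctx s κ) (τ x : ℝ) : ℝ := (i.p.gam + i.p.del) * vel i τ x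

theorem resid_of_dir {i : Ctx s κ} (h : i.c = 1) (x : ℝ) :
    resid i x = Y 0 i x + X 1 i x
    + Spoly i.p (X 0 i x) (X 1 i x) (X 2 i x) (X 3 i x)
      (X 0 i.swap x) (X 1 i.swap x) (X 2 i.swap x) (X 3 i.swap x)
    + Dpoly i.p (X 0 i x) (X 1 i x) (X 2 i x) (X 0 i.swap x) (X 1 i.swap x) (X 2 i.swap x)
      (Y 0 i x) (Y 1 i x) (Y 2 i x) (Y 0 i.swap x) (Y 1 i.swap x) (Y 2 i.swap x) := by
  rw [resid, h]; ring

theorem resid_swap_of_dir {i : Ctx s κ} (h : i.c = 1) (x : ℝ) :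
    resid i.swap x = Y 0 i.swap x - X 1 i.swap x
    - Spoly i.p (X 0 i.swap x) (X 1 i.swap x) (X 2 i.swap x) (X 3 i.swap x)
      (X 0 i x) (X 1 i x) (X 2 i x) (X 3 i x)
    + Dpoly i.p (X 0 i.swap x) (X 1 i.swap x) (X 2 i.swap x) (X 0 i x) (X 1 i x) (X 2 i x)
      (Y 0 i.swap x) (Y 1 i.swap x) (Y 2 i.swap x) (Y 0 i x) (Y 1 i x) (Y 2 i x) := by
  have h1 : i.swap.c = -1 := congrArg Neg.neg h
  have h2 : i.swap.p = i.p := rfl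
  rw [resid, h1, swap_swap, h2]; ring

theorem hasDerivAt_elev (i : Ctx s κ) (x : ℝ) :
    HasDerivAt (elev i i.t) (X 1 i x + X 1 i.swap x) x := by
  rw [elev_eq]
  exact (hasDerivAt_X (by norm_num) i x).add (hasDerivAt_X (by norm_num) i.swap x)

theorem hasDerivAt_vel (i : Ctx s κ) (x : ℝ) :
    HasDerivAt (vel i i.t) (X 1 i x - X 1 i.swap x) x := by
  rw [vel_eq]
  exact (hasDerivAt_X (by norm_num) i x).sub (hasDerivAt_X (by norm_num) i.swap x)

theorem hasDerivAt_vel1 (i : Ctx s κ) (x : ℝ) :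
    HasDerivAt (deriv (vel i i.t)) (X 2 i x - X 2 i.swap x) x := by
  rw [deriv_vel]
  exact (hasDerivAt_X (by norm_num) i x).sub (hasDerivAt_X (by norm_num) i.swap x)

theorem hasDerivAt_vel2 (i : Ctx s κ) (x : ℝ) :
    HasDerivAt (deriv (deriv (vel i i.t))) (X 3 i x - X 3 i.swap x) x := by
  rw [deriv2_vel]
  exact (hasDerivAt_X (by norm_num) i x).sub (hasDerivAt_X (by norm_num) i.swap x)

theorem timeDeriv_elev (i : Ctx s κ) (x : ℝ) :
    timeDeriv i.T (elev i) i.t x = Y 0 i x + Y 0 i.swap x :=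
  HasDerivWithinAt.timeDeriv_eq i.ht ((td_elev i).hasDeriv x)

namespace Regular

variable {ι : Type*} {e : ι → Ctx s κ} (R : Regular e)
include R

theorem residual1_eq (i : ι) (x : ℝ) :
    (e i).p.residual1 (e i).T (elev (e i)) (velo (e i)) (e i).t x =
      resid (e i) x + resid (e i).swap x + (e i).p.eps ^ 4 * deriv (fun x => (e i).p.fluxRem1
        (elev (e i) (e i).t x) (vel (e i) (e i).t x)
        ((e i).p.quad (elev (e i) (e i).t) (vel (e i) (e i).t) x)) x := by
  have hd := ((R.ho_fluxRem1.smooth i).differentiable (by norm_num) x).hasDerivAt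
  have hF := funext (flux1_eq (u := vel (e i) (e i).t) (e i).del_pos (e i).gam_nonneg (R.depth1 i)
    (R.depth2 i))
  have hc := R.dir i
  unfold residual1 velo
  rw [hF]
  generalize e i = i at *
  have hz := hasDerivAt_elev i x
  have hu := hasDerivAt_vel i x
  have hD := ((((hu.add ((hz.mul hu).const_mul (2 / 3 * (i.p.eps * i.p.alpha1)))).add
    (((hz.mul hz).mul hu).const_mul (i.p.eps ^ 2 * i.p.alpha2 / 3))).add
    ((((hz.mul hz).mul hz).mul hu).const_mul (i.p.eps ^ 3 * i.p.alpha3 / 5))).add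
    (hd.const_mul (i.p.eps ^ 4)))
  rw [timeDeriv_elev, resid_of_dir hc, resid_swap_of_dir hc]
  refine (congrArg _ hD.deriv).trans ?_
  simp only [Pi.mul_apply]
  simp only [elev_eq, vel_eq, Spoly, Dpoly]
  ring

theorem hasDeriv_momentum : ∃ q : ι → ℝ → ℝ, HO s 0 q (fun i => (e i).k) ∧ ∀ i x,
    HasDerivWithinAt (fun τ => (e i).p.momentum (elev (e i)) (velo (e i)) τ x)
      ((e i).p.eps ^ 2 * ((e i).p.mu * q i x)
        + ((e i).p.gam + (e i).p.del) * (Y 0 (e i) x - Y 0 (e i).swap x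
        + 2 * Dpoly (e i).p (X 0 (e i) x) (X 1 (e i) x) (X 2 (e i) x)
          (X 0 (e i).swap x) (X 1 (e i).swap x) (X 2 (e i).swap x)
          (Y 0 (e i) x) (Y 1 (e i) x) (Y 2 (e i) x) (Y 0 (e i).swap x) (Y 1 (e i).swap x)
          (Y 2 (e i).swap x))) (timeIco (e i).T) (e i).t := by
  obtain ⟨q, hq, htd⟩ := R.tb_qRem.rate
  refine ⟨q, hq, fun i x => ?_⟩
  have hr := (htd i).hasDeriv x
  have hdep := R.depth i
  set i := e i with hi
  have z0 := (td_elev i).hasDeriv x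
  have z1 := (td_elev1 i).hasDeriv x
  have z2 := (td_elev2 i).hasDeriv x
  have u0 := (td_vel i).hasDeriv x
  have u1 := (td_vel1 i).hasDeriv x
  have u2 := (td_vel2 i).hasDeriv x
  have hm := (((u2.const_mul (-i.p.nu)).sub
    ((((((z0.mul u2).add (u0.mul z2)).const_mul (1 / 2)).const_mul i.p.kap1).add
    ((((z0.mul u2).sub (u0.mul z2)).const_mul (1 / 2)).const_mul i.p.kap2)).add
    ((z1.mul u1).const_mul (i.p.kap1 + i.p.kap2 / 2)) |>.const_mul i.p.eps)).const_mul
      (2 * (i.p.gam + i.p.del)))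
  have hall := (u0.const_mul (i.p.gam + i.p.del)).add ((hm.add (hr.const_mul (i.p.eps ^ 2))).const_mul
    i.p.mu)
  have heq : ∀ τ ∈ timeIco i.T, (∀ x, 0 < i.p.h1 (elev i τ) x ∧ 0 < i.p.h2 (elev i τ) x) →
      i.p.momentum (elev i) (velo i) τ x = _ := fun τ hτ hd =>
    congrArg (fun y => (i.p.gam + i.p.del) * vel i τ x + i.p.mu * y)
      (Qbar_eq (u := vel i τ) i.del_pos i.gam_nonneg (fun x => (hd x).1) (fun x => (hd x).2)
        ((contDiff_elev i hτ).of_le (by norm_num)) ((contDiff_vel i hτ).of_le (by norm_num)) x)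
  refine (hall.congr_of_eventuallyEq ?_ ?_).congr_deriv ?_
  · filter_upwards [hdep, self_mem_nhdsWithin] with τ h1 h2 using heq τ h2 h1
  · exact heq i.t i.ht (hdep.self_of_nhdsWithin i.ht)
  · simp only [deriv2_elev, deriv2_vel]
    simp only [deriv_elev, deriv_vel]
    simp only [elev_eq, vel_eq, Dpoly]
    ring

theorem deriv_Rbar (i : ι) (x : ℝ) :
    deriv ((e i).p.Rbar (elev (e i) (e i).t) (velo (e i) (e i).t)) x =
      (1 - (e i).p.gam) * (4 / 3 * (X 1 (e i) x - X 1 (e i).swap x)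
          * (X 2 (e i) x - X 2 (e i).swap x)
        + 1 / 3 * (X 0 (e i) x - X 0 (e i).swap x) * (X 3 (e i) x - X 3 (e i).swap x))
      + (e i).p.eps * deriv (fun x => (e i).p.rRem (elev (e i) (e i).t x)
      (deriv (elev (e i) (e i).t) x) (vel (e i) (e i).t x)
      (deriv (vel (e i) (e i).t) x) (deriv (deriv (vel (e i) (e i).t)) x)
      ((e i).p.nl0 (elev (e i) (e i).t x) (vel (e i) (e i).t x)
        ((e i).p.quad (elev (e i) (e i).t) (vel (e i) (e i).t) x))
      ((e i).p.nl1 (elev (e i) (e i).t x) (deriv (elev (e i) (e i).t) x) (vel (e i) (e i).t x)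
        (deriv (vel (e i) (e i).t) x)
        (deriv ((e i).p.quad (elev (e i) (e i).t) (vel (e i) (e i).t)) x))
      ((e i).p.nl2 (elev (e i) (e i).t x) (deriv (elev (e i) (e i).t) x)
        (deriv (deriv (elev (e i) (e i).t)) x) (vel (e i) (e i).t x) (deriv (vel (e i) (e i).t) x)
        (deriv (deriv (vel (e i) (e i).t)) x)
        (deriv (deriv ((e i).p.quad (elev (e i) (e i).t) (vel (e i) (e i).t))) x))) x := by
  have hd := ((R.ho_rRem.smooth i).differentiable (by norm_num) x).hasDerivAt
  have hF := funext (Rbar_eq (u := vel (e i) (e i).t) (e i).del_pos (e i).gam_nonneg (R.depth1 i)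
    (R.depth2 i) ((contDiff_elev (e i) (e i).ht).of_le (by norm_num))
    ((contDiff_vel (e i) (e i).ht).of_le (by norm_num)))
  have hv : (velo (e i) (e i).t) = fun w => ((e i).p.gam + (e i).p.del) * vel (e i) (e i).t w := rfl
  rw [hv, hF]
  have u0 := hasDerivAt_vel (e i) x
  have u1 := hasDerivAt_vel1 (e i) x
  have u2 := hasDerivAt_vel2 (e i) x
  refine ((((((u1.mul u1).const_mul (1 / 2)).add ((u0.mul u2).const_mul (1 / 3))).const_mul
    (1 - (e i).p.gam)).add (hd.const_mul (e i).p.eps)).congr_deriv ?_).deriv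
  simp only [deriv2_vel]
  simp only [deriv_vel]
  simp only [vel_eq]
  ring

theorem deriv_flux2 (i : ι) (x : ℝ) :
    (e i).p.eps / 2 * deriv (fun y => ((e i).p.h1 (elev (e i) (e i).t) y ^ 2
        - (e i).p.gam * (e i).p.h2 (elev (e i) (e i).t) y ^ 2)
        / ((e i).p.h1 (elev (e i) (e i).t) y + (e i).p.gam * (e i).p.h2 (elev (e i) (e i).t) y) ^ 2
        * velo (e i) (e i).t y ^ 2) x =
      (Spoly (e i).p (X 0 (e i) x) (X 1 (e i) x) (X 2 (e i) x) (X 3 (e i) x)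
      (X 0 (e i).swap x) (X 1 (e i).swap x) (X 2 (e i).swap x) (X 3 (e i).swap x)
      + Spoly (e i).p (X 0 (e i).swap x) (X 1 (e i).swap x) (X 2 (e i).swap x) (X 3 (e i).swap x)
      (X 0 (e i) x) (X 1 (e i) x) (X 2 (e i) x) (X 3 (e i) x)) * ((e i).p.gam + (e i).p.del)
      + (e i).p.mu * (e i).p.eps * (1 - (e i).p.gam) * (4 / 3 * (X 1 (e i) x - X 1 (e i).swap x)
          * (X 2 (e i) x - X 2 (e i).swap x)
        + 1 / 3 * (X 0 (e i) x - X 0 (e i).swap x) * (X 3 (e i) x - X 3 (e i).swap x))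
      + (e i).p.eps ^ 4 * deriv (fun x => (e i).p.fluxRem2
        (elev (e i) (e i).t x) (vel (e i) (e i).t x)
        ((e i).p.quad (elev (e i) (e i).t) (vel (e i) (e i).t) x)) x := by
  have hd := ((R.ho_fluxRem2.smooth i).differentiable (by norm_num) x).hasDerivAt
  have hF := funext (flux2_eq (u := vel (e i) (e i).t) (e i).del_pos (e i).gam_nonneg (R.depth1 i)
    (R.depth2 i))
  unfold velo
  rw [hF]
  generalize e i = i at *
  have hz := hasDerivAt_elev i x
  have hu := hasDerivAt_vel i x
  have hD := (((((hu.mul hu).const_mul (i.p.alpha1 / 3)).add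
    (((hz.mul hu).mul hu).const_mul (i.p.eps * i.p.alpha2 / 3))).add
    ((((hz.mul hz).mul hu).mul hu).const_mul (i.p.eps ^ 2 * i.p.alpha3 * (3 / 10)))).const_mul
    (2 * (i.p.gam + i.p.del))).add (hd.const_mul (2 * i.p.eps ^ 3))
  have c : 2 * (i.p.gam + i.p.del) * i.p.kap3 = i.p.gam - 1 := by
    have := i.sum_pos
    unfold kap3; field_simp
  refine (congrArg _ hD.deriv).trans ?_
  simp only [Pi.mul_apply]
  simp only [vel_eq, elev_eq, Spoly]
  linear_combination -i.p.mu * i.p.eps * (4 / 3 * (X 1 i x - X 1 i.swap x)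
          * (X 2 i x - X 2 i.swap x)
        + 1 / 3 * (X 0 i x - X 0 i.swap x) * (X 3 i x - X 3 i.swap x)) * c

end Regular

end Ctx

namespace Ctx

variable {s : ℝ} [hs : Fact (3 / 2 < s)] {κ : Bounds}

theorem so_eps_four : SO (fun i : Ctx s κ => i.p.eps ^ 4) (m * m) :=
  (so_eps_sq.mul so_eps_sq).congr fun i => by ring

theorem so_mu_eps_sq : SO (fun i : Ctx s κ => i.p.mu * i.p.eps ^ 2) (m * m) :=
  so_mu_m.mul so_eps_sq

theorem so_mm_mmk : SO (m * m : Ctx s κ → ℝ) (m * (m * k)) := so_m.mul so_m_mk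

theorem so_sum : SO (fun i : Ctx s κ => i.p.gam + i.p.del) 1 := so_gam.add so_del

namespace Regular

variable {ι : Type*} {e : ι → Ctx s κ} (R : Regular e)
include R

theorem ho_resid : HO s 0 (fun i => resid (e i)) (fun i => (m * (m * k) : Ctx s κ → ℝ) (e i)) :=
  Ctx.ho_resid R.corrector R.corrector_swap

theorem ho_resid_swap :
    HO s 0 (fun i => resid (e i).swap) (fun i => (m * (m * k) : Ctx s κ → ℝ) (e i)) :=
  Ctx.ho_resid (e := fun i => (e i).swap) R.corrector_swap (by simpa only [swap_swap] using R.corrector)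

theorem ho_residual1 : HO s 0
    (fun i => (e i).p.residual1 (e i).T (elev (e i)) (velo (e i)) (e i).t)
    (fun i => (m * (m * k) : Ctx s κ → ℝ) (e i)) := by
  have h1 := HO.smul_one (so_eps_four.comp e) R.ho_fluxRem1.deriv
  exact ((R.ho_resid.add R.ho_resid_swap).add (h1.trans (so_mm_mmk.comp e))).congr
    fun i x => R.residual1_eq i x

theorem ho_residual2 : HO s 0
    (fun i => (e i).p.residual2 (e i).T (elev (e i)) (velo (e i)) (e i).t)
    (fun i => (m * (m * k) : Ctx s κ → ℝ) (e i)) := by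
  obtain ⟨q, hq, hd⟩ := R.hasDeriv_momentum
  have h1 := (HO.smul_one (so_eps_four.comp e) R.ho_fluxRem2.deriv).trans (so_mm_mmk.comp e)
  have h2 := (HO.smul_one (so_mu_eps_sq.comp e) R.ho_rRem.deriv).trans (so_mm_mmk.comp e)
  have h3 : HO s 0 (fun i x => (e i).p.mu * (e i).p.eps ^ 2 * q i x)
      (fun i => (m * (m * k) : Ctx s κ → ℝ) (e i)) := by
    have := HO.smul (so_mu_eps_sq.comp e) hq
    have e1 : (fun i => (m * (m * k) : Ctx s κ → ℝ) (e i)) =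
        (fun i => (m * m : Ctx s κ → ℝ) (e i)) * fun i => (e i).k := by
      ext i; simp only [Pi.mul_apply]; ring
    rw [e1]; exact this
  refine ((((HO.one_smul (so_sum.comp e) (R.ho_resid.sub R.ho_resid_swap)).add h3).add h1).sub
    h2).congr fun i x => ?_
  have ht : timeDeriv (e i).T ((e i).p.momentum (elev (e i)) (velo (e i))) (e i).t x = _ :=
    HasDerivWithinAt.timeDeriv_eq (e i).ht (hd i x)
  rw [residual2, ht, R.deriv_flux2, R.deriv_Rbar, deriv_elev, resid_of_dir (R.dir i),
    resid_swap_of_dir (R.dir i)]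
  simp only [Dpoly]
  ring

theorem consistent : ∃ C : ℝ, 0 < C ∧ ∀ i, (e i).p.GNConsistentAt s (e i).T (elev (e i))
    (velo (e i)) (C * ((e i).p.precision * (e i).k)) (e i).t := by
  obtain ⟨C, hC, hc⟩ := R.ho_residual1.bound
  obtain ⟨D, hD, hd⟩ := R.ho_residual2.bound
  obtain ⟨q, -, hm⟩ := R.hasDeriv_momentum
  refine ⟨C + D, by positivity, fun i => ⟨contDiff_elev (e i) (e i).ht,
    contDiff_const.mul (contDiff_vel (e i) (e i).ht), R.depth1 i, R.depth2 i,
    fun x => ((td_elev (e i)).hasDeriv x).differentiableWithinAt,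
    fun x => (hm i x).differentiableWithinAt, ?_⟩⟩
  have h1 := hc i
  have h2 := hd i
  simp only [Nat.cast_zero, add_zero] at h1 h2
  have e1 : (e i).p.precision * (e i).k = (m * (m * k) : Ctx s κ → ℝ) (e i) := by
    rw [precision_eq]; simp only [Pi.mul_apply]; ring
  have h0 := R.ho_resid.nonneg i
  rw [e1, add_mul, ENNReal.ofReal_add (by positivity) (by positivity)]
  exact add_le_add h1 h2

end Regular

end Ctx

/-! ### Systems of two waves -/

/-- Two counter-propagating waves on `[0, T)`, whose primitives between the characteristics are at
most of size `k`. -/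
structure Waves (s : ℝ) (κ : Bounds) where
  p : Params
  lam : ℝ
  th : ℝ
  T : ℝ≥0∞
  vp : ℝ → ℝ → ℝ
  vm : ℝ → ℝ → ℝ
  k : ℝ → ℝ
  regime : p.InRegime κ.muMax κ.epsMax κ.delMin κ.delMax
  hlam : |lam| ≤ κ.Lam
  hth : |th| ≤ κ.Th
  hk : ∀ t, 1 ≤ k t
  hk_cont : Continuous k
  wp : IsWave p s lam th κ.M 1 T vp
  wm : IsWave p s lam th κ.M (-1) T vm
  prim_p : ∀ t ∈ timeIco T, ∀ x y, |y - x| ≤ 2 * t → |∫ z in x..y, vp t z| ≤ κ.M * k t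
  prim_m : ∀ t ∈ timeIco T, ∀ x y, |y - x| ≤ 2 * t → |∫ z in x..y, vm t z| ≤ κ.M * k t

namespace Waves

variable {s : ℝ} [hs : Fact (3 / 2 < s)] {κ : Bounds}

/-- The configuration at time `t`. -/
def ctx (S : Waves s κ) {t : ℝ} (ht : t ∈ timeIco S.T) : Ctx s κ where
  p := S.p
  lam := S.lam
  th := S.th
  c := 1
  T := S.T
  a := S.vp
  b := S.vm
  t := t
  k := S.k t
  regime := S.regime
  hlam := S.hlam
  hth := S.hth
  hc := Or.inl rfl
  ht := ht
  hk := S.hk t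
  wa := S.wp
  wb := S.wm
  prim_a := S.prim_p t ht
  prim_b := S.prim_m t ht

/-- The corrector of the right-going wave. -/
def cp (S : Waves s κ) (t x : ℝ) : ℝ := corr S.p 1 (S.vp t) (S.vm t) t x

/-- The corrector of the left-going wave. -/
def cm (S : Waves s κ) (t x : ℝ) : ℝ := corr S.p (-1) (S.vm t) (S.vp t) t x

theorem solves_p (S : Waves s κ) {τ : ℝ} (hτ : τ ∈ timeIco S.T) : SolvesTransport 1
    (fun t x => S.p.fl (fun t x => S.vp τ (x - t)) (fun t x => S.vm τ (x + t)) t x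
      - S.p.fl (fun t x => S.vp τ (x - t)) (fun _ _ => 0) t x)
    (corr S.p 1 (S.vp τ) (S.vm τ)) := by
  have h := solvesTransport_corr (S.wp.smooth τ hτ) (S.wm.smooth τ hτ) S.p 1
  simpa only [one_mul, fl] using h

theorem solves_m (S : Waves s κ) {τ : ℝ} (hτ : τ ∈ timeIco S.T) : SolvesTransport (-1)
    (fun t x => S.p.fr (fun t x => S.vp τ (x - t)) (fun t x => S.vm τ (x + t)) t x
      - S.p.fr (fun _ _ => 0) (fun t x => S.vm τ (x + t)) t x)
    (corr S.p (-1) (S.vm τ) (S.vp τ)) := by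
  have h := solvesTransport_corr (S.wm.smooth τ hτ) (S.wp.smooth τ hτ) S.p (-1)
  simpa only [neg_mul, one_mul, sub_neg_eq_add, ← sub_eq_add_neg, fr] using h

theorem exists_corrector (S : Waves s κ) : ∃ zc vc, S.p.IsCorrector S.T S.vp S.vm zc vc :=
  ⟨fun t x => S.cp t x + S.cm t x, fun t x => (S.p.gam + S.p.del) * (S.cp t x - S.cm t x),
    fun τ => corr S.p 1 (S.vp τ) (S.vm τ), fun τ => corr S.p (-1) (S.vm τ) (S.vp τ),
    fun _ hτ => ⟨S.solves_p hτ, S.solves_m hτ⟩, fun _ _ _ => ⟨rfl, rfl⟩⟩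

theorem corrector_eq (S : Waves s κ) {zc vc : ℝ → ℝ → ℝ} (h : S.p.IsCorrector S.T S.vp S.vm zc vc)
    {t : ℝ} (ht : t ∈ timeIco S.T) :
    zc t = (fun x => S.cp t x + S.cm t x) ∧
      vc t = fun x => (S.p.gam + S.p.del) * (S.cp t x - S.cm t x) := by
  obtain ⟨wp, wm, h1, h2⟩ := h
  have e1 := TwoLayer.SolvesTransport.unique (h1 t ht).1 (S.solves_p ht)
  have e2 := TwoLayer.SolvesTransport.unique (h1 t ht).2 (S.solves_m ht)
  refine ⟨funext fun x => ?_, funext fun x => ?_⟩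
  · rw [(h2 t ht x).1, e1, e2]; rfl
  · rw [(h2 t ht x).2, e1, e2]; rfl

theorem timeDeriv_congr {T : ℝ≥0∞} {u w : ℝ → ℝ → ℝ} {t : ℝ} (ht : t ∈ timeIco T)
    (h : ∀ τ ∈ timeIco T, u τ = w τ) : timeDeriv T u t = timeDeriv T w t := by
  ext x
  exact derivWithin_congr (fun τ hτ => by rw [h τ hτ]) (by rw [h t ht])

/-- The corrector is small. -/
theorem corrector_bound : ∃ C : ℝ, 0 < C ∧ ∀ (S : Waves s κ) (zc vc : ℝ → ℝ → ℝ),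
    S.p.IsCorrector S.T S.vp S.vm zc vc → ∀ t ∈ timeIco S.T, CorrectorBoundAt s S.T zc vc
      (C * S.p.couplingSize * min t (S.k t)) (C * S.p.couplingSize * S.k t) t := by
  have hW := Ctx.ho_W (s := s) (κ := κ)
  have hWs : HO s 3 (fun i : Ctx s κ => Ctx.W i.swap) (Ctx.m * Ctx.q) := hW.comp Ctx.swap
  have hD := (Ctx.ho_Wd (s := s) (κ := κ)).mono (by norm_num : 0 ≤ 2)
  have hDs : HO s 0 (fun i : Ctx s κ => Ctx.Wd i.swap) (Ctx.m * Ctx.k) := hD.comp Ctx.swap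
  obtain ⟨C1, hC1, h1⟩ := (hW.add hWs).bound
  obtain ⟨C2, hC2, h2⟩ := (HO.one_smul Ctx.so_sum (hW.sub hWs)).bound
  obtain ⟨C3, hC3, h3⟩ := (hD.add hDs).bound
  obtain ⟨C4, hC4, h4⟩ := (HO.one_smul Ctx.so_sum (hD.sub hDs)).bound
  refine ⟨C1 + C2 + C3 + C4, by positivity, fun S zc vc hc t ht => ?_⟩
  set i := S.ctx ht
  have td1 := Ctx.td_W i
  have td2 := Ctx.td_W i.swap
  have dz : ∀ x, HasDerivWithinAt (fun τ => zc τ x) (Ctx.Wd i x + Ctx.Wd i.swap x)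
      (timeIco S.T) t := fun x => by
    refine ((td1.hasDeriv x).add (td2.hasDeriv x)).congr (fun τ hτ => ?_) ?_
    · exact congrFun (S.corrector_eq hc hτ).1 x
    · exact congrFun (S.corrector_eq hc ht).1 x
  have dv : ∀ x, HasDerivWithinAt (fun τ => vc τ x)
      ((S.p.gam + S.p.del) * (Ctx.Wd i x - Ctx.Wd i.swap x)) (timeIco S.T) t := fun x => by
    refine (((td1.hasDeriv x).sub (td2.hasDeriv x)).const_mul (S.p.gam + S.p.del)).congr
      (fun τ hτ => ?_) ?_
    · exact congrFun (S.corrector_eq hc hτ).2 x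
    · exact congrFun (S.corrector_eq hc ht).2 x
  have hm : 0 ≤ S.p.couplingSize := i.m_nonneg
  have hq : 0 ≤ min t (S.k t) := i.q_nonneg
  have hk : 0 ≤ S.k t := zero_le_one.trans (S.hk t)
  refine ⟨fun x => (dz x).differentiableWithinAt, fun x => (dv x).differentiableWithinAt, ?_, ?_⟩
  · have a1 := h1 i
    have a2 := h2 i
    rw [(S.corrector_eq hc ht).1, (S.corrector_eq hc ht).2]
    refine (add_le_add a1 a2).trans ?_
    have e1 : (Ctx.m * Ctx.q : Ctx s κ → ℝ) i = S.p.couplingSize * min t (S.k t) := rfl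
    rw [e1, ← ENNReal.ofReal_add (by positivity) (by positivity)]
    refine ENNReal.ofReal_le_ofReal ?_
    have : 0 ≤ (C3 + C4) * (S.p.couplingSize * min t (S.k t)) := by positivity
    linarith
  · have a1 := h3 i
    have a2 := h4 i
    simp only [Nat.cast_zero, add_zero] at a1 a2
    have ez : timeDeriv S.T zc t = fun x => Ctx.Wd i x + Ctx.Wd i.swap x := by
      ext x; exact HasDerivWithinAt.timeDeriv_eq ht (dz x)
    have ev : timeDeriv S.T vc t = fun x => (S.p.gam + S.p.del) * (Ctx.Wd i x - Ctx.Wd i.swap x) := by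
      ext x; exact HasDerivWithinAt.timeDeriv_eq ht (dv x)
    rw [ez, ev]
    refine (add_le_add a1 a2).trans ?_
    have e1 : (Ctx.m * Ctx.k : Ctx s κ → ℝ) i = S.p.couplingSize * S.k t := rfl
    rw [e1, ← ENNReal.ofReal_add (by positivity) (by positivity)]
    refine ENNReal.ofReal_le_ofReal ?_
    have : 0 ≤ (C1 + C2) * (S.p.couplingSize * S.k t) := by positivity
    linarith

end Waves

/-! ### Consistency of the corrected approximation -/

theorem Params.GNConsistentAt.congr {p : Params} {s : ℝ} {T : ℝ≥0∞} {z v z' v' : ℝ → ℝ → ℝ}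
    {K t : ℝ} (h : p.GNConsistentAt s T z v K t) (ht : t ∈ timeIco T)
    (hz : ∀ τ ∈ timeIco T, z' τ = z τ) (hv : ∀ τ ∈ timeIco T, v' τ = v τ) :
    p.GNConsistentAt s T z' v' K t := by
  have hm : ∀ τ ∈ timeIco T, p.momentum z' v' τ = p.momentum z v τ := fun τ hτ => by
    ext x; simp only [momentum, hz τ hτ, hv τ hτ]
  have e1 : p.residual1 T z' v' t = p.residual1 T z v t := by
    ext x; simp only [residual1, Waves.timeDeriv_congr ht hz, hz t ht, hv t ht]
  have e2 : p.residual2 T z' v' t = p.residual2 T z v t := by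
    ext x; simp only [residual2, Waves.timeDeriv_congr ht hm, hz t ht, hv t ht]
  exact ⟨by rw [hz t ht]; exact h.smooth_z, by rw [hv t ht]; exact h.smooth_v,
    by rw [hz t ht]; exact h.depth1, by rw [hz t ht]; exact h.depth2,
    fun x => (h.diff_z x).congr (fun τ hτ => congrFun (hz τ hτ) x) (congrFun (hz t ht) x),
    fun x => (h.diff_m x).congr (fun τ hτ => congrFun (hm τ hτ) x) (congrFun (hm t ht) x),
    by rw [e1, e2]; exact h.bound⟩

theorem Params.GNConsistentAt.mono {p : Params} {s : ℝ} {T : ℝ≥0∞} {z v : ℝ → ℝ → ℝ}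
    {K K' t : ℝ} (h : p.GNConsistentAt s T z v K t) (hK : K ≤ K') :
    p.GNConsistentAt s T z v K' t :=
  { h with bound := h.bound.trans (ENNReal.ofReal_le_ofReal hK) }

namespace Waves

variable {s : ℝ} [hs : Fact (3 / 2 < s)] {κ : Bounds}

theorem eventually_abs_elev_sub_le (S : Waves s κ) {t : ℝ} (ht : t ∈ timeIco S.T) {η : ℝ}
    (hη : 0 < η) : ∀ᶠ τ in 𝓝[timeIco S.T] t, ∀ x,
      |Ctx.elev (S.ctx ht) τ x - Ctx.elev (S.ctx ht) t x| ≤ η := by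
  classical
  have hY := Ctx.ho_Y (s := s) (κ := κ) (j := 0) (k' := 0) (by norm_num)
  obtain ⟨C, hC, hc⟩ := (hY.add (hY.comp Ctx.swap)).sup
  have h1 : ∀ᶠ τ in 𝓝 t, S.k τ < S.k t + 1 :=
    S.hk_cont.continuousAt.eventually (gt_mem_nhds (lt_add_one _))
  obtain ⟨r, hr, hball⟩ := Metric.eventually_nhds_iff_ball.1 h1
  set L := C * (S.k t + 1) with hL
  have hLpos : 0 < L := by have := S.hk t; positivity
  have h2 : ∀ᶠ τ in 𝓝 t, |τ - t| < min r (η / L) := by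
    have := Metric.ball_mem_nhds t (lt_min hr (div_pos hη hLpos))
    filter_upwards [this] with τ hτ using by simpa [Real.dist_eq] using hτ
  filter_upwards [self_mem_nhdsWithin, nhdsWithin_le_nhds h2] with τ hτ hτ2 x
  set A := timeIco S.T ∩ Metric.ball t r
  have hA : Convex ℝ A := (convex_timeIco S.T).inter (convex_ball t r)
  have hd : ∀ σ ∈ A, HasDerivWithinAt (fun τ => Ctx.elev (S.ctx ht) τ x)
      (if h : σ ∈ timeIco S.T then Ctx.Y 0 (S.ctx h) x + Ctx.Y 0 (S.ctx h).swap x else 0) A σ := by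
    intro σ hσ
    rw [dif_pos hσ.1]
    exact ((Ctx.td_elev (S.ctx hσ.1)).hasDeriv x).mono inter_subset_left
  have hb : ∀ σ ∈ A, ‖(if h : σ ∈ timeIco S.T then
      Ctx.Y 0 (S.ctx h) x + Ctx.Y 0 (S.ctx h).swap x else 0)‖ ≤ L := by
    intro σ hσ
    rw [dif_pos hσ.1]
    refine (hc (S.ctx hσ.1) x).trans ?_
    exact mul_le_mul_of_nonneg_left (hball σ hσ.2).le hC.le
  have := hA.norm_image_sub_le_of_norm_hasDerivWithin_le hd hb
    (⟨ht, Metric.mem_ball_self hr⟩ : t ∈ A)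
    (⟨hτ, by simpa [Real.dist_eq] using hτ2.trans_le (min_le_left _ _)⟩ : τ ∈ A)
  rw [Real.norm_eq_abs, Real.norm_eq_abs] at this
  refine this.trans ?_
  have h3 := hτ2.le.trans (min_le_right _ _)
  rwa [le_div_iff₀ hLpos, mul_comm] at h3

theorem elev_eq (S : Waves s κ) {zc vc : ℝ → ℝ → ℝ} (h : S.p.IsCorrector S.T S.vp S.vm zc vc)
    {t : ℝ} (ht : t ∈ timeIco S.T) {τ : ℝ} (hτ : τ ∈ timeIco S.T) :
    (fun x => zCL S.vp S.vm τ x + zc τ x) = Ctx.elev (S.ctx ht) τ := by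
  ext x
  rw [(S.corrector_eq h hτ).1]
  simp only [Ctx.elev, Ctx.wv, Ctx.swap, ctx, zCL, cp, cm, one_mul, neg_mul, sub_neg_eq_add]
  ring

theorem velo_eq (S : Waves s κ) {zc vc : ℝ → ℝ → ℝ} (h : S.p.IsCorrector S.T S.vp S.vm zc vc)
    {t : ℝ} (ht : t ∈ timeIco S.T) {τ : ℝ} (hτ : τ ∈ timeIco S.T) :
    (fun x => S.p.vCL S.vp S.vm τ x + vc τ x) = Ctx.velo (S.ctx ht) τ := by
  ext x
  rw [(S.corrector_eq h hτ).2]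
  simp only [Ctx.velo, Ctx.vel, Ctx.wv, Ctx.swap, ctx, vCL, cp, cm, one_mul, neg_mul,
    sub_neg_eq_add]
  ring

theorem _root_.TwoLayer.Params.bet_nonneg {p : Params} (hd : 0 < p.del) (h0 : 0 ≤ p.gam)
    (h1 : p.gam < 1) : 0 ≤ p.bet :=
  div_nonneg (mul_nonneg (by linarith) hd.le) (by linarith)

theorem _root_.TwoLayer.Params.bet_le_one {p : Params} (hd : 0 < p.del) (h0 : 0 ≤ p.gam) :
    p.bet ≤ 1 :=
  (div_le_one (by linarith)).2 (by nlinarith)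

/-- The corrected waves of size `B` at a time `t`, with a nonlinearity parameter at most `η`. -/
structure BoundedAt (s : ℝ) [Fact (3 / 2 < s)] (κ : Bounds) (B η : ℝ) where
  S : Waves s κ
  t : ℝ
  ht : t ∈ timeIco S.T
  eps_le : S.p.eps ≤ η
  bound : sobNorm (s + 3) (Ctx.elev (S.ctx ht) t)
    + sobNorm (s + 3) (Ctx.velo (S.ctx ht) t) ≤ ENNReal.ofReal B

/-- The configuration of bounded corrected waves. -/
def BoundedAt.ctx {B η : ℝ} (j : BoundedAt s κ B η) : Ctx s κ := j.S.ctx j.ht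

theorem regular {B η : ℝ} (hB : 0 < B)
    (h1 : η * ((cSob (s + 3)).toReal * B + 1) * (1 + |κ.delMax|) ≤ 1 / 2)
    (h2 : cMul (s + 3) * (η * B) ≤ 1 / 2) :
    Ctx.Regular (BoundedAt.ctx : BoundedAt s κ B η → Ctx s κ) := by
  have hr : 1 / 2 < s + 3 := by linarith [hs.out]
  set A := (cSob (s + 3)).toReal * B with hA
  have hA0 : 0 ≤ A := by positivity
  have hz : HO s 3 (fun j : BoundedAt s κ B η => Ctx.elev j.ctx j.t) 1 :=
    ⟨fun j => Ctx.contDiff_elev j.ctx j.ht, fun _ => zero_le_one, B, hB, fun j => by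
      rw [Pi.one_apply, mul_one]; exact (self_le_add_right _ _).trans j.bound⟩
  have hv : HO s 3 (fun j : BoundedAt s κ B η => Ctx.velo j.ctx j.t) 1 :=
    ⟨fun j => contDiff_const.mul (Ctx.contDiff_vel j.ctx j.ht), fun _ => zero_le_one, B, hB,
      fun j => by
        rw [Pi.one_apply, mul_one]; exact (self_le_add_left _ _).trans j.bound⟩
  have hu : HO s 3 (fun j : BoundedAt s κ B η => Ctx.vel j.ctx j.t) 1 :=
    (HO.one_smul (Ctx.so_inv_sum.comp BoundedAt.ctx) hv).congr fun j x => by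
      have := j.ctx.sum_pos
      simp only [Ctx.velo]; field_simp
  have hT := (Ctx.ho_Tr (s := s) (κ := κ) (j := 3) (k := 0) (by norm_num)).comp
    (BoundedAt.ctx : BoundedAt s κ B η → Ctx s κ)
  have hT' := ((Ctx.ho_Tr (s := s) (κ := κ) (j := 3) (k := 0) (by norm_num)).comp Ctx.swap).comp
    (BoundedAt.ctx : BoundedAt s κ B η → Ctx s κ)
  have hX : ∀ (j : BoundedAt s κ B η) x, Ctx.elev j.ctx j.t x = _ := fun j x =>
    congrFun (Ctx.elev_eq j.ctx) x
  have hX' : ∀ (j : BoundedAt s κ B η) x, Ctx.vel j.ctx j.t x = _ := fun j x =>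
    congrFun (Ctx.vel_eq j.ctx) x
  have heps : ∀ j : BoundedAt s κ B η, 0 ≤ j.S.p.eps := fun j => j.ctx.eps_nonneg
  have hsup : ∀ (j : BoundedAt s κ B η) x, |Ctx.elev j.ctx j.t x| ≤ A := fun j x =>
    abs_le_of_sobNorm hr (Ctx.contDiff_elev j.ctx j.ht).continuous
      ((self_le_add_right _ _).trans j.bound) hB.le x
  have hη : ∀ j : BoundedAt s κ B η, 0 ≤ η := fun j => (heps j).trans j.eps_le
  have hdep : ∀ (j : BoundedAt s κ B η) (z : ℝ → ℝ) (x : ℝ), |z x| ≤ A + 1 →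
      0 < j.S.p.h1 z x ∧ 0 < j.S.p.h2 z x := by
    intro j z x hzx
    have hd := j.ctx.del_pos
    have hd2 : j.S.p.del ≤ |κ.delMax| := j.S.regime.2.2.1.2.le.trans (le_abs_self _)
    have hd' : 0 < j.S.p.del := hd
    have h0 := hη j
    have e1 : |j.S.p.eps * z x| ≤ η * (A + 1) := by
      rw [abs_mul, abs_of_nonneg (heps j)]
      exact mul_le_mul j.eps_le hzx (abs_nonneg _) h0
    have e2 : η * (A + 1) * (1 + j.S.p.del) ≤ 1 / 2 := by
      refine le_trans ?_ h1
      gcongr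
    have e3 : 0 ≤ η * (A + 1) := by positivity
    have e4 : η * (A + 1) < 1 / j.S.p.del := by
      rw [lt_div_iff₀ hd']; nlinarith
    have := abs_le.1 e1
    refine ⟨?_, ?_⟩
    · simp only [Params.h1]; nlinarith [abs_nonneg κ.delMax, mul_nonneg e3 hd'.le]
    · simp only [Params.h2]; linarith
  refine ⟨fun _ => rfl, ?_, ?_, fun j => ?_, fun j => ?_, fun _ => zero_le_one, 2 * (|η| * B) + 1,
    by positivity, fun j => ?_⟩
  · refine (((hz.add hu).const_mul (1 / 2)).sub hT).congr fun j x => ?_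
    rw [hX, hX']; simp only [Ctx.X, iteratedDeriv_zero]; ring
  · refine (((hz.sub hu).const_mul (1 / 2)).sub hT').congr fun j x => ?_
    rw [hX, hX']; simp only [Ctx.X, iteratedDeriv_zero]; ring
  · filter_upwards [j.S.eventually_abs_elev_sub_le j.ht one_pos] with τ hτ x
    refine hdep j _ x ?_
    have e1 : -1 ≤ Ctx.elev j.ctx τ x - Ctx.elev j.ctx j.t x ∧ _ := abs_le.1 (hτ x)
    have e2 := abs_le.1 (hsup j x)
    have e3 : Ctx.elev j.ctx τ x - Ctx.elev j.ctx j.t x ≤ 1 := e1.2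
    exact abs_le.2 ⟨by linarith [e1.1, e2.1], by linarith [e2.2]⟩
  · have := fun x => hdep j (Ctx.elev j.ctx j.t) x ((hsup j x).trans (by linarith))
    exact contDiff_quot j.ctx.del_pos j.ctx.gam_nonneg (fun x => (this x).1) (fun x => (this x).2)
      (Ctx.contDiff_elev j.ctx j.ht)
  · have b0 : 0 ≤ j.S.p.bet :=
      bet_nonneg j.ctx.del_pos j.ctx.gam_nonneg j.S.regime.2.2.2.2
    have b1 : j.S.p.bet ≤ 1 := bet_le_one j.ctx.del_pos j.ctx.gam_nonneg
    have h0 := hη j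
    have hbe : |j.S.p.bet * j.S.p.eps| ≤ η := by
      rw [abs_of_nonneg (mul_nonneg b0 (heps j))]
      nlinarith [heps j, j.eps_le]
    have hg : ∀ x, |j.S.p.bet * j.S.p.eps * Ctx.elev j.ctx j.t x| ≤ 1 / 2 := fun x => by
      rw [abs_mul]
      calc _ ≤ η * A := mul_le_mul hbe (hsup j x) (abs_nonneg _) h0
        _ ≤ η * (A + 1) * (1 + |κ.delMax|) := by
          nlinarith [abs_nonneg κ.delMax, mul_nonneg h0 hA0,
            mul_nonneg (mul_nonneg h0 hA0) (abs_nonneg κ.delMax), mul_nonneg h0 (abs_nonneg κ.delMax)]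
        _ ≤ _ := h1
    have := sobNorm_geom hr (b := η * B) (g := fun x =>
      j.S.p.bet * j.S.p.eps * Ctx.elev j.ctx j.t x)
      (continuous_const.mul (Ctx.contDiff_elev j.ctx j.ht).continuous) (by positivity) (by
        rw [sobNorm_const_mul, ENNReal.ofReal_mul h0]
        exact mul_le_mul' (ENNReal.ofReal_le_ofReal hbe) ((self_le_add_right _ _).trans j.bound))
      h2 hg
    have e1 : j.ctx.p.quot (Ctx.elev j.ctx j.ctx.t) = fun x =>
        j.S.p.bet * j.S.p.eps * Ctx.elev j.ctx j.t x *
          (1 - j.S.p.bet * j.S.p.eps * Ctx.elev j.ctx j.t x)⁻¹ := by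
      ext x
      have : 1 - j.S.p.bet * j.S.p.eps * Ctx.elev j.ctx j.t x ≠ 0 := by
        have := abs_le.1 (hg x); linarith [this.2]
      change (1 - j.S.p.bet * j.S.p.eps * Ctx.elev j.ctx j.t x)⁻¹ - 1 = _
      field_simp; ring
    rw [e1]
    refine this.trans (ENNReal.ofReal_le_ofReal ?_)
    rw [abs_of_nonneg h0]; simp

theorem consistent {B : ℝ} (hB : 0 < B) : ∃ C e₀ : ℝ, 0 < C ∧ 0 < e₀ ∧
    ∀ (S : Waves s κ) (zc vc : ℝ → ℝ → ℝ), S.p.IsCorrector S.T S.vp S.vm zc vc →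
      ∀ t ∈ timeIco S.T, S.p.precision < e₀ →
        sobNorm (s + 3) (fun x => zCL S.vp S.vm t x + zc t x)
          + sobNorm (s + 3) (fun x => S.p.vCL S.vp S.vm t x + vc t x) ≤ ENNReal.ofReal B →
        S.p.GNConsistentAt s S.T (fun t x => zCL S.vp S.vm t x + zc t x)
          (fun t x => S.p.vCL S.vp S.vm t x + vc t x) (C * (S.p.precision * S.k t)) t := by
  set a := 2 * (((cSob (s + 3)).toReal * B + 1) * (1 + |κ.delMax|)) with ha
  set b := 2 * (cMul (s + 3) + 1) * B with hb
  have ha0 : 0 < a := by positivity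
  have hb0 : 0 < b := by have := cMul_nonneg (s + 3); positivity
  set η := min (1 / a) (1 / b) with hη
  have hη0 : 0 < η := lt_min (by positivity) (by positivity)
  have hηa : η * a ≤ 1 := by
    have := min_le_left (1 / a) (1 / b); rwa [← hη, le_div_iff₀ ha0] at this
  have hηb : η * b ≤ 1 := by
    have := min_le_right (1 / a) (1 / b); rwa [← hη, le_div_iff₀ hb0] at this
  obtain ⟨C, hC, hc⟩ := (regular (s := s) (κ := κ) (η := η) hB
    (by rw [ha] at hηa; linarith) (by rw [hb] at hηb; nlinarith)).consistent
  refine ⟨C, η ^ 4, hC, by positivity, fun S zc vc h t ht he hbd => ?_⟩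
  have hz := fun τ hτ => S.elev_eq h ht (τ := τ) hτ
  have hv := fun τ hτ => S.velo_eq h ht (τ := τ) hτ
  have heps : S.p.eps ≤ η := by
    have h4 : S.p.eps ^ 4 < η ^ 4 :=
      ((le_max_right _ _).trans (le_max_left _ _)).trans_lt he
    exact (lt_of_pow_lt_pow_left₀ 4 hη0.le h4).le
  rw [hz t ht, hv t ht] at hbd
  exact (hc ⟨S, t, ht, heps, hbd⟩).congr ht hz hv

end Waves

/-! ### The waves in terms of the decoupled approximation -/

theorem CorrectorBoundAt.mono {s : ℝ} {T : ℝ≥0∞} {zc vc : ℝ → ℝ → ℝ} {K L K' L' t : ℝ}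
    (h : CorrectorBoundAt s T zc vc K L t) (hK : K ≤ K') (hL : L ≤ L') :
    CorrectorBoundAt s T zc vc K' L' t :=
  ⟨h.diff_z, h.diff_v, h.bound.trans (ENNReal.ofReal_le_ofReal hK),
    h.bound_dt.trans (ENNReal.ofReal_le_ofReal hL)⟩

theorem sobNorm_combo_le (r : ℝ) (f g : ℝ → ℝ) {α β K : ℝ} (hα : |α| ≤ K) (hβ : |β| ≤ K) :
    sobNorm r (fun x => α * f x + β * g x) ≤ ENNReal.ofReal K * (sobNorm r f + sobNorm r g) := by
  refine (sobNorm_add_le r _ _).trans ?_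
  rw [sobNorm_const_mul, sobNorm_const_mul, mul_add]
  gcongr

theorem sobNorm_combo_translate_le (r : ℝ) (f g : ℝ → ℝ) {α β K : ℝ} (hα : |α| ≤ K)
    (hβ : |β| ≤ K) (h : ℝ) : sobNorm r (fun x => α * f (x + h) + β * g (x + h)) ≤
      ENNReal.ofReal K * (sobNorm r f + sobNorm r g) := by
  have := sobNorm_combo_le r (fun x => f (x + h)) (fun x => g (x + h)) hα hβ
  rwa [sobNorm_translate, sobNorm_translate] at this

theorem abs_integral_le_sqrt {f : ℝ → ℝ} (hf : Continuous f) {K : ℝ} (hK : 0 ≤ K)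
    (h : eLpNorm f 2 ≤ ENNReal.ofReal K) (x y : ℝ) : |∫ z in x..y, f z| ≤ √|y - x| * K := by
  have h1 : eLpNorm ((uIoc x y).indicator fun _ => (1 : ℝ)) 2 ≤ ENNReal.ofReal √|y - x| := by
    rw [eLpNorm_indicator_const measurableSet_uIoc (by norm_num) (by norm_num), enorm_one, one_mul,
      uIoc, Real.volume_Ioc, max_sub_min_eq_abs, Real.sqrt_eq_rpow,
      ENNReal.ofReal_rpow_of_nonneg (abs_nonneg _) (by norm_num)]
    simp
  have h2 := abs_integral_mul_le (aestronglyMeasurable_const.indicator measurableSet_uIoc)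
    hf.aestronglyMeasurable (Real.sqrt_nonneg _) hK h1 h x y
  rwa [intervalIntegral.integral_congr_ae (g := f) (ae_of_all _ fun z hz => by
    rw [indicator_of_mem hz, one_mul])] at h2

namespace Params.IsCLWaves

variable {s : ℝ} [hs : Fact (3 / 2 < s)] {p : Params} {lam th : ℝ} {T : ℝ≥0∞} {z0 v0 : ℝ → ℝ}
  {vp vm : ℝ → ℝ → ℝ}

theorem isCurve_p (h : p.IsCLWaves s lam th T z0 v0 vp vm) : IsCurve s T vp := ⟨h.smooth_p, h.c1_p⟩

theorem isCurve_m (h : p.IsCLWaves s lam th T z0 v0 vp vm) : IsCurve s T vm := ⟨h.smooth_m, h.c1_m⟩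

theorem hasDeriv_p (h : p.IsCLWaves s lam th T z0 v0 vp vm) {t : ℝ} (ht : t ∈ timeIco T) (x : ℝ) :
    HasDerivWithinAt (fun τ => vp τ (x - τ)) (timeDeriv T vp t (x - t) - deriv (vp t) (x - t))
      (timeIco T) t := by
  simpa using (h.isCurve_p.td_shift_sub ht 1 (n := 0) (k := 0) (by norm_num)).hasDeriv x

theorem hasDeriv_m (h : p.IsCLWaves s lam th T z0 v0 vp vm) {t : ℝ} (ht : t ∈ timeIco T) (x : ℝ) :
    HasDerivWithinAt (fun τ => vm τ (x + τ)) (timeDeriv T vm t (x + t) + deriv (vm t) (x + t))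
      (timeIco T) t := by
  simpa using (h.isCurve_m.td_shift ht 1 (n := 0) (k := 0) (by norm_num)).hasDeriv x

theorem timeDeriv_zCL (h : p.IsCLWaves s lam th T z0 v0 vp vm) {t : ℝ} (ht : t ∈ timeIco T) :
    timeDeriv T (zCL vp vm) t = fun x => timeDeriv T vp t (x - t) - deriv (vp t) (x - t)
      + (timeDeriv T vm t (x + t) + deriv (vm t) (x + t)) := by
  ext x
  exact HasDerivWithinAt.timeDeriv_eq ht ((h.hasDeriv_p ht x).add (h.hasDeriv_m ht x))

theorem timeDeriv_vCL (h : p.IsCLWaves s lam th T z0 v0 vp vm) {t : ℝ} (ht : t ∈ timeIco T) :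
    timeDeriv T (p.vCL vp vm) t = fun x => (p.gam + p.del) *
      (timeDeriv T vp t (x - t) - deriv (vp t) (x - t)
        - (timeDeriv T vm t (x + t) + deriv (vm t) (x + t))) := by
  ext x
  exact HasDerivWithinAt.timeDeriv_eq ht
    (((h.hasDeriv_p ht x).sub (h.hasDeriv_m ht x)).const_mul _)

theorem contDiff_timeDeriv_zCL (h : p.IsCLWaves s lam th T z0 v0 vp vm) {t : ℝ}
    (ht : t ∈ timeIco T) : ContDiff ℝ 5 (timeDeriv T (zCL vp vm) t) := by
  have h1 : ContDiff ℝ 5 (deriv (vp t)) :=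
    ((h.smooth_p t ht).of_le (by norm_num : (5 + 1 : WithTop ℕ∞) ≤ 7)).deriv'
  have h2 : ContDiff ℝ 5 (deriv (vm t)) :=
    ((h.smooth_m t ht).of_le (by norm_num : (5 + 1 : WithTop ℕ∞) ≤ 7)).deriv'
  have h3 := (h.isCurve_p.contDiff_timeDeriv ht).of_le (by norm_num : (5 : WithTop ℕ∞) ≤ 6)
  have h4 := (h.isCurve_m.contDiff_timeDeriv ht).of_le (by norm_num : (5 : WithTop ℕ∞) ≤ 6)
  rw [h.timeDeriv_zCL ht]
  exact ((h3.comp (by fun_prop)).sub (h1.comp (by fun_prop))).add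
    ((h4.comp (by fun_prop)).add (h2.comp (by fun_prop)))

theorem contDiff_timeDeriv_vCL (h : p.IsCLWaves s lam th T z0 v0 vp vm) {t : ℝ}
    (ht : t ∈ timeIco T) : ContDiff ℝ 5 (timeDeriv T (p.vCL vp vm) t) := by
  have h1 : ContDiff ℝ 5 (deriv (vp t)) :=
    ((h.smooth_p t ht).of_le (by norm_num : (5 + 1 : WithTop ℕ∞) ≤ 7)).deriv'
  have h2 : ContDiff ℝ 5 (deriv (vm t)) :=
    ((h.smooth_m t ht).of_le (by norm_num : (5 + 1 : WithTop ℕ∞) ≤ 7)).deriv'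
  have h3 := (h.isCurve_p.contDiff_timeDeriv ht).of_le (by norm_num : (5 : WithTop ℕ∞) ≤ 6)
  have h4 := (h.isCurve_m.contDiff_timeDeriv ht).of_le (by norm_num : (5 : WithTop ℕ∞) ≤ 6)
  rw [h.timeDeriv_vCL ht]
  exact contDiff_const.mul (((h3.comp (by fun_prop)).sub (h1.comp (by fun_prop))).sub
    ((h4.comp (by fun_prop)).add (h2.comp (by fun_prop))))

end Params.IsCLWaves

section Recover

variable {s : ℝ} [hs : Fact (3 / 2 < s)] {p : Params} {lam th : ℝ} {T : ℝ≥0∞} {z0 v0 : ℝ → ℝ}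
  {vp vm : ℝ → ℝ → ℝ} {d : ℝ}

theorem vp_eq (hc : p.gam + p.del ≠ 0) (vp vm : ℝ → ℝ → ℝ) (t x : ℝ) :
    vp t x = 1 / 2 * zCL vp vm t (x + t) + 1 / (2 * (p.gam + p.del)) * p.vCL vp vm t (x + t) := by
  simp only [zCL, vCL, add_sub_cancel_right]; field_simp; ring

theorem vm_eq (hc : p.gam + p.del ≠ 0) (vp vm : ℝ → ℝ → ℝ) (t x : ℝ) :
    vm t x = 1 / 2 * zCL vp vm t (x + -t)
      + -(1 / (2 * (p.gam + p.del))) * p.vCL vp vm t (x + -t) := by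
  simp only [zCL, vCL, neg_add_cancel_right]; field_simp; ring

theorem timeDeriv_vp_eq (hc : p.gam + p.del ≠ 0) (h : p.IsCLWaves s lam th T z0 v0 vp vm) {t : ℝ}
    (ht : t ∈ timeIco T) (x : ℝ) : timeDeriv T vp t x =
      1 / 2 * timeDeriv T (zCL vp vm) t (x + t)
        + 1 / (2 * (p.gam + p.del)) * timeDeriv T (p.vCL vp vm) t (x + t) + deriv (vp t) x := by
  rw [h.timeDeriv_zCL ht, h.timeDeriv_vCL ht]
  simp only [add_sub_cancel_right]; field_simp; ring

theorem timeDeriv_vm_eq (hc : p.gam + p.del ≠ 0) (h : p.IsCLWaves s lam th T z0 v0 vp vm) {t : ℝ}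
    (ht : t ∈ timeIco T) (x : ℝ) : timeDeriv T vm t x =
      1 / 2 * timeDeriv T (zCL vp vm) t (x + -t)
        + -(1 / (2 * (p.gam + p.del))) * timeDeriv T (p.vCL vp vm) t (x + -t)
        + -1 * deriv (vm t) x := by
  rw [h.timeDeriv_zCL ht, h.timeDeriv_vCL ht]
  simp only [neg_add_cancel_right]; field_simp; ring

theorem abs_half_le (hd : 0 < d) : |(1 / 2 : ℝ)| ≤ 1 + 1 / d := by
  have : 0 < 1 / d := by positivity
  rw [abs_of_pos (by norm_num)]; linarith

theorem abs_inv_two_mul_le {c : ℝ} (hd : 0 < d) (hc : d ≤ c) : |1 / (2 * c)| ≤ 1 + 1 / d := by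
  have h0 : 0 < c := hd.trans_le hc
  rw [abs_of_pos (by positivity)]
  have : 1 / (2 * c) ≤ 1 / d := one_div_le_one_div_of_le hd (by linarith)
  linarith

/-- Uniform bounds on the two waves and on their time derivatives. -/
def WaveBound (s : ℝ) (T : ℝ≥0∞) (vp vm : ℝ → ℝ → ℝ) (M : ℝ) : Prop :=
  ∀ t ∈ timeIco T,
    sobNorm (s + 6) (vp t) ≤ ENNReal.ofReal M ∧ sobNorm (s + 6) (vm t) ≤ ENNReal.ofReal M ∧
      sobNorm (s + 5) (timeDeriv T vp t) ≤ ENNReal.ofReal M ∧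
      sobNorm (s + 5) (timeDeriv T vm t) ≤ ENNReal.ofReal M

theorem WaveBound.mono {M M' : ℝ} (h : WaveBound s T vp vm M) (hM : M ≤ M') :
    WaveBound s T vp vm M' := fun t ht =>
  have e := ENNReal.ofReal_le_ofReal hM
  ⟨(h t ht).1.trans e, (h t ht).2.1.trans e, (h t ht).2.2.1.trans e, (h t ht).2.2.2.trans e⟩

theorem waveBound_of_uniformBound (hd : 0 < d) (hc : d ≤ p.gam + p.del) {M : ℝ} (hM : 0 ≤ M)
    (h : p.IsCLWaves s lam th T z0 v0 vp vm) (hU : p.UniformBound s T vp vm M) :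
    WaveBound s T vp vm (2 * ((1 + 1 / d) * M)) := by
  have hc0 : p.gam + p.del ≠ 0 := (hd.trans_le hc).ne'
  have a1 := abs_half_le hd
  have a2 := abs_inv_two_mul_le hd hc
  have a3 : |-(1 / (2 * (p.gam + p.del)))| ≤ 1 + 1 / d := by rwa [abs_neg]
  intro t ht
  have hb := hU t ht
  have hK : 0 ≤ 1 + 1 / d := by positivity
  have hz : ENNReal.ofReal (1 + 1 / d) * (sobNorm (s + 6) (zCL vp vm t)
      + sobNorm (s + 6) (p.vCL vp vm t)) ≤ ENNReal.ofReal ((1 + 1 / d) * M) := by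
    rw [ENNReal.ofReal_mul hK]
    gcongr
    exact le_trans (le_trans le_self_add le_self_add) hb
  have hz' : ENNReal.ofReal (1 + 1 / d) * (sobNorm (s + 5) (timeDeriv T (zCL vp vm) t)
      + sobNorm (s + 5) (timeDeriv T (p.vCL vp vm) t)) ≤ ENNReal.ofReal ((1 + 1 / d) * M) := by
    rw [ENNReal.ofReal_mul hK]
    gcongr
    refine le_trans ?_ hb
    rw [add_assoc (sobNorm (s + 6) _ + _)]
    exact le_add_self
  have e1 : vp t = fun x => _ := funext fun x => vp_eq hc0 vp vm t x
  have e2 : vm t = fun x => _ := funext fun x => vm_eq hc0 vp vm t x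
  have e3 : timeDeriv T vp t = fun x => _ := funext fun x => timeDeriv_vp_eq hc0 h ht x
  have e4 : timeDeriv T vm t = fun x => _ := funext fun x => timeDeriv_vm_eq hc0 h ht x
  have b1 : sobNorm (s + 6) (vp t) ≤ ENNReal.ofReal ((1 + 1 / d) * M) := by
    rw [e1]; exact (sobNorm_combo_translate_le (s + 6) _ _ a1 a2 t).trans hz
  have b2 : sobNorm (s + 6) (vm t) ≤ ENNReal.ofReal ((1 + 1 / d) * M) := by
    rw [e2]; exact (sobNorm_combo_translate_le (s + 6) _ _ a1 a3 (-t)).trans hz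
  have hle : ∀ f : ℝ → ℝ, ContDiff ℝ 7 f → sobNorm (s + 5) (deriv f) ≤ sobNorm (s + 6) f :=
    fun f hf => by
      have := sobNorm_deriv_le (r := s + 5) (by linarith [hs.out]) (hf.of_le (by norm_num))
      rwa [show s + 5 + 1 = s + 6 by ring] at this
  have hpos : 0 ≤ (1 + 1 / d) * M := by positivity
  have e5 : ENNReal.ofReal (2 * ((1 + 1 / d) * M)) =
      ENNReal.ofReal ((1 + 1 / d) * M) + ENNReal.ofReal ((1 + 1 / d) * M) := by
    rw [← ENNReal.ofReal_add hpos hpos, two_mul]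
  rw [e5]
  refine ⟨b1.trans le_self_add, b2.trans le_self_add, ?_, ?_⟩
  · rw [e3]
    refine (sobNorm_add_le _ _ _).trans (add_le_add ?_ ((hle _ (h.smooth_p t ht)).trans b1))
    exact (sobNorm_combo_translate_le (s + 5) _ _ a1 a2 t).trans hz'
  · rw [e4]
    refine (sobNorm_add_le _ _ _).trans (add_le_add ?_ ?_)
    · exact (sobNorm_combo_translate_le (s + 5) _ _ a1 a3 (-t)).trans hz'
    · rw [sobNorm_const_mul, abs_neg, abs_one, ENNReal.ofReal_one, one_mul]
      exact (hle _ (h.smooth_m t ht)).trans b2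

end Recover

/-- The two waves of the decoupled approximation. -/
def Params.IsCLWaves.waves {s lam th : ℝ} {p : Params} {T : ℝ≥0∞} {z0 v0 : ℝ → ℝ}
    {vp vm : ℝ → ℝ → ℝ} (h : p.IsCLWaves s lam th T z0 v0 vp vm) {κ : Bounds}
    (regime : p.InRegime κ.muMax κ.epsMax κ.delMin κ.delMax) (hlam : |lam| ≤ κ.Lam)
    (hth : |th| ≤ κ.Th) (hb : WaveBound s T vp vm κ.M) {k : ℝ → ℝ} (hk : ∀ t, 1 ≤ k t)
    (hk_cont : Continuous k)
    (hp : ∀ t ∈ timeIco T, ∀ x y, |y - x| ≤ 2 * t → |∫ z in x..y, vp t z| ≤ κ.M * k t)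
    (hm : ∀ t ∈ timeIco T, ∀ x y, |y - x| ≤ 2 * t → |∫ z in x..y, vm t z| ≤ κ.M * k t) :
    Waves s κ where
  p := p
  lam := lam
  th := th
  T := T
  vp := vp
  vm := vm
  k := k
  regime := regime
  hlam := hlam
  hth := hth
  hk := hk
  hk_cont := hk_cont
  wp := ⟨h.smooth_p, h.c1_p, h.eq_p, fun t ht => (hb t ht).1, fun t ht => (hb t ht).2.2.1⟩
  wm := ⟨h.smooth_m, h.c1_m, h.eq_m, fun t ht => (hb t ht).2.1, fun t ht => (hb t ht).2.2.2⟩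
  prim_p := hp
  prim_m := hm

theorem min_one_add_sqrt_le {t : ℝ} (ht : 0 ≤ t) : min t (1 + √t) ≤ 2 * min t √t := by
  have h0 := Real.sqrt_nonneg t
  have h1 := Real.mul_self_sqrt ht
  rcases le_total t 1 with h | h
  · have h2 : √t ≤ 1 := Real.sqrt_le_one.2 h
    rw [min_eq_left (b := √t) (by nlinarith)]
    exact (min_le_left _ _).trans (by linarith)
  · have h2 : 1 ≤ √t := Real.one_le_sqrt.2 h
    rw [min_eq_right (b := √t) (by nlinarith)]
    exact (min_le_right _ _).trans (by linarith)

theorem abs_integral_le_one_add_sqrt {f : ℝ → ℝ} (hf : Continuous f) {K r : ℝ} (hr : 0 ≤ r)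
    (hK : 0 ≤ K) (h : sobNorm r f ≤ ENNReal.ofReal K) {t : ℝ} (ht : 0 ≤ t) {x y : ℝ}
    (hxy : |y - x| ≤ 2 * t) : |∫ z in x..y, f z| ≤ 2 * K * (1 + √t) := by
  refine (abs_integral_le_sqrt hf hK ((eLpNorm_le_sobNorm hr f).trans h) x y).trans ?_
  have h1 : √|y - x| ≤ 2 * √t := by
    rw [Real.sqrt_le_left (by positivity), mul_pow, Real.sq_sqrt ht]; linarith
  nlinarith [Real.sqrt_nonneg t]

/-- The case of waves in Sobolev spaces. -/
theorem corrector_of_uniformBound {s : ℝ} [hs : Fact (3 / 2 < s)]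
    (muMax epsMax delMax Lam Th : ℝ) {delMin : ℝ} (hdelMin : 0 < delMin) {M : ℝ} (hM : 0 < M) :
    ∃ C : ℝ, 0 < C ∧ ∃ C' e₀ : ℝ → ℝ, (∀ B : ℝ, 0 < B → 0 < C' B ∧ 0 < e₀ B) ∧
      ∀ (p : Params) (lam th : ℝ) (T : ℝ≥0∞) (z0 v0 : ℝ → ℝ) (vp vm : ℝ → ℝ → ℝ),
        p.InRegime muMax epsMax delMin delMax → |lam| ≤ Lam → |th| ≤ Th →
        p.IsCLWaves s lam th T z0 v0 vp vm → p.UniformBound s T vp vm M →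
        (∃ zc vc, p.IsCorrector T vp vm zc vc) ∧
        ∀ zc vc, p.IsCorrector T vp vm zc vc →
          (∀ t ∈ timeIco T, CorrectorBoundAt s T zc vc
            (C * p.couplingSize * min t (√t)) (C * p.couplingSize * (1 + √t)) t) ∧
          ∀ B : ℝ, 0 < B → ∀ t ∈ timeIco T,
            p.precision * (1 + √t) < e₀ B →
            (∀ τ ∈ Icc 0 t,
              sobNorm (s + 3) (fun x => zCL vp vm τ x + zc τ x)
                + sobNorm (s + 3) (fun x => p.vCL vp vm τ x + vc τ x) ≤ ENNReal.ofReal B) →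
            ∀ τ ∈ Icc 0 t,
              p.GNConsistentAt s T (fun t x => zCL vp vm t x + zc t x)
                (fun t x => p.vCL vp vm t x + vc t x) (C' B * (p.precision * (1 + √t))) τ := by
  set N := 2 * ((1 + 1 / delMin) * M) with hN
  have hN0 : 0 < N := by positivity
  set κ : Bounds := ⟨muMax, epsMax, delMin, delMax, Lam, Th, 2 * N, hdelMin, by positivity⟩
  obtain ⟨C, hC, hcor⟩ := Waves.corrector_bound (s := s) (κ := κ)
  choose! C' e₀ hC' he₀ hcon using fun (B : ℝ) (hB : 0 < B) =>
    Waves.consistent (s := s) (κ := κ) hB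
  refine ⟨2 * C, by positivity, C', e₀, fun B hB => ⟨hC' B hB, he₀ B hB⟩, ?_⟩
  intro p lam th T z0 v0 vp vm hp hlam hth h hU
  have hsum : delMin ≤ p.gam + p.del := by linarith [hp.2.2.1.1, hp.2.2.2.1]
  have hb := waveBound_of_uniformBound hdelMin hsum hM.le h hU
  have hs6 : 0 ≤ s + 6 := by linarith [hs.out]
  set S : Waves s κ := h.waves (κ := κ) hp hlam hth (hb.mono (by simp only [κ]; linarith))
    (k := fun t => 1 + √t) (fun t => by linarith [Real.sqrt_nonneg t]) (by fun_prop)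
    (fun t ht x y hxy => abs_integral_le_one_add_sqrt (h.smooth_p t ht).continuous hs6 hN0.le
      (hb t ht).1 ht.1 hxy)
    (fun t ht x y hxy => abs_integral_le_one_add_sqrt (h.smooth_m t ht).continuous hs6 hN0.le
      (hb t ht).2.1 ht.1 hxy)
  refine ⟨S.exists_corrector, fun zc vc hc => ⟨fun t ht => ?_, fun B hB t ht he hBd τ hτ => ?_⟩⟩
  · have hm : 0 ≤ p.couplingSize := (S.ctx ht).m_nonneg
    have hCm : 0 ≤ C * p.couplingSize := by positivity
    refine (hcor S zc vc hc t ht).mono ?_ ?_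
    · calc C * p.couplingSize * min t (1 + √t) ≤ C * p.couplingSize * (2 * min t √t) := by
            gcongr; exact min_one_add_sqrt_le ht.1
        _ = _ := by ring
    · change C * p.couplingSize * (1 + √t) ≤ _
      nlinarith [mul_nonneg hCm (Real.sqrt_nonneg t)]
  · have hτT : τ ∈ timeIco T :=
      ⟨hτ.1, (ENNReal.ofReal_le_ofReal hτ.2).trans_lt ht.2⟩
    have hpr : 0 ≤ p.precision := (sq_nonneg p.mu).trans (le_max_right _ _)
    have h1 : p.precision ≤ p.precision * (1 + √t) :=
      le_mul_of_one_le_right hpr (by linarith [Real.sqrt_nonneg t])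
    refine (hcon B hB S zc vc hc τ hτT (h1.trans_lt he) (hBd τ hτ)).mono ?_
    have := hC' B hB
    change C' B * (p.precision * (1 + √τ)) ≤ _
    have := Real.sqrt_le_sqrt hτ.2
    gcongr

/-! ### Localized waves -/

theorem memLp_pow_mul_rpow {j : ℕ} {b : ℝ} (h : (j : ℝ) / 2 + 1 / 4 < b) :
    MemLp (fun x : ℝ => x ^ j * (1 + x ^ 2) ^ (-b)) 2 := by
  have hcont : Continuous fun x : ℝ => x ^ j * (1 + x ^ 2) ^ (-b) :=
    (continuous_pow j).mul ((by fun_prop : Continuous fun x : ℝ => 1 + x ^ 2).rpow_const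
      fun x => Or.inl (by positivity))
  rw [memLp_two_iff_integrable_sq hcont.aestronglyMeasurable]
  have h1 := integrable_rpow_neg_one_add_norm_sq (E := ℝ) (μ := volume) (r := 2 * (2 * b - j))
    (by rw [Module.finrank_self]; push_cast; linarith)
  refine h1.mono' (hcont.pow 2).aestronglyMeasurable (ae_of_all _ fun x => ?_)
  have h0 : (0 : ℝ) < 1 + x ^ 2 := by positivity
  rw [Real.norm_eq_abs, abs_of_nonneg (by positivity), Real.norm_eq_abs, sq_abs, mul_pow,
    ← pow_mul, mul_comm j 2, pow_mul, ← Real.rpow_natCast ((1 + x ^ 2) ^ (-b)) 2, ← Real.rpow_mul h0.le]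
  calc (x ^ 2) ^ j * (1 + x ^ 2) ^ (-b * (2 : ℕ)) ≤ (1 + x ^ 2) ^ j * (1 + x ^ 2) ^ (-b * (2 : ℕ)) := by
        gcongr; linarith
    _ = _ := by
        rw [← Real.rpow_natCast (1 + x ^ 2) j, ← Real.rpow_add h0]
        congr 1; push_cast; ring

theorem hasDerivAt_pow_mul_rpow (j : ℕ) (b x : ℝ) :
    HasDerivAt (fun x : ℝ => x ^ j * (1 + x ^ 2) ^ (-b))
      (j * (x ^ (j - 1) * (1 + x ^ 2) ^ (-b))
        + -(2 * b) * (x ^ (j + 1) * (1 + x ^ 2) ^ (-(b + 1)))) x := by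
  have h1 : HasDerivAt (fun x : ℝ => 1 + x ^ 2) (2 * x) x := by
    simpa using (hasDerivAt_pow 2 x).const_add 1
  have h2 := h1.rpow_const (p := -b) (Or.inl (by positivity))
  refine ((hasDerivAt_pow j x).mul h2).congr_deriv ?_
  rw [show -b - 1 = -(b + 1) by ring]; ring

theorem sobNorm_pow_mul_rpow_ne_top (n : ℕ) {j : ℕ} {b : ℝ} (h : (j : ℝ) / 2 + 1 / 4 < b) :
    sobNorm n (fun x : ℝ => x ^ j * (1 + x ^ 2) ^ (-b)) ≠ ⊤ := by
  induction n generalizing j b with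
  | zero =>
    rw [Nat.cast_zero, sobNorm_zero_eq (memLp_pow_mul_rpow h)]
    exact (memLp_pow_mul_rpow h).2.ne
  | succ n ih =>
    have hd := hasDerivAt_pow_mul_rpow j b
    have h1 : ((j - 1 : ℕ) : ℝ) ≤ j := by exact_mod_cast Nat.sub_le j 1
    push_cast
    refine ne_top_of_le_ne_top (ENNReal.add_ne_top.2 ⟨ih h, ?_⟩)
      (sobNorm_succ_le _ fun x => (hd x).differentiableAt)
    rw [funext fun x => (hd x).deriv]
    refine ne_top_of_le_ne_top (ENNReal.add_ne_top.2 ⟨?_, ?_⟩) (sobNorm_add_le _ _ _)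
    · rw [sobNorm_const_mul]
      exact ENNReal.mul_ne_top ENNReal.ofReal_ne_top (ih (by linarith))
    · rw [sobNorm_const_mul]
      exact ENNReal.mul_ne_top ENNReal.ofReal_ne_top (ih (by push_cast; linarith))

theorem sobNorm_weight_ne_top (s : ℝ) {a : ℝ} (ha : 1 / 2 < a) :
    sobNorm s (fun x : ℝ => (1 + x ^ 2) ^ (-a)) ≠ ⊤ := by
  obtain ⟨n, hn⟩ := exists_nat_ge s
  refine ne_top_of_le_ne_top ?_ (sobNorm_mono hn _)
  simpa using sobNorm_pow_mul_rpow_ne_top n (j := 0) (b := a) (by norm_num; linarith)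

theorem weight_cancel (a : ℝ) (f : ℝ → ℝ) (x : ℝ) :
    (1 + x ^ 2) ^ (-a) * ((1 + x ^ 2) ^ a * f x) = f x := by
  rw [← mul_assoc, ← Real.rpow_add (by positivity), neg_add_cancel, Real.rpow_zero, one_mul]

section Weight

variable {s : ℝ} [hs : Fact (3 / 2 < s)] {a : ℝ}

/-- The norm of the inverse of the weight. -/
def invWeight (s a : ℝ) : ℝ := (sobNorm s (fun x : ℝ => (1 + x ^ 2) ^ (-a))).toReal

theorem invWeight_nonneg (s a : ℝ) : 0 ≤ invWeight s a := ENNReal.toReal_nonneg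

theorem sobNorm_le_weighted (ha : 1 / 2 < a) (f : ℝ → ℝ) :
    sobNorm s f ≤ ENNReal.ofReal (cMul s * invWeight s a + 1) *
      sobNorm s (fun x => (1 + x ^ 2) ^ a * f x) := by
  set g := fun x : ℝ => (1 + x ^ 2) ^ a * f x
  have h0 := mul_nonneg (cMul_nonneg s) (invWeight_nonneg s a)
  by_cases hg : sobNorm s g = ⊤
  · rw [hg, ENNReal.mul_top (by simp; linarith)]; exact le_top
  have h1 := sobNorm_mul_le (r := s) (by linarith [hs.out]) (f := fun x : ℝ => (1 + x ^ 2) ^ (-a))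
    (g := g) (invWeight_nonneg s a)
    (ENNReal.ofReal_toReal (sobNorm_weight_ne_top s ha)).ge (ENNReal.ofReal_toReal hg).ge
  simp only [g, weight_cancel] at h1
  refine h1.trans ?_
  rw [← mul_assoc, ENNReal.ofReal_mul h0, ENNReal.ofReal_toReal hg]
  gcongr
  linarith

theorem sobNorm_le_sum_iteratedDeriv (n : ℕ) {f : ℝ → ℝ} (hf : ContDiff ℝ n f) :
    sobNorm (s + n) f ≤ 2 ^ n * ∑ k ∈ Finset.range (n + 1), sobNorm s (iteratedDeriv k f) := by
  induction n generalizing f with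
  | zero => simp
  | succ n ih =>
    have h1 := sobNorm_succ_le (s + n) (hf.differentiable (by simp))
    have h2 := ih (hf.of_le (by simp))
    have h3 := ih (f := deriv f) (ContDiff.deriv' (by exact_mod_cast hf))
    simp only [← iteratedDeriv_succ'] at h3
    rw [show s + ((n + 1 : ℕ) : ℝ) = s + n + 1 by push_cast; ring]
    refine (h1.trans (add_le_add h2 h3)).trans ?_
    rw [pow_succ, mul_assoc, two_mul, mul_add]
    gcongr 2 ^ n * ?_ + 2 ^ n * ?_
    · rw [Finset.sum_range_succ _ (n + 1)]; exact le_self_add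
    · rw [Finset.sum_range_succ' _ (n + 1)]; exact le_self_add

theorem sobNorm_le_weightedNorm (ha : 1 / 2 < a) (n : ℕ) {f : ℝ → ℝ} (hf : ContDiff ℝ n f) :
    sobNorm (s + n) f ≤ ENNReal.ofReal (2 ^ n * (cMul s * invWeight s a + 1)) *
      weightedNorm s a n f := by
  refine (sobNorm_le_sum_iteratedDeriv n hf).trans ?_
  rw [ENNReal.ofReal_mul (by positivity), ENNReal.ofReal_pow (by norm_num), mul_assoc]
  have : ENNReal.ofReal 2 = 2 := by norm_num
  rw [this, weightedNorm]
  refine mul_le_mul_right ?_ _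
  rw [Finset.mul_sum]
  exact Finset.sum_le_sum fun k _ => sobNorm_le_weighted ha _

theorem abs_integral_le_weighted (ha : 1 / 2 < a) {f : ℝ → ℝ} (hf : Continuous f) {K : ℝ}
    (hK : 0 ≤ K) (h : sobNorm s (fun x => (1 + x ^ 2) ^ a * f x) ≤ ENNReal.ofReal K) (x y : ℝ) :
    |∫ z in x..y, f z| ≤ invWeight s a * K := by
  have hs0 : 0 ≤ s := by linarith [hs.out]
  have hw : ∀ b : ℝ, Continuous fun x : ℝ => (1 + x ^ 2) ^ b := fun b =>
    (by fun_prop : Continuous fun x : ℝ => 1 + x ^ 2).rpow_const fun x => Or.inl (by positivity)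
  have h1 := abs_integral_mul_le (hw (-a)).aestronglyMeasurable
    (g := fun x => (1 + x ^ 2) ^ a * f x) ((hw a).mul hf).aestronglyMeasurable (invWeight_nonneg s a) hK
    ((eLpNorm_le_sobNorm hs0 _).trans (ENNReal.ofReal_toReal (sobNorm_weight_ne_top s ha)).ge)
    ((eLpNorm_le_sobNorm hs0 _).trans h) x y
  simpa only [weight_cancel] using h1

theorem sobNorm_le_weightedNorm_zero (n : ℕ) (f : ℝ → ℝ) :
    sobNorm s (fun x => (1 + x ^ 2) ^ a * f x) ≤ weightedNorm s a n f := by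
  rw [weightedNorm, Finset.sum_range_succ', iteratedDeriv_zero]
  exact le_add_self

end Weight

section Localized

variable {s : ℝ} [hs : Fact (3 / 2 < s)] {a : ℝ} {p : Params} {lam th : ℝ} {T : ℝ≥0∞}
  {z0 v0 : ℝ → ℝ} {vp vm : ℝ → ℝ → ℝ} {d : ℝ}

/-- The constant of the embedding of weighted spaces. -/
def cLoc (s a : ℝ) : ℝ := 2 ^ 6 * (cMul s * invWeight s a + 1)

theorem cLoc_pos (s a : ℝ) : 0 < cLoc s a := by
  have := mul_nonneg (cMul_nonneg s) (invWeight_nonneg s a)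
  unfold cLoc; positivity

theorem sobNorm_le_cLoc (ha : 1 / 2 < a) {n : ℕ} (hn : n ≤ 6) {f : ℝ → ℝ} (hf : ContDiff ℝ n f) :
    sobNorm (s + n) f ≤ ENNReal.ofReal (cLoc s a) * weightedNorm s a n f := by
  refine (sobNorm_le_weightedNorm ha n hf).trans ?_
  have := mul_nonneg (cMul_nonneg s) (invWeight_nonneg s a)
  unfold cLoc
  gcongr
  norm_num

theorem sobNorm_sum_le (ha : 1 / 2 < a) {f g f' g' : ℝ → ℝ} (hf : ContDiff ℝ 6 f)
    (hg : ContDiff ℝ 6 g) (hf' : ContDiff ℝ 5 f') (hg' : ContDiff ℝ 5 g') {M : ℝ}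
    (h : weightedNorm s a 6 f + weightedNorm s a 6 g + weightedNorm s a 5 f' + weightedNorm s a 5 g'
      ≤ ENNReal.ofReal M) :
    sobNorm (s + 6) f + sobNorm (s + 6) g + sobNorm (s + 5) f' + sobNorm (s + 5) g' ≤
      ENNReal.ofReal (cLoc s a * M) := by
  rw [ENNReal.ofReal_mul (cLoc_pos s a).le]
  refine le_trans ?_ (mul_le_mul_right h _)
  rw [mul_add, mul_add, mul_add]
  have h1 := sobNorm_le_cLoc (s := s) ha (n := 6) le_rfl hf
  have h2 := sobNorm_le_cLoc (s := s) ha (n := 6) le_rfl hg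
  have h3 := sobNorm_le_cLoc (s := s) ha (n := 5) (by norm_num) hf'
  have h4 := sobNorm_le_cLoc (s := s) ha (n := 5) (by norm_num) hg'
  push_cast at h1 h2 h3 h4
  gcongr

theorem contDiff_zCL (h : p.IsCLWaves s lam th T z0 v0 vp vm) {t : ℝ} (ht : t ∈ timeIco T) :
    ContDiff ℝ 6 (zCL vp vm t) :=
  (((h.smooth_p t ht).of_le (by norm_num)).comp (by fun_prop)).add
    (((h.smooth_m t ht).of_le (by norm_num)).comp (by fun_prop))

theorem contDiff_vCL (h : p.IsCLWaves s lam th T z0 v0 vp vm) {t : ℝ} (ht : t ∈ timeIco T) :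
    ContDiff ℝ 6 (p.vCL vp vm t) :=
  contDiff_const.mul ((((h.smooth_p t ht).of_le (by norm_num)).comp (by fun_prop)).sub
    (((h.smooth_m t ht).of_le (by norm_num)).comp (by fun_prop)))

theorem waveBound_of_localizedBound (ha : 1 / 2 < a) {M : ℝ}
    (h : p.IsCLWaves s lam th T z0 v0 vp vm) (hL : LocalizedBound s a T vp vm M) :
    WaveBound s T vp vm (cLoc s a * M) := fun t ht => by
  have := sobNorm_sum_le (s := s) ha ((h.smooth_p t ht).of_le (by norm_num))
    ((h.smooth_m t ht).of_le (by norm_num))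
    ((h.isCurve_p.contDiff_timeDeriv ht).of_le (by norm_num))
    ((h.isCurve_m.contDiff_timeDeriv ht).of_le (by norm_num)) (hL t ht)
  refine ⟨?_, ?_, ?_, ?_⟩ <;> refine le_trans ?_ this
  · exact le_self_add.trans (le_self_add.trans le_self_add)
  · exact le_add_self.trans (le_self_add.trans le_self_add)
  · exact le_add_self.trans le_self_add
  · exact le_add_self

theorem uniformBound_of_localizedBound (ha : 1 / 2 < a) {M : ℝ}
    (h : p.IsCLWaves s lam th T z0 v0 vp vm)
    (hL : LocalizedBound s a T (zCL vp vm) (p.vCL vp vm) M) :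
    p.UniformBound s T vp vm (cLoc s a * M) := fun t ht =>
  sobNorm_sum_le ha (contDiff_zCL h ht) (contDiff_vCL h ht) (h.contDiff_timeDeriv_zCL ht)
    (h.contDiff_timeDeriv_vCL ht) (hL t ht)

theorem Params.LocalizedBound.left {f g : ℝ → ℝ → ℝ} {M : ℝ} (hL : LocalizedBound s a T f g M) {t : ℝ}
    (ht : t ∈ timeIco T) :
    sobNorm s (fun x => (1 + x ^ 2) ^ a * f t x) + sobNorm s (fun x => (1 + x ^ 2) ^ a * g t x) ≤
      ENNReal.ofReal M :=
  (add_le_add (sobNorm_le_weightedNorm_zero 6 _) (sobNorm_le_weightedNorm_zero 6 _)).trans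
    ((le_self_add.trans le_self_add).trans (hL t ht))

theorem abs_integral_combo_le (ha : 1 / 2 < a) {f g : ℝ → ℝ} (hf : Continuous f)
    (hg : Continuous g) {M α β K : ℝ} (hM : 0 ≤ M) (hα : |α| ≤ K) (hβ : |β| ≤ K)
    (h : sobNorm s (fun x => (1 + x ^ 2) ^ a * f x) + sobNorm s (fun x => (1 + x ^ 2) ^ a * g x) ≤
      ENNReal.ofReal M) (x y r : ℝ) :
    |∫ z in x..y, α * f (z + r) + β * g (z + r)| ≤ invWeight s a * (K * M) := by
  have hK : 0 ≤ K := (abs_nonneg _).trans hα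
  rw [intervalIntegral.integral_comp_add_right (fun z => α * f z + β * g z)]
  refine abs_integral_le_weighted ha (by fun_prop) (by positivity) ?_ _ _
  have h1 := sobNorm_combo_le s (fun x => (1 + x ^ 2) ^ a * f x)
    (fun x => (1 + x ^ 2) ^ a * g x) hα hβ
  rw [ENNReal.ofReal_mul hK]
  refine le_trans (le_of_eq ?_) (h1.trans (mul_le_mul_right h _))
  congr 1; ext x; ring

/-- Localized waves are bounded, with bounded primitives. -/
theorem bounds_of_localized (ha : 1 / 2 < a) (hd : 0 < d) (hc : d ≤ p.gam + p.del) {M : ℝ}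
    (hM : 0 < M) (h : p.IsCLWaves s lam th T z0 v0 vp vm)
    (hL : LocalizedBound s a T (zCL vp vm) (p.vCL vp vm) M ∨ LocalizedBound s a T vp vm M) :
    WaveBound s T vp vm (2 * ((1 + 1 / d) * ((cLoc s a + invWeight s a) * M))) ∧
    ∀ t ∈ timeIco T, ∀ x y,
      |∫ z in x..y, vp t z| ≤ 2 * ((1 + 1 / d) * ((cLoc s a + invWeight s a) * M)) ∧
      |∫ z in x..y, vm t z| ≤ 2 * ((1 + 1 / d) * ((cLoc s a + invWeight s a) * M)) := by
  have hw := invWeight_nonneg s a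
  have hl := cLoc_pos s a
  have hd' : 0 < 1 / d := by positivity
  have e1 : (1 + 1 / d) * (cLoc s a * M) ≤ (1 + 1 / d) * ((cLoc s a + invWeight s a) * M) := by
    gcongr; linarith
  have e2 : invWeight s a * ((1 + 1 / d) * M) ≤
      2 * ((1 + 1 / d) * ((cLoc s a + invWeight s a) * M)) := by
    have : 0 ≤ (1 + 1 / d) * (cLoc s a * M) := by positivity
    have : 0 ≤ invWeight s a * ((1 + 1 / d) * M) := by positivity
    nlinarith
  have e3 : cLoc s a * M ≤ (1 + 1 / d) * (cLoc s a * M) :=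
    le_mul_of_one_le_left (by positivity) (by linarith)
  have e4 : invWeight s a * M ≤ invWeight s a * ((1 + 1 / d) * M) := by
    gcongr; exact le_mul_of_one_le_left hM.le (by linarith)
  have e5 : 0 ≤ (1 + 1 / d) * ((cLoc s a + invWeight s a) * M) := by positivity
  rcases hL with hL | hL
  · refine ⟨(waveBound_of_uniformBound hd hc (by positivity) h
      (uniformBound_of_localizedBound ha h hL)).mono (by linarith), fun t ht x y => ?_⟩
    have hc0 : p.gam + p.del ≠ 0 := (hd.trans_le hc).ne'
    have a2 := abs_inv_two_mul_le hd hc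
    have a3 : |-(1 / (2 * (p.gam + p.del)))| ≤ 1 + 1 / d := by rwa [abs_neg]
    have h1 := hL.left ht
    have c1 := (contDiff_zCL h ht).continuous
    have c2 := (contDiff_vCL h ht).continuous
    constructor
    · simp only [vp_eq hc0 vp vm t]
      exact (abs_integral_combo_le ha c1 c2 hM.le (abs_half_le hd) a2 h1 x y t).trans e2
    · simp only [vm_eq hc0 vp vm t]
      exact (abs_integral_combo_le ha c1 c2 hM.le (abs_half_le hd) a3 h1 x y (-t)).trans e2
  · refine ⟨(waveBound_of_localizedBound ha h hL).mono (by linarith), fun t ht x y => ⟨?_, ?_⟩⟩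
    · exact (abs_integral_le_weighted ha (h.smooth_p t ht).continuous hM.le
        (le_self_add.trans (hL.left ht)) x y).trans (e4.trans e2)
    · exact (abs_integral_le_weighted ha (h.smooth_m t ht).continuous hM.le
        (le_add_self.trans (hL.left ht)) x y).trans (e4.trans e2)

end Localized

theorem Waves.sobNorm_zCL_add_le {s : ℝ} [Fact (3 / 2 < s)] {κ : Bounds} (S : Waves s κ)
    {t : ℝ} (ht : t ∈ timeIco S.T) {zc vc : ℝ → ℝ} {K : ℝ} (hK : 0 ≤ K)
    (h : sobNorm (s + 3) zc + sobNorm (s + 3) vc ≤ ENNReal.ofReal K) :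
    sobNorm (s + 3) (fun x => zCL S.vp S.vm t x + zc x)
      + sobNorm (s + 3) (fun x => S.p.vCL S.vp S.vm t x + vc x) ≤
      ENNReal.ofReal (2 * κ.M + (1 + |κ.delMax|) * (2 * κ.M) + K) := by
  have hM := κ.hM
  have hle : s + 3 ≤ s + 6 := by linarith
  have h1 : sobNorm (s + 3) (fun x => S.vp t (x - t)) ≤ ENNReal.ofReal κ.M := by
    have := sobNorm_translate (s + 3) (S.vp t) (-t)
    simp only [← sub_eq_add_neg] at this
    rw [this]; exact (sobNorm_mono hle _).trans (S.wp.bound t ht)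
  have h2 : sobNorm (s + 3) (fun x => S.vm t (x + t)) ≤ ENNReal.ofReal κ.M := by
    rw [sobNorm_translate]; exact (sobNorm_mono hle _).trans (S.wm.bound t ht)
  have e0 : ENNReal.ofReal (2 * κ.M) = ENNReal.ofReal κ.M + ENNReal.ofReal κ.M := by
    rw [← ENNReal.ofReal_add hM.le hM.le, two_mul]
  have hz : sobNorm (s + 3) (zCL S.vp S.vm t) ≤ ENNReal.ofReal (2 * κ.M) := by
    rw [e0]; exact (sobNorm_add_le _ _ _).trans (add_le_add h1 h2)
  have hc : |S.p.gam + S.p.del| ≤ 1 + |κ.delMax| := by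
    have hp : 0 < S.p.gam + S.p.del := (S.ctx ht).sum_pos
    rw [abs_of_pos hp]
    have := S.regime.2.2.1.2.le.trans (le_abs_self κ.delMax)
    linarith [S.regime.2.2.2.2]
  have hv : sobNorm (s + 3) (S.p.vCL S.vp S.vm t) ≤
      ENNReal.ofReal ((1 + |κ.delMax|) * (2 * κ.M)) := by
    have : S.p.vCL S.vp S.vm t =
      fun x => (S.p.gam + S.p.del) * (S.vp t (x - t) - S.vm t (x + t)) := rfl
    rw [this, sobNorm_const_mul, ENNReal.ofReal_mul (by positivity), e0]
    gcongr
    exact (sobNorm_sub_le _ _ _).trans (add_le_add h1 h2)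
  rw [ENNReal.ofReal_add (by positivity) hK, ENNReal.ofReal_add (by positivity) (by positivity)]
  refine (add_le_add (sobNorm_add_le _ _ _) (sobNorm_add_le _ _ _)).trans ?_
  rw [add_add_add_comm]
  gcongr

/-- The case of localized waves. -/
theorem corrector_of_localizedBound {s : ℝ} [Fact (3 / 2 < s)]
    (muMax epsMax delMax Lam Th : ℝ) {delMin : ℝ} (hdelMin : 0 < delMin) {a M : ℝ}
    (ha : 1 / 2 < a) (hM : 0 < M) : ∃ C e₀ : ℝ, 0 < C ∧ 0 < e₀ ∧
      ∀ (p : Params) (lam th : ℝ) (T : ℝ≥0∞) (z0 v0 : ℝ → ℝ) (vp vm : ℝ → ℝ → ℝ),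
        p.InRegime muMax epsMax delMin delMax → |lam| ≤ Lam → |th| ≤ Th →
        p.IsCLWaves s lam th T z0 v0 vp vm →
        (LocalizedBound s a T (zCL vp vm) (p.vCL vp vm) M ∨ LocalizedBound s a T vp vm M) →
        (∃ zc vc, p.IsCorrector T vp vm zc vc) ∧
        ∀ zc vc, p.IsCorrector T vp vm zc vc →
          (∀ t ∈ timeIco T, CorrectorBoundAt s T zc vc
            (C * p.couplingSize * min t 1) (C * p.couplingSize) t) ∧
          (p.precision < e₀ → ∀ t ∈ timeIco T,
            p.GNConsistentAt s T (fun t x => zCL vp vm t x + zc t x)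
              (fun t x => p.vCL vp vm t x + vc t x) (C * p.precision) t) := by
  set N := 2 * ((1 + 1 / delMin) * ((cLoc s a + invWeight s a) * M)) with hN
  have hN0 : 0 < N := by
    have := cLoc_pos s a
    have := invWeight_nonneg s a
    positivity
  set κ : Bounds := ⟨muMax, epsMax, delMin, delMax, Lam, Th, N, hdelMin, hN0⟩ with hκ
  obtain ⟨C, hC, hcor⟩ := Waves.corrector_bound (s := s) (κ := κ)
  obtain ⟨D, hD, hm⟩ := Ctx.so_m_one (s := s) (κ := κ)
  have hB : 0 < 2 * κ.M + (1 + |κ.delMax|) * (2 * κ.M) + C * D := by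
    have := κ.hM; positivity
  obtain ⟨C', e₀, hC', he₀, hcon⟩ := Waves.consistent (s := s) (κ := κ) hB
  refine ⟨C + C', e₀, by positivity, he₀, ?_⟩
  intro p lam th T z0 v0 vp vm hp hlam hth h hL
  have hsum : delMin ≤ p.gam + p.del := by linarith [hp.2.2.1.1, hp.2.2.2.1]
  obtain ⟨hb, hprim⟩ := bounds_of_localized ha hdelMin hsum hM h hL
  set S : Waves s κ := h.waves (κ := κ) hp hlam hth hb
    (k := fun _ => 1) (fun _ => le_rfl) continuous_const
    (fun t ht x y _ => (hprim t ht x y).1.trans_eq (mul_one _).symm)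
    (fun t ht x y _ => (hprim t ht x y).2.trans_eq (mul_one _).symm)
  refine ⟨S.exists_corrector, fun zc vc hc => ⟨fun t ht => ?_, fun he t ht => ?_⟩⟩
  · have hm0 : 0 ≤ p.couplingSize := (S.ctx ht).m_nonneg
    have hq : 0 ≤ min t (1 : ℝ) := le_min ht.1 zero_le_one
    refine (hcor S zc vc hc t ht).mono ?_ ?_
    · change C * p.couplingSize * min t 1 ≤ _
      gcongr; linarith
    · change C * p.couplingSize * 1 ≤ _
      rw [mul_one]; gcongr; linarith
  · have hm0 : 0 ≤ p.couplingSize := (S.ctx ht).m_nonneg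
    have hpr : 0 ≤ p.precision := (sq_nonneg p.mu).trans (le_max_right _ _)
    have hmD : p.couplingSize ≤ D := by
      have := (le_abs_self _).trans (hm (S.ctx ht))
      rwa [Pi.one_apply, mul_one] at this
    have h1 := ((hcor S zc vc hc t ht).bound).trans (ENNReal.ofReal_le_ofReal
      (show C * p.couplingSize * min t 1 ≤ C * D from by
        calc _ ≤ C * p.couplingSize * 1 := by gcongr; exact min_le_right _ _
          _ ≤ C * D := by rw [mul_one]; gcongr))
    refine (hcon S zc vc hc t ht he (S.sobNorm_zCL_add_le ht (by positivity) h1)).mono ?_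
    change C' * (p.precision * 1) ≤ _
    rw [mul_one]; gcongr; linarith

end

end TwoLayer

theorem mainTheorem5
    (s muMax epsMax delMin delMax Lam Th : ℝ) (hs : 3 / 2 < s)
    (hmu : 0 < muMax) (heps : 0 < epsMax) (hdelMin : 0 < delMin) (hdelMax : 0 < delMax) :
    (∀ M : ℝ, 0 < M → ∃ C : ℝ, 0 < C ∧ ∃ C' e₀ : ℝ → ℝ, (∀ B : ℝ, 0 < B → 0 < C' B ∧ 0 < e₀ B) ∧
      ∀ (p : Params) (lam th : ℝ) (T : ℝ≥0∞) (z0 v0 : ℝ → ℝ) (vp vm : ℝ → ℝ → ℝ),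
        p.InRegime muMax epsMax delMin delMax → |lam| ≤ Lam → |th| ≤ Th → 0 < T →
        p.IsCLWaves s lam th T z0 v0 vp vm → p.UniformBound s T vp vm M →
        (∃ zc vc, p.IsCorrector T vp vm zc vc) ∧
        ∀ zc vc, p.IsCorrector T vp vm zc vc →
          (∀ t ∈ timeIco T, CorrectorBoundAt s T zc vc
            (C * p.couplingSize * min t (√t)) (C * p.couplingSize * (1 + √t)) t) ∧
          ∀ B : ℝ, 0 < B → ∀ t ∈ timeIco T,
            p.precision * (1 + √t) < e₀ B →
            (∀ τ ∈ Icc 0 t,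
              sobNorm (s + 3) (fun x => zCL vp vm τ x + zc τ x)
                + sobNorm (s + 3) (fun x => p.vCL vp vm τ x + vc τ x) ≤ ENNReal.ofReal B) →
            ∀ τ ∈ Icc 0 t,
              p.GNConsistentAt s T (fun t x => zCL vp vm t x + zc t x)
                (fun t x => p.vCL vp vm t x + vc t x) (C' B * (p.precision * (1 + √t))) τ) ∧
    (∀ a M : ℝ, 1 / 2 < a → 0 < M → ∃ C e₀ : ℝ, 0 < C ∧ 0 < e₀ ∧
      ∀ (p : Params) (lam th : ℝ) (T : ℝ≥0∞) (z0 v0 : ℝ → ℝ) (vp vm : ℝ → ℝ → ℝ),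
        p.InRegime muMax epsMax delMin delMax → |lam| ≤ Lam → |th| ≤ Th → 0 < T →
        p.IsCLWaves s lam th T z0 v0 vp vm →
        (LocalizedBound s a T (zCL vp vm) (p.vCL vp vm) M ∨ LocalizedBound s a T vp vm M) →
        (∃ zc vc, p.IsCorrector T vp vm zc vc) ∧
        ∀ zc vc, p.IsCorrector T vp vm zc vc →
          (∀ t ∈ timeIco T, CorrectorBoundAt s T zc vc
            (C * p.couplingSize * min t 1) (C * p.couplingSize) t) ∧
          (p.precision < e₀ → ∀ t ∈ timeIco T,
            p.GNConsistentAt s T (fun t x => zCL vp vm t x + zc t x)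
              (fun t x => p.vCL vp vm t x + vc t x) (C * p.precision) t)) := by
  have : Fact (3 / 2 < s) := ⟨hs⟩
  refine ⟨fun M hM => ?_, fun a M ha hM => ?_⟩
  · obtain ⟨C, hC, C', e₀, hpos, h⟩ :=
      corrector_of_uniformBound (s := s) muMax epsMax delMax Lam Th hdelMin hM
    exact ⟨C, hC, C', e₀, hpos, fun p lam th T z0 v0 vp vm hp hlam hth _ =>
      h p lam th T z0 v0 vp vm hp hlam hth⟩
  · obtain ⟨C, e₀, hC, he₀, h⟩ :=
      corrector_of_localizedBound (s := s) muMax epsMax delMax Lam Th hdelMin ha hM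
    exact ⟨C, e₀, hC, he₀, fun p lam th T z0 v0 vp vm hp hlam hth _ =>
      h p lam th T z0 v0 vp vm hp hlam hth⟩
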